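/- **Setting.** Fix $d\in\{1,2,3,4\}$, $\beta\in\{1,2\}$, $\rho\in(0,1/3)$, $\kappa>0$, $K\in\mathbb R$, and exponents $\mu<1/3$, $\delta>0$ with $2\delta<\mu-\rho<3\delta$. For $L\in\mathbb N$ and $W\ge 1$ let $\mathbb T=(\mathbb Z/L\mathbb Z)^d$ with its periodic Euclidean norm $|\cdot|$, $N=L^d$, $$M=\#\{x\in\mathbb T:1\le|x|\le W\},\qquad S_{xy}=\frac{\mathbf 1(1\le|x-y|\le W)}{M-1},\qquad \eta=M^{-\rho},\qquad \nu(E)=\tfrac2\pi\sqrt{1-E^2}.$$ Let $H=H^*$, $H_{xy}=\sqrt{S_{xy}}\,A_{xy}$, where the entries $A_{xy}$ with $x\le y$ (in some total order of $\mathbb T$) are independent, uniform on $\{-1,1\}$ if $\beta=1$ and uniform on the unit circle if $\beta=2$. Let $$Y^\eta_\phi(E)=\frac1N\sum_i\eta^{-1}\phi\bigl(\eta^{-1}(\lambda_i-E)\bigr),$$ where $\lambda_1,\dots,\lambda_N$ are the eigenvalues of $H/2$. Let $\phi_1,\phi_2:\mathbb R\to\mathbb R$ be smooth, integrable together with all their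 derivatives, with $\int\phi_i\ne0$, and such that either $\phi_1(e)=\phi_2(e)=2/(e^2+1)$, or both satisfy: for every $q>0$ there is $C_q$ with $|\phi_i(e)|\le C_q/(1+|e|^q)$. Put $\hat\phi(t)=\frac1{2\pi}\int e^{iet}\phi(e)\,de$, $$V_d(\phi_1,\phi_2)=\int_{\mathbb R}|t|^{1-d/2}\,\overline{\hat\phi_1(t)}\,\hat\phi_2(t)\,dt\quad(d\le3),\qquad V_4(\phi_1,\phi_2)=2\,\overline{\hat\phi_1(0)}\,\hat\phi_2(0).$$ **The leading term.** With $J_k$ the Bessel functions of the first kind, let $$\alpha_k(t)=2(-i)^k\frac{k+1}{t}J_{k+1}(t),\qquad a_n(t)=\sum_{k\ge0}\frac{\alpha_{n+2k}(t)}{(M-1)^k},\qquad \tilde\gamma_n(E,\phi)=\int_0^{M^{\rho+\delta}}e^{iEt}\,\hat\phi(\eta t)\,a_n(t)\,dt,$$ $$\mathcal V=\sum 2\operatorname{Re}\tilde\gamma_{2b_1+b_3+b_4}(E_1,\phi_1)\;2\operatorname{Re}\tilde\gamma_{2b_2+b_3+b_4}(E_2,\phi_2)\Bigl(\frac M{M-1}\Bigr)^{b_1+b_2}\operatorname{Tr}S^{b_3+b_4},$$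 the sum being over integers $b_1,b_2,b_4\ge0$, $b_3\ge1$ with $(b_3,b_4)\notin\{(2,0),(1,1)\}$ and $b_1+b_2+b_3+b_4\le M^\mu/2$, and let $$\Theta(E_1,E_2)=\frac2\beta\,\frac{(LW)^d}{N^2}\,\frac{\mathcal V}{\mathbb E Y^\eta_{\phi_1}(E_1)\;\mathbb E Y^\eta_{\phi_2}(E_2)}.$$ **Theorem.** There are constants $c_1>0$, $C$ and $W_0$, depending only on $\beta,d,\rho,\mu,\delta,\kappa,K,\phi_1,\phi_2$, such that for all $W\ge \max(W_0,1)$, all $L$ with $W^{1+d/6}\le L\le W^K$ and all $E\in[-1+\kappa,1-\kappa]$ the following holds. 1. If $d\in\{1,2,3\}$, then $$\Theta(E,E)=\frac{(d+2)^{d/2}}{2\beta\pi^{2+d}\nu(E)^4}\Bigl(\frac{\eta}{\nu(E)}\Bigr)^{d/2-2}\Bigl(\frac{V_d(\phi_1,\phi_2)}{\hat\phi_1(0)\hat\phi_2(0)}+r\Bigr),\qquad |r|\le C M^{-c_1}.$$ 2. If $d=4$, then $$\Theta(E,E)=\frac{18}{\beta\pi^6\nu(E)^4}\Bigl(\frac{V_4(\phi_1,\phi_2)}{\hat\phi_1(0)\hat\phi_2(0)}\,|\log\eta|+r\Bigr),\qquad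 |r|\le C.$$ If $\int\phi_1=\int\phi_2=2\pi$, then $\hat\phi_1(0)=\hat\phi_2(0)=1$ and the quotients are $V_d(\phi_1,\phi_2)$ and $V_4(\phi_1,\phi_2)=2$. -/

import Mathlib

open MeasureTheory
open scoped ContDiff ENNReal ComplexConjugate

noncomputable section

namespace RandomBand

/-! ## The torus and the variance profile -/

/-- The discrete `d`-dimensional torus of side length `L`. -/
abbrev Torus (d L : ℕ) : Type := Fin d → ZMod L

/-- The periodic Euclidean norm: in each coordinate `ZMod.valMinAbs` is the integer
representative of smallest absolute value, so this is `min_{k ∈ ℤ^d} |x + L k|`. -/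
def torusNorm {d L : ℕ} (x : Torus d L) : ℝ :=
  Real.sqrt (∑ i, ((x i).valMinAbs : ℝ) ^ 2)

/-- `M`, the number of points `x` of the torus with `1 ≤ |x| ≤ W`. -/
def bandM (d L : ℕ) (W : ℝ) : ℕ :=
  Nat.card {x : Torus d L // 1 ≤ torusNorm x ∧ torusNorm x ≤ W}

open Classical in
/-- The matrix of variances `S_{xy} = 1(1 ≤ |x - y| ≤ W) / (M - 1)`. -/
def varS (d L : ℕ) (W : ℝ) : Matrix (Torus d L) (Torus d L) ℝ :=
  fun x y => if 1 ≤ torusNorm (x - y) ∧ torusNorm (x - y) ≤ W then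
    1 / ((bandM d L W : ℝ) - 1) else 0

theorem torusNorm_neg {d L : ℕ} (x : Torus d L) : torusNorm (-x) = torusNorm x := by
  unfold torusNorm
  congr 1
  refine Finset.sum_congr rfl fun i _ => ?_
  have h : ((-x i).valMinAbs.natAbs) = (x i).valMinAbs.natAbs := ZMod.natAbs_valMinAbs_neg _
  have h2 : ((-x i).valMinAbs) ^ 2 = (x i).valMinAbs ^ 2 := by
    rw [← Int.natAbs_sq, h, Int.natAbs_sq]
  simpa using congrArg (fun z : ℤ => (z : ℝ)) h2

theorem varS_symm (d L : ℕ) (W : ℝ) (x y : Torus d L) :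
    varS d L W x y = varS d L W y x := by
  have h : torusNorm (x - y) = torusNorm (y - x) := by
    rw [← torusNorm_neg (x - y), neg_sub]
  unfold varS
  rw [h]

theorem varS_diag (d L : ℕ) (W : ℝ) (x : Torus d L) : varS d L W x x = 0 := by
  have h : ¬ (1 ≤ torusNorm (x - x)) := by
    simp [torusNorm]
  unfold varS
  rw [if_neg (fun h' => h h'.1)]

/-! ## The random band matrix -/

/-- The two symmetry classes. -/
inductive SymmetryClass : Type
  | realSymmetric : SymmetryClass
  | complexHermitian : SymmetryClass

/-- The symmetry index `β`: `1` for real symmetric, `2` for complex Hermitian matrices. -/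
def SymmetryClass.beta : SymmetryClass → ℝ
  | .realSymmetric => 1
  | .complexHermitian => 2

/-- The law of a single entry `A_{xy}`: a fair random sign, or the uniform law on the
unit circle. -/
def entryLaw : SymmetryClass → Measure ℂ
  | .realSymmetric =>
      (2⁻¹ : ℝ≥0∞) • Measure.dirac (1 : ℂ) + (2⁻¹ : ℝ≥0∞) • Measure.dirac (-1 : ℂ)
  | .complexHermitian =>
      (volume.restrict (Set.Ioc (0 : ℝ) 1)).map
        (fun θ : ℝ => Complex.exp (2 * Real.pi * Complex.I * θ))

instance entryLaw_isProbabilityMeasure (s : SymmetryClass) :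
    IsProbabilityMeasure (entryLaw s) := by
  cases s with
  | realSymmetric =>
    constructor
    simp [entryLaw, ENNReal.inv_two_add_inv_two]
  | complexHermitian =>
    have : IsProbabilityMeasure (volume.restrict (Set.Ioc (0 : ℝ) 1)) := ⟨by simp⟩
    exact Measure.isProbabilityMeasure_map (by fun_prop)

/-- The sample space: one complex number for each pair of points of the torus. -/
abbrev Sample (d L : ℕ) : Type := Torus d L × Torus d L → ℂ

/-- The coordinates are independent with the given law. -/
def sampleLaw (s : SymmetryClass) (d L : ℕ) [NeZero L] : Measure (Sample d L) :=
  Measure.pi (fun _ => entryLaw s)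

open Classical in
/-- The matrix `A`: the entries with `x ≤ y`, in an arbitrary total order of the torus, are the
independent coordinates of the sample, the others are given by Hermitian symmetry. (The diagonal
is immaterial, since the diagonal of `S` vanishes.) -/
def noise {d L : ℕ} [NeZero L] (a : Sample d L) : Matrix (Torus d L) (Torus d L) ℂ :=
  fun x y => if Fintype.equivFin (Torus d L) x ≤ Fintype.equivFin (Torus d L) y then a (x, y)
    else conj (a (y, x))

/-- The random band matrix `H_{xy} = √S_{xy} A_{xy}`. -/
def bandMatrix {d L : ℕ} [NeZero L] (W : ℝ) (a : Sample d L) :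
    Matrix (Torus d L) (Torus d L) ℂ :=
  fun x y => (Real.sqrt (varS d L W x y) : ℂ) * noise a x y

/-- The matrix `H / 2`. -/
def halfBandMatrix {d L : ℕ} [NeZero L] (W : ℝ) (a : Sample d L) :
    Matrix (Torus d L) (Torus d L) ℂ :=
  fun x y => bandMatrix W a x y / 2

theorem halfBandMatrix_isHermitian {d L : ℕ} [NeZero L] (W : ℝ) (a : Sample d L) :
    (halfBandMatrix W a).IsHermitian := by
  refine Matrix.IsHermitian.ext fun x y => ?_
  by_cases hxy : x = y
  · subst hxy
    simp [halfBandMatrix, bandMatrix, varS_diag]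
  · have hne : Fintype.equivFin (Torus d L) x ≠ Fintype.equivFin (Torus d L) y :=
      fun h => hxy ((Fintype.equivFin (Torus d L)).injective h)
    rcases lt_or_gt_of_ne hne with h | h
    · simp [halfBandMatrix, bandMatrix, noise, varS_symm d L W y x, h.le, not_le.mpr h]
    · simp [halfBandMatrix, bandMatrix, noise, varS_symm d L W y x, h.le, not_le.mpr h]

/-- The smoothed local density of states
`Y^η_φ(E) = N⁻¹ ∑ᵢ φ^η(λᵢ - E)`, `φ^η(e) = η⁻¹ φ(η⁻¹ e)`, with `λᵢ` the eigenvalues of `H / 2`. -/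
def localDensity {d L : ℕ} [NeZero L] (W η : ℝ) (φ : ℝ → ℝ) (E : ℝ) (a : Sample d L) : ℝ :=
  ((L : ℝ) ^ d)⁻¹ *
    ∑ i, η⁻¹ * φ (η⁻¹ * ((halfBandMatrix_isHermitian W a).eigenvalues i - E))

/-- The expectation of `Y^η_φ(E)`. -/
def meanDensity (s : SymmetryClass) (d L : ℕ) [NeZero L] (W η : ℝ) (φ : ℝ → ℝ) (E : ℝ) : ℝ :=
  ∫ a, localDensity (d := d) (L := L) W η φ E a ∂(sampleLaw s d L)

/-- The density of the semicircle law on `[-1, 1]`. -/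
def semicircle (E : ℝ) : ℝ := 2 / Real.pi * Real.sqrt (1 - E ^ 2)

/-! ## Test functions -/

/-- Test functions: smooth, real-valued, integrable together with all derivatives, and with
nonvanishing integral. -/
structure IsTestFunction (φ : ℝ → ℝ) : Prop where
  smooth : ContDiff ℝ ∞ φ
  integrable : ∀ k : ℕ, Integrable (iteratedDeriv k φ)
  integral_ne_zero : ∫ e, φ e ≠ 0

/-- The Cauchy kernel. -/
def IsCauchyKernel (φ : ℝ → ℝ) : Prop := ∀ e, φ e = 2 / (e ^ 2 + 1)

/-- Decay faster than any power. -/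
def HasRapidDecay (φ : ℝ → ℝ) : Prop :=
  ∀ q : ℝ, 0 < q → ∃ C : ℝ, ∀ e, |φ e| ≤ C / (1 + |e| ^ q)

/-- The Fourier transform `(2π)⁻¹ ∫ e^{iet} φ(e) de`. -/
def fourierHat (φ : ℝ → ℝ) (t : ℝ) : ℂ :=
  (2 * Real.pi : ℂ)⁻¹ * ∫ e : ℝ, Complex.exp (Complex.I * e * t) * (φ e : ℂ)

/-- The quadratic form `V_d` for `d ≤ 3`. -/
def formV (d : ℕ) (φ₁ φ₂ : ℝ → ℝ) : ℂ :=
  ∫ t : ℝ, ((|t| ^ (1 - (d : ℝ) / 2) : ℝ) : ℂ) * conj (fourierHat φ₁ t) * fourierHat φ₂ t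

/-- The quadratic form `V_4`. -/
def formV4 (φ₁ φ₂ : ℝ → ℝ) : ℂ := 2 * conj (fourierHat φ₁ 0) * fourierHat φ₂ 0

/-! ## The leading term `Θ` -/

/-- The Bessel function of the first kind `J_n`. -/
def besselJ (n : ℕ) (t : ℝ) : ℝ :=
  ∑' m : ℕ, (-1) ^ m / ((m.factorial : ℝ) * ((m + n).factorial : ℝ)) * (t / 2) ^ (2 * m + n)

/-- The coefficient `α_k(t) = 2 (-i)^k (k+1) J_{k+1}(t) / t` of the Chebyshev expansion of the
propagator `e^{-itξ}`. -/
def chebCoeff (k : ℕ) (t : ℝ) : ℂ :=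
  2 * (-Complex.I) ^ k * (((k + 1 : ℝ) / t * besselJ (k + 1) t : ℝ) : ℂ)

/-- The coefficient `a_n(t) = ∑_k α_{n+2k}(t) / (M-1)^k` of the expansion in nonbacktracking
powers. -/
def nbCoeff (M : ℝ) (n : ℕ) (t : ℝ) : ℂ :=
  ∑' k : ℕ, chebCoeff (n + 2 * k) t / ((M : ℂ) - 1) ^ k

/-- `γ̃_n(E, φ) = ∫_0^{M^{ρ+δ}} e^{iEt} φ̂(ηt) a_n(t) dt`, where `η = M^{-ρ}`. -/
def gammaTilde (M ρ δ : ℝ) (n : ℕ) (E : ℝ) (φ : ℝ → ℝ) : ℂ :=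
  ∫ t in (0 : ℝ)..(M ^ (ρ + δ)),
    Complex.exp (Complex.I * E * t) * fourierHat φ (M ^ (-ρ) * t) * nbCoeff M n t

open Classical in
/-- The dumbbell contribution `𝒱_main`: the sum over `b₁, b₂, b₄ ≥ 0` and `b₃ ≥ 1` with
`(b₃, b₄) ≠ (2, 0), (1, 1)` and `b₁ + b₂ + b₃ + b₄ ≤ M^μ / 2`. -/
def mainV (d L : ℕ) [NeZero L] (W ρ μ δ : ℝ) (φ₁ φ₂ : ℝ → ℝ) (E₁ E₂ : ℝ) : ℝ :=
  let M : ℝ := bandM d L W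
  let B : ℕ := ⌊M ^ μ / 2⌋₊
  ∑ b₁ ∈ Finset.range (B + 1), ∑ b₂ ∈ Finset.range (B + 1),
    ∑ b₃ ∈ Finset.Icc 1 B, ∑ b₄ ∈ Finset.range (B + 1),
      if (b₃, b₄) ≠ (2, 0) ∧ (b₃, b₄) ≠ (1, 1) ∧ ((b₁ + b₂ + b₃ + b₄ : ℕ) : ℝ) ≤ M ^ μ / 2 then
        (2 * (gammaTilde M ρ δ (2 * b₁ + b₃ + b₄) E₁ φ₁).re) *
        (2 * (gammaTilde M ρ δ (2 * b₂ + b₃ + b₄) E₂ φ₂).re) *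
        (M / (M - 1)) ^ (b₁ + b₂) * (varS d L W ^ (b₃ + b₄)).trace
      else 0

/-- The leading term of the density-density correlation,
`Θ = (2/β) (LW)^d N⁻² 𝒱_main / (𝔼 Y₁ 𝔼 Y₂)`, with `N = L^d` and `η = M^{-ρ}`. -/
def leadingTheta (s : SymmetryClass) (d L : ℕ) [NeZero L] (W ρ μ δ : ℝ) (φ₁ φ₂ : ℝ → ℝ)
    (E₁ E₂ : ℝ) : ℝ :=
  let η : ℝ := (bandM d L W : ℝ) ^ (-ρ)
  2 / s.beta * (((L : ℝ) * W) ^ d / ((L : ℝ) ^ d) ^ 2) *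
    (mainV d L W ρ μ δ φ₁ φ₂ E₁ E₂ /
      (meanDensity s d L W η φ₁ E₁ * meanDensity s d L W η φ₂ E₂))

end RandomBand

end

/-!
`Θ` is the quotient of the dumbbell sum `𝒱` by a product of two mean densities, and numerator and
denominator are treated separately.

*Numerator.* Summing over the lengths `b₁, b₂` of the two legs for a fixed length
`m = b₃ + b₄ ≥ 3` of the bridges turns `𝒱` into `∑ₘ D(m) Tr Sᵐ` (`mainV_eq_sum`). By Bessel's
integral and the recurrence for `α_k`, `2 Re γ̃ₙ` is, up to `O(M^(ρ-1))`, the difference of the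
Chebyshev coefficients of order `n` and `n + 2` of `x ↦ η⁻¹ φ(η⁻¹ (x - E))`
(`exists_gammaTilde_approx`), so the sums over the legs telescope. Linearizing `cos θ` at `arccos E`
makes the remaining coefficients Fourier transforms (`exists_levelTransform_sub_le`), and `D(m)`
becomes `2 (1 - E²)⁻¹ Re (conj φ̂₁(mh) φ̂₂(mh))` with `h = η / √(1 - E²)`, plus a term oscillating
like `e^(2im arccos E)` (`exists_dumbbell_sub_le`, `linearTransform_mul`).

On the torus `Tr Sᵐ` is the sum of the `m`-th powers of the characteristic function of a uniform
step in the punctured ball, and a local limit theorem gives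
`(W/L)^d Tr Sᵐ ≈ ((d + 2) / (2πm))^(d/2)` (`exists_trace_pow_sub_le`); here `L ≥ W^(1+d/6)` and
`μ < 1/3` ensure that the walk does not feel the periodicity. Hence `𝒱` is governed by
`∑ₘ m^(1-d/2) conj φ̂₁(mh) φ̂₂(mh)`. The oscillating part cancels by summation by parts, and the sum
is a Riemann sum (`exists_mainV_sub_le`): for `d ≤ 3` it yields `h^(d/2-2) V_d / 2`
(`exists_mainV_sub_formV_le`), while for `d = 4` the weight `1 / m` yields the logarithm
(`exists_mainV_sub_log_le`).

*Denominator.* The mean density is `ν ∫ φ` with a relative error that is a power of `M`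
(`exists_meanDensity_sub_le`). Resampling one matrix entry changes the resolvent little, so its
entries concentrate by the Efron–Stein inequality (`integral_norm_sub_mean_sq_le`). The mean
resolvent then solves the semicircle equation approximately (`norm_self_consistent_le`), and the
stability of that equation (`semicircle_stability`) gives the density of states smoothed by a
Poisson kernel; a general `φ` is compared with its Poisson smoothing on a slightly smaller scale.
-/

set_option linter.unusedSectionVars false

noncomputable section

open scoped Real
open Complex (I abs_im_le_norm abs_re_le_norm conj_I conj_conj conj_ofReal continuous_conj exp
  exp_add exp_conj im im_sum measurable_im mul_conj' normSq_apply norm_real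
  ofReal_cos ofReal_mul ofReal_re re_ofReal_mul re_sum real_smul sub_re two_cos)
open Function (comp_apply ne_iff uncurry update update_of_ne update_self)
open Real (abs_cos_le_one arccos cos exp_le_exp exp_pos log mul_rpow norm_eq_abs norm_of_nonneg
  one_le_rpow one_le_sqrt pi_gt_three pi_ne_zero pi_pos rpow_add
  rpow_mul rpow_natCast rpow_neg rpow_one rpow_pos_of_pos rpow_sub sin sq_sqrt sqrt sqrt_eq_rpow
  sqrt_inv sqrt_le_iff sqrt_le_one sqrt_mul sqrt_nonneg sqrt_pos sqrt_sq)
open Finset (Icc Ico abs_sum_le_sum_abs card_erase_of_mem card_pos card_range card_univ mem_Icc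
  mem_Ico mem_erase mem_filter mem_range mem_univ mul_sum range single_le_sum sum_add_distrib
  sum_comm sum_congr sum_const sum_div sum_eq_zero sum_filter sum_le_sum sum_mul sum_nbij'
  sum_nonneg sum_sub_distrib univ)
open Fintype (card equivFin)
open Filter (Eventually atTop)
open Set (Ioc Ioi uIcc_of_le)
open Equiv (addRight swap)
open Nat (cast_nonneg cast_sub)
open Complex renaming norm_exp_ofReal_mul_I → norm_expI
open Real renaming rpow_le_rpow_of_exponent_le → rpow_mono
open Filter renaming eventually_ge_atTop → ev_ge

-- `pos%`, `lin%`, `mono%` and `num%` are proof terms for routine side conditions.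
local notation:max "pos%" => by positivity
local notation:max "lin%" => by linarith
local notation:max "mono%" => by gcongr
local notation:max "num%" => by norm_num
local notation:10000 n "!" => Nat.factorial n
local notation:max "ℱ" => RandomBand.fourierHat
local notation:max "ς" E:max => √(1 - E ^ 2)
local notation "bulk" κ:max => Set.Icc (-1 + κ) (1 - κ)

namespace RandomBand

section

/-! ### The Efron–Stein inequality on a finite product space -/

section EfronStein

variable {ι α : Type*} [Fintype ι] [DecidableEq ι] [MeasurableSpace α]

lemma measurable_update_pair (i : ι) : Measurable (fun p : (ι → α) × α => update p.1 i p.2) := by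
  rw [measurable_pi_iff]; intro j
  by_cases h : j = i
  · subst h; simpa using measurable_snd
  · simpa [update_of_ne h, Function.comp_def] using (measurable_pi_apply j).comp measurable_fst

/-- Resampling one coordinate preserves a product law. -/
lemma measurePreserving_update (ν : Measure α) [IsProbabilityMeasure ν] (i : ι) :
    MeasurePreserving (fun p : (ι → α) × α => update p.1 i p.2)
      ((Measure.pi fun _ : ι => ν).prod ν) (Measure.pi fun _ : ι => ν) := by
  have hm := measurable_update_pair (α := α) i
  refine ⟨hm, ?_⟩; refine (Measure.pi_eq fun s hs => ?_).symm
  rw [Measure.map_apply hm (MeasurableSet.univ_pi hs)]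
  have hset : (fun p : (ι → α) × α => update p.1 i p.2) ⁻¹' (Set.univ.pi s)
    = (Set.univ.pi (update s i Set.univ)) ×ˢ s i := by
    ext ⟨x, t⟩; simp only [Set.mem_preimage, Set.mem_pi, Set.mem_univ, true_implies, Set.mem_prod]
    constructor
    · intro h; refine ⟨fun j => ?_, by simpa using h i⟩
      by_cases hj : j = i
      · subst hj; simp
      · simpa [update_of_ne hj] using h j
    · rintro ⟨h1, h2⟩ j
      by_cases hj : j = i
      · subst hj; simpa using h2
      · simpa [update_of_ne hj] using h1 j
  rw [hset, Measure.prod_prod, Measure.pi_pi, ← Finset.mul_prod_erase _ _ (mem_univ i),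
    ← Finset.mul_prod_erase univ (fun j => ν (s j)) (mem_univ i)]
  simp only [update_self, measure_univ, one_mul]; rw [mul_comm]; congr 1
  refine Finset.prod_congr rfl fun j hj => ?_; rw [update_of_ne (Finset.ne_of_mem_erase hj)]

/-- The average over the coordinate `i`. -/
def coordMean (ν : Measure α) (i : ι) (f : (ι → α) → ℂ) (x : ι → α) : ℂ := ∫ t, f (update x i t) ∂ν

lemma measurable_coordMean (ν : Measure α) [IsProbabilityMeasure ν] (i : ι)
    {f : (ι → α) → ℂ} (hf : Measurable f) : Measurable (coordMean ν i f) :=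
  (StronglyMeasurable.integral_prod_right (f := fun (x : ι → α) (t : α) => f (update x i t))
    (hf.comp (measurable_update_pair i)).stronglyMeasurable).measurable

lemma norm_coordMean_le (ν : Measure α) [IsProbabilityMeasure ν] (i : ι)
    {f : (ι → α) → ℂ} {C : ℝ} (hC : ∀ x, ‖f x‖ ≤ C) (x : ι → α) : ‖coordMean ν i f x‖ ≤ C := by
  simpa [coordMean] using
    norm_integral_le_of_norm_le_const (μ := ν) (.of_forall fun t => hC (update x i t))

lemma integrable_of_bdd {β F : Type*} [MeasurableSpace β] [NormedAddCommGroup F]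
    [MeasurableSpace F] [BorelSpace F] [SecondCountableTopology F]
    (m : Measure β) [IsFiniteMeasure m]
    {f : β → F} (hf : Measurable f) {C : ℝ} (hC : ∀ x, ‖f x‖ ≤ C) : Integrable f m :=
  .of_bound hf.aestronglyMeasurable C (.of_forall hC)

lemma integrable_norm_sub_sq {β : Type*} [MeasurableSpace β] (m : Measure β) [IsFiniteMeasure m]
    {f g : β → ℂ} (hf : Measurable f) (hg : Measurable g) {C : ℝ} (hfC : ∀ x, ‖f x‖ ≤ C)
    (hgC : ∀ x, ‖g x‖ ≤ C) : Integrable (fun x => ‖f x - g x‖ ^ 2) m :=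
  integrable_of_bdd m (C := (C + C) ^ 2) ((hf.sub hg).norm.pow_const 2) fun x => by
    rw [norm_pow, norm_norm]; gcongr
    exact (norm_sub_le _ _).trans (add_le_add (hfC x) (hgC x))

/-- Averaging over a resampled coordinate does not change an expectation. -/
lemma integral_update {F : Type*} [NormedAddCommGroup F] [NormedSpace ℝ F]
    (ν : Measure α) [IsProbabilityMeasure ν] (i : ι) {f : (ι → α) → F}
    (hf : Integrable f (Measure.pi fun _ : ι => ν)) :
    ∫ x, f x ∂(Measure.pi fun _ : ι => ν)
      = ∫ x, ∫ t, f (update x i t) ∂ν ∂(Measure.pi fun _ : ι => ν) := by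
  have h := measurePreserving_update ν i
  have hi : Integrable (fun p : (ι → α) × α => f (update p.1 i p.2))
    ((Measure.pi fun _ : ι => ν).prod ν) := h.integrable_comp_of_integrable hf
  rw [← integral_prod _ hi]; conv_lhs => rw [← h.map_eq]
  rw [integral_map h.measurable.aemeasurable]; rw [h.map_eq]; exact hf.aestronglyMeasurable

lemma variance_identity (ν : Measure α) [IsProbabilityMeasure ν] {g : α → ℂ}
    (hg : Measurable g) {C : ℝ} (hC : ∀ x, ‖g x‖ ≤ C) (c : ℂ) :
    ∫ t, ‖g t - c‖ ^ 2 ∂ν = ∫ t, ‖g t - ∫ s, g s ∂ν‖ ^ 2 ∂ν + ‖(∫ s, g s ∂ν) - c‖ ^ 2 := by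
  set m := ∫ s, g s ∂ν with hm
  have h1 := integrable_of_bdd ν hg hC
  have h2 : Integrable (fun t => ‖g t - m‖ ^ 2) ν :=
    integrable_norm_sub_sq ν hg measurable_const hC fun _ => by
      simpa using norm_integral_le_of_norm_le_const (μ := ν) (.of_forall hC)
  have h3 : Integrable (fun t => g t - m) ν := h1.sub (integrable_const m)
  have e : ∀ t, ‖g t - c‖ ^ 2 = ‖g t - m‖ ^ 2 + 2 * inner ℝ (m - c) (g t - m) + ‖m - c‖ ^ 2 := by
    intro t; rw [← sub_add_sub_cancel (g t) m c, norm_add_sq_real, real_inner_comm]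
  have h4 : Integrable (fun t => 2 * inner ℝ (m - c) (g t - m)) ν := (h3.const_inner _).const_mul 2
  simp_rw [e]
  rw [integral_add (by exact h2.add h4) (integrable_const _), integral_add h2 h4, integral_const_mul,
    integral_inner h3, integral_sub h1 (integrable_const m)]
  simp [hm]

lemma integral_norm_sub_mean_sq_le (ν : Measure α) [IsProbabilityMeasure ν] {g h : α → ℂ}
    (hg : Measurable g) (hh : Measurable h) {C : ℝ} (hgC : ∀ x, ‖g x‖ ≤ C) (hhC : ∀ x, ‖h x‖ ≤ C)
    (c : ℂ) : ∫ t, ‖g t - ∫ s, h s ∂ν‖ ^ 2 ∂ν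
      ≤ ∫ t, ‖c - g t‖ ^ 2 ∂ν + ∫ t, ‖g t - h t‖ ^ 2 ∂ν := by
  have e1 := variance_identity ν hg hgC (∫ s, h s ∂ν)
  have e2 := variance_identity ν hg hgC c
  have e3 := variance_identity ν (hg.sub hh) (C := C + C) (fun t =>
    (norm_sub_le _ _).trans (add_le_add (hgC t) (hhC t))) 0
  simp only [Pi.sub_apply, sub_zero,
    integral_sub (integrable_of_bdd ν hg hgC) (integrable_of_bdd ν hh hhC)] at e3
  simp_rw [norm_sub_rev c]; rw [e1, e2, e3, add_assoc, add_le_add_iff_left]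
  have h0 : 0 ≤ ∫ t, ‖g t - h t - (∫ s, g s ∂ν - ∫ s, h s ∂ν)‖ ^ 2 ∂ν :=
    integral_nonneg fun t => sq_nonneg _
  nlinarith [sq_nonneg ‖(∫ s, g s ∂ν) - c‖]

lemma coordMean_update (ν : Measure α) (i : ι) (f : (ι → α) → ℂ) (x : ι → α) (t : α) :
    coordMean ν i f (update x i t) = coordMean ν i f x := by
  simp [coordMean]

/-- One step of the telescoping: the averages over the coordinates in a list are
peeled off one at a time, the increments being orthogonal. -/
lemma integral_sq_sub_coordMean_le (ν : Measure α) [IsProbabilityMeasure ν] (i : ι)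
    {f h : (ι → α) → ℂ} (hf : Measurable f) (hh : Measurable h) {C : ℝ}
    (hfC : ∀ x, ‖f x‖ ≤ C) (hhC : ∀ x, ‖h x‖ ≤ C) :
    ∫ x, ‖f x - coordMean ν i h x‖ ^ 2 ∂(Measure.pi fun _ : ι => ν)
      ≤ (∫ x, ∫ t, ‖f x - f (update x i t)‖ ^ 2 ∂ν ∂(Measure.pi fun _ : ι => ν))
        + ∫ x, ‖f x - h x‖ ^ 2 ∂(Measure.pi fun _ : ι => ν) := by
  set P := Measure.pi fun _ : ι => ν
  have hup := measurable_update_pair (α := α) i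
  have hupx : ∀ x : ι → α, Measurable fun t => update x i t := fun x =>
    hup.comp (measurable_const.prodMk measurable_id)
  have i4 : Integrable (fun x => ∫ t, ‖f x - f (update x i t)‖ ^ 2 ∂ν) P :=
    (integrable_norm_sub_sq (P.prod ν) (hf.comp measurable_fst) (hf.comp hup)
      (fun _ => hfC _) fun _ => hfC _).integral_prod_left
  have i6 : Integrable (fun x => ∫ t, ‖f (update x i t) - h (update x i t)‖ ^ 2 ∂ν) P :=
    (integrable_norm_sub_sq (P.prod ν) (hf.comp hup) (hh.comp hup)
      (fun _ => hfC _) fun _ => hhC _).integral_prod_left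
  rw [integral_update ν i (integrable_norm_sub_sq P hf (measurable_coordMean ν i hh) hfC
    (norm_coordMean_le ν i hhC)), integral_update ν i (integrable_norm_sub_sq P hf hh hfC hhC),
    ← integral_add i4 i6]
  simp only [coordMean_update]
  exact integral_mono_of_nonneg (.of_forall fun x => integral_nonneg fun t => sq_nonneg _)
    (i4.add i6) (.of_forall fun x => integral_norm_sub_mean_sq_le ν (hf.comp (hupx x))
      (hh.comp (hupx x)) (fun _ => hfC _) (fun _ => hhC _) (f x))

lemma coordMean_update_of_invariant (ν : Measure α) (i j : ι) {f : (ι → α) → ℂ}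
    (hinv : ∀ x t, f (update x j t) = f x) (x : ι → α) (t : α) :
    coordMean ν i f (update x j t) = coordMean ν i f x := by
  by_cases h : i = j
  · subst h; exact coordMean_update ν i f x t
  · unfold coordMean; congr 1; ext s; rw [Function.update_comm (Ne.symm h), hinv]

/-- The Efron–Stein inequality. -/
lemma efron_stein (ν : Measure α) [IsProbabilityMeasure ν]
    {f : (ι → α) → ℂ} (hf : Measurable f) {C : ℝ} (hfC : ∀ x, ‖f x‖ ≤ C) :
    ∫ x, ‖f x - ∫ y, f y ∂(Measure.pi fun _ : ι => ν)‖ ^ 2 ∂(Measure.pi fun _ : ι => ν)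
      ≤ ∑ i, ∫ x, ∫ t, ‖f x - f (update x i t)‖ ^ 2 ∂ν ∂(Measure.pi fun _ : ι => ν) := by
  set P := Measure.pi fun _ : ι => ν
  let A : List ι → (ι → α) → ℂ := fun l => l.foldr (fun i h => coordMean ν i h) f
  have hA : ∀ l : List ι, Measurable (A l) ∧ (∀ x, ‖A l x‖ ≤ C) ∧
    ∫ x, A l x ∂P = ∫ x, f x ∂P ∧ (∀ j ∈ l, ∀ x t, A l (update x j t) = A l x) ∧
    ∫ x, ‖f x - A l x‖ ^ 2 ∂P
      ≤ (l.map fun i => ∫ x, ∫ t, ‖f x - f (update x i t)‖ ^ 2 ∂ν ∂P).sum := by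
    intro l
    induction l with
    | nil => exact ⟨hf, hfC, rfl, by simp, by simp [A]⟩
    | cons i l ih =>
      obtain ⟨h1, h2, h3, h4, h5⟩ := ih
      refine ⟨measurable_coordMean ν i h1, norm_coordMean_le ν i h2, ?_, ?_, ?_⟩
      · rw [← h3, integral_update ν i (integrable_of_bdd P h1 h2)]; rfl
      · intro j hj x t
        rcases List.mem_cons.1 hj with rfl | hj
        · exact coordMean_update ν _ _ x t
        · exact coordMean_update_of_invariant ν i j (h4 j hj) x t
      · rw [List.map_cons, List.sum_cons]
        exact (integral_sq_sub_coordMean_le ν i hf h1 hfC h2).trans mono%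
  obtain ⟨h1, h2, h3, h4, h5⟩ := hA (univ : Finset ι).toList
  -- a function invariant under changes of every coordinate is constant
  have hconst : ∀ x y, A (univ : Finset ι).toList x = A (univ : Finset ι).toList y := by
    intro x y
    have : ∀ s : Finset ι, A (univ : Finset ι).toList (s.piecewise y x)
      = A (univ : Finset ι).toList x := by
      intro s
      induction s using Finset.induction_on with
      | empty => simp
      | insert j s hj ih =>
        rw [Finset.piecewise_insert, h4 j (by simp), ih]
    have h := this univ
    rw [Finset.piecewise_univ] at h; exact h.symm
  have hval : ∀ x, A (univ : Finset ι).toList x = ∫ y, f y ∂P := by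
    intro x; rw [← h3]; simp [fun y => hconst y x]
  simp only [hval] at h5; refine h5.trans (le_of_eq ?_); rw [Finset.sum_map_toList]

end EfronStein

/-! ### Resolvents of Hermitian matrices -/

section Green

open scoped Matrix

variable {ι : Type*} [Fintype ι] [DecidableEq ι]

/-- The resolvent `(H - z)⁻¹`. -/
def green (H : Matrix ι ι ℂ) (z : ℂ) : Matrix ι ι ℂ := (H - z • 1)⁻¹

lemma green_eq_spectral {H : Matrix ι ι ℂ} (hH : H.IsHermitian) {z : ℂ} (hz : z.im ≠ 0) :
    (H - z • 1) * ((hH.eigenvectorUnitary : Matrix ι ι ℂ)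
      * Matrix.diagonal (fun i => ((hH.eigenvalues i : ℂ) - z)⁻¹)
      * star (hH.eigenvectorUnitary : Matrix ι ι ℂ)) = 1 := by
  have hs := hH.spectral_theorem
  rw [Unitary.conjStarAlgAut_apply] at hs
  set U : Matrix ι ι ℂ := (hH.eigenvectorUnitary : Matrix ι ι ℂ)
  have hUU : star U * U = 1 := Unitary.coe_star_mul_self hH.eigenvectorUnitary
  have hUU' : U * star U = 1 := Unitary.coe_mul_star_self hH.eigenvectorUnitary
  have h1 : H - z • 1 = U * Matrix.diagonal (fun i => (hH.eigenvalues i : ℂ) - z) * star U := by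
    have : Matrix.diagonal (fun i => (hH.eigenvalues i : ℂ) - z)
      = Matrix.diagonal (RCLike.ofReal ∘ hH.eigenvalues) - z • 1 := by
      rw [← Matrix.diagonal_one, ← Matrix.diagonal_smul, Matrix.diagonal_sub]; congr 1; ext i; simp
    rw [this, mul_sub, sub_mul, ← hs]; simp [hUU']
  have hne : ∀ i, (hH.eigenvalues i : ℂ) - z ≠ 0 := fun i h => by
    have := congrArg im h
    simp at this; exact hz this
  rw [h1, ← mul_assoc, ← mul_assoc, mul_assoc (U * _) _ U, hUU, mul_one, mul_assoc U,
    Matrix.diagonal_mul_diagonal]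
  simp [hne, hUU']

variable {H : Matrix ι ι ℂ} {z : ℂ}

lemma mul_green (hH : H.IsHermitian) (hz : z.im ≠ 0) : (H - z • 1) * green H z = 1 := by
  have h := green_eq_spectral hH hz
  have h2 : green H z = _ := Matrix.inv_eq_right_inv h
  rw [h2, h]

lemma green_mul (hH : H.IsHermitian) (hz : z.im ≠ 0) : green H z * (H - z • 1) = 1 :=
  _root_.mul_eq_one_comm.1 (mul_green hH hz)

lemma trace_green (hH : H.IsHermitian) (hz : z.im ≠ 0) :
    (green H z).trace = ∑ i, ((hH.eigenvalues i : ℂ) - z)⁻¹ := by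
  have h2 : green H z = _ := Matrix.inv_eq_right_inv (green_eq_spectral hH hz)
  rw [h2, Matrix.trace_mul_comm, ← mul_assoc, Unitary.coe_star_mul_self, one_mul,
    Matrix.trace_diagonal]

/-- The resolvent identity. -/
lemma green_sub_green {H' : Matrix ι ι ℂ} (hH : H.IsHermitian) (hH' : H'.IsHermitian)
    (hz : 0 < z.im) : green H z - green H' z = green H z * (H' - H) * green H' z := by
  have e : H' - H = (H' - z • 1) - (H - z • 1) := by abel
  rw [e, mul_sub, sub_mul, mul_assoc, mul_green hH' hz.ne', green_mul hH hz.ne']; simp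

lemma conjTranspose_green (hH : H.IsHermitian) : (green H z)ᴴ = green H (conj z) := by
  simp [green, Matrix.conjTranspose_nonsing_inv, hH.eq]

/-- The resolvent identity in the spectral parameter. -/
lemma green_sub_green_spectral (hH : H.IsHermitian) {w : ℂ} (hz : z.im ≠ 0) (hw : w.im ≠ 0) :
    green H z - green H w = (z - w) • (green H z * green H w) := by
  have e : (z - w) • (green H z * green H w)
    = green H z * ((H - w • 1) - (H - z • 1)) * green H w := by simp [← sub_smul]
  rw [e, mul_sub, sub_mul, mul_assoc, mul_green hH hw, green_mul hH hz]; simp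

lemma green_sub_conjTranspose (hH : H.IsHermitian) (hz : 0 < z.im) :
    green H z - (green H z)ᴴ = (z - conj z) • (green H z * (green H z)ᴴ) := by
  rw [conjTranspose_green hH, green_sub_green_spectral hH hz.ne' (by simpa using hz.ne')]

lemma green_sub_conjTranspose' (hH : H.IsHermitian) (hz : 0 < z.im) :
    green H z - (green H z)ᴴ = (z - conj z) • ((green H z)ᴴ * green H z) := by
  rw [conjTranspose_green hH, ← neg_sub, green_sub_green_spectral hH (by simpa using hz.ne') hz.ne',
    ← neg_smul, neg_sub]

lemma sub_conj_eq (z : ℂ) : z - conj z = 2 * (z.im : ℂ) * I := by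
  apply Complex.ext <;> simp; ring

lemma sum_sq_eq_im_div (hz : 0 < z.im) {g : ℂ} {v : ι → ℂ}
    (h : g - conj g = (z - conj z) * ∑ y, (‖v y‖ : ℂ) ^ 2) :
    ∑ y, ‖v y‖ ^ 2 = g.im / z.im := by
  rw [sub_conj_eq, sub_conj_eq] at h
  have h2 : (g.im : ℂ) = z.im * ∑ y, (‖v y‖ : ℂ) ^ 2 := by
    apply mul_left_cancel₀ (show (2 * I : ℂ) ≠ 0 by simp)
    linear_combination h
  rw [eq_div_iff hz.ne', mul_comm]; exact mod_cast h2.symm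

/-- The Ward identity, for rows. -/
lemma ward_row (hH : H.IsHermitian) (hz : 0 < z.im) (x : ι) :
    ∑ y, ‖green H z x y‖ ^ 2 = (green H z x x).im / z.im := by
  have h := congrFun (congrFun (green_sub_conjTranspose hH hz) x) x
  simp only [Matrix.sub_apply, Matrix.conjTranspose_apply, Matrix.smul_apply, Matrix.mul_apply,
    smul_eq_mul, RCLike.star_def, mul_conj'] at h
  exact sum_sq_eq_im_div hz h

/-- The Ward identity, for columns. -/
lemma ward_col (hH : H.IsHermitian) (hz : 0 < z.im) (x : ι) :
    ∑ y, ‖green H z y x‖ ^ 2 = (green H z x x).im / z.im := by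
  have h := congrFun (congrFun (green_sub_conjTranspose' hH hz) x) x
  simp only [Matrix.sub_apply, Matrix.conjTranspose_apply, Matrix.smul_apply, Matrix.mul_apply,
    smul_eq_mul, RCLike.star_def, Complex.conj_mul'] at h
  exact sum_sq_eq_im_div hz h

lemma green_im_nonneg (hH : H.IsHermitian) (hz : 0 < z.im) (x : ι) : 0 ≤ (green H z x x).im := by
  have h := ward_row hH hz x
  have h2 : 0 ≤ (green H z x x).im / z.im := by rw [← h]; positivity
  have h3 := mul_nonneg h2 hz.le
  rwa [div_mul_cancel₀ _ hz.ne'] at h3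

lemma norm_green_sq_le (hH : H.IsHermitian) (hz : 0 < z.im) (x y : ι) :
    ‖green H z x y‖ ^ 2 ≤ (green H z x x).im / z.im := by
  rw [← ward_row hH hz x]
  exact single_le_sum (f := fun y => ‖green H z x y‖ ^ 2) (fun i _ => sq_nonneg _) (mem_univ y)

lemma green_im_le (hH : H.IsHermitian) (hz : 0 < z.im) (x : ι) : (green H z x x).im ≤ 1 / z.im := by
  have h := norm_green_sq_le hH hz x x
  have h2 := (le_abs_self _).trans (abs_im_le_norm (green H z x x))
  rw [le_div_iff₀ hz] at h ⊢
  rcases (green_im_nonneg hH hz x).eq_or_lt with h0 | h0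
  · simp [← h0]
  · have := pow_le_pow_left₀ h0.le h2 2
    exact le_of_mul_le_mul_left (by nlinarith) h0

lemma norm_green_le (hH : H.IsHermitian) (hz : 0 < z.im) (x y : ι) :
    ‖green H z x y‖ ≤ 1 / z.im := by
  refine (abs_le_of_sq_le_sq' ((norm_green_sq_le hH hz x y).trans ?_) pos%).2
  rw [div_le_iff₀ hz]; exact (green_im_le hH hz x).trans (le_of_eq (by field_simp))

/-- The operator norm bound `‖v (H - z)⁻¹‖ ≤ ‖v‖ / Im z`. -/
lemma sum_norm_vecMul_green_le (hH : H.IsHermitian) (hz : 0 < z.im) (v : ι → ℂ) :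
    ∑ b, ‖∑ y, v y * green H z y b‖ ^ 2 ≤ (∑ y, ‖v y‖ ^ 2) / z.im ^ 2 := by
  set w : ι → ℂ := fun b => ∑ y, v y * green H z y b with hw
  set S := ∑ b, ‖w b‖ ^ 2 with hS
  set V := ∑ y, ‖v y‖ ^ 2
  set q : ℂ := ∑ b, w b * conj (v b) with hq
  have hquad : (z - conj z) * (S : ℂ) = q - conj q := by
    have h := green_sub_conjTranspose hH hz
    have h1 : ∑ a, ∑ b, v a * (green H z - (green H z)ᴴ) a b * conj (v b) = q - conj q := by
      simp only [Matrix.sub_apply, Matrix.conjTranspose_apply, mul_sub, sub_mul,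
        sum_sub_distrib, hq, hw, map_sum, map_mul, sum_mul, conj_conj,
        RCLike.star_def]
      congr 1
      · rw [sum_comm]
      · refine sum_congr rfl fun a _ => sum_congr rfl fun b _ => by ring
    have h2 : ∑ a, ∑ b, v a * ((z - conj z) • (green H z * (green H z)ᴴ)) a b
      * conj (v b) = (z - conj z) * (S : ℂ) := by
      have : (S : ℂ) = ∑ c, w c * conj (w c) := by simp only [mul_conj', hS]; push_cast; rfl
      rw [this]
      simp only [Matrix.smul_apply, Matrix.mul_apply, Matrix.conjTranspose_apply, smul_eq_mul,
        RCLike.star_def, hw, map_sum, map_mul, mul_sum, sum_mul]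
      rw [sum_comm]
      conv_rhs => rw [sum_comm]
      refine sum_congr rfl fun b _ => ?_
      conv_rhs => rw [sum_comm]
      refine sum_congr rfl fun a _ => sum_congr rfl fun c _ => by ring
    rw [← h1, ← h2, h]
  have hqn : ‖q‖ ^ 2 ≤ S * V := by
    have h1 : ‖q‖ ≤ ∑ b, ‖w b‖ * ‖v b‖ := by refine (norm_sum_le _ _).trans (le_of_eq ?_); simp
    calc ‖q‖ ^ 2 ≤ (∑ b, ‖w b‖ * ‖v b‖) ^ 2 := mono%
      _ ≤ _ := Finset.sum_mul_sq_le_sq_mul_sq _ _ _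
  have hS0 : 0 ≤ S := sum_nonneg fun i _ => sq_nonneg _
  have him : z.im * S = q.im := by
    rw [sub_conj_eq, sub_conj_eq] at hquad
    have hne : (2 * I : ℂ) ≠ 0 := by simp
    have : ((z.im * S : ℝ) : ℂ) = ((q.im : ℝ) : ℂ) := by
      apply mul_left_cancel₀ hne
      push_cast
      linear_combination hquad
    exact_mod_cast this
  have h3 : (z.im * S) ^ 2 ≤ S * V := by
    rw [him]; refine le_trans ?_ hqn
    have := abs_im_le_norm q
    rw [← sq_abs q.im]; gcongr
  rw [le_div_iff₀ pos%]
  rcases hS0.eq_or_lt with h0 | h0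
  · rw [← h0]; simp; positivity
  · have : S * (S * z.im ^ 2) ≤ S * V := by nlinarith
    exact le_of_mul_le_mul_left this h0

end Green

end

section

/-! ### Sensitivity of the resolvent to a single matrix entry -/

section Sensitivity

variable {ι : Type*} [Fintype ι] [DecidableEq ι]

/-- The Hermitian matrix with entries `δ` at `(a, b)` and `conj δ` at `(b, a)`. -/
def pairMatrix (a b : ι) (δ : ℂ) : Matrix ι ι ℂ := Matrix.single a b δ + Matrix.single b a (conj δ)

lemma mul_pairMatrix_mul_apply (A B : Matrix ι ι ℂ) (a b : ι) (δ : ℂ) (i j : ι) :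
    (A * pairMatrix a b δ * B) i j = A i a * δ * B b j + A i b * conj δ * B a j := by
  have h : ∀ (a b : ι) (δ : ℂ), (A * Matrix.single a b δ * B) i j = A i a * δ * B b j := by
    intro a b δ; rw [Matrix.mul_apply, Finset.sum_eq_single b]
    · rw [Matrix.mul_single_apply_same]
    · intro c _ hc; rw [Matrix.mul_single_apply_of_ne _ _ _ _ _ hc, zero_mul]
    · simp
  rw [pairMatrix, Matrix.mul_add, Matrix.add_mul, Matrix.add_apply, h, h]

/-- The weighted partial trace `∑ y, D y * G y y`. -/
def localTrace (D : ι → ℝ) (G : Matrix ι ι ℂ) : ℂ := ∑ y, (D y : ℂ) * G y y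

/-- The matrix `G D G`, which governs the derivatives of `localTrace D G` when `G` is a
resolvent. -/
def sandwich (D : ι → ℝ) (G : Matrix ι ι ℂ) : Matrix ι ι ℂ :=
  G * Matrix.diagonal (fun y => (D y : ℂ)) * G

variable {H H' : Matrix ι ι ℂ} {z : ℂ}

lemma sandwich_apply (D : ι → ℝ) (G : Matrix ι ι ℂ) (a b : ι) :
    sandwich D G a b = ∑ y, G a y * D y * G y b := by
  rw [sandwich, Matrix.mul_apply]; exact sum_congr rfl fun y _ => by rw [Matrix.mul_diagonal]

lemma norm_green_mul_pairMatrix_mul_le (hH : H.IsHermitian) (hz : 0 < z.im) (a b : ι) (δ : ℂ)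
    (B : Matrix ι ι ℂ) (i j : ι) :
    ‖(green H z * pairMatrix a b δ * B) i j‖ ≤ ‖δ‖ / z.im * (‖B b j‖ + ‖B a j‖) := by
  rw [mul_pairMatrix_mul_apply]; refine (norm_add_le _ _).trans ?_
  simp only [norm_mul, RCLike.norm_conj]
  calc _ ≤ 1 / z.im * ‖δ‖ * ‖B b j‖ + 1 / z.im * ‖δ‖ * ‖B a j‖ := by
        gcongr <;> exact norm_green_le hH hz _ _
    _ = _ := by ring

/-- Changing one entry of `H` (and its conjugate) changes `localTrace D (H - z)⁻¹` by an amount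
controlled by the entries of `sandwich D (H - z)⁻¹` for the *unperturbed* matrix. -/
lemma norm_localTrace_sub_sq_le (hH : H.IsHermitian) (hH' : H'.IsHermitian) (hz : 0 < z.im)
    {a b : ι} {δ : ℂ} (hΔ : H' = H + pairMatrix a b δ) (hδ : ‖δ‖ ≤ z.im) (D : ι → ℝ) :
    ‖localTrace D (green H z) - localTrace D (green H' z)‖ ^ 2
      ≤ 16 * ‖δ‖ ^ 2 * (‖sandwich D (green H z) a b‖ ^ 2 + ‖sandwich D (green H z) b a‖ ^ 2
        + ‖δ‖ ^ 2 / z.im ^ 2 * (‖sandwich D (green H z) a a‖ ^ 2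
          + ‖sandwich D (green H z) b b‖ ^ 2)) := by
  set G := green H z with hG
  set G' := green H' z with hG'
  set K := sandwich D G with hK
  set Lm : Matrix ι ι ℂ := G' * Matrix.diagonal (fun y => (D y : ℂ)) * G with hL
  have hdiff : H' - H = pairMatrix a b δ := by rw [hΔ]; abel
  have e1 : G - G' = G * pairMatrix a b δ * G' := by rw [← hdiff]; exact green_sub_green hH hH' hz
  have e2 : G - G' = G' * pairMatrix a b δ * G := by
    rw [← neg_sub, green_sub_green hH' hH hz, ← neg_sub H' H, hdiff]; simp [← hG, ← hG']
  have e3 : Lm = K - G' * pairMatrix a b δ * K := by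
    conv_lhs => rw [hL, ← sub_sub_cancel G G', e2]
    simp only [hK, sandwich, sub_mul, mul_assoc]
  have hT : localTrace D G - localTrace D G' = δ * Lm b a + conj δ * Lm a b := by
    have hLm : ∀ i j, Lm i j = ∑ y, G' i y * D y * G y j := fun i j => by
      rw [hL, Matrix.mul_apply]; exact sum_congr rfl fun y _ => by rw [Matrix.mul_diagonal]
    simp only [localTrace, ← sum_sub_distrib, ← mul_sub, ← Matrix.sub_apply, e1, hLm, mul_sum,
      ← sum_add_distrib, mul_pairMatrix_mul_apply]
    exact sum_congr rfl fun y _ => by ring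
  set r := ‖δ‖ / z.im with hr
  have hb : ∀ i j, ‖Lm i j‖ ≤ ‖K i j‖ + r * (‖K b j‖ + ‖K a j‖) := fun i j => by
    rw [e3]
    exact (norm_sub_le _ _).trans
      (by gcongr; exact norm_green_mul_pairMatrix_mul_le hH' hz a b δ K i j)
  have hr1 : ∀ w : ℂ, r * ‖w‖ ≤ ‖w‖ := fun w =>
    mul_le_of_le_one_left (norm_nonneg w) ((div_le_one hz).2 hδ)
  have hr2 : ‖δ‖ ^ 2 / z.im ^ 2 = r ^ 2 := by rw [hr]; ring
  rw [hT, hr2]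
  have n3 : ‖δ * Lm b a + conj δ * Lm a b‖ ≤ ‖δ‖ * ((2 * ‖K b a‖ + r * ‖K a a‖)
    + (2 * ‖K a b‖ + r * ‖K b b‖)) := by
    refine (norm_add_le _ _).trans ?_; rw [norm_mul, norm_mul, RCLike.norm_conj, ← mul_add]
    gcongr <;> linarith [hb b a, hb a b, hr1 (K b a), hr1 (K a b)]
  have hsq : ∀ p q u v : ℝ, ((2 * p + u) + (2 * q + v)) ^ 2
    ≤ 16 * (q ^ 2 + p ^ 2 + (u ^ 2 + v ^ 2)) := by
    intro p q u v
    nlinarith [sq_nonneg (p - q), sq_nonneg (p - u), sq_nonneg (p - v), sq_nonneg (q - u),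
      sq_nonneg (q - v), sq_nonneg (u - v), sq_nonneg u, sq_nonneg v]
  calc _ ≤ _ := pow_le_pow_left₀ (norm_nonneg _) n3 2
    _ ≤ ‖δ‖ ^ 2 * (16 * (‖K a b‖ ^ 2 + ‖K b a‖ ^ 2
      + ((r * ‖K a a‖) ^ 2 + (r * ‖K b b‖) ^ 2))) := by rw [mul_pow]; gcongr; exact hsq _ _ _ _
    _ = _ := by ring

variable {D : ι → ℝ} {σ : ℝ}

lemma sum_norm_sandwich_sq_le (hH : H.IsHermitian) (hz : 0 < z.im) (hD : ∀ y, 0 ≤ D y)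
    (hσ : ∀ y, D y ≤ σ) :
    ∑ a, ∑ b, ‖sandwich D (green H z) a b‖ ^ 2 ≤ σ / z.im ^ 3 * ∑ y, D y * (green H z y y).im := by
  calc _ ≤ ∑ a, (∑ y, ‖green H z a y * D y‖ ^ 2) / z.im ^ 2 := by
          refine sum_le_sum fun a _ => ?_; simp only [sandwich_apply]
          exact sum_norm_vecMul_green_le hH hz fun y => green H z a y * D y
    _ = (∑ y, D y ^ 2 * ∑ a, ‖green H z a y‖ ^ 2) / z.im ^ 2 := by
      rw [← sum_div, sum_comm]; congr 1
      refine sum_congr rfl fun y _ => ?_; rw [mul_sum]; refine sum_congr rfl fun a _ => ?_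
      rw [norm_mul, mul_pow, norm_real, norm_eq_abs, sq_abs]; ring
    _ ≤ (∑ y, σ * (D y * ((green H z y y).im / z.im))) / z.im ^ 2 := by
      refine div_le_div_of_nonneg_right (sum_le_sum fun y _ => ?_) (sq_nonneg _)
      rw [ward_col hH hz y, ← mul_assoc, sq]
      have : 0 ≤ (green H z y y).im / z.im := div_nonneg (green_im_nonneg hH hz y) hz.le
      exact mul_le_mul_of_nonneg_right (mul_le_mul_of_nonneg_right (hσ y) (hD y)) this
    _ = _ := by rw [mul_sum, sum_div]; refine sum_congr rfl fun y _ => ?_; field_simp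

lemma norm_sandwich_diag_le_sum (hD : ∀ y, 0 ≤ D y) (G : Matrix ι ι ℂ) (a : ι) :
    ‖sandwich D G a a‖ ≤ ∑ y, D y * ((‖G a y‖ ^ 2 + ‖G y a‖ ^ 2) / 2) := by
  rw [sandwich_apply]; refine norm_sum_le_of_le _ (fun y _ => ?_)
  rw [norm_mul, norm_mul, norm_real, norm_of_nonneg (hD y)]
  have := two_mul_le_add_sq ‖G a y‖ ‖G y a‖
  nlinarith [hD y]

lemma norm_sandwich_diag_le (hH : H.IsHermitian) (hz : 0 < z.im) (hD : ∀ y, 0 ≤ D y)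
    (hσ : ∀ y, D y ≤ σ) (a : ι) : ‖sandwich D (green H z) a a‖ ≤ σ / z.im ^ 2 := by
  have hσ0 : 0 ≤ σ := (hD a).trans (hσ a)
  calc _ ≤ ∑ y, D y * ((‖green H z a y‖ ^ 2 + ‖green H z y a‖ ^ 2) / 2) :=
        norm_sandwich_diag_le_sum hD _ a
    _ ≤ ∑ y, σ * ((‖green H z a y‖ ^ 2 + ‖green H z y a‖ ^ 2) / 2) := by gcongr with y; exact hσ y
    _ = σ * ((green H z a a).im / z.im) := by
      rw [← mul_sum, ← sum_div, sum_add_distrib, ward_row hH hz, ward_col hH hz]; ring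
    _ ≤ σ * (1 / z.im / z.im) := by gcongr; exact green_im_le hH hz a
    _ = _ := by field_simp

lemma sum_norm_sandwich_diag_le (hH : H.IsHermitian) (hz : 0 < z.im) (hD : ∀ y, 0 ≤ D y) :
    ∑ a, ‖sandwich D (green H z) a a‖ ≤ (∑ y, D y * (green H z y y).im) / z.im := by
  calc _ ≤ ∑ a, ∑ y, D y * ((‖green H z a y‖ ^ 2 + ‖green H z y a‖ ^ 2) / 2) :=
        sum_le_sum fun a _ => norm_sandwich_diag_le_sum hD _ a
    _ = ∑ y, D y * ((green H z y y).im / z.im) := by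
      rw [sum_comm]; refine sum_congr rfl fun y _ => ?_
      rw [← mul_sum, ← sum_div, sum_add_distrib, ward_row hH hz, ward_col hH hz]; ring
    _ = _ := by rw [sum_div]; exact sum_congr rfl fun y _ => by ring

lemma sum_norm_sandwich_diag_sq_le (hH : H.IsHermitian) (hz : 0 < z.im) (hD : ∀ y, 0 ≤ D y)
    (hσ : ∀ y, D y ≤ σ) :
    ∑ a, ‖sandwich D (green H z) a a‖ ^ 2 ≤ σ / z.im ^ 3 * ∑ y, D y * (green H z y y).im := by
  rcases isEmpty_or_nonempty ι with h | ⟨⟨a0⟩⟩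
  · simp
  have hσ0 : 0 ≤ σ := (hD a0).trans (hσ a0)
  calc _ ≤ ∑ a, σ / z.im ^ 2 * ‖sandwich D (green H z) a a‖ := by
        refine sum_le_sum fun a _ => ?_; rw [sq]; gcongr
        exact norm_sandwich_diag_le hH hz hD hσ a
    _ ≤ σ / z.im ^ 2 * ((∑ y, D y * (green H z y y).im) / z.im) := by
      rw [← mul_sum]; gcongr
      exact sum_norm_sandwich_diag_le hH hz hD
    _ = _ := by field_simp

/-- The total sensitivity of `localTrace D (H - z)⁻¹`, weighted with a variance profile `S`. -/
lemma sum_sensitivity_le (hH : H.IsHermitian) (hz : 0 < z.im) (hz1 : z.im ≤ 1)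
    (hD : ∀ y, 0 ≤ D y) (hσ : ∀ y, D y ≤ σ) {S : ι → ι → ℝ} (hS0 : ∀ a b, 0 ≤ S a b)
    (hSσ : ∀ a b, S a b ≤ σ) (hrow : ∀ a, ∑ b, S a b ≤ 2) (hcol : ∀ b, ∑ a, S a b ≤ 2) :
    ∑ a, ∑ b, S a b * (‖sandwich D (green H z) a b‖ ^ 2 + ‖sandwich D (green H z) b a‖ ^ 2
      + 4 * S a b / z.im ^ 2 * (‖sandwich D (green H z) a a‖ ^ 2
        + ‖sandwich D (green H z) b b‖ ^ 2))
      ≤ 18 * σ ^ 2 / z.im ^ 5 * ∑ y, D y * (green H z y y).im := by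
  rcases isEmpty_or_nonempty ι with h | ⟨⟨a0⟩⟩
  · simp
  have hσ0 : 0 ≤ σ := (hD a0).trans (hσ a0)
  set K := sandwich D (green H z) with hK
  set I' := ∑ y, D y * (green H z y y).im with hI
  have hI0 : 0 ≤ I' := sum_nonneg fun y _ => mul_nonneg (hD y) (green_im_nonneg hH hz y)
  have k1 := sum_norm_sandwich_sq_le hH hz hD hσ
  have k2 := sum_norm_sandwich_diag_sq_le hH hz hD hσ
  rw [← hK, ← hI] at k1 k2
  calc _ ≤ ∑ a, ∑ b, (σ * (‖K a b‖ ^ 2 + ‖K b a‖ ^ 2)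
        + 4 * σ / z.im ^ 2 * (S a b * ‖K a a‖ ^ 2 + S a b * ‖K b b‖ ^ 2)) := by
        refine sum_le_sum fun a _ => sum_le_sum fun b _ => ?_
        have h1 : S a b * (‖K a b‖ ^ 2 + ‖K b a‖ ^ 2) ≤ σ * (‖K a b‖ ^ 2 + ‖K b a‖ ^ 2) := by
          gcongr; exact hSσ a b
        have h2 : S a b * (4 * S a b / z.im ^ 2 * (‖K a a‖ ^ 2 + ‖K b b‖ ^ 2))
          ≤ 4 * σ / z.im ^ 2 * (S a b * ‖K a a‖ ^ 2 + S a b * ‖K b b‖ ^ 2) := by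
          have : S a b * (4 * S a b / z.im ^ 2 * (‖K a a‖ ^ 2 + ‖K b b‖ ^ 2))
            = 4 * S a b / z.im ^ 2 * (S a b * ‖K a a‖ ^ 2 + S a b * ‖K b b‖ ^ 2) := by ring
          rw [this]
          have := hS0 a b
          gcongr
          exact hSσ a b
        linarith
    _ = σ * (∑ a, ∑ b, ‖K a b‖ ^ 2 + ∑ a, ∑ b, ‖K b a‖ ^ 2)
      + 4 * σ / z.im ^ 2 * (∑ a, ∑ b, S a b * ‖K a a‖ ^ 2 + ∑ a, ∑ b, S a b * ‖K b b‖ ^ 2) := by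
      simp only [sum_add_distrib, ← mul_sum]
    _ ≤ σ * (σ / z.im ^ 3 * I' + σ / z.im ^ 3 * I')
      + 4 * σ / z.im ^ 2 * (2 * (σ / z.im ^ 3 * I') + 2 * (σ / z.im ^ 3 * I')) := by
      gcongr
      · rw [sum_comm]; exact k1
      · calc _ = ∑ a, (∑ b, S a b) * ‖K a a‖ ^ 2 := by simp only [sum_mul]
          _ ≤ ∑ a, 2 * ‖K a a‖ ^ 2 := by gcongr with a; exact hrow a
          _ ≤ _ := by rw [← mul_sum]; gcongr
      · rw [sum_comm]
        calc _ = ∑ b, (∑ a, S a b) * ‖K b b‖ ^ 2 := by simp only [sum_mul]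
          _ ≤ ∑ b, 2 * ‖K b b‖ ^ 2 := by gcongr with b; exact hcol b
          _ ≤ _ := by rw [← mul_sum]; gcongr
    _ = σ ^ 2 * I' * (2 * z.im ^ 2 + 16) / z.im ^ 5 := by field_simp; ring
    _ ≤ σ ^ 2 * I' * 18 / z.im ^ 5 := by
      gcongr
      nlinarith
    _ = _ := by ring

/-- Removing the entry `h` at `(x, y)` from `H`: the first-order term of `h (H - z)⁻¹_{yx}` is
`-|h|² G_yy G_xx`. -/
lemma norm_entry_expansion_le {H0 : Matrix ι ι ℂ} (hH : H.IsHermitian) (hH0 : H0.IsHermitian)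
    (hz : 0 < z.im) {x y : ι} {h : ℂ} (hΔ : H = H0 + pairMatrix x y h) (hh : ‖h‖ ≤ z.im) :
    ‖h * green H z y x - h * green H0 z y x + (‖h‖ : ℂ) ^ 2 * green H z y y * green H z x x‖
      ≤ ‖h‖ ^ 2 * (4 * ‖green H z y x‖ ^ 2 + ‖green H z x y‖ ^ 2
        + 3 * ‖h‖ ^ 2 / z.im ^ 2 * ‖green H z x x‖ ^ 2) := by
  set G := green H z
  set G0 := green H0 z with hG0
  have hdiff : H - H0 = pairMatrix x y h := by rw [hΔ]; abel
  have e0 : G0 - G = G0 * pairMatrix x y h * G := by rw [← hdiff]; exact green_sub_green hH0 hH hz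
  have e1 : G0 y x - G y x = _ :=
    (congrFun (congrFun e0 y) x).trans (mul_pairMatrix_mul_apply _ _ _ _ _ _ _)
  set s := ‖h‖ with hs
  set r := s / z.im with hr
  have hs0 : 0 ≤ s := norm_nonneg _
  have hr0 : 0 ≤ r := pos%
  have n1 : ‖G0 y x‖ ≤ 2 * ‖G y x‖ + r * ‖G x x‖ := by
    have h1 := norm_green_mul_pairMatrix_mul_le hH0 hz x y h G y x
    rw [← hG0, ← e0, Matrix.sub_apply, ← hs, ← hr] at h1
    linarith [norm_le_norm_add_norm_sub' (G0 y x) (G y x),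
      mul_le_of_le_one_left (norm_nonneg (G y x)) (show r ≤ 1 from (div_le_one hz).2 hh)]
  have n2 : ‖G0 y y - G y y‖ ≤ r * (2 * ‖G y x‖ + r * ‖G x x‖) + r * ‖G x y‖ := by
    have hb : ∀ {A : ℂ}, ‖A‖ ≤ 1 / z.im → ‖A‖ * s ≤ r := fun hA => by
      rw [hr, div_eq_inv_mul, ← one_div]; gcongr
    rw [← Matrix.sub_apply, e0, mul_pairMatrix_mul_apply]
    calc _ ≤ (‖G y y‖ * s) * ‖G0 y x‖ + (‖G0 y y‖ * s) * ‖G x y‖ := by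
          refine (norm_add_le _ _).trans (le_of_eq ?_); simp only [norm_mul, RCLike.norm_conj]; ring
      _ ≤ _ := by
        gcongr
        · exact hb (norm_green_le hH hz y y)
        · exact hb (norm_green_le hH0 hz y y)
  have hconj : h * conj h = (s : ℂ) ^ 2 := by rw [mul_conj']
  have e3 : h * G y x - h * G0 y x + (s : ℂ) ^ 2 * G y y * G x x
    = - (h ^ 2 * G0 y x * G y x + (s : ℂ) ^ 2 * (G0 y y - G y y) * G x x) := by
    rw [← hconj]
    linear_combination (-h) * e1
  rw [e3, norm_neg]
  have hr2 : 3 * s ^ 2 / z.im ^ 2 = 3 * r ^ 2 := by rw [hr]; ring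
  rw [hr2]
  calc _ ≤ s ^ 2 * ‖G0 y x‖ * ‖G y x‖ + s ^ 2 * ‖G0 y y - G y y‖ * ‖G x x‖ := by
        refine (norm_add_le _ _).trans (le_of_eq ?_); simp [norm_pow, hs]
    _ ≤ s ^ 2 * (2 * ‖G y x‖ + r * ‖G x x‖) * ‖G y x‖
      + s ^ 2 * (r * (2 * ‖G y x‖ + r * ‖G x x‖) + r * ‖G x y‖) * ‖G x x‖ := mono%
    _ = s ^ 2 * (2 * ‖G y x‖ ^ 2 + 3 * (‖G y x‖ * (r * ‖G x x‖))
      + ‖G x y‖ * (r * ‖G x x‖) + (r * ‖G x x‖) ^ 2) := by ring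
    _ ≤ s ^ 2 * (4 * ‖G y x‖ ^ 2 + ‖G x y‖ ^ 2 + 3 * (r * ‖G x x‖) ^ 2) := by
      refine mul_le_mul_of_nonneg_left ?_ (sq_nonneg s)
      nlinarith [two_mul_le_add_sq ‖G y x‖ (r * ‖G x x‖),
        two_mul_le_add_sq ‖G x y‖ (r * ‖G x x‖), sq_nonneg ‖G y x‖, sq_nonneg ‖G x y‖]
    _ = _ := by ring

end Sensitivity

end

section

/-! ### The law of the band matrix -/

lemma entryLaw_ae_norm (s : SymmetryClass) : ∀ᵐ t ∂(entryLaw s), ‖t‖ = 1 := by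
  have hms : MeasurableSet {t : ℂ | ‖t‖ = 1} := measurableSet_eq_fun measurable_norm measurable_const
  cases s with
  | realSymmetric =>
    rw [entryLaw, ae_add_measure_iff]; constructor
    · refine Measure.ae_smul_measure ?_ _; rw [ae_dirac_iff hms]; simp
    · refine Measure.ae_smul_measure ?_ _; rw [ae_dirac_iff hms]; simp
  | complexHermitian =>
    rw [entryLaw, ae_map_iff (by fun_prop) hms]; refine Eventually.of_forall fun θ => ?_
    have : (2 * π * I * θ : ℂ) = ((2 * π * θ : ℝ) : ℂ) * I := by push_cast; ring
    rw [this, norm_expI]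

lemma integral_entryLaw (s : SymmetryClass) : ∫ t, t ∂(entryLaw s) = 0 := by
  cases s with
  | realSymmetric =>
    rw [entryLaw, integral_add_measure, integral_smul_measure, integral_smul_measure,
      integral_dirac, integral_dirac]
    · simp
    · exact Integrable.smul_measure (integrable_dirac (by simp)) (by simp)
    · exact Integrable.smul_measure (integrable_dirac (by simp)) (by simp)
  | complexHermitian =>
    rw [entryLaw, integral_map (by fun_prop) (by fun_prop),
      ← intervalIntegral.integral_of_le zero_le_one]
    rw [integral_exp_mul_complex (by simp [pi_ne_zero])]; simp [Complex.exp_two_pi_mul_I]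

lemma measurePreserving_conj (s : SymmetryClass) :
    MeasurePreserving (fun t : ℂ => conj t) (entryLaw s) (entryLaw s) := by
  have hm : Measurable (fun t : ℂ => conj t) := continuous_conj.measurable
  refine ⟨hm, ?_⟩
  cases s with
  | realSymmetric =>
    rw [entryLaw, Measure.map_add _ _ hm, Measure.map_smul, Measure.map_smul,
      Measure.map_dirac' hm, Measure.map_dirac' hm]
    simp
  | complexHermitian =>
    have hr : MeasurePreserving (fun θ : ℝ => 1 - θ) (volume.restrict (Ioc (0 : ℝ) 1))
      (volume.restrict (Ioc (0 : ℝ) 1)) := by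
      have h := (Measure.measurePreserving_sub_left (volume : Measure ℝ) 1).restrict_preimage
        (s := Ioc (0 : ℝ) 1) measurableSet_Ioc
      have hs : (fun θ : ℝ => 1 - θ) ⁻¹' Ioc (0 : ℝ) 1 = Set.Ico 0 1 := by
        ext θ; simp only [Set.mem_preimage, Set.mem_Ioc, Set.mem_Ico]
        constructor <;> rintro ⟨h1, h2⟩ <;> constructor <;> linarith
      rw [hs] at h
      rwa [Measure.restrict_congr_set (Ico_ae_eq_Ioc (a := (0 : ℝ)) (b := 1))] at h
    have hf : Measurable (fun θ : ℝ => exp (2 * π * I * θ)) := by fun_prop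
    rw [entryLaw, Measure.map_map hm hf]
    have : (fun t : ℂ => conj t) ∘ (fun θ : ℝ => exp (2 * π * I * θ))
      = (fun θ : ℝ => exp (2 * π * I * θ)) ∘ (fun θ : ℝ => 1 - θ) := by
      ext θ; simp only [comp_apply, ← exp_conj]
      have : (2 * π * I * ((1 - θ : ℝ) : ℂ)) = conj (2 * π * I * (θ : ℂ)) + 2 * π * I := by
        simp [Complex.conj_ofNat]; ring
      rw [this, exp_add, Complex.exp_two_pi_mul_I, mul_one]
    rw [this, ← Measure.map_map hf hr.measurable, hr.map_eq]

section Band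

variable {d L : ℕ} [NeZero L] {W : ℝ}

/-- The numbering of the torus which selects the independent entries of the matrix. -/
local notation "ord" => equivFin (Torus d L)

lemma bandMatrix_isHermitian (W : ℝ) (a : Sample d L) : (bandMatrix W a).IsHermitian := by
  have h := halfBandMatrix_isHermitian W a
  have e : bandMatrix W a = (2 : ℂ) • halfBandMatrix W a := by
    ext x y; simp [halfBandMatrix, mul_div_cancel₀]
  rw [Matrix.IsHermitian, e, Matrix.conjTranspose_smul, h.eq]; simp

lemma pairMatrix_swap {ι : Type*} [DecidableEq ι] (p q : ι) (δ : ℂ) :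
    pairMatrix p q (conj δ) = pairMatrix q p δ := by
  simp [pairMatrix, add_comm]

/-- Changing the entry sitting at a coordinate of the sample. -/
lemma bandMatrix_update (a : Sample d L) {p q : Torus d L} (hpq : p ≠ q)
    (hle : ord p ≤ ord q) (t : ℂ) :
    bandMatrix W (update a (p, q) t)
      = bandMatrix W a + pairMatrix p q ((sqrt (varS d L W p q) : ℂ) * (t - a (p, q))) := by
  have hlt : ¬ (ord q ≤ ord p) := fun h =>
    hpq ((ord).injective (le_antisymm hle h))
  ext x y
  rw [Matrix.add_apply, pairMatrix, Matrix.add_apply, Matrix.single_apply, Matrix.single_apply]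
  simp only [bandMatrix, noise]
  by_cases h1 : p = x ∧ q = y
  · obtain ⟨rfl, rfl⟩ := h1
    simp [hle, hpq]; ring
  by_cases h2 : q = x ∧ p = y
  · obtain ⟨rfl, rfl⟩ := h2
    simp [hlt, hpq, Ne.symm hpq, varS_symm d L W q p]; ring
  · rw [if_neg h1, if_neg h2]
    have n1 : (x, y) ≠ (p, q) := fun h => h1 ⟨(Prod.ext_iff.1 h).1.symm, (Prod.ext_iff.1 h).2.symm⟩
    have n2 : (y, x) ≠ (p, q) := fun h => h2 ⟨(Prod.ext_iff.1 h).2.symm, (Prod.ext_iff.1 h).1.symm⟩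
    simp [update_of_ne n1, update_of_ne n2]

/-- The coordinates that are not used by the matrix. -/
lemma bandMatrix_update_of_not (a : Sample d L) {p q : Torus d L}
    (h : p = q ∨ ¬ ord p ≤ ord q) (t : ℂ) :
    bandMatrix W (update a (p, q) t) = bandMatrix W a := by
  ext x y; simp only [bandMatrix, noise]
  by_cases hxy : x = y
  · subst hxy; simp [varS_diag]
  congr 1
  split_ifs with hle
  · have : (x, y) ≠ (p, q) := by
      rintro ⟨rfl, rfl⟩
      rcases h with h | h
      · exact hxy h
      · exact h hle
    rw [update_of_ne this]
  · have : (y, x) ≠ (p, q) := by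
      intro heq
      obtain ⟨h1, h2⟩ := Prod.ext_iff.1 heq
      simp only at h1 h2; subst h1; subst h2
      rcases h with h | h
      · exact hxy h.symm
      · exact h (le_of_not_ge hle)
    rw [update_of_ne this]

lemma continuous_bandMatrix (W : ℝ) : Continuous (fun a : Sample d L => bandMatrix W a) := by
  refine continuous_pi fun x => continuous_pi fun y => ?_; refine continuous_const.mul ?_
  unfold noise
  split_ifs
  · exact continuous_apply _
  · exact continuous_conj.comp (continuous_apply _)

lemma measurable_green (W : ℝ) (z : ℂ) (x y : Torus d L) :
    Measurable (fun a : Sample d L => green (bandMatrix W a) z x y) := by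
  have hc : Continuous (fun a : Sample d L => bandMatrix W a - z • 1) :=
    (continuous_bandMatrix W).sub continuous_const
  have h1 : Measurable (fun a : Sample d L => (bandMatrix W a - z • 1).det) :=
    hc.matrix_det.measurable
  have h2 : Measurable (fun a : Sample d L =>
    (bandMatrix W a - z • 1).adjugate x y) :=
    (hc.matrix_adjugate.matrix_elem x y).measurable
  have : (fun a : Sample d L => green (bandMatrix W a) z x y) = fun a =>
    ((bandMatrix W a - z • 1).det)⁻¹ * (bandMatrix W a - z • 1).adjugate x y := by
    ext a; rw [green, Matrix.inv_def, Ring.inverse_eq_inv']; rfl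
  rw [this]; exact h1.inv.mul h2

lemma sampleLaw_ae_norm (s : SymmetryClass) : ∀ᵐ a ∂(sampleLaw s d L), ∀ c, ‖a c‖ = 1 := by
  rw [ae_all_iff]; intro c
  exact (Measure.quasiMeasurePreserving_eval (fun _ => entryLaw s) c).ae (entryLaw_ae_norm s)

instance isProbabilityMeasure_sampleLaw (s : SymmetryClass) :
    IsProbabilityMeasure (sampleLaw s d L) := by
  unfold sampleLaw; infer_instance

/-! ### Translation invariance -/

lemma varS_add_right (v x y : Torus d L) : varS d L W (x + v) (y + v) = varS d L W x y := by
  unfold varS; rw [add_sub_add_right_eq_sub]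

open Classical in
/-- The coordinate that a translation by `v` moves to the coordinate `p`. -/
def shiftCoord (v : Torus d L) (p : Torus d L × Torus d L) : Torus d L × Torus d L :=
  if (ord p.1 ≤ ord p.2 ↔ ord (p.1 + v) ≤ ord (p.2 + v))
  then (p.1 + v, p.2 + v) else (p.2 + v, p.1 + v)

lemma shiftCoord_injective (v : Torus d L) : Function.Injective (shiftCoord v) := by
  have key : ∀ x y : Torus d L, (ord x ≤ ord y ↔ ord (x + v) ≤ ord (y + v)) → (ord y ≤ ord x ↔
      ord (y + v) ≤ ord (x + v)) := by
    intro x y h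
    by_cases hxy : x = y
    · subst hxy; simp
    · have h1 : ord x ≠ ord y := fun h' =>
        hxy ((equivFin _).injective h')
      have h2 : ord (x + v) ≠ ord (y + v) :=
        fun h' => hxy (add_right_cancel ((equivFin _).injective h'))
      constructor
      · intro h3
        by_contra h4
        exact absurd (le_antisymm (h.2 (le_of_not_ge h4)) h3) h1
      · intro h3
        by_contra h4
        exact absurd (le_antisymm (h.1 (le_of_not_ge h4)) h3) h2
  rintro ⟨x, y⟩ ⟨x', y'⟩ h; unfold shiftCoord at h; simp only at h
  split_ifs at h with h1 h2 h2
  · simpa using h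
  · simp only [Prod.mk.injEq, add_left_inj] at h
    obtain ⟨rfl, rfl⟩ := h
    exact absurd (key _ _ h1) h2
  · simp only [Prod.mk.injEq, add_left_inj] at h
    obtain ⟨rfl, rfl⟩ := h
    exact absurd (key _ _ h2) h1
  · simp only [Prod.mk.injEq, add_left_inj] at h
    obtain ⟨rfl, rfl⟩ := h
    rfl

open Classical in
/-- The action of the translation by `v` on samples. -/
def shiftSample (v : Torus d L) (a : Sample d L) : Sample d L := fun p =>
  if (ord p.1 ≤ ord p.2 ↔ ord (p.1 + v) ≤ ord (p.2 + v))
  then a (shiftCoord v p) else conj (a (shiftCoord v p))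

lemma measurePreserving_shiftSample (s : SymmetryClass) (v : Torus d L) :
    MeasurePreserving (shiftSample v) (sampleLaw s d L) (sampleLaw s d L) := by
  classical
  let f : Torus d L × Torus d L ≃ Torus d L × Torus d L :=
    Equiv.ofBijective (shiftCoord v) (Finite.injective_iff_bijective.1 (shiftCoord_injective v))
  have h1 := measurePreserving_piCongrLeft (fun _ : Torus d L × Torus d L => entryLaw s) f.symm
  have h2 : MeasurePreserving (fun (a : Sample d L) p =>
    (if (ord p.1 ≤ ord p.2 ↔ ord (p.1 + v) ≤ ord (p.2 + v))
    then (id : ℂ → ℂ) else (fun t : ℂ => conj t)) (a p)) (sampleLaw s d L) (sampleLaw s d L) := by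
    unfold sampleLaw; refine measurePreserving_pi _ _ fun p => ?_
    split_ifs
    · exact MeasurePreserving.id _
    · exact measurePreserving_conj s
  have h3 := h2.comp h1
  suffices he : shiftSample v = (fun (a : Sample d L) p =>
    (if (ord p.1 ≤ ord p.2 ↔ ord (p.1 + v) ≤ ord (p.2 + v))
    then (id : ℂ → ℂ) else (fun t : ℂ => conj t)) (a p)) ∘
      (MeasurableEquiv.piCongrLeft (fun _ : Torus d L × Torus d L => ℂ) f.symm) by
    rw [he]; exact h3
  ext a p
  have e : (MeasurableEquiv.piCongrLeft (fun _ : Torus d L × Torus d L => ℂ) f.symm) a p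
    = a (shiftCoord v p) := by
    have := Equiv.piCongrLeft_apply_apply (P := fun _ : Torus d L × Torus d L => ℂ) f.symm a (f p)
    rw [Equiv.symm_apply_apply] at this; exact this
  simp only [shiftSample, comp_apply]; rw [e]
  split_ifs <;> rfl

lemma noise_shiftSample (v : Torus d L) (a : Sample d L) {x y : Torus d L} (hxy : x ≠ y) :
    noise (shiftSample v a) x y = noise a (x + v) (y + v) := by
  have h1 : ord x ≠ ord y := fun h' =>
    hxy ((equivFin _).injective h')
  have h2 : ord (x + v) ≠ ord (y + v) :=
    fun h' => hxy (add_right_cancel ((equivFin _).injective h'))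
  unfold noise shiftSample shiftCoord; simp only
  rcases lt_or_gt_of_ne h1 with h3 | h3 <;> rcases lt_or_gt_of_ne h2 with h4 | h4 <;>
    simp [h3.le, h4.le, not_le.2 h3, not_le.2 h4]

lemma bandMatrix_shiftSample (v : Torus d L) (a : Sample d L) : bandMatrix W (shiftSample v a)
      = (bandMatrix W a).submatrix (addRight v) (addRight v) := by
  ext x y; simp only [Matrix.submatrix_apply, Equiv.coe_addRight, bandMatrix, varS_add_right]
  by_cases hxy : x = y
  · subst hxy; simp [varS_diag]
  · rw [noise_shiftSample v a hxy]

/-- The diagonal entries of the resolvent are identically distributed. -/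
lemma integral_green_diag (s : SymmetryClass) (W : ℝ) (z : ℂ) (x : Torus d L) :
    ∫ a, green (bandMatrix W a) z x x ∂(sampleLaw s d L)
      = ∫ a, green (bandMatrix W a) z 0 0 ∂(sampleLaw s d L) := by
  have h := measurePreserving_shiftSample (d := d) (L := L) s x
  rw [← h.map_eq, integral_map h.measurable.aemeasurable
    (measurable_green W z 0 0).aestronglyMeasurable, h.map_eq]
  congr 1
  ext a
  have : green (bandMatrix W (shiftSample x a)) z
    = (green (bandMatrix W a) z).submatrix (addRight x) (addRight x) := by
    rw [bandMatrix_shiftSample, green, green, ← Matrix.inv_submatrix_equiv]; congr 1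
    rw [Matrix.submatrix_sub, Matrix.submatrix_smul]; congr 2
    exact (Matrix.submatrix_one_equiv (addRight x)).symm
  rw [this]; simp

/-! ### The variance profile -/

lemma varS_nonneg (hM : 1 < bandM d L W) (x y : Torus d L) : 0 ≤ varS d L W x y := by
  unfold varS
  have : (1 : ℝ) < bandM d L W := mod_cast hM
  split_ifs
  · apply div_nonneg zero_le_one; linarith
  · exact le_rfl

lemma varS_le (hM : 1 < bandM d L W) (x y : Torus d L) :
    varS d L W x y ≤ 1 / ((bandM d L W : ℝ) - 1) := by
  unfold varS
  have : (1 : ℝ) < bandM d L W := mod_cast hM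
  split_ifs
  · exact le_rfl
  · apply div_nonneg zero_le_one; linarith

lemma sum_varS (x : Torus d L) :
    ∑ y, varS d L W x y = (bandM d L W : ℝ) * (1 / ((bandM d L W : ℝ) - 1)) := by
  classical
  have h1 : ∑ y, varS d L W x y = ∑ c : Torus d L,
    if 1 ≤ torusNorm c ∧ torusNorm c ≤ W then 1 / ((bandM d L W : ℝ) - 1) else 0 := by
    refine Fintype.sum_equiv (Equiv.subLeft x) _ _ fun y => ?_; simp [varS]
  rw [h1, ← sum_filter, sum_const, nsmul_eq_mul]; congr 2
  rw [bandM, Nat.card_eq_fintype_card, Fintype.card_subtype]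

end Band

end

section

/-! ### The self-consistent equation for the averaged resolvent -/

section Local

variable {d L : ℕ} [NeZero L] {W : ℝ} {z : ℂ} (s : SymmetryClass)

/-- The averaged diagonal entry of the resolvent. -/
def meanGreen (d L : ℕ) [NeZero L] (W : ℝ) (z : ℂ) : ℂ :=
  ∫ a, green (bandMatrix W a) z 0 0 ∂(sampleLaw s d L)

local notation "ord" => equivFin (Torus d L)
local notation "G[" a "]" => green (bandMatrix W a) z
local notation "S" => varS d L W
local notation "σ₀" => (1 / ((bandM d L W : ℝ) - 1))
local notation "ℙ" => sampleLaw s d L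

lemma integrable_green (hz : 0 < z.im) (x y : Torus d L) : Integrable (fun a => G[a] x y) ℙ :=
  integrable_of_bdd _ (measurable_green W z x y)
    fun a => norm_green_le (bandMatrix_isHermitian W a) hz x y

lemma integrable_green_im (hz : 0 < z.im) (x y : Torus d L) :
    Integrable (fun a => (G[a] x y).im) ℙ :=
  (integrable_green s hz x y).im

lemma integral_im_green_diag (hz : 0 < z.im) (x : Torus d L) :
    ∫ a, (G[a] x x).im ∂ℙ = (meanGreen s d L W z).im := by
  rw [meanGreen, ← integral_green_diag s W z x]; exact integral_im (integrable_green s hz x x)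

/-- The local average `∑ y, S x y * G y y`. -/
def localAvg (W : ℝ) (z : ℂ) (x : Torus d L) (a : Sample d L) : ℂ :=
  localTrace (varS d L W x) (green (bandMatrix W a) z)

lemma measurable_localAvg (x : Torus d L) : Measurable (localAvg (d := d) (L := L) W z x) := by
  unfold localAvg localTrace
  exact Finset.measurable_sum _ fun y _ => (measurable_green W z y y).const_mul _

lemma sum_varS_le (hM : 2 ≤ bandM d L W) (x : Torus d L) : ∑ y, S x y ≤ 2 := by
  rw [sum_varS, mul_one_div, div_le_iff₀]
  · have : (2 : ℝ) ≤ bandM d L W := mod_cast hM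
    linarith
  · have : (2 : ℝ) ≤ bandM d L W := mod_cast hM
    linarith

lemma norm_localAvg_le (hM : 2 ≤ bandM d L W) (hz : 0 < z.im) (x : Torus d L) (a : Sample d L) :
    ‖localAvg W z x a‖ ≤ 2 / z.im := by
  unfold localAvg localTrace
  calc _ ≤ ∑ y, S x y * (1 / z.im) := by
        refine norm_sum_le_of_le _ (fun y _ => ?_)
        rw [norm_mul, norm_real, norm_of_nonneg (varS_nonneg hM x y)]
        exact mul_le_mul_of_nonneg_left (norm_green_le (bandMatrix_isHermitian W a) hz y y)
          (varS_nonneg hM x y)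
    _ ≤ 2 * (1 / z.im) := by
      rw [← sum_mul]; gcongr
      exact sum_varS_le hM x
    _ = _ := by ring

lemma integral_localAvg (hz : 0 < z.im) (x : Torus d L) : ∫ a, localAvg W z x a ∂ℙ
      = ((bandM d L W : ℝ) * σ₀ : ℝ) * meanGreen s d L W z := by
  unfold localAvg localTrace
  rw [integral_finsetSum _ fun y _ => (integrable_green s hz y y).const_mul _]
  simp only [integral_const_mul, integral_green_diag s W z]
  rw [← sum_mul, ← Complex.ofReal_sum, sum_varS]; rfl

lemma sqrt_varS_sq (hM : 1 < bandM d L W) (x y : Torus d L) :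
    sqrt (S x y) ^ 2 = S x y := sq_sqrt (varS_nonneg hM x y)

/-- Concentration of the local average: its variance is of order `M⁻² η⁻⁵ Im 𝔼 G`. -/
lemma variance_localAvg_le (hM : 2 ≤ bandM d L W) (hz : 0 < z.im) (hz1 : z.im ≤ 1)
    (hη : 4 * σ₀ ≤ z.im ^ 2) (x : Torus d L) :
    ∫ a, ‖localAvg W z x a - ∫ b, localAvg W z x b ∂ℙ‖ ^ 2 ∂ℙ
      ≤ 2304 * σ₀ ^ 2 / z.im ^ 5 * (meanGreen s d L W z).im := by
  set σ := σ₀ with hσdef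
  set P := ℙ
  have hM2 : (2 : ℝ) ≤ bandM d L W := mod_cast hM
  have hM1 : 1 < bandM d L W := hM
  have hσ0 : 0 ≤ σ := by rw [hσdef]; apply div_nonneg zero_le_one; linarith
  obtain ⟨T, hT⟩ : ∃ T : Sample d L → ℂ, T = localAvg W z x := ⟨_, rfl⟩
  rw [← hT]
  have mT : Measurable T := hT ▸ measurable_localAvg x
  have bT : ∀ a, ‖T a‖ ≤ 2 / z.im := hT ▸ norm_localAvg_le hM hz x
  set K : Sample d L → Matrix _ _ ℂ := fun a => sandwich (S x) (G[a])
  -- the sensitivity to the coordinate `(p, q)`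
  let Q : Torus d L → Torus d L → Sample d L → ℝ := fun p q a =>
    S p q * (‖K a p q‖ ^ 2 + ‖K a q p‖ ^ 2 + 4 * S p q / z.im ^ 2 * (‖K a p p‖ ^ 2 + ‖K a q q‖ ^ 2))
  have hQ0 : ∀ p q a, 0 ≤ Q p q a := by
    intro p q a
    have := varS_nonneg hM1 p q
    positivity
  have hsens : ∀ᵐ a ∂P, ∀ c : Torus d L × Torus d L,
    ∫ t, ‖T a - T (update a c t)‖ ^ 2 ∂(entryLaw s) ≤ 64 * Q c.1 c.2 a := by
    filter_upwards [sampleLaw_ae_norm s] with a ha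
    rintro ⟨p, q⟩
    have hpt : ∀ᵐ t ∂(entryLaw s), ‖T a - T (update a (p, q) t)‖ ^ 2 ≤ 64 * Q p q a := by
      filter_upwards [entryLaw_ae_norm s] with t ht
      by_cases hc : p = q ∨ ¬ ord p ≤ ord q
      · have : T (update a (p, q) t) = T a := by
          simp only [hT, localAvg, bandMatrix_update_of_not a hc t]
        rw [this]
        have := hQ0 p q a
        simp; positivity
      · push Not at hc
        set δ : ℂ := (sqrt (S p q) : ℂ) * (t - a (p, q)) with hδ
        have hδn : ‖δ‖ ≤ sqrt (S p q) * 2 := by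
          rw [hδ, norm_mul, norm_real, norm_of_nonneg (sqrt_nonneg _)]; gcongr
          calc _ ≤ ‖t‖ + ‖a (p, q)‖ := norm_sub_le _ _
            _ = 2 := by rw [ht, ha]; norm_num
        have hδ2 : ‖δ‖ ^ 2 ≤ 4 * S p q := by
          calc _ ≤ (sqrt (S p q) * 2) ^ 2 := mono%
            _ = _ := by rw [mul_pow, sqrt_varS_sq hM1]; ring
        have hδη : ‖δ‖ ≤ z.im := by
          refine abs_le_of_sq_le_sq' (hδ2.trans ?_) hz.le |>.2; refine le_trans ?_ hη
          have := varS_le hM1 p q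
          linarith
        have := norm_localTrace_sub_sq_le (bandMatrix_isHermitian W a)
          (bandMatrix_isHermitian W (update a (p, q) t)) hz
          (bandMatrix_update a hc.1 hc.2 t) hδη (S x)
        rw [hT]; refine this.trans ?_
        have hS := varS_nonneg hM1 p q
        calc _ ≤ 16 * (4 * S p q) * (‖K a p q‖ ^ 2 + ‖K a q p‖ ^ 2 + 4 * S p q / z.im ^ 2
                * (‖K a p p‖ ^ 2
                + ‖K a q q‖ ^ 2)) := mono%
          _ = _ := by simp only [Q]; ring
    calc _ ≤ ∫ _t, 64 * Q p q a ∂(entryLaw s) :=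
          integral_mono_of_nonneg (.of_forall fun t => sq_nonneg _) (integrable_const _) hpt
      _ = _ := by simp
  have hint : ∀ c : Torus d L × Torus d L,
    Integrable (fun a => ∫ t, ‖T a - T (update a c t)‖ ^ 2 ∂(entryLaw s)) P := fun c =>
    (integrable_norm_sub_sq (P.prod (entryLaw s)) (mT.comp measurable_fst)
      (mT.comp (measurable_update_pair c)) (fun _ => bT _) fun _ => bT _).integral_prod_left
  calc _ ≤ ∑ c : Torus d L × Torus d L,
        ∫ a, ∫ t, ‖T a - T (update a c t)‖ ^ 2 ∂(entryLaw s) ∂P := efron_stein (entryLaw s) mT bT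
    _ = ∫ a, ∑ c : Torus d L × Torus d L, ∫ t, ‖T a - T (update a c t)‖ ^ 2 ∂(entryLaw s) ∂P :=
      (integral_finsetSum _ fun c _ => hint c).symm
    _ ≤ ∫ a, 64 * (18 * σ ^ 2 / z.im ^ 5 * ∑ y, S x y * (G[a] y y).im) ∂P := by
      refine integral_mono_ae (integrable_finsetSum _ fun c _ => hint c) ?_ ?_
      · refine Integrable.const_mul (Integrable.const_mul (integrable_finsetSum _ fun y _ =>
          Integrable.const_mul ?_ _) _) _
        exact integrable_green_im s hz y y
      · filter_upwards [hsens] with a ha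
        calc _ ≤ ∑ c : Torus d L × Torus d L, 64 * Q c.1 c.2 a := sum_le_sum fun c _ => ha c
          _ = 64 * ∑ p, ∑ q, Q p q a := by rw [← mul_sum, Fintype.sum_prod_type]
          _ ≤ _ := by
            gcongr
            exact sum_sensitivity_le (bandMatrix_isHermitian W a) hz hz1
              (fun y => varS_nonneg hM1 x y) (fun y => varS_le hM1 x y)
              (fun p q => varS_nonneg hM1 p q) (fun p q => varS_le hM1 p q)
              (fun p => sum_varS_le hM p)
              (fun q => by simp_rw [varS_symm d L W _ q]; exact sum_varS_le hM q)
    _ = 64 * (18 * σ ^ 2 / z.im ^ 5 * ((∑ y, S x y) * (meanGreen s d L W z).im)) := by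
      rw [integral_const_mul, integral_const_mul, integral_finsetSum _ fun y _ =>
        (integrable_green_im s hz y y).const_mul _]
      simp only [integral_const_mul]; congr 2
      rw [sum_mul]
      exact sum_congr rfl fun y _ => by
        congr 1
        exact integral_im_green_diag s hz y
    _ ≤ 64 * (18 * σ ^ 2 / z.im ^ 5 * (2 * (meanGreen s d L W z).im)) := by
      have : 0 ≤ (meanGreen s d L W z).im := by
        rw [← integral_im_green_diag s hz 0]
        exact integral_nonneg fun a => green_im_nonneg (bandMatrix_isHermitian W a) hz 0
      gcongr
      exact sum_varS_le hM x
    _ = _ := by ring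

/-- A centred entry is uncorrelated with whatever does not depend on it. -/
lemma integral_entry_mul_eq_zero (c : Torus d L × Torus d L) {F : Sample d L → ℂ}
    (hF : Measurable F) {C : ℝ} (hC : ∀ a, ‖F a‖ ≤ C) {u : ℂ → ℂ} (hu : Measurable u)
    (hu1 : ∀ t, ‖u t‖ = ‖t‖) (hu0 : ∫ t, u t ∂(entryLaw s) = 0) :
    ∫ a, u (a c) * F (update a c 0) ∂ℙ = 0 := by
  have mup : Measurable fun a : Sample d L => update a c (0 : ℂ) :=
    (measurable_update_pair (α := ℂ) c).comp (measurable_id.prodMk measurable_const)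
  have hi : Integrable (fun a : Sample d L => u (a c) * F (update a c 0)) ℙ := by
    refine Integrable.of_bound ((hu.comp (measurable_pi_apply c)).mul
      (hF.comp mup)).aestronglyMeasurable C ?_
    filter_upwards [sampleLaw_ae_norm s] with a ha
    rw [norm_mul, hu1, ha, one_mul]; exact hC _
  unfold sampleLaw at hi ⊢; rw [integral_update (entryLaw s) c hi]
  simp only [update_self, Function.update_idem, integral_mul_const, hu0, zero_mul, integral_zero]

lemma integral_conj_entryLaw : ∫ t, conj t ∂(entryLaw s) = 0 := by
  have := integral_conj (μ := entryLaw s) (f := fun t => t)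
  rw [this, integral_entryLaw, map_zero]

lemma pairMatrix_neg {ι : Type*} [DecidableEq ι] (p q : ι) (δ : ℂ) :
    pairMatrix p q (-δ) = -pairMatrix p q δ := by
  ext i j; simp only [pairMatrix, Matrix.add_apply, Matrix.neg_apply, Matrix.single_apply, map_neg]
  split_ifs <;> ring

/-- The contribution of the entry `(x, y)` to the Schwinger–Dyson equation. -/
lemma norm_integral_entry_mul_green_le (hM : 2 ≤ bandM d L W) (hz : 0 < z.im)
    (hη : 4 * σ₀ ≤ z.im ^ 2) (x y : Torus d L) :
    ‖∫ a, (bandMatrix W a x y * G[a] y x + (S x y : ℂ) * G[a] y y * G[a] x x) ∂ℙ‖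
      ≤ ∫ a, S x y * (4 * ‖G[a] y x‖ ^ 2 + ‖G[a] x y‖ ^ 2 + 3 * S x y / z.im ^ 2 * ‖G[a] x x‖ ^ 2)
          ∂ℙ := by
  have hM1 : 1 < bandM d L W := hM
  have hS := varS_nonneg hM1 x y
  by_cases hxy : x = y
  · subst hxy; simp [bandMatrix, varS_diag]
  -- the coordinate carrying the entry, and the entry as a function of it
  obtain ⟨c, u, hu, hu1, hu0, hent, hzero⟩ : ∃ (c : Torus d L × Torus d L) (u : ℂ → ℂ),
    Measurable u ∧ (∀ t, ‖u t‖ = ‖t‖) ∧ (∫ t, u t ∂(entryLaw s) = 0) ∧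
    (∀ a : Sample d L, bandMatrix W a x y = (sqrt (S x y) : ℂ) * u (a c)) ∧
    (∀ a : Sample d L, bandMatrix W a = bandMatrix W (update a c 0)
      + pairMatrix x y ((sqrt (S x y) : ℂ) * u (a c))) := by
    by_cases hle : ord x ≤ ord y
    · refine ⟨(x, y), fun t => t, measurable_id, fun t => rfl, integral_entryLaw s, ?_, ?_⟩
      · intro a; simp [bandMatrix, noise, hle]
      · intro a
        rw [bandMatrix_update a hxy hle 0, zero_sub, mul_neg, pairMatrix_neg, neg_add_cancel_right]
    · refine ⟨(y, x), fun t => conj t, continuous_conj.measurable, fun t => by simp,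
        integral_conj_entryLaw s, ?_, ?_⟩
      · intro a; simp [bandMatrix, noise, hle]
      · intro a
        have e : (sqrt (S x y) : ℂ) * conj (a (y, x))
          = conj ((sqrt (S x y) : ℂ) * a (y, x)) := by simp
        rw [bandMatrix_update a (Ne.symm hxy) (le_of_not_ge hle) 0, zero_sub, mul_neg,
          pairMatrix_neg, varS_symm d L W y x, e, pairMatrix_swap, neg_add_cancel_right]
  set P := ℙ
  have mup : Measurable fun a : Sample d L => update a c (0 : ℂ) :=
    (measurable_update_pair (α := ℂ) c).comp (measurable_id.prodMk measurable_const)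
  have mG := fun i j => measurable_green (d := d) (L := L) W z i j
  have bG : ∀ (a : Sample d L) i j, ‖G[a] i j‖ ≤ 1 / z.im := fun a i j =>
    norm_green_le (bandMatrix_isHermitian W a) hz i j
  have mH : Measurable fun a : Sample d L => bandMatrix W a x y :=
    ((continuous_bandMatrix W).matrix_elem x y).measurable
  have hnorm : ∀ᵐ a ∂P, ‖bandMatrix W a x y‖ = sqrt (S x y) := by
    filter_upwards [sampleLaw_ae_norm s] with a ha
    rw [hent, norm_mul, hu1, ha, mul_one, norm_real, norm_of_nonneg (sqrt_nonneg _)]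
  have h0 : ∫ a, bandMatrix W a x y * green (bandMatrix W (update a c 0)) z y x ∂P = 0 := by
    have := integral_entry_mul_eq_zero s c (mG y x) (fun a => bG a y x) hu hu1 hu0
    simp only [hent, mul_assoc]; rw [integral_const_mul, this, mul_zero]
  have i0 : Integrable (fun a => bandMatrix W a x y
    * green (bandMatrix W (update a c 0)) z y x) P := by
    refine Integrable.of_bound (mH.mul ((mG y x).comp mup)).aestronglyMeasurable
      (sqrt (S x y) * (1 / z.im)) ?_
    filter_upwards [hnorm] with a ha
    rw [norm_mul, ha]; gcongr
    exact bG _ _ _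
  have i1 : Integrable (fun a => bandMatrix W a x y * G[a] y x
    + (S x y : ℂ) * G[a] y y * G[a] x x) P := by
    refine Integrable.of_bound ((mH.mul (mG y x)).add
      (((mG y y).const_mul _).mul (mG x x))).aestronglyMeasurable
      (sqrt (S x y) * (1 / z.im) + S x y * (1 / z.im) * (1 / z.im)) ?_
    filter_upwards [hnorm] with a ha
    refine (norm_add_le _ _).trans ?_
    rw [norm_mul, norm_mul, norm_mul, ha, norm_real, norm_of_nonneg hS]; gcongr <;> exact bG _ _ _
  have e1 : ∫ a, (bandMatrix W a x y * G[a] y x + (S x y : ℂ) * G[a] y y * G[a] x x) ∂P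
    = ∫ a, ((bandMatrix W a x y * G[a] y x + (S x y : ℂ) * G[a] y y * G[a] x x)
      - bandMatrix W a x y * green (bandMatrix W (update a c 0)) z y x) ∂P := by
    rw [integral_sub i1 i0, h0, sub_zero]
  rw [e1]
  have bsq : ∀ (a : Sample d L) i j, ‖G[a] i j‖ ^ 2 ≤ (1 / z.im) ^ 2 :=
    fun a i j => pow_le_pow_left₀ (norm_nonneg _) (bG a i j) 2
  have isq : ∀ i j, Integrable (fun a => ‖G[a] i j‖ ^ 2) P := fun i j =>
    integrable_of_bdd _ ((mG i j).norm.pow_const 2) fun a => by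
      rw [norm_pow, norm_norm]; exact bsq a i j
  refine norm_integral_le_of_norm_le ?_ ?_
  · exact Integrable.const_mul ((((isq y x).const_mul 4).add (isq x y)).add
      ((isq x x).const_mul _)) _
  · filter_upwards [hnorm] with a ha
    have hη' : ‖(sqrt (S x y) : ℂ) * u (a c)‖ ≤ z.im := by
      rw [← hent, ha]; refine abs_le_of_sq_le_sq' ?_ hz.le |>.2; rw [sqrt_varS_sq hM1]
      have := varS_le hM1 x y
      have h2 : 0 ≤ σ₀ := hS.trans this
      linarith
    have key := norm_entry_expansion_le (bandMatrix_isHermitian W a)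
      (bandMatrix_isHermitian W (update a c 0)) hz (hzero a) hη'
    rw [← hent, ha, sqrt_varS_sq hM1] at key
    have e2 : ((sqrt (S x y) : ℝ) : ℂ) ^ 2 = (S x y : ℂ) := by
      rw [← Complex.ofReal_pow, sqrt_varS_sq hM1]
    rw [e2] at key; refine le_trans (le_of_eq ?_) key; congr 1
    ring

end Local

end

section

section Local

variable {d L : ℕ} [NeZero L] {W : ℝ} {z : ℂ} (s : SymmetryClass)

local notation "G[" a "]" => green (bandMatrix W a) z
local notation "S" => varS d L W
local notation "σ₀" => (1 / ((bandM d L W : ℝ) - 1))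
local notation "ℙ" => sampleLaw s d L

lemma meanGreen_im_nonneg (hz : 0 < z.im) : 0 ≤ (meanGreen s d L W z).im := by
  rw [← integral_im_green_diag s hz 0]
  exact integral_nonneg fun a => green_im_nonneg (bandMatrix_isHermitian W a) hz 0

/-- The Schwinger–Dyson equation `1 + z g + 𝔼 [T G] ≈ 0` for `g = 𝔼 G_xx` and
`T = ∑ y, S x y * G y y`. -/
lemma norm_schwingerDyson_le (hM : 2 ≤ bandM d L W) (hz : 0 < z.im) (hz1 : z.im ≤ 1)
    (hη : 4 * σ₀ ≤ z.im ^ 2) :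
    ‖1 + z * meanGreen s d L W z + ∫ a, localAvg W z 0 a * G[a] 0 0 ∂ℙ‖
      ≤ 11 * σ₀ / z.im ^ 3 * (meanGreen s d L W z).im := by
  set σ := σ₀
  set P := ℙ
  have hM1 : 1 < bandM d L W := hM
  have hσ0 : 0 ≤ σ := (varS_nonneg hM1 0 0).trans (varS_le (W := W) hM1 (0 : Torus d L) 0)
  have mG := fun i j => measurable_green (d := d) (L := L) W z i j
  have bG : ∀ (a : Sample d L) i j, ‖G[a] i j‖ ≤ 1 / z.im := fun a i j =>
    norm_green_le (bandMatrix_isHermitian W a) hz i j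
  have mH : ∀ y, Measurable fun a : Sample d L => bandMatrix W a 0 y := fun y =>
    ((continuous_bandMatrix W).matrix_elem 0 y).measurable
  have hnorm : ∀ᵐ a ∂P, ∀ y, ‖bandMatrix W a 0 y‖ ≤ 1 * sqrt (S 0 y) := by
    filter_upwards [sampleLaw_ae_norm s] with a ha y
    rw [bandMatrix, norm_mul, norm_real, norm_of_nonneg (sqrt_nonneg _), mul_comm]; gcongr
    unfold noise
    split_ifs
    · exact (ha _).le
    · rw [RCLike.norm_conj]; exact (ha _).le
  have i1 : ∀ y, Integrable (fun a => bandMatrix W a 0 y * G[a] y 0) P := by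
    intro y
    refine Integrable.of_bound ((mH y).mul (mG y 0)).aestronglyMeasurable
      (1 * sqrt (S 0 y) * (1 / z.im)) ?_
    filter_upwards [hnorm] with a ha
    rw [norm_mul]; gcongr
    · exact ha y
    · exact bG _ _ _
  have i2 : ∀ y, Integrable (fun a => (S 0 y : ℂ) * G[a] y y * G[a] 0 0) P := by
    intro y
    refine integrable_of_bdd (C := ‖(S 0 y : ℂ)‖ * (1 / z.im) * (1 / z.im)) _
      (((mG y y).const_mul _).mul (mG 0 0)) fun a => ?_
    rw [norm_mul, norm_mul]; gcongr <;> exact bG _ _ _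
  have hid : ∀ a : Sample d L, 1 + z * G[a] 0 0 = ∑ y, bandMatrix W a 0 y * G[a] y 0 := by
    intro a
    have h := congrFun (congrFun (mul_green (bandMatrix_isHermitian W a) hz.ne') 0) 0
    rw [Matrix.sub_mul, Matrix.sub_apply, Matrix.mul_apply, Matrix.one_apply_eq] at h
    simp only [Matrix.smul_mul, Matrix.one_mul, Matrix.smul_apply, smul_eq_mul] at h
    linear_combination -h
  have e1 : 1 + z * meanGreen s d L W z = ∑ y, ∫ a, bandMatrix W a 0 y * G[a] y 0 ∂P := by
    rw [← integral_finsetSum _ fun y _ => i1 y]; simp only [← hid]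
    rw [integral_add (integrable_const _) ((integrable_green s hz 0 0).const_mul _),
      integral_const_mul]
    simp [meanGreen]
  have e2 : ∫ a, localAvg W z 0 a * G[a] 0 0 ∂P = ∑ y, ∫ a, (S 0 y : ℂ) * G[a] y y
      * G[a] 0 0 ∂P := by
    rw [← integral_finsetSum _ fun y _ => i2 y]; simp only [localAvg, localTrace, sum_mul]
  have isq : ∀ i j, Integrable (fun a => ‖G[a] i j‖ ^ 2) P := fun i j =>
    integrable_of_bdd (C := (1 / z.im) ^ 2) _ ((mG i j).norm.pow_const 2) fun a => by
      rw [norm_pow, norm_norm]; exact pow_le_pow_left₀ (norm_nonneg _) (bG a i j) 2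
  rw [e1, e2, ← sum_add_distrib]
  calc _ ≤ ∑ y, ∫ a, S 0 y * (4 * ‖G[a] y 0‖ ^ 2 + ‖G[a] 0 y‖ ^ 2
        + 3 * S 0 y / z.im ^ 2 * ‖G[a] 0 0‖ ^ 2) ∂P := by
        refine norm_sum_le_of_le _ (fun y _ => ?_); rw [← integral_add (i1 y) (i2 y)]
        exact norm_integral_entry_mul_green_le s hM hz hη 0 y
    _ = ∫ a, ∑ y, S 0 y * (4 * ‖G[a] y 0‖ ^ 2 + ‖G[a] 0 y‖ ^ 2
      + 3 * S 0 y / z.im ^ 2 * ‖G[a] 0 0‖ ^ 2) ∂P := by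
      refine (integral_finsetSum _ fun y _ => ?_).symm
      exact Integrable.const_mul ((((isq y 0).const_mul 4).add (isq 0 y)).add
        ((isq 0 0).const_mul _)) _
    _ ≤ ∫ a, 11 * σ / z.im ^ 3 * (G[a] 0 0).im ∂P := by
      refine integral_mono (integrable_finsetSum _ fun y _ => Integrable.const_mul
        ((((isq y 0).const_mul 4).add (isq 0 y)).add ((isq 0 0).const_mul _)) _)
        ((integrable_green_im s hz 0 0).const_mul _) fun a => ?_
      set G := G[a] with hG
      set I' := (G 0 0).im with hI
      have hI0 : 0 ≤ I' := green_im_nonneg (bandMatrix_isHermitian W a) hz 0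
      have w1 := ward_row (bandMatrix_isHermitian W a) hz 0
      have w2 := ward_col (bandMatrix_isHermitian W a) hz 0
      have w3 := norm_green_sq_le (bandMatrix_isHermitian W a) hz 0 0
      simp only [← hG, ← hI] at w1 w2 w3
      calc _ ≤ ∑ y, (σ * (4 * ‖G y 0‖ ^ 2 + ‖G 0 y‖ ^ 2)
            + S 0 y * (3 * σ / z.im ^ 2 * (I' / z.im))) := by
            refine sum_le_sum fun y _ => ?_
            have h0 := varS_nonneg hM1 (0 : Torus d L) y
            have h1 := varS_le hM1 (0 : Torus d L) y
            rw [mul_add]; gcongr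
        _ = σ * (4 * (I' / z.im) + I' / z.im)
          + (∑ y, S 0 y) * (3 * σ / z.im ^ 2 * (I' / z.im)) := by
          rw [sum_add_distrib, ← sum_mul, ← mul_sum, sum_add_distrib, ← mul_sum, w1, w2]
        _ ≤ σ * (4 * (I' / z.im) + I' / z.im) + 2 * (3 * σ / z.im ^ 2 * (I' / z.im)) := by
          gcongr
          exact sum_varS_le hM 0
        _ = σ * I' * (5 * z.im ^ 2 + 6) / z.im ^ 3 := by field_simp; ring
        _ ≤ σ * I' * 11 / z.im ^ 3 := by
          gcongr
          nlinarith
        _ = _ := by ring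
    _ = _ := by rw [integral_const_mul, integral_im_green_diag s hz 0]

/-- The averaged resolvent entry approximately solves the quadratic equation of the semicircle
law. -/
lemma norm_self_consistent_le (hM : 2 ≤ bandM d L W) (hz : 0 < z.im) (hz1 : z.im ≤ 1)
    (hη : 4 * σ₀ ≤ z.im ^ 2) :
    ‖1 + z * meanGreen s d L W z + meanGreen s d L W z ^ 2‖
      ≤ 59 * σ₀ / z.im ^ 3 * (meanGreen s d L W z).im + σ₀ * ‖meanGreen s d L W z‖ ^ 2 := by
  set σ := σ₀ with hσdef
  set P := ℙ with hP
  set g := meanGreen s d L W z with hg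
  have hM1 : 1 < bandM d L W := hM
  have hM2 : (2 : ℝ) ≤ bandM d L W := mod_cast hM
  have hσ0 : 0 < σ := by rw [hσdef]; apply one_div_pos.2; linarith
  have hgI : 0 ≤ g.im := meanGreen_im_nonneg s hz
  have mG := fun i j => measurable_green (d := d) (L := L) W z i j
  have bG : ∀ (a : Sample d L) i j, ‖G[a] i j‖ ≤ 1 / z.im := fun a i j =>
    norm_green_le (bandMatrix_isHermitian W a) hz i j
  have mT : Measurable (localAvg (d := d) (L := L) W z 0) := measurable_localAvg 0
  have bT := norm_localAvg_le (d := d) (L := L) hM hz 0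
  set τ := ∫ a, localAvg W z 0 a ∂P with hτ
  have eτ : τ = g + σ * g := by
    rw [hτ, integral_localAvg s hz 0]
    have : (bandM d L W : ℝ) * σ₀ = 1 + σ := by
      have : (bandM d L W : ℝ) - 1 ≠ 0 := lin%
      rw [hσdef]; field_simp; ring
    rw [this]; push_cast; ring
  have iTG : Integrable (fun a => localAvg W z 0 a * G[a] 0 0) P :=
    integrable_of_bdd (C := 2 / z.im * (1 / z.im)) _ (mT.mul (mG 0 0)) fun a => by
      rw [norm_mul]; gcongr
      · exact bT a
      · exact bG a 0 0
  have iτG : Integrable (fun a => τ * G[a] 0 0) P := (integrable_green s hz 0 0).const_mul _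
  have ecov : ∫ a, (localAvg W z 0 a - τ) * G[a] 0 0 ∂P
    = (∫ a, localAvg W z 0 a * G[a] 0 0 ∂P) - τ * g := by
    simp only [sub_mul]; rw [integral_sub iTG iτG, integral_const_mul]; rfl
  have hvar := variance_localAvg_le s hM hz hz1 hη (0 : Torus d L)
  have bτ : ‖τ‖ ≤ 2 / z.im := by
    have := norm_integral_le_of_norm_le_const (μ := P) (.of_forall bT)
    simpa using this
  have iv : Integrable (fun a => ‖localAvg W z 0 a - τ‖ ^ 2) P :=
    integrable_norm_sub_sq P mT measurable_const bT fun _ => bτ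
  -- the weight balances the two second moments
  have hcov : ‖∫ a, (localAvg W z 0 a - τ) * G[a] 0 0 ∂P‖ ≤ 48 * σ / z.im ^ 3 * g.im := by
    set lam := z.im ^ 2 / (48 * σ) with hlam
    have hlam0 : 0 < lam := pos%
    calc _ ≤ ∫ a, (lam / 2 * ‖localAvg W z 0 a - τ‖ ^ 2
          + 1 / (2 * lam) * ((G[a] 0 0).im / z.im)) ∂P := by
          refine norm_integral_le_of_norm_le ((iv.const_mul _).add
            (((integrable_green_im s hz 0 0).div_const _).const_mul _))
            (.of_forall fun a => ?_)
          rw [norm_mul]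
          have h1 := norm_green_sq_le (bandMatrix_isHermitian W a) hz 0 0
          have h2 : 1 / (2 * lam) * ‖G[a] 0 0‖ ^ 2 ≤ 1 / (2 * lam) * ((G[a] 0 0).im / z.im) := mono%
          refine le_trans ?_ (add_le_add le_rfl h2)
          have h3 : ∀ u v : ℝ, u * v ≤ lam / 2 * u ^ 2 + 1 / (2 * lam) * v ^ 2 := by
            intro u v
            have : lam / 2 * u ^ 2 + 1 / (2 * lam) * v ^ 2 - u * v
              = (lam * u - v) ^ 2 / (2 * lam) := by field_simp; ring
            have h4 : 0 ≤ (lam * u - v) ^ 2 / (2 * lam) := pos%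
            linarith
          exact h3 _ _
      _ = lam / 2 * (∫ a, ‖localAvg W z 0 a - τ‖ ^ 2 ∂P) + 1 / (2 * lam) * (g.im / z.im) := by
        rw [integral_add (iv.const_mul _)
          (((integrable_green_im s hz 0 0).div_const _).const_mul _), integral_const_mul,
          integral_const_mul, integral_div, integral_im_green_diag s hz 0]
      _ ≤ lam / 2 * (2304 * σ ^ 2 / z.im ^ 5 * g.im) + 1 / (2 * lam) * (g.im / z.im) := mono%
      _ = _ := by rw [hlam]; field_simp; ring
  have hSD := norm_schwingerDyson_le (d := d) (L := L) s hM hz hz1 hη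
  rw [← hσdef, ← hP, ← hg] at hSD
  have e3 : 1 + z * g + g ^ 2 = (1 + z * g + ∫ a, localAvg W z 0 a * G[a] 0 0 ∂P)
      - (∫ a, (localAvg W z 0 a - τ) * G[a] 0 0 ∂P) - σ * g ^ 2 := by
    rw [ecov, eτ]; ring
  rw [e3]
  calc _ ≤ 11 * σ / z.im ^ 3 * g.im + 48 * σ / z.im ^ 3 * g.im + σ * ‖g‖ ^ 2 := by
        refine (norm_sub_le _ _).trans (add_le_add ((norm_sub_le _ _).trans (add_le_add hSD hcov)) ?_)
        rw [norm_mul, norm_pow, norm_real, norm_of_nonneg hσ0.le]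
    _ = _ := by ring

end Local

/-- Stability of the quadratic equation of the semicircle law in the bulk: a solution in the upper
half-plane of the perturbed equation is close to the solution at the real energy. -/
lemma semicircle_stability {g z : ℂ} {ε : ℝ} (hg : 0 ≤ g.im) (hz : 0 < z.im) (hz1 : z.im ≤ 1)
    (hre : |z.re| < 2) (hε0 : 0 ≤ ε) (hε : ε ≤ 1 / 2)
    (h : ‖1 + z * g + g ^ 2‖ ≤ ε * (‖g‖ + ‖g‖ ^ 2)) :
    |g.im - sqrt (4 - z.re ^ 2) / 2| ≤ (144 * ε + 16 * z.im) / sqrt (4 - z.re ^ 2) := by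
  set E := z.re
  set η := z.im
  have hz3 : ‖z‖ ≤ 3 := (Complex.norm_le_abs_re_add_abs_im z).trans (by
    rw [abs_of_pos hz]; linarith)
  set x := ‖g‖ with hx
  have hx0 : 0 ≤ x := norm_nonneg _
  have h1 : x ^ 2 ≤ ε * (x + x ^ 2) + 1 + 3 * x := by
    have e : g ^ 2 = (1 + z * g + g ^ 2) - 1 - z * g := by ring
    calc x ^ 2 = ‖g ^ 2‖ := by rw [norm_pow]
      _ = ‖(1 + z * g + g ^ 2) - 1 - z * g‖ := by rw [← e]
      _ ≤ ‖1 + z * g + g ^ 2‖ + ‖(1 : ℂ)‖ + ‖z * g‖ :=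
        (norm_sub_le _ _).trans (add_le_add (norm_sub_le _ _) le_rfl)
      _ ≤ ε * (x + x ^ 2) + 1 + 3 * x := by rw [norm_one, norm_mul]; gcongr
  have hx8 : x ≤ 8 := by
    by_contra hc
    push Not at hc
    have : ε * (x + x ^ 2) ≤ 1 / 2 * (x + x ^ 2) := mono%
    nlinarith
  have hpos : 0 < 4 - E ^ 2 := by nlinarith [abs_lt.1 hre]
  set w := sqrt (4 - E ^ 2)
  have hw0 : 0 < w := sqrt_pos.2 hpos
  have hw2 : w ^ 2 = 4 - E ^ 2 := sq_sqrt hpos.le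
  set m : ℂ := ⟨-E / 2, w / 2⟩ with hm
  have hfac : (g - m) * (g - conj m) = (1 + z * g + g ^ 2) - (η : ℂ) * I * g := by
    have hs : m + conj m = -(E : ℂ) := by apply Complex.ext <;> simp [hm]
    have hp : m * conj m = 1 := by
      rw [Complex.mul_conj, normSq_apply]; simp only [hm]; norm_cast; nlinarith
    have hzE : z = (E : ℂ) + (η : ℂ) * I := (Complex.re_add_im z).symm
    rw [hzE]
    linear_combination (-g) * hs + hp
  have h2 : ‖g - m‖ * ‖g - conj m‖ ≤ 72 * ε + 8 * η := by
    rw [← norm_mul, hfac]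
    calc _ ≤ ‖1 + z * g + g ^ 2‖ + ‖(η : ℂ) * I * g‖ := norm_sub_le _ _
      _ ≤ ε * (x + x ^ 2) + η * x := by
        gcongr
        simp [abs_of_pos hz, hx]
      _ ≤ ε * (8 + 8 ^ 2) + η * 8 := mono%
      _ = _ := by ring
  have h3 : w / 2 ≤ ‖g - conj m‖ := by
    refine le_trans ?_ ((le_abs_self _).trans (abs_im_le_norm _)); simp [hm]; exact hg
  have h4 : |g.im - w / 2| ≤ ‖g - m‖ := by
    refine le_trans (le_of_eq ?_) (abs_im_le_norm _); simp [hm]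
  have h5 : ‖g - m‖ * (w / 2) ≤ 72 * ε + 8 * η :=
    (mul_le_mul_of_nonneg_left h3 (norm_nonneg _)).trans h2
  rw [le_div_iff₀ hw0]; nlinarith

/-- The local semicircle law for the averaged resolvent at scales `η ≫ M^(-1/3)`. -/
lemma abs_im_meanGreen_sub_le (s : SymmetryClass) {d L : ℕ} [NeZero L] {W : ℝ} {z : ℂ}
    (hz : 0 < z.im) (hz1 : z.im ≤ 1) (hre : |z.re| < 2)
    (hη : 240 ≤ (bandM d L W : ℝ) * z.im ^ 3) :
    |(meanGreen s d L W z).im - sqrt (4 - z.re ^ 2) / 2|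
      ≤ (17280 / ((bandM d L W : ℝ) * z.im ^ 3) + 16 * z.im) / sqrt (4 - z.re ^ 2) := by
  have hz3 : z.im ^ 3 ≤ 1 := pow_le_one₀ hz.le hz1
  have hz30 : 0 < z.im ^ 3 := pos%
  have hMb : (240 : ℝ) ≤ bandM d L W := by
    have : (bandM d L W : ℝ) * z.im ^ 3 ≤ bandM d L W * 1 := mono%
    linarith
  have hM : 2 ≤ bandM d L W := by
    have : (2 : ℝ) ≤ bandM d L W := lin%
    exact_mod_cast this
  set M : ℝ := (bandM d L W : ℝ)
  have hσ : 1 / (M - 1) ≤ 2 / M := by rw [div_le_div_iff₀ lin% lin%]; linarith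
  have hσ0 : 0 ≤ 1 / (M - 1) := by apply div_nonneg zero_le_one; linarith
  have hη2 : 4 * (1 / (M - 1)) ≤ z.im ^ 2 := by
    calc _ ≤ 4 * (2 / M) := mono%
      _ ≤ z.im ^ 3 := by rw [← mul_div_assoc, div_le_iff₀ lin%]; linarith
      _ ≤ z.im ^ 2 := pow_le_pow_of_le_one hz.le hz1 num%
  have key := norm_self_consistent_le (d := d) (L := L) s hM hz hz1 hη2
  set g := meanGreen s d L W z
  have hgi : g.im ≤ ‖g‖ := (le_abs_self _).trans (abs_im_le_norm _)
  have hgi0 : 0 ≤ g.im := meanGreen_im_nonneg s hz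
  set ε := 120 / (M * z.im ^ 3) with hε
  have hε1 : ε ≤ 1 / 2 := by rw [hε, div_le_div_iff₀ pos% num%]; linarith
  have h1 : 59 * (1 / (M - 1)) / z.im ^ 3 ≤ ε := by
    calc _ ≤ 59 * (2 / M) / z.im ^ 3 := mono%
      _ = 118 / (M * z.im ^ 3) := by field_simp; norm_num
      _ ≤ _ := by rw [hε]; gcongr; norm_num
  have h2 : 1 / (M - 1) ≤ ε := by
    calc _ ≤ 59 * (1 / (M - 1)) / z.im ^ 3 := by rw [le_div_iff₀ hz30]; nlinarith
      _ ≤ _ := h1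
  have h3 : ‖1 + z * g + g ^ 2‖ ≤ ε * (‖g‖ + ‖g‖ ^ 2) := by
    calc _ ≤ _ := key
      _ ≤ ε * ‖g‖ + ε * ‖g‖ ^ 2 := mono%
      _ = _ := by ring
  have := semicircle_stability hgi0 hz hz1 hre pos% hε1 h3
  refine this.trans (le_of_eq ?_); rw [hε]; ring

end

section

/-! ### Test functions and their Fourier transforms -/

section TestFunctions

variable {φ : ℝ → ℝ}

/-- Both classes of test functions decay at least quadratically; this is all that is used of
their decay. -/
lemma exists_quadratic_decay (h : IsCauchyKernel φ ∨ HasRapidDecay φ) :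
    ∃ C, 0 < C ∧ ∀ u, |φ u| ≤ C / (1 + u ^ 2) := by
  rcases h with h | h
  · refine ⟨2, two_pos, fun u => ?_⟩; rw [h, abs_of_nonneg pos%, add_comm]
  · obtain ⟨C, hC⟩ := h 2 two_pos
    refine ⟨|C| + 1, pos%, fun u => (hC u).trans ?_⟩
    have : |u| ^ (2 : ℝ) = u ^ 2 := by
      rw [show (2 : ℝ) = ((2 : ℕ) : ℝ) from num%, rpow_natCast, sq_abs]
    rw [this]; gcongr
    linarith [le_abs_self C]

lemma IsTestFunction.continuous (hφ : IsTestFunction φ) : Continuous φ := hφ.smooth.continuous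

lemma IsTestFunction.integrable_self (hφ : IsTestFunction φ) : Integrable φ := by
  simpa using hφ.integrable 0

lemma IsTestFunction.exists_lipschitz (hφ : IsTestFunction φ) :
    ∃ K, 0 < K ∧ ∀ x y, |φ x - φ y| ≤ K * |x - y| := by
  have hd : Differentiable ℝ φ := hφ.smooth.differentiable (by simp)
  have h1 : ContDiff ℝ ∞ (deriv φ) := by
    have := hφ.smooth
    rw [show ((⊤ : ℕ∞) : WithTop ℕ∞) = ((⊤ : ℕ∞) : WithTop ℕ∞) + 1 from rfl,
      contDiff_succ_iff_deriv] at this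
    exact this.2.2
  have hd1 : Differentiable ℝ (deriv φ) := h1.differentiable (by simp)
  have hi2 : Integrable (deriv (deriv φ)) := by simpa [iteratedDeriv_succ] using hφ.integrable 2
  have hc2 : Continuous (deriv (deriv φ)) := h1.continuous_deriv (by simp)
  set K := |deriv φ 0| + ∫ x, ‖deriv (deriv φ) x‖ with hK
  have hK0 : 0 ≤ K := by
    have : 0 ≤ ∫ x, ‖deriv (deriv φ) x‖ := integral_nonneg fun x => norm_nonneg _
    positivity
  have hbd : ∀ x, ‖deriv φ x‖ ≤ K + 1 := by
    intro x
    have e : ∫ t in (0 : ℝ)..x, deriv (deriv φ) t = deriv φ x - deriv φ 0 :=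
      intervalIntegral.integral_deriv_eq_sub (fun t _ => hd1 t) (hc2.intervalIntegrable _ _)
    have e2 : deriv φ x = deriv φ 0 + ∫ t in (0 : ℝ)..x, deriv (deriv φ) t := by rw [e]; ring
    rw [e2]
    have h3 : ‖∫ t in (0 : ℝ)..x, deriv (deriv φ) t‖ ≤ ∫ t, ‖deriv (deriv φ) t‖ := by
      refine (intervalIntegral.norm_integral_le_integral_norm_uIoc).trans ?_
      exact setIntegral_le_integral hi2.norm (.of_forall fun t => norm_nonneg _)
    calc _ ≤ ‖deriv φ 0‖ + ‖∫ t in (0 : ℝ)..x, deriv (deriv φ) t‖ := norm_add_le _ _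
      _ ≤ _ := by rw [hK, norm_eq_abs (deriv φ 0)]; linarith
  refine ⟨K + 1, lin%, fun x y => ?_⟩
  have := Convex.norm_image_sub_le_of_norm_deriv_le (f := φ) (s := Set.univ) (C := K + 1)
    (fun x _ => hd x) (fun x _ => hbd x) convex_univ (Set.mem_univ y) (Set.mem_univ x)
  simpa using this

lemma fourierHat_eq_fourier (φ : ℝ → ℝ) (t : ℝ) : ℱ φ t = (2 * π : ℂ)⁻¹
      * FourierTransform.fourier (fun e : ℝ => (φ e : ℂ)) (-t / (2 * π)) := by
  rw [fourierHat, Real.fourier_real_eq_integral_exp_smul]; congr 2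
  ext e; rw [smul_eq_mul]; congr 2
  have : -2 * π * e * (-t / (2 * π)) = e * t := by field_simp
  rw [this]; push_cast; ring

lemma iteratedDeriv_ofReal (hφ : ContDiff ℝ ∞ φ) (k : ℕ) :
    iteratedDeriv k (fun e : ℝ => (φ e : ℂ)) = fun e => ((iteratedDeriv k φ e : ℝ) : ℂ) := by
  induction k with
  | zero => simp
  | succ k ih =>
    rw [iteratedDeriv_succ, ih, iteratedDeriv_succ]; ext e
    have hd : Differentiable ℝ (iteratedDeriv k φ) :=
      hφ.differentiable_iteratedDeriv k (mod_cast WithTop.coe_lt_top k)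
    exact (hd e).hasDerivAt.ofReal_comp.deriv

lemma norm_inv_two_pi_le : ‖((2 * π : ℂ))⁻¹‖ ≤ 1 := by
  rw [norm_inv]; apply inv_le_one_of_one_le₀
  simp only [norm_mul, Complex.norm_ofNat, norm_real, norm_eq_abs, abs_of_pos pi_pos]
  linarith [pi_gt_three]

lemma norm_wave (x t : ℝ) : ‖exp (I * x * t)‖ = 1 := by
  rw [← norm_expI (x * t)]; congr 2; push_cast; ring

/-- The Fourier transform of a test function decays faster than any power. -/
lemma IsTestFunction.exists_fourierHat_decay (hφ : IsTestFunction φ) (k : ℕ) :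
    ∃ C, 0 < C ∧ ∀ t, ‖ℱ φ t‖ * |t| ^ k ≤ C := by
  set f : ℝ → ℂ := fun e => (φ e : ℂ) with hf
  have hsm : ContDiff ℝ ∞ f := Complex.ofRealCLM.contDiff.comp hφ.smooth
  have hi : ∀ n : ℕ, (n : ℕ∞) ≤ ⊤ → Integrable (iteratedDeriv n f) := by
    intro n _; rw [hf, iteratedDeriv_ofReal hφ.smooth]; exact (hφ.integrable n).ofReal
  have key := Real.fourier_iteratedDeriv (N := ⊤) (n := k) hsm hi le_top
  refine ⟨(∫ x, ‖iteratedDeriv k f x‖) + 1, by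
    have : 0 ≤ ∫ x, ‖iteratedDeriv k f x‖ := integral_nonneg fun x => norm_nonneg _
    linarith, fun t => ?_⟩
  have h1 := congrFun key (-t / (2 * π))
  have h2 : ‖FourierTransform.fourier (iteratedDeriv k f) (-t / (2 * π))‖
    ≤ ∫ x, ‖iteratedDeriv k f x‖ := by
    rw [Real.fourier_real_eq_integral_exp_smul]
    refine (norm_integral_le_integral_norm _).trans (le_of_eq ?_); congr 1; ext v
    rw [norm_smul, norm_expI, one_mul]
  have h3 : (2 * π * I * ((-t / (2 * π) : ℝ) : ℂ)) = -(t : ℂ) * I := by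
    push_cast
    have : (π : ℂ) ≠ 0 := mod_cast pi_ne_zero
    field_simp
  rw [h1, h3, norm_smul, norm_pow] at h2
  have h4 : ‖-(t : ℂ) * I‖ = |t| := by simp
  rw [h4] at h2; rw [fourierHat_eq_fourier, norm_mul]
  have h5 := norm_inv_two_pi_le
  calc _ ≤ 1 * ‖FourierTransform.fourier f (-t / (2 * π))‖ * |t| ^ k := mono%
    _ ≤ _ := by rw [one_mul, mul_comm]; linarith

lemma IsTestFunction.exists_fourierHat_le (hφ : IsTestFunction φ) (k : ℕ) :
    ∃ C, 0 < C ∧ ∀ t, ‖ℱ φ t‖ ≤ C / (1 + |t| ^ k) := by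
  obtain ⟨C0, h0, hC0⟩ := hφ.exists_fourierHat_decay 0
  obtain ⟨C1, h1, hC1⟩ := hφ.exists_fourierHat_decay k
  refine ⟨C0 + C1, pos%, fun t => ?_⟩; rw [le_div_iff₀ pos%, mul_add]
  have := hC0 t
  simp only [pow_zero, mul_one] at this ⊢; linarith [hC1 t]

lemma fourierHat_neg (φ : ℝ → ℝ) (t : ℝ) : ℱ φ (-t) = conj (ℱ φ t) := by
  rw [fourierHat, fourierHat, map_mul, ← integral_conj]; congr 1
  · simp [Complex.conj_ofNat]
  · congr 1; ext e; rw [map_mul, ← exp_conj, conj_ofReal]; congr 2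
    simp

lemma norm_exp_mul_I_sub_exp_le (a b : ℝ) : ‖exp (a * I) - exp (b * I)‖ ≤ 2 * sqrt |a - b| := by
  have h1 : ‖exp (a * I) - exp (b * I)‖ ≤ 2 := by
    refine (norm_sub_le _ _).trans ?_; rw [norm_expI, norm_expI]; norm_num
  have h2 : ‖exp (a * I) - exp (b * I)‖ ≤ |a - b| := by
    have e : exp (a * I) - exp (b * I) = exp (b * I) * (exp (I * ((a - b : ℝ) : ℂ)) - 1) := by
      rw [mul_sub, ← exp_add, mul_one]; congr 2; push_cast; ring
    rw [e, norm_mul, norm_expI, one_mul]; exact Real.norm_exp_I_mul_ofReal_sub_one_le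
  rcases le_total |a - b| 1 with h | h
  · have h3 : |a - b| ≤ sqrt |a - b| := by
      apply Real.le_sqrt_of_sq_le
      nlinarith [abs_nonneg (a - b)]
    linarith [sqrt_nonneg |a - b|]
  · have h3 : 1 ≤ sqrt |a - b| := one_le_sqrt.2 h
    linarith

lemma integrable_one_add_sq_rpow {p : ℝ} (hp : 1 / 2 < p) :
    Integrable (fun x : ℝ => (1 + x ^ 2) ^ (-p)) := by
  have h := integrable_rpow_neg_one_add_norm_sq (E := ℝ) (μ := volume) (r := 2 * p)
    (by simp; linarith)
  refine h.congr (.of_forall fun x => ?_); simp only [norm_eq_abs, sq_abs]; congr 1; ring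

lemma sqrt_abs_le (v : ℝ) : sqrt |v| ≤ (1 + v ^ 2) ^ (1 / 4 : ℝ) := by
  have h1 : sqrt |v| = (v ^ 2) ^ (1 / 4 : ℝ) := by
    rw [← sq_abs v, sqrt_eq_rpow, ← rpow_natCast, ← rpow_mul (abs_nonneg v)]; norm_num
  rw [h1]; apply Real.rpow_le_rpow (sq_nonneg v) lin% num%

lemma sqrt_abs_mul_le (v : ℝ) : sqrt |v| / (1 + v ^ 2) ≤ (1 + v ^ 2) ^ (-(3 / 4) : ℝ) := by
  have h0 : 0 < 1 + v ^ 2 := pos%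
  rw [div_le_iff₀ h0]; refine (sqrt_abs_le v).trans (le_of_eq ?_)
  conv_rhs => rw [← rpow_one (1 + v ^ 2), ← rpow_mul h0.le, ← rpow_add h0]
  norm_num

lemma exists_fourierHat_holder (hφ : IsTestFunction φ) {C : ℝ} (hC : ∀ u, |φ u| ≤ C / (1 + u ^ 2)) :
    ∃ K, 0 < K ∧ ∀ t u, ‖ℱ φ t - ℱ φ u‖ ≤ K * sqrt |t - u| := by
  have hint : Integrable (fun x : ℝ => (1 + x ^ 2) ^ (-(3 / 4) : ℝ)) :=
    integrable_one_add_sq_rpow num%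
  set J := ∫ x : ℝ, (1 + x ^ 2) ^ (-(3 / 4) : ℝ)
  have hJ0 : 0 ≤ J := integral_nonneg fun x => pos%
  have hC0 : 0 ≤ C := by have := (abs_nonneg _).trans (hC 0); simpa using this
  refine ⟨2 * C * J + 1, pos%, fun t u => ?_⟩
  have hi : ∀ t : ℝ, Integrable fun e : ℝ => exp (I * e * t) * (φ e : ℂ) := by
    intro t
    refine (hφ.integrable_self.ofReal (𝕜 := ℂ)).bdd_mul (c := 1) (by fun_prop)
      (.of_forall fun e => ?_)
    rw [norm_wave]
  rw [fourierHat, fourierHat, ← mul_sub, ← integral_sub (hi t) (hi u), norm_mul]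
  have h5 := norm_inv_two_pi_le
  have hpt : ∀ e : ℝ, ‖exp (I * e * t) * (φ e : ℂ) - exp (I * e * u) * (φ e : ℂ)‖
    ≤ 2 * C * sqrt |t - u| * (1 + e ^ 2) ^ (-(3 / 4) : ℝ) := by
    intro e
    rw [← sub_mul, norm_mul, show I * (e : ℂ) * (t : ℂ) = ((e * t : ℝ) : ℂ) * I by push_cast; ring,
      show I * (e : ℂ) * (u : ℂ) = ((e * u : ℝ) : ℂ) * I by push_cast; ring,
      norm_real, norm_eq_abs]
    have h1 := norm_exp_mul_I_sub_exp_le (e * t) (e * u)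
    have h2 : sqrt |e * t - e * u| = sqrt |e| * sqrt |t - u| := by
      rw [← mul_sub, abs_mul, sqrt_mul (abs_nonneg _)]
    rw [h2] at h1
    calc _ ≤ 2 * (sqrt |e| * sqrt |t - u|) * (C / (1 + e ^ 2)) := by gcongr; exact hC e
      _ = 2 * C * sqrt |t - u| * (sqrt |e| / (1 + e ^ 2)) := by ring
      _ ≤ _ := by gcongr; exact sqrt_abs_mul_le e
  calc _ ≤ 1 * ∫ e : ℝ, 2 * C * sqrt |t - u| * (1 + e ^ 2) ^ (-(3 / 4) : ℝ) := by
        gcongr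
        exact norm_integral_le_of_norm_le (hint.const_mul _) (.of_forall hpt)
    _ = 2 * C * J * sqrt |t - u| := by rw [integral_const_mul]; ring
    _ ≤ _ := by gcongr; linarith

lemma IsTestFunction.continuous_fourierHat (hφ : IsTestFunction φ) : Continuous (ℱ φ) := by
  have h : ℱ φ = fun t => (2 * π : ℂ)⁻¹
    * FourierTransform.fourier (fun e : ℝ => (φ e : ℂ)) (-t / (2 * π)) := by
    ext t; exact fourierHat_eq_fourier φ t
  rw [h]; refine continuous_const.mul (Continuous.comp ?_ (by fun_prop))
  exact VectorFourier.fourierIntegral_continuous Real.continuous_fourierChar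
    (by exact continuous_inner) (hφ.integrable_self.ofReal)

lemma IsTestFunction.integrable_fourierHat (hφ : IsTestFunction φ) : Integrable (ℱ φ) := by
  obtain ⟨C, hC0, hC⟩ := hφ.exists_fourierHat_le 2
  refine (integrable_inv_one_add_sq.const_mul C).mono'
    hφ.continuous_fourierHat.aestronglyMeasurable (.of_forall fun t => ?_)
  refine (hC t).trans (le_of_eq ?_); rw [sq_abs]; rfl

/-- Fourier inversion. -/
lemma IsTestFunction.fourier_inversion (hφ : IsTestFunction φ) (e : ℝ) :
    ∫ t : ℝ, exp (-(I * e * t)) * ℱ φ t = (φ e : ℂ) := by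
  set f : ℝ → ℂ := fun e => (φ e : ℂ)
  have hfi : Integrable f := hφ.integrable_self.ofReal
  have hfc : Continuous f := Complex.continuous_ofReal.comp hφ.continuous
  have hpi : (π : ℂ) ≠ 0 := mod_cast pi_ne_zero
  have h1 : ∀ v : ℝ, FourierTransform.fourier f v = (2 * π : ℂ) * ℱ φ (v * (-(2 * π))) := by
    intro v; rw [fourierHat_eq_fourier, ← mul_assoc, mul_inv_cancel₀ (by simp [hpi]), one_mul]
    rw [mul_neg, neg_neg, mul_div_assoc, div_self pos%, mul_one]
  have hFi : Integrable (FourierTransform.fourier f) := by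
    have : FourierTransform.fourier f = fun v : ℝ => (2 * π : ℂ) * ℱ φ (v * (-(2 * π))) := funext h1
    rw [this]; exact (hφ.integrable_fourierHat.comp_mul_right' (by simp [pi_ne_zero])).const_mul _
  have h2 := congrFun (hfc.fourierInv_fourier_eq hfi hFi) e
  rw [Real.fourierInv_eq'] at h2
  have h3 := Measure.integral_comp_mul_right (fun t : ℝ =>
    exp (-(I * e * t)) * ℱ φ t) (-(2 * π))
  have h4 : ∫ v : ℝ, exp (((2 * π * inner ℝ v e : ℝ) : ℂ) * I) • FourierTransform.fourier f v
    = (2 * π : ℂ) * ∫ v : ℝ, exp (-(I * e * ((v * (-(2 * π)) : ℝ) : ℂ)))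
      * ℱ φ (v * (-(2 * π))) := by
    rw [← integral_const_mul]; congr 1; ext v; rw [h1, smul_eq_mul]
    have : ((2 * π * inner ℝ v e : ℝ) : ℂ) * I = -(I * e * ((v * (-(2 * π)) : ℝ) : ℂ)) := by
      simp; ring
    rw [this]; ring
  rw [h4, h3] at h2; rw [abs_inv, abs_neg, abs_of_pos (pos% : (0 : ℝ) < 2 * π), real_smul] at h2
  change _ = f e; rw [← h2]; push_cast; field_simp

end TestFunctions

end

/-! ### Bessel functions -/

/-- The function `(-i)ⁿ J_n`, the Fourier coefficient of the wave `e^{-it cos θ}`. -/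
def besselWave (n : ℕ) (t : ℝ) : ℂ := (-I) ^ n * (besselJ n t : ℂ)

lemma hasSum_integral_exp_mul {w g : ℝ → ℂ} (hw : Continuous w) (hg : Continuous g)
    (hw1 : ∀ θ, ‖w θ‖ ≤ 1) {B : ℝ} (hB : ∀ θ, ‖g θ‖ ≤ B) (u : ℂ) :
    HasSum (fun l : ℕ => u ^ l / (l ! : ℂ) * ∫ θ in (-π)..π, w θ ^ l * g θ)
      (∫ θ in (-π)..π, exp (u * w θ) * g θ) := by
  have hB0 : 0 ≤ B := (norm_nonneg _).trans (hB 0)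
  have := intervalIntegral.hasSum_integral_of_dominated_convergence (μ := volume) (a := -π) (b := π)
    (F := fun (l : ℕ) θ => u ^ l / (l ! : ℂ) * (w θ ^ l * g θ))
    (f := fun θ => exp (u * w θ) * g θ) (fun l _ => ‖u‖ ^ l / l ! * B)
    (fun l => by fun_prop)
    (fun l => Eventually.of_forall fun θ _ => ?_)
    (.of_forall fun θ _ => (Real.summable_pow_div_factorial ‖u‖).mul_right B)
    (by simp) (.of_forall fun θ _ => ?_)
  · simpa only [intervalIntegral.integral_const_mul] using this
  · rw [norm_mul, norm_mul, norm_div, norm_pow, norm_pow, Complex.norm_natCast]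
    have : ‖w θ‖ ^ l * ‖g θ‖ ≤ 1 * B := by
      gcongr
      · exact pow_le_one₀ (norm_nonneg _) (hw1 θ)
      · exact hB θ
    rw [one_mul] at this; gcongr
  · have h := NormedSpace.expSeries_div_hasSum_exp (u * w θ)
    rw [← Complex.exp_eq_exp_ℂ] at h
    have h2 := h.mul_right (g θ)
    have e : (fun l : ℕ => u ^ l / (l ! : ℂ) * (w θ ^ l * g θ))
      = fun l : ℕ => (u * w θ) ^ l / (l ! : ℂ) * g θ := by
      ext l; rw [mul_pow]; ring
    rw [e]; exact h2

lemma integral_exp_int_mul (m : ℤ) : ∫ θ in (-π)..π, exp (m * (θ * I))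
      = if m = 0 then (2 * π : ℂ) else 0 := by
  split_ifs with h
  · subst h; simp; ring
  · have hc : (m * I : ℂ) ≠ 0 := by simp [h]
    have e : ∀ θ : ℝ, exp (m * (θ * I)) = exp ((m * I) * θ) := by intro θ; congr 1; ring
    simp only [e]; rw [integral_exp_mul_complex hc]
    have : (m * I * (π : ℂ)) = (m * I) * ((-π : ℝ) : ℂ) + m * (2 * π * I) := by push_cast; ring
    rw [this, exp_add, Complex.exp_int_mul_two_pi_mul_I, mul_one, sub_self, zero_div]

lemma norm_exp_neg_nat_mul (k : ℕ) (θ : ℝ) : ‖exp (-(k : ℂ) * (θ * I))‖ = 1 := by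
  rw [← norm_expI (-(k * θ))]; congr 2; push_cast; ring

lemma norm_exp_neg_I_mul (t c : ℝ) : ‖exp (-(I * t * c))‖ = 1 := by
  rw [← norm_expI (-(t * c))]; congr 2; push_cast; ring

/-- Taylor coefficients of the exponential as Fourier coefficients. -/
lemma integral_exp_exp (u : ℂ) (k : ℕ) : ∫ θ in (-π)..π, exp (u * exp (θ * I))
      * exp (-(k : ℂ) * (θ * I)) = 2 * π * (u ^ k / k !) := by
  have h := hasSum_integral_exp_mul (w := fun θ => exp (θ * I))
    (g := fun θ => exp (-(k : ℂ) * (θ * I))) (by fun_prop) (by fun_prop)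
    (fun θ => (norm_expI θ).le) (B := 1)
    (fun θ => (norm_exp_neg_nat_mul k θ).le) u
  refine h.unique ?_
  have hterm : ∀ l : ℕ, u ^ l / (l ! : ℂ) * (∫ θ in (-π)..π,
    exp (θ * I) ^ l * exp (-(k : ℂ) * (θ * I)))
    = if l = k then 2 * π * (u ^ k / k !) else 0 := by
    intro l
    have e : ∀ θ : ℝ, exp (θ * I) ^ l * exp (-(k : ℂ) * (θ * I))
      = exp (((l - k : ℤ) : ℂ) * (θ * I)) := by
      intro θ; rw [← Complex.exp_nat_mul, ← exp_add]; congr 1; push_cast; ring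
    simp only [e]; rw [integral_exp_int_mul]
    by_cases hl : l = k
    · subst hl; simp; ring
    · have : ((l : ℤ) - k) ≠ 0 := by omega
      simp [hl, this]
  simp only [hterm]; exact hasSum_ite_eq k _

lemma hasSum_besselWave (n : ℕ) (t : ℝ) : HasSum (fun l : ℕ => 2 * π * ((-I) ^ n
      * (((-1) ^ l / ((l ! : ℝ) * ((l + n)! : ℝ)) * (t / 2) ^ (2 * l + n) : ℝ) : ℂ)))
      (∫ θ in (-π)..π, exp (-(I * t * cos θ)) * exp (-(n : ℂ) * (θ * I))) := by
  set u : ℂ := -(I * t) / 2 with hu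
  have hb : ∀ θ : ℝ, ‖exp (u * exp (θ * I)) * exp (-(n : ℂ) * (θ * I))‖ ≤ Real.exp ‖u‖ := by
    intro θ; rw [norm_mul, norm_exp_neg_nat_mul, mul_one, Complex.norm_exp]; apply exp_le_exp.2
    refine (Complex.re_le_norm _).trans ?_; rw [norm_mul, norm_expI, mul_one]
  have h := hasSum_integral_exp_mul (w := fun θ => exp (-(θ * I)))
    (g := fun θ => exp (u * exp (θ * I)) * exp (-(n : ℂ) * (θ * I))) (by fun_prop) (by fun_prop)
    (fun θ => by rw [show -((θ : ℂ) * I) = ((-θ : ℝ) : ℂ) * I by push_cast; ring, norm_expI]) hb u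
  convert h using 1
  · ext l
    have e : ∀ θ : ℝ, exp (-(θ * I)) ^ l * (exp (u * exp (θ * I)) * exp (-(n : ℂ) * (θ * I)))
      = exp (u * exp (θ * I)) * exp (-((l + n : ℕ) : ℂ) * (θ * I)) := by
      intro θ
      have : exp (-((l + n : ℕ) : ℂ) * (θ * I))
        = exp (-(θ * I)) ^ l * exp (-(n : ℂ) * (θ * I)) := by
        rw [← Complex.exp_nat_mul, ← exp_add]; congr 1; push_cast; ring
      rw [this, mul_left_comm]
    simp only [e]; rw [integral_exp_exp]
    have hu2 : u ^ l * u ^ (l + n) = (-I) ^ n * ((-1) ^ l * ((t : ℂ) / 2) ^ (2 * l + n)) := by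
      have h1 : u = (-I) * ((t : ℂ) / 2) := by rw [hu]; ring
      have h2 : (-I) ^ l * (-I) ^ l = (-1) ^ l := by rw [← mul_pow]; simp
      rw [h1]
      calc _ = ((-I) ^ l * (-I) ^ l) * (-I) ^ n * ((t : ℂ) / 2) ^ (2 * l + n) := by
            generalize (-I) = w
            ring
        _ = _ := by rw [h2]; generalize (-I) ^ n = w; ring
    push_cast
    have f1 : (l ! : ℂ) ≠ 0 := mod_cast l.factorial_ne_zero
    have f2 : ((l + n)! : ℂ) ≠ 0 := mod_cast (l + n).factorial_ne_zero
    calc _ = 2 * π * ((-I) ^ n * ((-1) ^ l * ((t : ℂ) / 2) ^ (2 * l + n)))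
          / ((l ! : ℂ) * ((l + n)! : ℂ)) := by ring
      _ = _ := by rw [← hu2]; generalize u = v; ring
  · congr 1; ext θ; rw [← mul_assoc (exp (u * _))]; congr 1
    rw [← exp_add, ← mul_add]; congr 1
    have : exp (-(θ * I)) + exp (θ * I) = 2 * Complex.cos θ := by rw [two_cos]; ring_nf
    rw [this, hu, ofReal_cos]; ring

/-- Bessel's integral. -/
lemma besselWave_eq_integral (n : ℕ) (t : ℝ) : besselWave n t = (π : ℂ)⁻¹ * ∫ θ in (0 : ℝ)..π,
      exp (-(I * t * cos θ)) * (cos (n * θ) : ℂ) := by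
  have h := (hasSum_besselWave n t).tsum_eq
  rw [tsum_mul_left, tsum_mul_left, ← Complex.ofReal_tsum] at h
  have hpi : (π : ℂ) ≠ 0 := mod_cast pi_ne_zero
  set F : ℝ → ℂ := fun θ => exp (-(I * t * cos θ)) * exp (-(n : ℂ) * (θ * I)) with hF
  have hFc : Continuous F := by fun_prop
  have i1 : IntervalIntegrable (fun θ => F (-θ)) volume 0 π :=
    (hFc.comp continuous_neg).intervalIntegrable _ _
  have h2 : ∫ θ in (-π)..π, F θ = ∫ θ in (0 : ℝ)..π, (F (-θ) + F θ) := by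
    rw [← intervalIntegral.integral_add_adjacent_intervals (b := 0)
      (hFc.intervalIntegrable _ _) (hFc.intervalIntegrable _ _),
      intervalIntegral.integral_add i1 (hFc.intervalIntegrable _ _)]
    congr 1
    have := intervalIntegral.integral_comp_neg (a := 0) (b := π) F
    rw [neg_zero] at this; exact this.symm
  have h3 : ∀ θ, F (-θ) + F θ = 2 * (exp (-(I * t * cos θ)) * (cos (n * θ) : ℂ)) := by
    intro θ; simp only [hF, Real.cos_neg]; rw [← mul_add]
    have : exp (-(n : ℂ) * (((-θ : ℝ) : ℂ) * I))
      + exp (-(n : ℂ) * (θ * I)) = 2 * (cos (n * θ) : ℂ) := by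
      rw [ofReal_cos, two_cos]; congr 2 <;> (push_cast; ring)
    rw [this]; ring
  change _ = ∫ θ in (-π)..π, F θ at h; rw [h2] at h
  simp only [h3, intervalIntegral.integral_const_mul] at h
  have h4 : besselWave n t = (-I) ^ n * ((∑' m : ℕ, (-1) ^ m
    / ((m ! : ℝ) * ((m + n)! : ℝ)) * (t / 2) ^ (2 * m + n) : ℝ) : ℂ) := rfl
  rw [← h4] at h
  generalize (∫ θ in (0 : ℝ)..π, exp (-(I * t * cos θ)) * (cos (n * θ) : ℂ)) = y at h ⊢
  generalize besselWave n t = x at h ⊢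
  have h5 : (2 : ℂ) ≠ 0 := two_ne_zero
  rw [eq_inv_mul_iff_mul_eq₀ hpi]; apply mul_left_cancel₀ h5
  linear_combination h

lemma norm_besselWave_le (n : ℕ) (t : ℝ) : ‖besselWave n t‖ ≤ 1 := by
  rw [besselWave_eq_integral, norm_mul]
  have h1 := intervalIntegral.norm_integral_le_of_norm_le_const (a := 0) (b := π) (C := 1)
    (f := fun θ => exp (-(I * t * cos θ)) * (cos (n * θ) : ℂ)) (fun θ _ => by
      rw [norm_mul, norm_exp_neg_I_mul, one_mul, norm_real, norm_eq_abs]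
      exact abs_cos_le_one _)
  rw [sub_zero, abs_of_pos pi_pos, one_mul] at h1
  rw [norm_inv, norm_real, norm_of_nonneg pi_pos.le]
  calc _ ≤ π⁻¹ * π := mono%
    _ = 1 := inv_mul_cancel₀ pi_ne_zero

lemma continuous_besselWave (n : ℕ) : Continuous (besselWave n) := by
  have : besselWave n = fun t : ℝ => (π : ℂ)⁻¹ * ∫ θ in (0 : ℝ)..π,
    exp (-(I * t * cos θ)) * (cos (n * θ) : ℂ) := by
    ext t; exact besselWave_eq_integral n t
  rw [this]; refine continuous_const.mul ?_
  exact intervalIntegral.continuous_parametric_intervalIntegral_of_continuous' (by fun_prop) _ _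

lemma besselWave_neg (n : ℕ) (t : ℝ) : besselWave n (-t) = conj (besselWave n t) := by
  have h : besselJ n (-t) = (-1) ^ n * besselJ n t := by
    rw [besselJ, besselJ, ← tsum_mul_left]; congr 1; ext m
    have : (-t / 2) ^ (2 * m + n) = (-1) ^ n * (t / 2) ^ (2 * m + n) := by
      rw [neg_div, neg_pow, pow_add, pow_mul]; simp
    rw [this]; ring
  rw [besselWave, besselWave, h, map_mul, map_pow, conj_ofReal]
  simp only [map_neg, conj_I, neg_neg]; push_cast; rw [← mul_assoc, ← mul_pow]; simp

/-- The Bessel recurrence in terms of Fourier coefficients: `α_k` is a difference. -/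
lemma chebCoeff_eq (k : ℕ) {t : ℝ} (ht : t ≠ 0) :
    chebCoeff k t = besselWave k t - besselWave (k + 2) t := by
  have hpi : (π : ℂ) ≠ 0 := mod_cast pi_ne_zero
  have htc : (t : ℂ) ≠ 0 := mod_cast ht
  set e : ℝ → ℂ := fun θ => exp (-(I * t * cos θ)) with he
  have hec : Continuous e := by fun_prop
  have hde : ∀ θ : ℝ, HasDerivAt e (I * t * sin θ * e θ) θ := by
    intro θ
    have h1 : HasDerivAt (fun θ : ℝ => ((cos θ : ℝ) : ℂ)) ((-sin θ : ℝ) : ℂ) θ :=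
      (Real.hasDerivAt_cos θ).ofReal_comp
    have h2 := ((h1.const_mul (I * t)).fun_neg).cexp
    convert h2 using 1
    simp only [he]; push_cast; ring
  have hds : ∀ θ : ℝ, HasDerivAt (fun θ : ℝ => ((sin ((k + 1 : ℕ) * θ) : ℝ) : ℂ))
    ((((k + 1 : ℕ) : ℝ) * cos ((k + 1 : ℕ) * θ) : ℝ) : ℂ) θ := by
    intro θ
    have h1 : HasDerivAt (fun θ : ℝ => sin ((k + 1 : ℕ) * θ))
      (cos ((k + 1 : ℕ) * θ) * ((k + 1 : ℕ) : ℝ)) θ := by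
      have := ((hasDerivAt_id θ).const_mul ((k + 1 : ℕ) : ℝ)).sin
      simpa using this
    convert h1.ofReal_comp using 1
    push_cast; ring
  -- integrate the derivative of `e θ * sin ((k + 1) θ)`
  have hparts : ∫ θ in (0 : ℝ)..π, (I * t * sin θ * e θ * ((sin ((k + 1 : ℕ) * θ) : ℝ) : ℂ)
    + e θ * ((((k + 1 : ℕ) : ℝ) * cos ((k + 1 : ℕ) * θ) : ℝ) : ℂ)) = 0 := by
    rw [intervalIntegral.integral_eq_sub_of_hasDerivAt (fun θ _ => (hde θ).mul (hds θ))
      (Continuous.intervalIntegrable (by fun_prop) _ _), Pi.mul_apply, Pi.mul_apply,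
      Real.sin_nat_mul_pi]
    simp
  have hprod : ∀ θ : ℝ, e θ * (cos (k * θ) : ℂ) - e θ * (cos ((k + 2 : ℕ) * θ) : ℂ)
    = 2 / (I * t) * (I * t * sin θ * e θ * ((sin ((k + 1 : ℕ) * θ) : ℝ) : ℂ)) := by
    intro θ
    have h1 : cos (k * θ) - cos ((k + 2 : ℕ) * θ) = 2 * (sin ((k + 1 : ℕ) * θ) * sin θ) := by
      have a1 : (k : ℝ) * θ = ((k + 1 : ℕ) : ℝ) * θ - θ := by push_cast; ring
      have a2 : ((k + 2 : ℕ) : ℝ) * θ = ((k + 1 : ℕ) : ℝ) * θ + θ := by push_cast; ring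
      rw [a1, a2, Real.cos_sub, Real.cos_add]; ring
    have h2 : (cos (k * θ) : ℂ) - (cos ((k + 2 : ℕ) * θ) : ℂ)
      = 2 * ((sin ((k + 1 : ℕ) * θ) : ℂ) * (sin θ : ℂ)) := mod_cast h1
    rw [← mul_sub, h2]; field_simp
  have i1 : IntervalIntegrable (fun θ : ℝ => e θ * (cos (k * θ) : ℂ)) volume 0 π :=
    Continuous.intervalIntegrable (by fun_prop) _ _
  have i2 : IntervalIntegrable (fun θ : ℝ => e θ * (cos ((k + 2 : ℕ) * θ) : ℂ))
    volume 0 π := Continuous.intervalIntegrable (by fun_prop) _ _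
  rw [intervalIntegral.integral_add (Continuous.intervalIntegrable (by fun_prop) _ _)
    (Continuous.intervalIntegrable (by fun_prop) _ _)] at hparts
  have i5 : ∫ θ in (0 : ℝ)..π, e θ * ((((k + 1 : ℕ) : ℝ) * cos ((k + 1 : ℕ) * θ) : ℝ) : ℂ)
    = ((k + 1 : ℕ) : ℂ) * (π * besselWave (k + 1) t) := by
    rw [besselWave_eq_integral, ← mul_assoc, ← mul_assoc, mul_assoc _ (π : ℂ),
      mul_inv_cancel₀ hpi, mul_one, ← intervalIntegral.integral_const_mul]
    congr 1; ext θ; simp only [he]; push_cast; ring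
  rw [i5] at hparts
  rw [besselWave_eq_integral k, besselWave_eq_integral (k + 2), ← mul_sub,
    ← intervalIntegral.integral_sub i1 i2]
  simp only [hprod]
  rw [intervalIntegral.integral_const_mul, eq_neg_of_add_eq_zero_left hparts, chebCoeff,
    besselWave, pow_succ]
  push_cast
  have hI : I ≠ 0 := Complex.I_ne_zero
  field_simp

/-- Below the turning point the Bessel functions are exponentially small. -/
lemma norm_besselWave_le_pow (n : ℕ) {t : ℝ} (ht : 8 * |t| ≤ n) :
    ‖besselWave n t‖ ≤ (1 / 2) ^ n := by
  set x := |t| / 2 with hx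
  have hx0 : 0 ≤ x := pos%
  have hfac : ∀ m : ℕ, (m ! : ℝ) * n ! ≤ (m + n)! := by
    intro m
    exact_mod_cast Nat.le_of_dvd (Nat.factorial_pos _) (Nat.factorial_mul_factorial_dvd_factorial_add m n)
  have hterm : ∀ m : ℕ, ‖(-1 : ℝ) ^ m / ((m ! : ℝ) * ((m + n)! : ℝ))
    * (t / 2) ^ (2 * m + n)‖ ≤ (x ^ n / n ! * Real.exp x) * (x ^ m / m !) := by
    intro m
    have p1 : (0 : ℝ) < m ! := mod_cast m.factorial_pos
    have p2 : (0 : ℝ) < n ! := mod_cast n.factorial_pos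
    have p3 : (0 : ℝ) < (m + n)! := mod_cast (m + n).factorial_pos
    have e : ‖(-1 : ℝ) ^ m / ((m ! : ℝ) * ((m + n)! : ℝ))
      * (t / 2) ^ (2 * m + n)‖ = x ^ (2 * m + n) / ((m ! : ℝ) * ((m + n)! : ℝ)) := by
      rw [norm_mul, norm_div, norm_pow, norm_pow, norm_neg, norm_one, one_pow, norm_mul,
        norm_of_nonneg p1.le, norm_of_nonneg p3.le, norm_eq_abs, abs_div]
      simp [hx]; ring
    rw [e]
    have hexp : x ^ m / m ! ≤ Real.exp x := Real.pow_div_factorial_le_exp x hx0 m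
    calc x ^ (2 * m + n) / ((m ! : ℝ) * ((m + n)! : ℝ))
          ≤ x ^ (2 * m + n) / ((m ! : ℝ) * ((m ! : ℝ) * n !)) := by gcongr; exact hfac m
      _ = (x ^ n / n ! * (x ^ m / m !)) * (x ^ m / m !) := by field_simp; ring
      _ ≤ _ := mono%
  have hs : HasSum (fun m : ℕ => (x ^ n / n ! * Real.exp x) * (x ^ m / m !))
    ((x ^ n / n ! * Real.exp x) * Real.exp x) := by
    have h := NormedSpace.expSeries_div_hasSum_exp x
    rw [← Real.exp_eq_exp_ℝ] at h; exact h.mul_left _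
  have hJ : |besselJ n t| ≤ (x ^ n / n ! * Real.exp x) * Real.exp x := by
    rw [← norm_eq_abs, besselJ]; exact tsum_of_norm_bounded hs hterm
  have hn : ‖besselWave n t‖ = |besselJ n t| := by simp [besselWave]
  rw [hn]; refine hJ.trans ?_
  have hxn : x ≤ n / 16 := by rw [hx]; linarith
  have h1 : x ^ n / n ! ≤ (1 / 16) ^ n * Real.exp n := by
    calc x ^ n / n ! ≤ ((n : ℝ) / 16) ^ n / n ! := mono%
      _ = (1 / 16) ^ n * ((n : ℝ) ^ n / n !) := by rw [div_pow, one_div, inv_pow]; ring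
      _ ≤ _ := by
        gcongr
        exact Real.pow_div_factorial_le_exp n (cast_nonneg n) n
  have h2 : Real.exp x ≤ Real.exp (n / 16) := exp_le_exp.2 hxn
  have h8 : Real.exp (9 / 8) ≤ 8 := by
    have := Real.exp_one_lt_d9
    have h9 : Real.exp (9 / 8) ≤ Real.exp 1 ^ 2 := by
      rw [← Real.exp_nat_mul]; apply exp_le_exp.2; norm_num
    have h0 : 0 < Real.exp 1 := exp_pos 1
    nlinarith
  calc _ ≤ ((1 / 16) ^ n * Real.exp n) * Real.exp (n / 16) * Real.exp (n / 16) := mono%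
    _ = (1 / 16 * Real.exp (9 / 8)) ^ n := by
      rw [mul_pow, ← Real.exp_nat_mul, mul_assoc, mul_assoc, ← Real.exp_add, ← Real.exp_add]
      congr 2; ring
    _ ≤ (1 / 2) ^ n := by
      gcongr
      linarith

section

/-! ### Chebyshev coefficients of the rescaled test function -/

variable {φ : ℝ → ℝ}

/-- The `n`-th Chebyshev coefficient of the rescaled test function
`η⁻¹ φ(η⁻¹ (x - E))` on `[-1, 1]`, with the substitution `x = cos θ`. -/
def levelTransform (φ : ℝ → ℝ) (η E : ℝ) (n : ℕ) : ℝ :=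
  π⁻¹ * ∫ θ in (0 : ℝ)..π, η⁻¹ * φ (η⁻¹ * (cos θ - E)) * cos (n * θ)

lemma IsTestFunction.integrable_fourierHat_mul (hφ : IsTestFunction φ) {η : ℝ} (hη : 0 < η) :
    Integrable (fun t => ℱ φ (η * t)) :=
  hφ.integrable_fourierHat.comp_mul_left' hη.ne'

/-- The Chebyshev coefficients are obtained by testing the Fourier transform of the test function
against Bessel functions. -/
lemma integral_fourierHat_besselWave (hφ : IsTestFunction φ) {η : ℝ} (hη : 0 < η) (E : ℝ) (n : ℕ) :
    ∫ t : ℝ, exp (I * E * t) * ℱ φ (η * t) * besselWave n t = (levelTransform φ η E n : ℂ) := by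
  have hcf := hφ.continuous_fourierHat
  have hinner : ∀ x : ℝ, ∫ t : ℝ, exp (-(I * x * t)) * ℱ φ (η * t)
    = ((η⁻¹ * φ (η⁻¹ * x) : ℝ) : ℂ) := by
    intro x
    have h := Measure.integral_comp_mul_left (fun u : ℝ => exp (-(I * (η⁻¹ * x : ℝ) * u)) * ℱ φ u) η
    rw [hφ.fourier_inversion, abs_of_pos (inv_pos.2 hη)] at h; rw [ofReal_mul, ← real_smul, ← h]
    congr 1; ext t; congr 3
    have : (η : ℂ) ≠ 0 := mod_cast hη.ne'
    push_cast; field_simp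
  set G : ℝ → ℝ → ℂ := fun t θ => exp (I * E * t) * ℱ φ (η * t)
    * (exp (-(I * t * cos θ)) * (cos (n * θ) : ℂ)) with hG
  have hGc : Continuous (uncurry G) := by simp only [hG, Function.uncurry_def]; fun_prop
  have hint : Integrable (uncurry G) (volume.prod (volume.restrict (Ioc 0 π))) := by
    have hi := (hφ.integrable_fourierHat_mul hη).norm.mul_prod
      (integrable_const (μ := volume.restrict (Ioc (0 : ℝ) π)) (1 : ℝ))
    refine hi.mono' hGc.aestronglyMeasurable (.of_forall fun p => ?_)
    simp only [hG, Function.uncurry_def, norm_mul, norm_wave, one_mul]; gcongr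
    rw [norm_exp_neg_I_mul, one_mul, norm_real]; exact abs_cos_le_one _
  have hswap := integral_integral_swap hint
  have hl : ∀ t : ℝ, exp (I * E * t) * ℱ φ (η * t) * besselWave n t
    = (π : ℂ)⁻¹ * ∫ θ in Ioc 0 π, G t θ := by
    intro t; rw [besselWave_eq_integral, intervalIntegral.integral_of_le pi_pos.le]; simp only [hG]
    rw [integral_const_mul]; ring
  have hr : ∀ θ : ℝ, ∫ t : ℝ, G t θ = ((η⁻¹ * φ (η⁻¹ * (cos θ - E)) * cos (n * θ) : ℝ) : ℂ) := by
    intro θ; rw [ofReal_mul, ← hinner, ← integral_mul_const]; congr 1; ext t; simp only [hG]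
    rw [show ∀ a b c d : ℂ, a * b * (c * d) = (a * c) * b * d by intros; ring, ← exp_add]
    congr 3; push_cast; ring
  simp only [hl]; rw [integral_const_mul, hswap]; simp only [hr]
  rw [integral_complex_ofReal, levelTransform, intervalIntegral.integral_of_le pi_pos.le]
  push_cast; rfl

lemma integral_eq_two_re {f : ℝ → ℂ} (hf : Integrable f) (hsymm : ∀ t, f (-t) = conj (f t)) :
    ∫ t, f t = ((2 * (∫ t in Ioi (0 : ℝ), f t).re : ℝ) : ℂ) := by
  have h1 := integral_add_compl (measurableSet_Ioi (a := (0 : ℝ))) hf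
  rw [Set.compl_Ioi] at h1
  have h2 : ∫ t in Set.Iic (0 : ℝ), f t = conj (∫ t in Ioi (0 : ℝ), f t) := by
    have h := integral_comp_neg_Ioi (0 : ℝ) f
    rw [neg_zero] at h; rw [← h, ← integral_conj]; simp only [hsymm]
  rw [← h1, h2, Complex.add_conj]

lemma integrable_fourierHat_besselWave (hφ : IsTestFunction φ) {η : ℝ} (hη : 0 < η) (E : ℝ)
    (n : ℕ) :
    Integrable fun t : ℝ =>
      exp (I * E * t) * ℱ φ (η * t) * besselWave n t := by
  have hcf := hφ.continuous_fourierHat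
  have hcb := continuous_besselWave n
  refine (hφ.integrable_fourierHat_mul hη).norm.mono' (by fun_prop) (.of_forall fun t => ?_)
  rw [norm_mul, norm_mul, norm_wave, one_mul]
  exact mul_le_of_le_one_right (norm_nonneg _) (norm_besselWave_le n t)

lemma levelTransform_eq_two_re (hφ : IsTestFunction φ) {η : ℝ} (hη : 0 < η) (E : ℝ) (n : ℕ) :
    levelTransform φ η E n = 2 * (∫ t in Ioi (0 : ℝ),
      exp (I * E * t) * ℱ φ (η * t) * besselWave n t).re := by
  have h := integral_eq_two_re (integrable_fourierHat_besselWave hφ hη E n) (fun t => by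
    rw [map_mul, map_mul, besselWave_neg, mul_neg, fourierHat_neg, ← exp_conj]; congr 3
    simp)
  rw [integral_fourierHat_besselWave hφ hη] at h
  exact_mod_cast h

lemma IsTestFunction.norm_setIntegral_le (hφ : IsTestFunction φ) {η c : ℝ} (hη : 0 < η) {s : Set ℝ}
    (hs : MeasurableSet s) {f : ℝ → ℂ} (hf : ∀ t ∈ s, ‖f t‖ ≤ c * ‖ℱ φ (η * t)‖) :
    ‖∫ t in s, f t‖ ≤ c * ∫ t in s, ‖ℱ φ (η * t)‖ := by
  rw [← integral_const_mul]
  exact norm_integral_le_of_norm_le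
    ((hφ.integrable_fourierHat_mul hη).norm.const_mul _).integrableOn
    ((ae_restrict_mem hs).mono hf)

lemma IsTestFunction.setIntegral_norm_fourierHat_le (hφ : IsTestFunction φ) {η : ℝ} (hη : 0 < η)
    (s : Set ℝ) : ∫ t in s, ‖ℱ φ (η * t)‖ ≤ η⁻¹ * ∫ t, ‖ℱ φ t‖ := by
  refine (setIntegral_le_integral (hφ.integrable_fourierHat_mul hη).norm
    (.of_forall fun t => norm_nonneg _)).trans_eq ?_
  rw [Measure.integral_comp_mul_left (fun u => ‖ℱ φ u‖) η, abs_of_pos (inv_pos.2 hη), smul_eq_mul]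

/-- The Fourier transform of the test function is negligible beyond its natural scale. -/
lemma exists_integral_tail_le (hφ : IsTestFunction φ) (k : ℕ) :
    ∃ C, 0 < C ∧ ∀ η Y, 0 < η → 1 ≤ Y → ∀ s : Set ℝ, MeasurableSet s → (∀ t ∈ s, Y ≤ η * |t|) →
      ∫ t in s, ‖ℱ φ (η * t)‖ ≤ C * η⁻¹ * (Y ^ k)⁻¹ := by
  obtain ⟨C, hC0, hC⟩ := hφ.exists_fourierHat_decay (k + 2)
  refine ⟨2 * C * π, pos%, fun η Y hη hY s hs hsY => ?_⟩
  have hY0 : 0 < Y := lin%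
  have hsc : Integrable (fun t : ℝ => (1 + (η * t) ^ 2)⁻¹) :=
    integrable_inv_one_add_sq.comp_mul_left' hη.ne'
  calc ∫ t in s, ‖ℱ φ (η * t)‖ ≤ ∫ t in s, 2 * C * (Y ^ k)⁻¹ * (1 + (η * t) ^ 2)⁻¹ := by
        refine setIntegral_mono_on (hφ.integrable_fourierHat_mul hη).norm.integrableOn
          (hsc.const_mul _).integrableOn hs fun t ht => ?_
        have h1 := hC (η * t)
        have h2 : Y ≤ |η * t| := by rw [abs_mul, abs_of_pos hη]; exact hsY t ht
        set u := |η * t| with hu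
        have hu1 : 1 ≤ u := hY.trans h2
        rw [← sq_abs (η * t), ← hu]; rw [pow_add] at h1
        have h3 : Y ^ k ≤ u ^ k := mono%
        have hk : 0 < Y ^ k := pos%
        have h4 : ‖ℱ φ (η * t)‖ * (Y ^ k * u ^ 2) ≤ C := by refine le_trans ?_ h1; gcongr
        have h5 : ‖ℱ φ (η * t)‖ ≤ C / (Y ^ k * u ^ 2) := by rw [le_div_iff₀ pos%]; exact h4
        refine h5.trans ?_; rw [div_le_iff₀ pos%]
        have h6 : 2 * C * (Y ^ k)⁻¹ * (1 + u ^ 2)⁻¹ * (Y ^ k * u ^ 2)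
          = C * (2 * u ^ 2 / (1 + u ^ 2)) := by field_simp
        rw [h6]
        have h7 : 1 ≤ 2 * u ^ 2 / (1 + u ^ 2) := by rw [le_div_iff₀ pos%]; nlinarith
        nlinarith
    _ ≤ ∫ t, 2 * C * (Y ^ k)⁻¹ * (1 + (η * t) ^ 2)⁻¹ := setIntegral_le_integral (hsc.const_mul _)
        (.of_forall fun t => pos%)
    _ = _ := by
      rw [integral_const_mul, Measure.integral_comp_mul_left (fun u : ℝ => (1 + u ^ 2)⁻¹) η,
        integral_univ_inv_one_add_sq, abs_of_pos (inv_pos.2 hη), smul_eq_mul]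
      ring

/-- The sum of the series defining `nbCoeff`, with the singularity at the origin removed. -/
def nbCoeffReg (M : ℝ) (n : ℕ) (t : ℝ) : ℂ :=
  ∑' k : ℕ, (besselWave (n + 2 * k) t - besselWave (n + 2 * k + 2) t) / ((M : ℂ) - 1) ^ k

lemma norm_besselWave_sub_le (k l : ℕ) (t : ℝ) : ‖besselWave k t - besselWave l t‖ ≤ 2 :=
  calc _ ≤ ‖besselWave k t‖ + ‖besselWave l t‖ := norm_sub_le _ _
    _ ≤ 1 + 1 := add_le_add (norm_besselWave_le _ _) (norm_besselWave_le _ _)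
    _ = 2 := num%

lemma norm_nbCoeff_term_le {M : ℝ} (hM : 3 ≤ M) (n k : ℕ) (t : ℝ) :
    ‖(besselWave (n + 2 * k) t - besselWave (n + 2 * k + 2) t) / ((M : ℂ) - 1) ^ k‖
      ≤ 2 * ((M - 1)⁻¹) ^ k := by
  rw [norm_div, norm_pow, show (M : ℂ) - 1 = ((M - 1 : ℝ) : ℂ) by push_cast; ring,
    norm_real, norm_of_nonneg lin%, inv_pow, div_eq_mul_inv]
  have : 0 ≤ ((M - 1) ^ k)⁻¹ := inv_nonneg.2 (pow_nonneg lin% _)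
  gcongr
  exact norm_besselWave_sub_le _ _ _

lemma summable_nbCoeff_bound {M : ℝ} (hM : 3 ≤ M) : Summable fun k : ℕ => 2 * ((M - 1)⁻¹) ^ k :=
  (summable_geometric_of_lt_one (inv_nonneg.2 lin%) (inv_lt_one_of_one_lt₀ lin%)).mul_left _

lemma nbCoeff_eq_reg (M : ℝ) (n : ℕ) {t : ℝ} (ht : t ≠ 0) : nbCoeff M n t = nbCoeffReg M n t := by
  rw [nbCoeff, nbCoeffReg]; congr 1; ext k; rw [chebCoeff_eq _ ht]

lemma continuous_nbCoeffReg {M : ℝ} (hM : 3 ≤ M) (n : ℕ) : Continuous (nbCoeffReg M n) := by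
  refine continuous_tsum (fun k => ?_) (summable_nbCoeff_bound hM)
    (fun k t => norm_nbCoeff_term_le hM n k t)
  have h1 := continuous_besselWave (n + 2 * k)
  have h2 := continuous_besselWave (n + 2 * k + 2)
  fun_prop

/-- Only the first term of the series matters when `M` is large. -/
lemma norm_nbCoeffReg_sub_le {M : ℝ} (hM : 3 ≤ M) (n : ℕ) (t : ℝ) :
    ‖nbCoeffReg M n t - (besselWave n t - besselWave (n + 2) t)‖ ≤ 6 / M := by
  have hs : Summable fun k : ℕ =>
    (besselWave (n + 2 * k) t - besselWave (n + 2 * k + 2) t) / ((M : ℂ) - 1) ^ k :=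
    Summable.of_norm_bounded (summable_nbCoeff_bound hM) fun k => norm_nbCoeff_term_le hM n k t
  rw [nbCoeffReg, hs.tsum_eq_zero_add]
  simp only [mul_zero, add_zero, pow_zero, div_one, add_sub_cancel_left]
  have hg : HasSum (fun k : ℕ => 2 * (M - 1)⁻¹ * ((M - 1)⁻¹) ^ k)
    (2 * (M - 1)⁻¹ * (1 - (M - 1)⁻¹)⁻¹) :=
    (hasSum_geometric_of_lt_one (inv_nonneg.2 lin%) (inv_lt_one_of_one_lt₀ lin%)).mul_left _
  refine (tsum_of_norm_bounded hg fun k => ?_).trans ?_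
  · refine (norm_nbCoeff_term_le hM n (k + 1) t).trans (le_of_eq ?_); rw [pow_succ]; ring
  · have h1 : M - 1 ≠ 0 := lin%
    have h2 : 0 < M - 2 := lin%
    have h3 : 2 * (M - 1)⁻¹ * (1 - (M - 1)⁻¹)⁻¹ = 2 / (M - 2) := by
      have : 1 - (M - 1)⁻¹ = (M - 2) / (M - 1) := by field_simp; ring
      rw [this]; field_simp
    rw [h3, div_le_div_iff₀ h2 lin%]; linarith

/-- The transforms `γ̃_n` are, up to a small error, differences of Chebyshev coefficients. -/
lemma exists_gammaTilde_approx (hφ : IsTestFunction φ) {ρ δ : ℝ} (hδ : 0 < δ) :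
    ∃ C, 0 < C ∧ ∀ (M E : ℝ) (n : ℕ), 3 ≤ M →
      |2 * (gammaTilde M ρ δ n E φ).re
        - (levelTransform φ (M ^ (-ρ)) E n - levelTransform φ (M ^ (-ρ)) E (n + 2))|
        ≤ C * M ^ (ρ - 1) := by
  obtain ⟨k, hk⟩ := exists_nat_ge (1 / δ)
  have hk' : 1 ≤ k * δ := by rwa [div_le_iff₀ hδ] at hk
  obtain ⟨C, hC0, hC⟩ := exists_integral_tail_le hφ k
  set I' := ∫ t, ‖ℱ φ t‖
  have hI0 : 0 ≤ I' := integral_nonneg fun t => norm_nonneg _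
  refine ⟨2 * (6 * I' + 2 * C), pos%, fun M E n hM => ?_⟩
  have hM0 : 0 < M := lin%
  set η := M ^ (-ρ) with hη
  have hη0 : 0 < η := rpow_pos_of_pos hM0 _
  set T := M ^ (ρ + δ) with hT
  have hT0 : 0 < T := rpow_pos_of_pos hM0 _
  have hcf := hφ.continuous_fourierHat
  set w : ℝ → ℂ := fun t => exp (I * E * t) * ℱ φ (η * t) with hw
  have hwc : Continuous w := by fun_prop
  have hwn : ∀ t, ‖w t‖ = ‖ℱ φ (η * t)‖ := fun t => by
    simp only [hw]; rw [norm_mul, norm_wave, one_mul]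
  set b : ℝ → ℂ := fun t => besselWave n t - besselWave (n + 2) t with hb
  have hbc : Continuous b := (continuous_besselWave n).sub (continuous_besselWave (n + 2))
  have hbn : ∀ t, ‖b t‖ ≤ 2 := fun t => norm_besselWave_sub_le _ _ _
  have hnc := continuous_nbCoeffReg hM n
  have i1 : Integrable fun t => w t * b t := by
    refine ((hφ.integrable_fourierHat_mul hη0).norm.mul_const 2).mono'
      (hwc.mul hbc).aestronglyMeasurable (.of_forall fun t => ?_)
    rw [norm_mul, hwn]; gcongr
    exact hbn t
  have hXX : levelTransform φ η E n - levelTransform φ η E (n + 2)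
    = 2 * (∫ t in Ioi (0 : ℝ), w t * b t).re := by
    rw [levelTransform_eq_two_re hφ hη0, levelTransform_eq_two_re hφ hη0, ← mul_sub,
      ← sub_re, ← integral_sub (integrable_fourierHat_besselWave hφ hη0 E n).integrableOn
        (integrable_fourierHat_besselWave hφ hη0 E (n + 2)).integrableOn]
    simp only [hw, hb, mul_sub]
  have hgam : gammaTilde M ρ δ n E φ = ∫ t in Ioc 0 T, w t * nbCoeffReg M n t := by
    rw [gammaTilde, intervalIntegral.integral_of_le hT0.le]
    refine setIntegral_congr_fun measurableSet_Ioc fun t ht => ?_; simp only [hw]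
    rw [nbCoeff_eq_reg _ _ ht.1.ne']
  have hsplit : ∫ t in Ioi (0 : ℝ), w t * b t
    = (∫ t in Ioc 0 T, w t * b t) + ∫ t in Ioi T, w t * b t := by
    rw [← Set.Ioc_union_Ioi_eq_Ioi hT0.le]
    exact setIntegral_union Set.Ioc_disjoint_Ioi_same measurableSet_Ioi i1.integrableOn
      i1.integrableOn
  have i2 : IntegrableOn (fun t => w t * nbCoeffReg M n t) (Ioc 0 T) :=
    ((hwc.mul hnc).integrableOn_Icc (a := 0) (b := T)).mono_set Set.Ioc_subset_Icc_self
  have hd : gammaTilde M ρ δ n E φ - ∫ t in Ioi (0 : ℝ), w t * b t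
    = (∫ t in Ioc 0 T, w t * (nbCoeffReg M n t - b t)) - ∫ t in Ioi T, w t * b t := by
    rw [hgam, hsplit, ← sub_sub, ← integral_sub i2 i1.integrableOn]; simp only [mul_sub]
  have e1 : ‖∫ t in Ioc 0 T, w t * (nbCoeffReg M n t - b t)‖ ≤ 6 / M * (η⁻¹ * I') :=
    (hφ.norm_setIntegral_le hη0 measurableSet_Ioc fun t _ => by
      rw [norm_mul, hwn, mul_comm]; gcongr; exact norm_nbCoeffReg_sub_le hM n t).trans
      (mul_le_mul_of_nonneg_left (hφ.setIntegral_norm_fourierHat_le hη0 _) pos%)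
  have e2 : ‖∫ t in Ioi T, w t * b t‖ ≤ 2 * (C * η⁻¹ * ((M ^ δ) ^ k)⁻¹) := by
    refine (hφ.norm_setIntegral_le hη0 measurableSet_Ioi fun t _ => by
      rw [norm_mul, hwn, mul_comm]; gcongr; exact hbn t).trans ?_
    gcongr
    refine hC η (M ^ δ) hη0 (one_le_rpow lin% hδ.le) _ measurableSet_Ioi fun t ht => ?_
    rw [show M ^ δ = η * T by rw [hη, hT, ← rpow_add hM0]; congr 1; ring]; gcongr
    exact (le_of_lt ht).trans (le_abs_self t)
  have hηi : η⁻¹ = M ^ ρ := by rw [hη, rpow_neg hM0.le, inv_inv]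
  have hMk : ((M ^ δ) ^ k)⁻¹ ≤ M⁻¹ := by
    gcongr
    rw [← Real.rpow_mul_natCast hM0.le]
    calc M = M ^ (1 : ℝ) := (rpow_one M).symm
      _ ≤ _ := rpow_mono lin% lin%
  have hM1 : M ^ (ρ - 1) = η⁻¹ * M⁻¹ := by rw [hηi, rpow_sub hM0, rpow_one]; rfl
  rw [hXX, ← mul_sub, ← sub_re, hd, abs_mul, abs_two]
  calc _ ≤ 2 * ‖(∫ t in Ioc 0 T, w t * (nbCoeffReg M n t - b t)) - ∫ t in Ioi T, w t * b t‖ := by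
        gcongr
        exact abs_re_le_norm _
    _ ≤ 2 * (6 / M * (η⁻¹ * I') + 2 * (C * η⁻¹ * ((M ^ δ) ^ k)⁻¹)) := by
      gcongr
      exact (norm_sub_le _ _).trans (add_le_add e1 e2)
    _ ≤ 2 * (6 / M * (η⁻¹ * I') + 2 * (C * η⁻¹ * M⁻¹)) := mono%
    _ = _ := by rw [hM1]; ring

/-- Chebyshev coefficients of an order beyond the scale `η⁻¹` are negligible. -/
lemma exists_levelTransform_decay (hφ : IsTestFunction φ) (k : ℕ) :
    ∃ C, 0 < C ∧ ∀ (η E : ℝ) (n : ℕ), 0 < η → η ≤ 1 → 8 ≤ n * η →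
      |levelTransform φ η E n| ≤ C * η⁻¹ * ((n * η) ^ k)⁻¹ := by
  obtain ⟨C, hC0, hC⟩ := exists_integral_tail_le hφ k
  set I' := ∫ t, ‖ℱ φ t‖
  have hI0 : 0 ≤ I' := integral_nonneg fun t => norm_nonneg _
  refine ⟨I' * (2 ^ k * k !) + C * 8 ^ k, pos%, fun η E n hη hη1 hn => ?_⟩
  have hcf := hφ.continuous_fourierHat
  have hcb := continuous_besselWave n
  have hint := integrable_fourierHat_besselWave hφ hη E n
  set f : ℝ → ℂ := fun t => exp (I * E * t) * ℱ φ (η * t) * besselWave n t with hf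
  have hn0 : (0 : ℝ) < n := by
    by_contra h
    have : (n : ℝ) * η ≤ 0 := mul_nonpos_of_nonpos_of_nonneg (not_lt.1 h) hη.le
    linarith
  have hfn : ∀ t, ‖f t‖ = ‖ℱ φ (η * t)‖ * ‖besselWave n t‖ := fun t => by
    simp only [hf]; rw [norm_mul, norm_mul, norm_wave, one_mul]
  set s : Set ℝ := {t | (n : ℝ) < 8 * |t|}
  have hsm : MeasurableSet s := measurableSet_lt measurable_const (by fun_prop)
  have h1 : ‖∫ t in s, f t‖ ≤ 1 * (C * η⁻¹ * ((n * η / 8) ^ k)⁻¹) := by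
    refine (hφ.norm_setIntegral_le hη hsm fun t _ => by
      rw [hfn, mul_comm]; gcongr; exact norm_besselWave_le n t).trans ?_
    gcongr
    refine hC η _ hη lin% s hsm fun t ht => ?_
    have : (n : ℝ) < 8 * |t| := ht
    nlinarith
  have h2 : ‖∫ t in sᶜ, f t‖ ≤ (1 / 2) ^ n * (η⁻¹ * I') :=
    (hφ.norm_setIntegral_le hη hsm.compl fun t ht => by
      rw [hfn, mul_comm]; gcongr; exact norm_besselWave_le_pow n (not_lt.1 ht)).trans
      (mul_le_mul_of_nonneg_left (hφ.setIntegral_norm_fourierHat_le hη _) pos%)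
  have h3 : (levelTransform φ η E n : ℂ) = (∫ t in s, f t) + ∫ t in sᶜ, f t := by
    rw [integral_add_compl hsm hint, integral_fourierHat_besselWave hφ hη]
  have h4 : |levelTransform φ η E n| = ‖(levelTransform φ η E n : ℂ)‖ := by simp
  have h5 : ((1 : ℝ) / 2) ^ n ≤ 2 ^ k * k ! * ((n * η) ^ k)⁻¹ := by
    have h2e : Real.exp (1 / 2) ≤ 2 := by
      have := Real.exp_one_lt_d9
      have h9 : Real.exp (1 / 2) ^ 2 = Real.exp 1 := by rw [← Real.exp_nat_mul]; norm_num
      have h0 : 0 < Real.exp (1 / 2) := exp_pos _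
      nlinarith
    have h6 : ((n : ℝ) / 2) ^ k / k ! ≤ 2 ^ n := by
      calc _ ≤ Real.exp (n / 2) := Real.pow_div_factorial_le_exp _ pos% k
        _ = Real.exp (1 / 2) ^ n := by rw [← Real.exp_nat_mul]; congr 1; ring
        _ ≤ 2 ^ n := mono%
    have h7 : (n * η) ^ k ≤ 2 ^ k * k ! * 2 ^ n := by
      calc (n * η) ^ k ≤ (n : ℝ) ^ k := by gcongr; nlinarith
        _ = 2 ^ k * k ! * (((n : ℝ) / 2) ^ k / k !) := by
          have : (k ! : ℝ) ≠ 0 := mod_cast k.factorial_ne_zero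
          rw [div_pow]; field_simp
        _ ≤ _ := mono%
    rw [← div_eq_mul_inv, le_div_iff₀ pos%, div_pow, one_pow, one_div, inv_mul_le_iff₀ pos%]
    linarith
  rw [h4, h3]
  calc _ ≤ 1 * (C * η⁻¹ * ((n * η / 8) ^ k)⁻¹) + (2 ^ k * k ! * ((n * η) ^ k)⁻¹) * (η⁻¹ * I') :=
        (norm_add_le _ _).trans (add_le_add h1 (h2.trans mono%))
    _ = _ := by rw [div_pow, inv_div]; ring

end

section

/-! ### Linearization of the Chebyshev coefficients -/

variable {φ : ℝ → ℝ}

/-- The limiting form of the Chebyshev coefficients: near `θ0 = arccos E` the map `cos` is replaced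
by its linearization. -/
def linearTransform (φ : ℝ → ℝ) (η E : ℝ) (n : ℕ) : ℝ := 2 / ς E * (exp (I * n * arccos E)
    * conj (ℱ φ (n * η / ς E))).re

/-- Interpolation between a Lipschitz bound and a decay bound. -/
lemma le_rpow_interpolation {D K B c η x : ℝ} (hD : 0 ≤ D) (hK : 0 ≤ K) (hB : 0 ≤ B) (hc : 0 < c)
    (hη : 0 < η) (h1 : D ≤ K * x ^ 2 / η) (h2 : D ≤ B / (1 + (c * x / η) ^ 2)) :
    D ≤ ((K / c ^ 2) ^ (1 / 8 : ℝ) * B ^ (7 / 8 : ℝ)) * η ^ (1 / 8 : ℝ)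
      * (1 + (c * x / η) ^ 2) ^ (-(3 / 4) : ℝ) := by
  set v := c * x / η with hv
  have hw : 0 < 1 + v ^ 2 := pos%
  have h3 : K * x ^ 2 / η ≤ (K / c ^ 2) * η * (1 + v ^ 2) := by
    have : K * x ^ 2 / η = (K / c ^ 2) * η * v ^ 2 := by rw [hv]; field_simp
    rw [this]; gcongr
    linarith
  calc D = D ^ (1 / 8 : ℝ) * D ^ (7 / 8 : ℝ) := by
        rw [← Real.rpow_add_of_nonneg hD num% num%]; norm_num
    _ ≤ ((K / c ^ 2) * η * (1 + v ^ 2)) ^ (1 / 8 : ℝ) * (B / (1 + v ^ 2)) ^ (7 / 8 : ℝ) := by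
      gcongr
      exact h1.trans h3
    _ = _ := by
      rw [mul_rpow pos% hw.le, mul_rpow pos% hη.le, Real.div_rpow hB hw.le]
      have : (1 + v ^ 2) ^ (-(3 / 4) : ℝ)
        = (1 + v ^ 2) ^ (1 / 8 : ℝ) / (1 + v ^ 2) ^ (7 / 8 : ℝ) := by
        rw [← rpow_sub hw]; norm_num
      rw [this]; ring

lemma abs_cos_sub_add_le (θ θ0 : ℝ) :
    |cos θ - cos θ0 + sin θ0 * (θ - θ0)| ≤ (θ - θ0) ^ 2 := by
  set x := θ - θ0 with hx
  have h1 : cos θ - cos θ0 + sin θ0 * x = cos θ0 * (cos x - 1) + sin θ0 * (x - sin x) := by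
    have : θ = θ0 + x := by rw [hx]; ring
    rw [this, Real.cos_add]; ring
  have h2 : |cos x - 1| ≤ x ^ 2 / 2 := by
    rw [abs_le]; constructor
    · have := Real.one_sub_sq_div_two_le_cos (x := x); linarith
    · have := Real.cos_le_one x; have := sq_nonneg x; linarith
  have h3 : |x - sin x| ≤ x ^ 2 / 2 := by
    have key : ∀ y : ℝ, 0 ≤ y → |y - sin y| ≤ y ^ 2 / 2 := by
      intro y hy; rw [abs_of_nonneg (by linarith [Real.sin_le hy])]
      rcases hy.eq_or_lt with h0 | h0
      · simp [← h0]
      rcases le_or_gt y 3 with h | h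
      · have := Real.sin_gt_sub_cube h0
        nlinarith [mul_nonneg (sq_nonneg y) (sub_nonneg.2 h)]
      · have := Real.neg_one_le_sin y
        nlinarith
    rcases le_total 0 x with h | h
    · exact key x h
    · have := key (-x) lin%
      rw [Real.sin_neg, ← abs_neg] at this; convert this using 1 <;> ring_nf
  rw [h1]
  calc _ ≤ |cos θ0| * |cos x - 1| + |sin θ0| * |x - sin x| := by
        rw [← abs_mul, ← abs_mul]; exact abs_add_le _ _
    _ ≤ 1 * (x ^ 2 / 2) + 1 * (x ^ 2 / 2) := by
      gcongr
      · exact abs_cos_le_one _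
      · exact Real.abs_sin_le_one _
    _ = x ^ 2 := by ring

/-- On `[0, π]` the function `cos` separates points from an interior point. -/
lemma le_abs_cos_sub {θ θ0 : ℝ} (h0 : 0 ≤ θ) (h1 : θ ≤ π) (h2 : 0 ≤ θ0) (h3 : θ0 ≤ π) :
    sin θ0 / π * |θ - θ0| ≤ |cos θ - cos θ0| := by
  have hs0 : 0 ≤ sin (θ0 / 2) := Real.sin_nonneg_of_nonneg_of_le_pi lin% lin%
  have hc0 : 0 ≤ cos (θ0 / 2) := Real.cos_nonneg_of_mem_Icc ⟨lin%, lin%⟩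
  have hs : 0 ≤ sin (θ / 2) := Real.sin_nonneg_of_nonneg_of_le_pi lin% lin%
  have hc : 0 ≤ cos (θ / 2) := Real.cos_nonneg_of_mem_Icc ⟨lin%, lin%⟩
  have hd : sin θ0 = 2 * sin (θ0 / 2) * cos (θ0 / 2) := by rw [← Real.sin_two_mul]; congr 1; ring
  have h4 : sin θ0 / 2 ≤ sin ((θ + θ0) / 2) := by
    have e : sin ((θ + θ0) / 2) = sin (θ / 2) * cos (θ0 / 2) + cos (θ / 2) * sin (θ0 / 2) := by
      rw [← Real.sin_add]; congr 1; ring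
    rw [e, hd]
    have a1 := Real.sin_sq_add_cos_sq (θ / 2)
    have a2 : 1 ≤ sin (θ / 2) + cos (θ / 2) := by nlinarith
    have a3 := Real.sin_le_one (θ0 / 2)
    have a4 := Real.cos_le_one (θ0 / 2)
    have a5 : sin (θ0 / 2) * cos (θ0 / 2) ≤ sin (θ0 / 2) := by nlinarith
    have a6 : sin (θ0 / 2) * cos (θ0 / 2) ≤ cos (θ0 / 2) := by nlinarith
    have a7 : 0 ≤ sin (θ0 / 2) * cos (θ0 / 2) := mul_nonneg hs0 hc0
    nlinarith
  have h5 : |θ - θ0| / π ≤ |sin ((θ - θ0) / 2)| := by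
    have key : ∀ y : ℝ, 0 ≤ y → y ≤ π → y / π ≤ sin (y / 2) := by
      intro y hy hy'
      have := Real.mul_le_sin (x := y / 2) lin% lin%
      calc _ = 2 / π * (y / 2) := by ring
        _ ≤ _ := this
    rcases le_total θ0 θ with h | h
    · rw [abs_of_nonneg lin%]; exact (key _ lin% lin%).trans (le_abs_self _)
    · rw [abs_of_nonpos lin%]; refine (key _ lin% lin%).trans ?_
      rw [neg_div, Real.sin_neg]; exact neg_le_abs _
  rw [Real.cos_sub_cos, abs_mul, abs_mul, abs_neg, abs_two]
  have h6 : 0 ≤ sin θ0 := Real.sin_nonneg_of_nonneg_of_le_pi h2 h3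
  calc _ = 2 * (sin θ0 / 2) * (|θ - θ0| / π) := by ring
    _ ≤ 2 * |sin ((θ + θ0) / 2)| * |sin ((θ - θ0) / 2)| := by
      gcongr
      exact h4.trans (le_abs_self _)

lemma integral_linearized (φ : ℝ → ℝ) {η s : ℝ} (hη : 0 < η) (hs : 0 < s) (θ0 : ℝ) (n : ℕ) :
    ∫ θ : ℝ, exp (I * n * θ) * ((η⁻¹ * φ (η⁻¹ * (-(s * (θ - θ0)))) : ℝ) : ℂ)
      = 2 * π / s * (exp (I * n * θ0) * conj (ℱ φ (n * η / s))) := by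
  have hpi : (π : ℂ) ≠ 0 := mod_cast pi_ne_zero
  have hsc : (s : ℂ) ≠ 0 := mod_cast hs.ne'
  have hηc : (η : ℂ) ≠ 0 := mod_cast hη.ne'
  rw [← fourierHat_neg, fourierHat, ← integral_add_right_eq_self _ θ0]
  set a : ℝ := -(s / η) with ha
  have ha0 : a ≠ 0 := by rw [ha]; exact neg_ne_zero.2 pos%
  have h := Measure.integral_comp_mul_left
    (fun e : ℝ => exp (I * e * (-(n * η / s) : ℝ)) * (φ e : ℂ)) a
  have haa : |a⁻¹| = η / s := by rw [ha, inv_neg, abs_neg, inv_div, abs_of_pos pos%]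
  rw [haa, real_smul] at h
  have h2 : (∫ e : ℝ, exp (I * e * (-(n * η / s) : ℝ)) * (φ e : ℂ))
    = (s : ℂ) / η * ∫ x : ℝ, exp (I * (a * x : ℝ) * (-(n * η / s) : ℝ)) * (φ (a * x) : ℂ) := by
    rw [h]
    generalize (∫ e : ℝ, exp (I * e * (-(n * η / s) : ℝ)) * (φ e : ℂ)) = y
    push_cast; field_simp
  rw [h2]
  have h3 : ∀ x : ℝ, exp (I * n * ((x + θ0 : ℝ) : ℂ))
    * ((η⁻¹ * φ (η⁻¹ * (-(s * (x + θ0 - θ0)))) : ℝ) : ℂ)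
    = (exp (I * n * θ0) * (η : ℂ)⁻¹)
      * (exp (I * (a * x : ℝ) * (-(n * η / s) : ℝ)) * (φ (a * x) : ℂ)) := by
    intro x
    have e1 : η⁻¹ * (-(s * (x + θ0 - θ0))) = a * x := by rw [ha]; field_simp; ring
    have e2 : I * (a * x : ℝ) * (-(n * η / s) : ℝ) = I * n * x := by rw [ha]; push_cast; field_simp
    rw [e1, e2]; push_cast; rw [mul_add, exp_add]; ring
  simp only [h3]; rw [integral_const_mul]
  generalize (∫ x : ℝ, exp (I * (a * x : ℝ) * (-(n * η / s) : ℝ)) * (φ (a * x) : ℂ)) = y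
  field_simp

/-- Linearizing the cosine at the energy costs a power of `η`, uniformly in the order. -/
lemma exists_levelTransform_sub_le (hφ : IsTestFunction φ) {C : ℝ}
    (hC : ∀ u, |φ u| ≤ C / (1 + u ^ 2)) {σ : ℝ} (hσ : 0 < σ) :
    ∃ C', 0 < C' ∧ ∀ (η E : ℝ) (n : ℕ), 0 < η → η ≤ 1 → -1 ≤ E → E ≤ 1 → σ ≤ ς E →
      |levelTransform φ η E n - linearTransform φ η E n| ≤ C' * η ^ (1 / 8 : ℝ) := by
  obtain ⟨K, hK0, hK⟩ := hφ.exists_lipschitz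
  have hC0 : 0 ≤ C := by have := (abs_nonneg _).trans (hC 0); simpa using this
  set c := σ / π with hc
  have hc0 : 0 < c := pos%
  have hcσ : c ≤ σ := div_le_self hσ.le (by linarith [pi_gt_three])
  set K' := K + C / σ ^ 2 with hK'
  have hK'0 : 0 < K' := pos%
  set A := (K' / c ^ 2) ^ (1 / 8 : ℝ) * (2 * C) ^ (7 / 8 : ℝ)
  have hA0 : 0 ≤ A := pos%
  set J := ∫ x : ℝ, (1 + x ^ 2) ^ (-(3 / 4) : ℝ) with hJ
  have hJi : Integrable (fun x : ℝ => (1 + x ^ 2) ^ (-(3 / 4) : ℝ)) :=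
    integrable_one_add_sq_rpow num%
  have hJ0 : 0 ≤ J := integral_nonneg fun x => pos%
  refine ⟨A * c⁻¹ * J + 1, pos%, fun η E n hη hη1 hE1 hE2 hs => ?_⟩
  set s := ς E with hsd
  have hs0 : 0 < s := hσ.trans_le hs
  set θ0 := arccos E with hθ
  have hcos : cos θ0 = E := Real.cos_arccos hE1 hE2
  have hsin : sin θ0 = s := Real.sin_arccos E
  have hθ0 : 0 ≤ θ0 := Real.arccos_nonneg E
  have hθ1 : θ0 ≤ π := Real.arccos_le_pi E
  set F : ℝ → ℝ := (Ioc 0 π).indicator (fun θ => η⁻¹ * φ (η⁻¹ * (cos θ - E))) with hF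
  set G : ℝ → ℝ := fun θ => η⁻¹ * φ (η⁻¹ * (-(s * (θ - θ0)))) with hG
  have hCmono : ∀ u v : ℝ, v ^ 2 ≤ u ^ 2 → |φ u| ≤ C / (1 + v ^ 2) := fun u v huv =>
    (hC u).trans mono%
  have hlin : ∀ x : ℝ, |φ (η⁻¹ * (-(s * x)))| ≤ C / (1 + (c * x / η) ^ 2) := by
    intro x; apply hCmono
    have : (η⁻¹ * (-(s * x))) ^ 2 = s ^ 2 * (x / η) ^ 2 := by field_simp
    rw [this, mul_div_assoc, mul_pow]; gcongr
    linarith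
  have hmain : ∀ θ, |F θ - G θ| ≤ η⁻¹ * (A * η ^ (1 / 8 : ℝ)
    * (1 + (c * (θ - θ0) / η) ^ 2) ^ (-(3 / 4) : ℝ)) := by
    intro θ
    by_cases hθm : θ ∈ Ioc 0 π
    · simp only [hF, hG, Set.indicator_of_mem hθm]
      rw [← mul_sub, abs_mul, abs_of_pos (inv_pos.2 hη)]
      refine mul_le_mul_of_nonneg_left ?_ (inv_pos.2 hη).le
      refine le_rpow_interpolation (abs_nonneg _) hK'0.le pos% hc0 hη ?_ ?_
      · refine (hK _ _).trans ?_
        rw [← mul_sub, abs_mul, abs_of_pos (inv_pos.2 hη), sub_neg_eq_add, ← hcos, ← hsin]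
        calc K * (η⁻¹ * |cos θ - cos θ0 + sin θ0 * (θ - θ0)|) ≤ K * (η⁻¹ * (θ - θ0) ^ 2) := by
              gcongr
              exact abs_cos_sub_add_le _ _
          _ ≤ K' * (η⁻¹ * (θ - θ0) ^ 2) := by
            gcongr
            rw [hK']
            have : 0 ≤ C / σ ^ 2 := pos%
            linarith
          _ = _ := by ring
      · have h1 : |φ (η⁻¹ * (cos θ - E))| ≤ C / (1 + (c * (θ - θ0) / η) ^ 2) := by
          apply hCmono
          rw [sq_le_sq, abs_div, abs_mul, abs_mul, abs_of_pos hc0, abs_of_pos hη,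
            abs_of_pos (inv_pos.2 hη), div_eq_inv_mul]
          gcongr
          rw [← hcos]; refine le_trans ?_ (le_abs_cos_sub hθm.1.le hθm.2 hθ0 hθ1); rw [hsin, hc]
          gcongr
        calc _ ≤ |φ (η⁻¹ * (cos θ - E))| + |φ (η⁻¹ * (-(s * (θ - θ0))))| := abs_sub _ _
          _ ≤ C / (1 + (c * (θ - θ0) / η) ^ 2) + C / (1 + (c * (θ - θ0) / η) ^ 2) :=
            add_le_add h1 (hlin _)
          _ = _ := by ring
    · simp only [hF, hG, Set.indicator_of_notMem hθm]
      rw [zero_sub, abs_neg, abs_mul, abs_of_pos (inv_pos.2 hη)]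
      refine mul_le_mul_of_nonneg_left ?_ (inv_pos.2 hη).le
      refine le_rpow_interpolation (abs_nonneg _) hK'0.le pos% hc0 hη ?_ ((hlin _).trans ?_)
      · have h1 : |φ (η⁻¹ * (-(s * (θ - θ0))))| ≤ C := by
          simpa using hCmono (η⁻¹ * (-(s * (θ - θ0)))) 0 (by
            rw [zero_pow two_ne_zero]; exact sq_nonneg _)
        have h2 : s ≤ |θ - θ0| := by
          rw [← hsin]; rw [Set.mem_Ioc, not_and_or, not_lt, not_le] at hθm
          rcases hθm with h | h
          · have := Real.sin_le hθ0
            rw [abs_of_nonpos lin%]; linarith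
          · have := Real.sin_le (x := π - θ0) lin%
            rw [Real.sin_pi_sub] at this; rw [abs_of_nonneg lin%]; linarith
        have h3 : σ ^ 2 ≤ (θ - θ0) ^ 2 := by
          rw [← sq_abs (θ - θ0)]; gcongr
          linarith
        refine h1.trans ?_; rw [le_div_iff₀ hη]
        calc C * η ≤ C * 1 := mono%
          _ = C / σ ^ 2 * σ ^ 2 := by field_simp
          _ ≤ K' * (θ - θ0) ^ 2 := by
            gcongr
            rw [hK']; linarith
      · gcongr
        linarith
  have hcont := hφ.continuous
  have iF : Integrable (fun θ => F θ * cos (n * θ)) := by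
    have h1 : IntegrableOn (fun θ => η⁻¹ * φ (η⁻¹ * (cos θ - E)) * cos (n * θ)) (Ioc 0 π) :=
      (Continuous.integrableOn_Icc (by fun_prop)).mono_set Set.Ioc_subset_Icc_self
    rw [← integrable_indicator_iff measurableSet_Ioc] at h1
    refine h1.congr (.of_forall fun θ => ?_); simp only [hF, Set.indicator]
    split_ifs <;> simp
  have hGi : Integrable G := by
    have h1 : Integrable fun θ => φ ((-(s / η)) * θ) :=
      hφ.integrable_self.comp_mul_left' (neg_ne_zero.2 pos%)
    have h2 := (h1.comp_sub_right θ0).const_mul η⁻¹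
    refine h2.congr (.of_forall fun θ => ?_); simp only [hG]; congr 2; field_simp
  have iG : Integrable (fun θ => G θ * cos (n * θ)) := by
    refine hGi.norm.mono' (by fun_prop) (.of_forall fun θ => ?_); rw [norm_mul]
    exact mul_le_of_le_one_right (norm_nonneg _) (abs_cos_le_one _)
  have hX : levelTransform φ η E n = π⁻¹ * ∫ θ, F θ * cos (n * θ) := by
    rw [levelTransform, intervalIntegral.integral_of_le pi_pos.le,
      ← integral_indicator measurableSet_Ioc]
    congr 2; ext θ; simp only [hF, Set.indicator]
    split_ifs <;> simp
  have hY : linearTransform φ η E n = π⁻¹ * ∫ θ, G θ * cos (n * θ) := by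
    have h1 := integral_linearized φ hη hs0 θ0 n
    have h2 : ∫ θ, G θ * cos (n * θ) = (∫ θ : ℝ, exp (I * n * θ) * (G θ : ℂ)).re := by
      have i : Integrable fun θ : ℝ => exp (I * n * θ) * (G θ : ℂ) := by
        refine hGi.norm.mono' (Continuous.aestronglyMeasurable (by fun_prop))
          (.of_forall fun θ => ?_)
        have := norm_wave n θ
        rw [Complex.ofReal_natCast] at this; rw [norm_mul, this, one_mul, norm_real]
      rw [show (∫ θ : ℝ, exp (I * n * θ) * (G θ : ℂ)).re
        = ∫ θ : ℝ, (exp (I * n * θ) * (G θ : ℂ)).re from (integral_re i).symm]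
      congr 1; ext θ
      rw [Complex.re_mul_ofReal, show I * n * θ = ((n * θ : ℝ) : ℂ) * I by
        push_cast; ring, Complex.exp_ofReal_mul_I_re, mul_comm]
    rw [h2, h1, linearTransform, show (2 * π / s : ℂ) = ((2 * π / s : ℝ) : ℂ) by
      push_cast; ring, re_ofReal_mul]
    simp only [← hsd, ← hθ]; field_simp
  rw [hX, hY, ← mul_sub, ← integral_sub iF iG]
  have iB : Integrable (fun θ => η⁻¹ * (A * η ^ (1 / 8 : ℝ)
    * (1 + (c * (θ - θ0) / η) ^ 2) ^ (-(3 / 4) : ℝ))) := by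
    have h1 := (hJi.comp_mul_left' (R := c / η) pos%).comp_sub_right θ0
    refine ((h1.const_mul (A * η ^ (1 / 8 : ℝ))).const_mul η⁻¹).congr (.of_forall fun θ => ?_)
    simp only; congr 4; ring
  have hB : ∫ θ, η⁻¹ * (A * η ^ (1 / 8 : ℝ) * (1 + (c * (θ - θ0) / η) ^ 2) ^ (-(3 / 4) : ℝ))
    = A * c⁻¹ * J * η ^ (1 / 8 : ℝ) := by
    rw [integral_const_mul, integral_const_mul]
    have h1 := integral_sub_right_eq_self (μ := volume)
      (fun x : ℝ => (1 + (c * x / η) ^ 2) ^ (-(3 / 4) : ℝ)) θ0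
    have h2 := Measure.integral_comp_mul_left (fun x : ℝ => (1 + x ^ 2) ^ (-(3 / 4) : ℝ)) (c / η)
    rw [h1]
    have h3 : ∀ x : ℝ, c * x / η = c / η * x := fun x => by ring
    simp only [h3]; rw [h2, abs_of_pos pos%, smul_eq_mul, ← hJ]; field_simp
  have hbound : |∫ θ, (F θ * cos (n * θ) - G θ * cos (n * θ))| ≤ A * c⁻¹ * J * η ^ (1 / 8 : ℝ) := by
    rw [← hB, ← norm_eq_abs]; refine norm_integral_le_of_norm_le iB (.of_forall fun θ => ?_)
    rw [← sub_mul, norm_mul]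
    exact (mul_le_of_le_one_right (norm_nonneg _) (abs_cos_le_one _)).trans (hmain θ)
  rw [abs_mul, abs_of_pos (inv_pos.2 pi_pos)]
  have hpi1 : π⁻¹ ≤ 1 := inv_le_one_of_one_le₀ (by linarith [pi_gt_three])
  have hη8 : 0 ≤ η ^ (1 / 8 : ℝ) := pos%
  calc _ ≤ 1 * (A * c⁻¹ * J * η ^ (1 / 8 : ℝ)) := mono%
    _ ≤ _ := by nlinarith

end

/-! ### Summation over the two legs of the dumbbell -/

/-- The sum over the leg lengths `b1`, `b2` at fixed length `m = b3 + b4` of the bridge. -/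
def dumbbell (B : ℕ) (q : ℝ) (x y : ℕ → ℝ) (m : ℕ) : ℝ :=
  ∑ b1 ∈ range (B + 1), ∑ b2 ∈ range (B + 1),
    if b1 + b2 + m ≤ B then x (2 * b1 + m) * y (2 * b2 + m) * q ^ (b1 + b2) else 0

lemma dumbbell_eq_zero {B : ℕ} (q : ℝ) (x y : ℕ → ℝ) {m : ℕ} (hm : B < m) :
    dumbbell B q x y m = 0 := by
  refine sum_eq_zero fun b1 _ => sum_eq_zero fun b2 _ => if_neg (by omega)

lemma sum_bridge {B : ℕ} (g : ℕ → ℝ) (h1 : g 1 = 0) (hB : ∀ m, B < m → g m = 0) :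
    (∑ b3 ∈ Icc 1 B, ∑ b4 ∈ range (B + 1),
      if (b3, b4) ≠ (2, 0) ∧ (b3, b4) ≠ (1, 1) then g (b3 + b4) else 0)
      = ∑ m ∈ Icc 3 B, m * g m := by
  have hinner : ∀ b3 ∈ Icc 1 B, (∑ b4 ∈ range (B + 1),
    if (b3, b4) ≠ (2, 0) ∧ (b3, b4) ≠ (1, 1) then g (b3 + b4) else 0)
    = ∑ m ∈ Icc 3 B, if b3 ≤ m then g m else 0 := by
    intro b3 hb3; rw [mem_Icc] at hb3
    have e : ∀ b4 : ℕ, (if (b3, b4) ≠ (2, 0) ∧ (b3, b4) ≠ (1, 1) then g (b3 + b4) else 0)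
      = if 3 ≤ b3 + b4 ∧ b3 + b4 ≤ B then g (b3 + b4) else 0 := by
      intro b4; simp only [ne_eq, Prod.mk.injEq]
      by_cases hlt : B < b3 + b4
      · rw [hB _ hlt]; simp
      by_cases hone : b3 + b4 = 1
      · rw [hone, h1]; simp
      congr 1
      rw [eq_iff_iff]; omega
    simp only [e]; rw [← sum_filter, ← sum_filter]
    refine sum_nbij' (fun b4 => b3 + b4) (fun m => m - b3) ?_ ?_ ?_ ?_ ?_ <;>
      simp only [mem_filter, mem_range, mem_Icc]
    · intro a ha; omega
    · intro a ha; rw [Nat.add_sub_cancel' ha.2]; omega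
    · intro a ha; omega
    · intro a ha; omega
    · intro a ha; trivial
  rw [sum_congr rfl hinner, sum_comm]; refine sum_congr rfl fun m hm => ?_; rw [mem_Icc] at hm
  rw [← sum_filter, sum_const, nsmul_eq_mul]
  have : (Icc 1 B).filter (fun b => b ≤ m) = Icc 1 m := by
    ext b; simp only [mem_filter, mem_Icc]; omega
  rw [this]; simp

/-- Organizing the sum by the length of the bridge. -/
lemma mainV_eq_sum (d L : ℕ) [NeZero L] (W ρ μ δ : ℝ) (φ1 φ2 : ℝ → ℝ) (E1 E2 : ℝ) :
    mainV d L W ρ μ δ φ1 φ2 E1 E2 =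
      ∑ m ∈ Icc 3 ⌊(bandM d L W : ℝ) ^ μ / 2⌋₊, m * ((varS d L W ^ m).trace
        * dumbbell ⌊(bandM d L W : ℝ) ^ μ / 2⌋₊ ((bandM d L W : ℝ) / ((bandM d L W : ℝ) - 1))
          (fun n => 2 * (gammaTilde (bandM d L W) ρ δ n E1 φ1).re)
          (fun n => 2 * (gammaTilde (bandM d L W) ρ δ n E2 φ2).re) m) := by
  set M : ℝ := (bandM d L W : ℝ) with hM
  set B : ℕ := ⌊M ^ μ / 2⌋₊ with hB
  set G1 : ℕ → ℝ := fun n => 2 * (gammaTilde M ρ δ n E1 φ1).re with hG1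
  set G2 : ℕ → ℝ := fun n => 2 * (gammaTilde M ρ δ n E2 φ2).re with hG2
  have htr : (varS d L W ^ 1).trace = 0 := by
    rw [pow_one, Matrix.trace]; exact sum_eq_zero fun x _ => varS_diag d L W x
  rw [← sum_bridge (fun m => (varS d L W ^ m).trace * dumbbell B (M / (M - 1)) G1 G2 m)
    (by simp only [htr, zero_mul])
    (fun m hm => by simp only [dumbbell_eq_zero _ _ _ hm, mul_zero])]
  have hle : ∀ n : ℕ, ((n : ℝ) ≤ M ^ μ / 2) ↔ n ≤ B := fun n => by rw [hB, Nat.le_floor_iff pos%]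
  rw [mainV]; simp only [← hM, ← hB, hle]; rw [sum_comm]
  have hcomm : ∀ f : ℕ → ℕ → ℕ → ℕ → ℝ, (∑ b2 ∈ range (B + 1), ∑ b1 ∈ range (B + 1), ∑ b3 ∈ Icc 1 B,
      ∑ b4 ∈ range (B + 1), f b1 b2 b3 b4)
    = ∑ b3 ∈ Icc 1 B, ∑ b4 ∈ range (B + 1), ∑ b1 ∈ range (B + 1),
      ∑ b2 ∈ range (B + 1), f b1 b2 b3 b4 := by
    intro f
    calc _ = ∑ b2 ∈ range (B + 1), ∑ b3 ∈ Icc 1 B, ∑ b4 ∈ range (B + 1),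
          ∑ b1 ∈ range (B + 1), f b1 b2 b3 b4 := by
          refine sum_congr rfl fun b2 _ => ?_; rw [sum_comm]
          exact sum_congr rfl fun b3 _ => sum_comm
      _ = ∑ b3 ∈ Icc 1 B, ∑ b2 ∈ range (B + 1), ∑ b4 ∈ range (B + 1),
        ∑ b1 ∈ range (B + 1), f b1 b2 b3 b4 := sum_comm
      _ = _ := by
        refine sum_congr rfl fun b3 _ => ?_; rw [sum_comm]; exact sum_congr rfl fun b4 _ => sum_comm
  rw [hcomm]; refine sum_congr rfl fun b3 _ => sum_congr rfl fun b4 _ => ?_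
  by_cases h : (b3, b4) ≠ (2, 0) ∧ (b3, b4) ≠ (1, 1)
  · rw [if_pos h, dumbbell, mul_sum]; refine sum_congr rfl fun b1 _ => ?_; rw [mul_sum]
    refine sum_congr rfl fun b2 _ => ?_
    have hcond : ((b3, b4) ≠ (2, 0) ∧ (b3, b4) ≠ (1, 1) ∧ b1 + b2 + b3 + b4 ≤ B)
      ↔ b1 + b2 + (b3 + b4) ≤ B := by
      rw [← and_assoc]; refine ⟨fun h' => by omega, fun h' => ⟨h, by omega⟩⟩
    simp only [hcond]
    split_ifs
    · simp only [hG1, hG2, ← add_assoc]; ring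
    · simp
  · rw [if_neg h]; refine sum_eq_zero fun b1 _ => sum_eq_zero fun b2 _ => if_neg fun h' => h ?_
    exact ⟨h'.1, h'.2.1⟩

/-- If the leg weights are nearly differences of step two of bounded sequences which are small
beyond `B`, the sum over the legs telescopes. -/
lemma abs_dumbbell_sub_le {B : ℕ} {q K ε1 ε2 τ : ℝ} {x y X Y : ℕ → ℝ}
    (hx : ∀ n, |x n - (X n - X (n + 2))| ≤ ε1) (hy : ∀ n, |y n - (Y n - Y (n + 2))| ≤ ε1)
    (hX : ∀ n, |X n| ≤ K) (hY : ∀ n, |Y n| ≤ K)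
    (hXB : ∀ n, B < n → |X n| ≤ ε2) (hYB : ∀ n, B < n → |Y n| ≤ ε2)
    (hq : 1 ≤ q) (hqB : q ^ B ≤ 1 + τ) (hτ : τ ≤ 1) (hK : 1 ≤ K) (hε1 : ε1 ≤ 1)
    (he : (B + 1) * ε1 + ε2 ≤ 1) {m : ℕ} (hm : m ≤ B) :
    |dumbbell B q x y m - X m * Y m|
      ≤ (B + 1) ^ 2 * (6 * K * (2 * ε2 + ε1) + 9 * K ^ 2 * τ) + 3 * K * ((B + 1) * ε1 + ε2) := by
  have hε10 : 0 ≤ ε1 := (abs_nonneg _).trans (hx 0)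
  have hε20 : 0 ≤ ε2 := (abs_nonneg _).trans (hXB (B + 1) (by omega))
  have hτ0 : 0 ≤ τ := by have := one_le_pow₀ hq (n := B); linarith
  have bound : ∀ {x X : ℕ → ℝ}, (∀ n, |x n - (X n - X (n + 2))| ≤ ε1) → (∀ n, |X n| ≤ K) →
    ∀ n, |x n| ≤ 3 * K := by
    intro x X hx hX n
    have h1 := hx n
    have h2 := hX n
    have h3 := hX (n + 2)
    rw [abs_le] at *
    constructor <;> linarith
  have small : ∀ {x X : ℕ → ℝ}, (∀ n, |x n - (X n - X (n + 2))| ≤ ε1) →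
    (∀ n, B < n → |X n| ≤ ε2) → ∀ n, B < n → |x n| ≤ 2 * ε2 + ε1 := by
    intro x X hx hX n hn
    have h1 := hx n
    have h2 := hX n hn
    have h3 := hX (n + 2) (by omega)
    rw [abs_le] at *
    constructor <;> linarith
  set B' := (B - m) / 2
  set u : ℕ → ℝ := fun b => if b ≤ B' then x (2 * b + m) else 0 with hu
  set v : ℕ → ℝ := fun b => if b ≤ B' then y (2 * b + m) else 0 with hv
  have hsq : |dumbbell B q x y m - (∑ b ∈ range (B + 1), u b) * ∑ b ∈ range (B + 1), v b|
    ≤ (B + 1) ^ 2 * (6 * K * (2 * ε2 + ε1) + 9 * K ^ 2 * τ) := by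
    rw [Finset.sum_mul_sum, dumbbell, ← sum_sub_distrib]; simp only [← sum_sub_distrib]
    set Q := 6 * K * (2 * ε2 + ε1) + 9 * K ^ 2 * τ with hQ
    have hterm : ∀ b1 b2 : ℕ, |(if b1 + b2 + m ≤ B then
      x (2 * b1 + m) * y (2 * b2 + m) * q ^ (b1 + b2) else 0) - u b1 * v b2| ≤ Q := by
      intro b1 b2
      have hx3 := bound hx hX (2 * b1 + m)
      have hy3 := bound hy hY (2 * b2 + m)
      have hQ1 : 0 ≤ 6 * K * (2 * ε2 + ε1) := pos%
      have hQ2 : 0 ≤ 9 * K ^ 2 * τ := pos%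
      by_cases ht : b1 + b2 + m ≤ B
      · rw [if_pos ht]
        have hq1 : 1 ≤ q ^ (b1 + b2) := one_le_pow₀ hq
        have hq2 : q ^ (b1 + b2) ≤ 1 + τ := (pow_le_pow_right₀ hq (by omega)).trans hqB
        by_cases h12 : b1 ≤ B' ∧ b2 ≤ B'
        · simp only [hu, hv, if_pos h12.1, if_pos h12.2]
          rw [show ∀ a b c : ℝ, a * b * c - a * b = a * b * (c - 1) by intros; ring, abs_mul,
            abs_mul, abs_of_nonneg (lin% : 0 ≤ q ^ (b1 + b2) - 1)]
          calc _ ≤ 3 * K * (3 * K) * τ := by gcongr; linarith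
            _ ≤ Q := by rw [hQ]; linarith
        · have huv : u b1 * v b2 = 0 := by
            simp only [hu, hv]; rw [not_and_or] at h12
            rcases h12 with h | h <;> simp [h]
          rw [huv, sub_zero, abs_mul, abs_mul, abs_of_nonneg (lin% : 0 ≤ q ^ (b1 + b2))]
          have hprod : |x (2 * b1 + m)| * |y (2 * b2 + m)| ≤ 3 * K * (2 * ε2 + ε1) := by
            rw [not_and_or] at h12
            rcases h12 with h | h
            · have := small hx hXB (2 * b1 + m) (by omega)
              calc _ ≤ (2 * ε2 + ε1) * (3 * K) := mono%
                _ = _ := by ring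
            · have := small hy hYB (2 * b2 + m) (by omega)
              gcongr
          calc _ ≤ 3 * K * (2 * ε2 + ε1) * 2 := by gcongr; linarith
            _ ≤ Q := by rw [hQ]; linarith
      · rw [if_neg ht]
        have huv : u b1 * v b2 = 0 := by
          simp only [hu, hv]
          have : ¬ (b1 ≤ B' ∧ b2 ≤ B') := by omega
          rw [not_and_or] at this
          rcases this with h | h <;> simp [h]
        rw [huv, sub_zero, abs_zero]; rw [hQ]; positivity
    calc _ ≤ ∑ b1 ∈ range (B + 1), ∑ b2 ∈ range (B + 1), Q :=
          (abs_sum_le_sum_abs _ _).trans (sum_le_sum fun b1 _ =>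
            (abs_sum_le_sum_abs _ _).trans (sum_le_sum fun b2 _ => hterm b1 b2))
      _ = _ := by simp only [sum_const, card_range, nsmul_eq_mul]; push_cast; ring
  have tele : ∀ {x X : ℕ → ℝ}, (∀ n, |x n - (X n - X (n + 2))| ≤ ε1) → (∀ n, B < n → |X n| ≤ ε2) →
    |(∑ b ∈ range (B + 1), if b ≤ B' then x (2 * b + m) else 0) - X m| ≤ (B + 1) * ε1 + ε2 := by
    intro x X hx hXB
    have h1 : (∑ b ∈ range (B + 1), if b ≤ B' then x (2 * b + m) else 0)
      = ∑ b ∈ range (B' + 1), x (2 * b + m) := by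
      rw [← sum_filter]; congr 1
      ext b; simp only [mem_filter, mem_range]; omega
    have h2 : ∑ b ∈ range (B' + 1), (X (2 * b + m) - X (2 * b + m + 2))
      = X m - X (2 * (B' + 1) + m) := by
      have := Finset.sum_range_sub' (fun b => X (2 * b + m)) (B' + 1)
      simp only [mul_zero, zero_add] at this; rw [← this]; refine sum_congr rfl fun b _ => ?_
      congr 2; ring
    have h3 : (∑ b ∈ range (B' + 1), x (2 * b + m)) - X m
      = (∑ b ∈ range (B' + 1), (x (2 * b + m) - (X (2 * b + m) - X (2 * b + m + 2))))
        - X (2 * (B' + 1) + m) := by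
      rw [sum_sub_distrib, h2]; ring
    rw [h1, h3]
    have h4 : |∑ b ∈ range (B' + 1), (x (2 * b + m) - (X (2 * b + m) - X (2 * b + m + 2)))|
      ≤ (B + 1) * ε1 := by
      calc _ ≤ ∑ b ∈ range (B' + 1), ε1 :=
            (abs_sum_le_sum_abs _ _).trans (sum_le_sum fun b _ => hx _)
        _ = ((B' + 1 : ℕ) : ℝ) * ε1 := by simp only [sum_const, card_range, nsmul_eq_mul]
        _ ≤ _ := by
          gcongr
          have : B' + 1 ≤ B + 1 := by omega
          exact_mod_cast this
    have h5 := hXB (2 * (B' + 1) + m) (by omega)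
    exact (abs_sub _ _).trans (add_le_add h4 h5)
  have hu' := tele hx hXB
  have hv' := tele hy hYB
  change |(∑ b ∈ range (B + 1), u b) - X m| ≤ _ at hu'
  change |(∑ b ∈ range (B + 1), v b) - Y m| ≤ _ at hv'
  set Su := ∑ b ∈ range (B + 1), u b
  set Sv := ∑ b ∈ range (B + 1), v b
  set e := (B + 1) * ε1 + ε2
  have hprod : |Su * Sv - X m * Y m| ≤ 3 * K * e := by
    have e1 : Su * Sv - X m * Y m = (Su - X m) * Y m + X m * (Sv - Y m)
      + (Su - X m) * (Sv - Y m) := by ring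
    have he0 : 0 ≤ e := (abs_nonneg _).trans hu'
    rw [e1]
    calc _ ≤ |(Su - X m) * Y m| + |X m * (Sv - Y m)| + |(Su - X m) * (Sv - Y m)| :=
          (abs_add_le _ _).trans (add_le_add_left (abs_add_le _ _) _)
      _ ≤ e * K + K * e + e * 1 := by
        rw [abs_mul, abs_mul, abs_mul]
        have := hX m
        have := hY m
        gcongr
        linarith
      _ ≤ 3 * K * e := by nlinarith
  calc _ = |(dumbbell B q x y m - Su * Sv) + (Su * Sv - X m * Y m)| := by congr 1; ring
    _ ≤ _ := (abs_add_le _ _).trans (add_le_add hsq hprod)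

lemma abs_dumbbell_le {B : ℕ} {q ε : ℝ} {x y : ℕ → ℝ} {m : ℕ}
    (hx : ∀ n, m ≤ n → |x n| ≤ ε) (hy : ∀ n, m ≤ n → |y n| ≤ ε)
    (hq : 1 ≤ q) (hqB : q ^ B ≤ 2) :
    |dumbbell B q x y m| ≤ (B + 1) ^ 2 * (2 * ε ^ 2) := by
  have hε : 0 ≤ ε := (abs_nonneg _).trans (hx m le_rfl)
  rw [dumbbell]
  calc _ ≤ ∑ b1 ∈ range (B + 1), ∑ b2 ∈ range (B + 1), 2 * ε ^ 2 := by
          refine (abs_sum_le_sum_abs _ _).trans (sum_le_sum fun b1 _ =>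
            (abs_sum_le_sum_abs _ _).trans (sum_le_sum fun b2 _ => ?_))
          split_ifs with h
          · have h1 := hx (2 * b1 + m) (by omega)
            have h2 := hy (2 * b2 + m) (by omega)
            have h3 : q ^ (b1 + b2) ≤ 2 := (pow_le_pow_right₀ hq (by omega)).trans hqB
            rw [abs_mul, abs_mul, abs_of_nonneg (pos% : 0 ≤ q ^ (b1 + b2))]
            calc _ ≤ ε * ε * 2 := mono%
              _ = _ := by ring
          · rw [abs_zero]; positivity
    _ = _ := by simp only [sum_const, card_range, nsmul_eq_mul]; push_cast; ring

section

variable {φ : ℝ → ℝ}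

lemma sqrt_le_of_mem_bulk {κ E : ℝ} (hκ : 0 < κ) (hE : E ∈ bulk κ) : √κ ≤ ς E := by
  apply Real.sqrt_le_sqrt
  nlinarith [hE.1, hE.2]

lemma exists_linearTransform_bdd (hφ : IsTestFunction φ) {κ : ℝ} (hκ : 0 < κ) :
    ∃ K, 0 < K ∧ ∀ (η E : ℝ) (n : ℕ), E ∈ bulk κ →
      |linearTransform φ η E n| ≤ K := by
  obtain ⟨S, hS0, hS⟩ := hφ.exists_fourierHat_decay 0
  have hσ := sqrt_pos.2 hκ
  refine ⟨2 / √κ * S, pos%, fun η E n hE => ?_⟩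
  have hs := sqrt_le_of_mem_bulk hκ hE
  rw [linearTransform, abs_mul, abs_of_nonneg pos%]; gcongr
  refine (abs_re_le_norm _).trans ?_
  have h1 := norm_wave n (arccos E)
  rw [Complex.ofReal_natCast] at h1; rw [norm_mul, h1, one_mul, RCLike.norm_conj]
  simpa using hS (n * η / ς E)

lemma exists_levelTransform_bdd (hφ : IsTestFunction φ) {C : ℝ}
    (hC : ∀ u, |φ u| ≤ C / (1 + u ^ 2)) {κ : ℝ} (hκ : 0 < κ) :
    ∃ K, 1 ≤ K ∧ ∀ (η E : ℝ) (n : ℕ), 0 < η → η ≤ 1 → E ∈ bulk κ →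
      |levelTransform φ η E n| ≤ K ∧ |linearTransform φ η E n| ≤ K ∧
      |levelTransform φ η E n - linearTransform φ η E n| ≤ K * η ^ (1 / 8 : ℝ) := by
  obtain ⟨K, hK0, hK⟩ := exists_linearTransform_bdd hφ hκ
  obtain ⟨C', hC'0, hC'⟩ := exists_levelTransform_sub_le hφ hC (sqrt_pos.2 hκ)
  refine ⟨K + C' + 1, lin%, fun η E n hη hη1 hE => ?_⟩
  have h1 := hK η E n hE
  have h2 := hC' η E n hη hη1 (by linarith [hE.1]) (by linarith [hE.2]) (sqrt_le_of_mem_bulk hκ hE)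
  have h3 : η ^ (1 / 8 : ℝ) ≤ 1 := Real.rpow_le_one hη.le hη1 num%
  have h4 : 0 ≤ η ^ (1 / 8 : ℝ) := pos%
  refine ⟨?_, lin%, h2.trans (by gcongr; linarith)⟩
  calc _ = |(levelTransform φ η E n - linearTransform φ η E n) + linearTransform φ η E n| := by
        congr 1; ring
    _ ≤ C' * η ^ (1 / 8 : ℝ) + K := (abs_add_le _ _).trans (add_le_add h2 h1)
    _ ≤ C' * 1 + K := mono%
    _ ≤ _ := lin%

lemma eventually_const_mul_rpow_le {C a b : ℝ} (ha : 0 < a) (hb : 0 < b) :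
    ∀ᶠ M : ℝ in atTop, C * M ^ (-a) ≤ b := by
  have h := (tendsto_rpow_neg_atTop ha).const_mul C
  rw [mul_zero] at h; exact h.eventually (eventually_le_nhds hb)

lemma eventually_le_rpow (C : ℝ) {a : ℝ} (ha : 0 < a) : ∀ᶠ M : ℝ in atTop, C ≤ M ^ a :=
  (tendsto_rpow_atTop ha).eventually (ev_ge C)

lemma pow_ratio_le {M μ : ℝ} {B : ℕ} (hM : 2 ≤ M) (hB : (B : ℝ) ≤ M ^ μ / 2)
    (hU : 2 * M ^ (μ - 1) ≤ 1) : (M / (M - 1)) ^ B ≤ 1 + 2 * M ^ (μ - 1) := by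
  have hM0 : 0 < M := lin%
  have hPe : M ^ μ = M ^ (μ - 1) * M := by rw [Real.rpow_sub_one hM0.ne', div_mul_cancel₀ _ hM0.ne']
  have hU0 : 0 < M ^ (μ - 1) := rpow_pos_of_pos hM0 _
  rw [hPe] at hB
  set U := M ^ (μ - 1)
  have e : M / (M - 1) = 1 / (M - 1) + 1 := by
    have : M - 1 ≠ 0 := lin%
    field_simp; ring
  have h1 : M / (M - 1) ≤ Real.exp (1 / (M - 1)) := by rw [e]; exact Real.add_one_le_exp _
  have h2 : (B : ℝ) * (1 / (M - 1)) ≤ U := by rw [mul_one_div, div_le_iff₀ lin%]; nlinarith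
  have h0 : 0 ≤ M / (M - 1) := div_nonneg hM0.le lin%
  calc _ ≤ Real.exp (1 / (M - 1)) ^ B := mono%
    _ = Real.exp (B * (1 / (M - 1))) := by rw [← Real.exp_nat_mul]
    _ ≤ Real.exp U := exp_le_exp.2 h2
    _ ≤ 1 + 2 * U := by
      have := Real.abs_exp_sub_one_le (x := U) (by rw [abs_of_pos hU0]; linarith)
      rw [abs_of_pos hU0] at this; linarith [le_abs_self (Real.exp U - 1)]

set_option maxHeartbeats 1600000 in
/-- The sum over the legs reduces to the product of two linearized Chebyshev coefficients, and it
is much smaller for bridges longer than `η⁻¹`. -/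
lemma exists_dumbbell_sub_le {φ1 φ2 : ℝ → ℝ} (hφ1 : IsTestFunction φ1) (hφ2 : IsTestFunction φ2)
    {C1 C2 : ℝ} (hC1 : ∀ u, |φ1 u| ≤ C1 / (1 + u ^ 2)) (hC2 : ∀ u, |φ2 u| ≤ C2 / (1 + u ^ 2))
    {ρ μ δ κ ε : ℝ} (hρ : 0 < ρ) (hμ : μ < 1 / 3) (hδ : 0 < δ) (hκ : 0 < κ) (hε : 0 < ε)
    (hεμ : ρ + ε < μ) :
    ∃ C, 0 < C ∧ ∀ᶠ M : ℝ in atTop, ∀ E ∈ bulk κ, ∀ m : ℕ, m ≤ ⌊M ^ μ / 2⌋₊ →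
      |dumbbell ⌊M ^ μ / 2⌋₊ (M / (M - 1)) (fun n => 2 * (gammaTilde M ρ δ n E φ1).re)
        (fun n => 2 * (gammaTilde M ρ δ n E φ2).re) m
        - linearTransform φ1 (M ^ (-ρ)) E m * linearTransform φ2 (M ^ (-ρ)) E m|
        ≤ C * M ^ (-(min (1 - 3 * μ) (ρ / 8))) ∧
      (M ^ (ρ + ε) ≤ m →
        |dumbbell ⌊M ^ μ / 2⌋₊ (M / (M - 1)) (fun n => 2 * (gammaTilde M ρ δ n E φ1).re)
          (fun n => 2 * (gammaTilde M ρ δ n E φ2).re) m| ≤ C * M ^ (2 * μ + 2 * ρ - 2)) := by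
  obtain ⟨k, hk⟩ := exists_nat_ge (1 / ε)
  have hk' : 1 ≤ k * ε := by rwa [div_le_iff₀ hε] at hk
  obtain ⟨G1, hG10, hG1⟩ := exists_gammaTilde_approx hφ1 (ρ := ρ) hδ
  obtain ⟨G2, hG20, hG2⟩ := exists_gammaTilde_approx hφ2 (ρ := ρ) hδ
  obtain ⟨T1, hT10, hT1⟩ := exists_levelTransform_decay hφ1 k
  obtain ⟨T2, hT20, hT2⟩ := exists_levelTransform_decay hφ2 k
  obtain ⟨K1, hK10, hK₁⟩ := exists_levelTransform_bdd hφ1 hC1 hκ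
  obtain ⟨K2, hK20, hK2⟩ := exists_levelTransform_bdd hφ2 hC2 hκ
  set A := G1 + G2 with hA
  set T := T1 + T2 with hT
  set K := K1 + K2 with hK
  have hA0 : 0 < A := pos%
  have hT0 : 0 < T := pos%
  have hK1 : 1 ≤ K := lin%
  clear_value A T K
  refine ⟨(6 * K * (2 * T + A) + 18 * K ^ 2 + 3 * K * (A + T)) + 2 * K ^ 2 + 2 * (2 * T + A) ^ 2,
    pos%, ?_⟩
  filter_upwards [ev_ge (8 : ℝ), eventually_le_rpow 8 hε,
    eventually_le_rpow 2 (sub_pos.2 hεμ), eventually_le_rpow 2 (show 0 < μ from lin%),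
    eventually_const_mul_rpow_le (C := A + T) (a := 1 - 2 * μ) (b := 1) lin% one_pos,
    eventually_const_mul_rpow_le (C := 2) (a := 1 - μ) (b := 1) lin% one_pos]
    with M hM8 hMε hMμ hMμ2 hMe hMτ E hE m hm
  have hM0 : 0 < M := lin%
  have hM1 : 1 ≤ M := lin%
  set B := ⌊M ^ μ / 2⌋₊
  set η := M ^ (-ρ) with hη
  have hη0 : 0 < η := rpow_pos_of_pos hM0 _
  have hη1 : η ≤ 1 := Real.rpow_le_one_of_one_le_of_nonpos hM1 lin%
  have hηi : η⁻¹ = M ^ ρ := by rw [hη, rpow_neg hM0.le, inv_inv]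
  have hlarge : ∀ n : ℕ, M ^ (ρ + ε) ≤ n → M ^ ε ≤ n * η := by
    intro n hn
    calc M ^ ε = M ^ (ρ + ε) * η := by rw [hη, ← rpow_add hM0]; congr 1; ring
      _ ≤ n * η := mono%
  have hBlarge : ∀ n : ℕ, B < n → M ^ (ρ + ε) ≤ n := by
    intro n hn
    have h1 : M ^ μ / 2 < n := Nat.lt_of_floor_lt hn
    have h2 : M ^ μ = M ^ (ρ + ε) * M ^ (μ - (ρ + ε)) := by rw [← rpow_add hM0]; congr 1; ring
    have h3 : M ^ (ρ + ε) * 2 ≤ M ^ (ρ + ε) * M ^ (μ - (ρ + ε)) := mono%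
    linarith
  have hdecay : ∀ {φ : ℝ → ℝ} {T' : ℝ}, (∀ (η E : ℝ) (n : ℕ), 0 < η → η ≤ 1 → 8 ≤ n * η →
    |levelTransform φ η E n| ≤ T' * η⁻¹ * ((n * η) ^ k)⁻¹) → 0 < T' → T' ≤ T →
    ∀ n : ℕ, M ^ (ρ + ε) ≤ n → |levelTransform φ η E n| ≤ T * M ^ (ρ - 1) := by
    intro φ T' h hT'0 hT' n hn
    have h1 := hlarge n hn
    have h2 : ((n * η) ^ k)⁻¹ ≤ M⁻¹ := by
      gcongr
      calc M = M ^ (1 : ℝ) := (rpow_one M).symm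
        _ ≤ M ^ (ε * k) := rpow_mono hM1 lin%
        _ = (M ^ ε) ^ k := Real.rpow_mul_natCast hM0.le _ _
        _ ≤ (n * η) ^ k := mono%
    calc _ ≤ T' * η⁻¹ * ((n * η) ^ k)⁻¹ := h η E n hη0 hη1 (hMε.trans h1)
      _ ≤ T * η⁻¹ * M⁻¹ := mono%
      _ = _ := by rw [hηi, rpow_sub hM0, rpow_one]; ring
  have hd1 := hdecay hT1 hT10 lin%
  have hd2 := hdecay hT2 hT20 lin%
  have hR0 : 0 < M ^ (ρ - 1) := rpow_pos_of_pos hM0 _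
  have hx : ∀ n : ℕ, |2 * (gammaTilde M ρ δ n E φ1).re
    - (levelTransform φ1 η E n - levelTransform φ1 η E (n + 2))| ≤ A * M ^ (ρ - 1) := fun n =>
    (hG1 M E n lin%).trans (by gcongr; linarith)
  have hy : ∀ n : ℕ, |2 * (gammaTilde M ρ δ n E φ2).re
    - (levelTransform φ2 η E n - levelTransform φ2 η E (n + 2))| ≤ A * M ^ (ρ - 1) := fun n =>
    (hG2 M E n lin%).trans (by gcongr; linarith)
  set P := M ^ μ with hP
  set U := M ^ (μ - 1) with hU
  have hU0 : 0 < U := rpow_pos_of_pos hM0 _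
  have hRU : M ^ (ρ - 1) ≤ U := rpow_mono hM1 lin%
  have hBle : (B : ℝ) ≤ P / 2 := Nat.floor_le pos%
  have hB1 : (B : ℝ) + 1 ≤ P := lin%
  have hPU : P * U = M ^ (-(1 - 2 * μ)) := by rw [hP, hU, ← rpow_add hM0]; congr 1; ring
  have hq1 : 1 ≤ M / (M - 1) := by rw [le_div_iff₀ lin%]; linarith
  have hτ1 : 2 * U ≤ 1 := by refine le_trans (le_of_eq ?_) hMτ; rw [hU]; congr 2; ring
  have hqB : (M / (M - 1)) ^ B ≤ 1 + 2 * U := pow_ratio_le lin% hBle hτ1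
  have hAT : A * U ≤ 1 ∧ (B + 1) * (A * U) + T * U ≤ 1 := by
    have h1 : U ≤ P * U := le_mul_of_one_le_left hU0.le lin%
    have h2 : (A + T) * (P * U) ≤ 1 := by rw [hPU]; exact hMe
    have h3 : (B + 1) * (A * U) ≤ P * (A * U) := mono%
    have h4 : T * U ≤ T * (P * U) := mono%
    have h5 : A * U ≤ A * (P * U) := mono%
    have h6 : 0 < T * (P * U) := pos%
    constructor <;> linarith
  have hV : P ^ 2 * U = M ^ (-(1 - 3 * μ)) := by
    rw [hP, hU, ← rpow_natCast, ← rpow_mul hM0.le, ← rpow_add hM0]; congr 1; push_cast; ring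
  clear_value P U
  constructor
  · have hnear := abs_dumbbell_sub_le (K := K) (ε1 := A * U) (ε2 := T * U) (τ := 2 * U)
      (fun n => (hx n).trans mono%) (fun n => (hy n).trans mono%)
      (fun n => (hK₁ η E n hη0 hη1 hE).1.trans lin%)
      (fun n => (hK2 η E n hη0 hη1 hE).1.trans lin%)
      (fun n hn => (hd1 n (hBlarge n hn)).trans mono%)
      (fun n hn => (hd2 n (hBlarge n hn)).trans mono%)
      hq1 hqB hτ1 hK1 hAT.1 hAT.2 hm
    set D := dumbbell B (M / (M - 1)) (fun n => 2 * (gammaTilde M ρ δ n E φ1).re)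
      (fun n => 2 * (gammaTilde M ρ δ n E φ2).re) m
    obtain ⟨a1, a2, a3⟩ := hK₁ η E m hη0 hη1 hE
    obtain ⟨b1, b2, b3⟩ := hK2 η E m hη0 hη1 hE
    set X1 := levelTransform φ1 η E m
    set X2 := levelTransform φ2 η E m
    set Y1 := linearTransform φ1 η E m
    set Y2 := linearTransform φ2 η E m
    clear_value D X1 X2 Y1 Y2
    have hη8 : η ^ (1 / 8 : ℝ) = M ^ (-(ρ / 8)) := by rw [hη, ← rpow_mul hM0.le]; congr 1; ring
    set c := min (1 - 3 * μ) (ρ / 8)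
    have hc1 : P ^ 2 * U ≤ M ^ (-c) := by
      rw [hV]; exact rpow_mono hM1 (neg_le_neg (min_le_left _ _))
    have hc2 : η ^ (1 / 8 : ℝ) ≤ M ^ (-c) := by
      rw [hη8]; exact rpow_mono hM1 (neg_le_neg (min_le_right _ _))
    have hc0 : 0 < M ^ (-c) := rpow_pos_of_pos hM0 _
    clear_value c
    have hXY : |X1 * X2 - Y1 * Y2| ≤ 2 * K ^ 2 * M ^ (-c) := by
      have e : X1 * X2 - Y1 * Y2 = (X1 - Y1) * X2 + Y1 * (X2 - Y2) := by ring
      rw [e]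
      calc _ ≤ |(X1 - Y1) * X2| + |Y1 * (X2 - Y2)| := abs_add_le _ _
        _ ≤ (K * M ^ (-c)) * K + K * (K * M ^ (-c)) := by
          rw [abs_mul, abs_mul]
          have k1 : K1 ≤ K := lin%
          have k2 : K2 ≤ K := lin%
          gcongr
          · exact a3.trans mono%
          · exact b1.trans k2
          · exact a2.trans k1
          · exact b3.trans mono%
        _ = _ := by ring
    have hnear2 : |D - X1 * X2| ≤ (6 * K * (2 * T + A) + 18 * K ^ 2 + 3 * K * (A + T)) * M ^ (-c) := by
      refine hnear.trans ?_
      have hB2 : ((B : ℝ) + 1) ^ 2 ≤ P ^ 2 := mono%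
      have hP1 : 1 ≤ P := lin%
      have hUP : U ≤ P ^ 2 * U := le_mul_of_one_le_left hU0.le (one_le_pow₀ hP1)
      have hPUP : P * U ≤ P ^ 2 * U :=
        mul_le_mul_of_nonneg_right (le_self_pow₀ hP1 two_ne_zero) hU0.le
      calc _ ≤ P ^ 2 * (6 * K * (2 * (T * U) + A * U) + 9 * K ^ 2 * (2 * U))
            + 3 * K * (P * (A * U) + T * U) := mono%
        _ = (6 * K * (2 * T + A) + 18 * K ^ 2) * (P ^ 2 * U)
          + 3 * K * (A * (P * U) + T * U) := by ring
        _ ≤ (6 * K * (2 * T + A) + 18 * K ^ 2) * (P ^ 2 * U)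
          + 3 * K * (A * (P ^ 2 * U) + T * (P ^ 2 * U)) := mono%
        _ = (6 * K * (2 * T + A) + 18 * K ^ 2 + 3 * K * (A + T)) * (P ^ 2 * U) := by ring
        _ ≤ _ := mono%
    calc |D - Y1 * Y2| = |(D - X1 * X2) + (X1 * X2 - Y1 * Y2)| := by congr 1; ring
      _ ≤ _ := abs_add_le _ _
      _ ≤ _ := add_le_add hnear2 hXY
      _ = ((6 * K * (2 * T + A) + 18 * K ^ 2 + 3 * K * (A + T)) + 2 * K ^ 2) * M ^ (-c) := by ring
      _ ≤ _ := by
        refine mul_le_mul_of_nonneg_right ?_ hc0.le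
        have : 0 ≤ 2 * (2 * T + A) ^ 2 := pos%
        linarith
  · intro hmlarge
    have hsmall : ∀ {x X : ℕ → ℝ}, (∀ n, |x n - (X n - X (n + 2))| ≤ A * M ^ (ρ - 1)) →
      (∀ n : ℕ, M ^ (ρ + ε) ≤ n → |X n| ≤ T * M ^ (ρ - 1)) → ∀ n, m ≤ n →
      |x n| ≤ (2 * T + A) * M ^ (ρ - 1) := by
      intro x X h1 h2 n hn
      have hn1 : M ^ (ρ + ε) ≤ n := hmlarge.trans (mod_cast hn)
      have e1 := h1 n
      have e2 := h2 n hn1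
      have e3 := h2 (n + 2) (hn1.trans (by push_cast; linarith))
      rw [abs_le] at *
      constructor <;> linarith
    refine (abs_dumbbell_le (hsmall hx hd1) (hsmall hy hd2) hq1 lin%).trans ?_
    calc _ ≤ P ^ 2 * (2 * ((2 * T + A) * M ^ (ρ - 1)) ^ 2) := mono%
      _ = 2 * (2 * T + A) ^ 2 * (P ^ 2 * (M ^ (ρ - 1)) ^ 2) := by ring
      _ = 2 * (2 * T + A) ^ 2 * M ^ (2 * μ + 2 * ρ - 2) := by
        congr 1
        rw [hP, ← rpow_natCast, ← rpow_natCast, ← rpow_mul hM0.le,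
          ← rpow_mul hM0.le, ← rpow_add hM0]
        congr 1; push_cast; ring
      _ ≤ _ := by
        refine mul_le_mul_of_nonneg_right ?_ (Real.rpow_nonneg hM0.le _)
        have : 0 ≤ (6 * K * (2 * T + A) + 18 * K ^ 2 + 3 * K * (A + T)) + 2 * K ^ 2 := pos%
        linarith

end

section

/-! ### Lattice points in balls -/

/-- The lattice points of Euclidean norm at most `r`. -/
def latticeBall (d : ℕ) (r : ℝ) : Finset (Fin d → ℤ) :=
  (Fintype.piFinset fun _ => Icc (-⌊r⌋) ⌊r⌋).filter fun n => ∑ i, (n i : ℝ) ^ 2 ≤ r ^ 2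

/-- The closed Euclidean ball, as a subset of `Fin d → ℝ`. -/
def euclBall (d : ℕ) (r : ℝ) : Set (Fin d → ℝ) := {x | ∑ i, x i ^ 2 ≤ r ^ 2}

variable {d : ℕ}

lemma mem_latticeBall {r : ℝ} (hr : 0 ≤ r) {n : Fin d → ℤ} :
    n ∈ latticeBall d r ↔ ∑ i, (n i : ℝ) ^ 2 ≤ r ^ 2 := by
  rw [latticeBall, mem_filter, and_iff_right_iff_imp, Fintype.mem_piFinset]; intro h i
  have h1 : (n i : ℝ) ^ 2 ≤ r ^ 2 :=
    (single_le_sum (f := fun i => (n i : ℝ) ^ 2) (fun _ _ => sq_nonneg _) (mem_univ i)).trans h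
  have h2 := abs_le_of_sq_le_sq' h1 hr
  rw [mem_Icc]; constructor
  · have : -n i ≤ ⌊r⌋ := Int.le_floor.2 (by push_cast; linarith)
    linarith
  · exact Int.le_floor.2 h2.2

lemma sqrt_sum_sq_eq_norm (x : Fin d → ℝ) : √(∑ i, x i ^ 2) = ‖WithLp.toLp 2 x‖ := by
  rw [EuclideanSpace.norm_eq]; simp

lemma sqrt_sum_sq_add_le (x y : Fin d → ℝ) :
    √(∑ i, (x i + y i) ^ 2) ≤ √(∑ i, x i ^ 2) + √(∑ i, y i ^ 2) := by
  have := norm_add_le (WithLp.toLp 2 x) (WithLp.toLp 2 y)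
  rw [← WithLp.toLp_add, ← sqrt_sum_sq_eq_norm, ← sqrt_sum_sq_eq_norm, ← sqrt_sum_sq_eq_norm] at this
  exact this

lemma sqrt_sum_sq_le_sqrt (x : Fin d → ℝ) (hx : ∀ i, |x i| ≤ 1) : √(∑ i, x i ^ 2) ≤ √d := by
  apply Real.sqrt_le_sqrt
  calc ∑ i, x i ^ 2 ≤ ∑ _i : Fin d, (1 : ℝ) := by
        refine sum_le_sum fun i _ => ?_; rw [← sq_abs]; exact pow_le_one₀ (abs_nonneg _) (hx i)
    _ = d := by simp

open scoped Pointwise in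
lemma volume_euclBall {r : ℝ} (hr : 0 < r) :
    volume (euclBall d r) = ENNReal.ofReal (r ^ d) * volume (euclBall d 1) := by
  have h : euclBall d r = r • euclBall d 1 := by
    ext x; rw [Set.mem_smul_set_iff_inv_smul_mem₀ hr.ne']
    change ∑ i, x i ^ 2 ≤ r ^ 2 ↔ ∑ i, (r⁻¹ * x i) ^ 2 ≤ 1 ^ 2
    simp only [mul_pow, one_pow, ← mul_sum]; rw [inv_pow, inv_mul_le_iff₀ pos%, mul_one]
  rw [h, Measure.addHaar_smul]; simp [abs_of_pos hr]

lemma volume_euclBall_one_lt_top : volume (euclBall d 1) < ⊤ := by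
  refine (measure_mono (t := Set.Icc (fun _ => (-1 : ℝ)) (fun _ => 1)) ?_).trans_lt
    isCompact_Icc.measure_lt_top
  intro x hx
  have h : ∀ i, -1 ≤ x i ∧ x i ≤ 1 := fun i => by
    have h1 : x i ^ 2 ≤ 1 ^ 2 := (single_le_sum (f := fun i => x i ^ 2) (fun _ _ => sq_nonneg _)
        (mem_univ i)).trans hx
    exact abs_le_of_sq_le_sq' h1 zero_le_one
  exact ⟨fun i => (h i).1, fun i => (h i).2⟩

lemma volume_euclBall_one_pos : 0 < volume (euclBall d 1) := by
  have hc : Continuous fun x : Fin d → ℝ => ∑ i, x i ^ 2 := by fun_prop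
  have hopen : IsOpen {x : Fin d → ℝ | ∑ i, x i ^ 2 < 1} := isOpen_lt hc continuous_const
  refine (hopen.measure_pos volume ⟨0, by simp⟩).trans_le (measure_mono fun x hx => ?_)
  change ∑ i, x i ^ 2 < 1 at hx; change ∑ i, x i ^ 2 ≤ 1 ^ 2; linarith

/-- The unit cube with lower corner `n`. -/
def unitCube (n : Fin d → ℤ) : Set (Fin d → ℝ) := Set.univ.pi fun i => Set.Ico (n i : ℝ) (n i + 1)

lemma mem_unitCube_iff {n : Fin d → ℤ} {x : Fin d → ℝ} : x ∈ unitCube n ↔ (fun i => ⌊x i⌋) = n := by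
  simp only [unitCube, Set.mem_pi, Set.mem_univ, true_imp_iff, Set.mem_Ico, funext_iff,
    Int.floor_eq_iff]

lemma volume_iUnion_unitCube (s : Finset (Fin d → ℤ)) : volume (⋃ n ∈ s, unitCube n) = s.card := by
  rw [measure_biUnion_finset]
  · have : ∀ n : Fin d → ℤ, volume (unitCube n) = 1 := fun n => by
      rw [unitCube, Real.volume_pi_Ico]; simp
    simp [this]
  · intro n _ m _ hnm; rw [Function.onFun, Set.disjoint_left]; intro x hx hx'
    rw [mem_unitCube_iff] at hx hx'; exact hnm (hx.symm.trans hx')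
  · intro n _; exact MeasurableSet.univ_pi fun i => measurableSet_Ico

lemma card_latticeBall_le {r : ℝ} (hr : 0 ≤ r) (hd : 0 < d) :
    ((latticeBall d r).card : ℝ) ≤ (volume (euclBall d 1)).toReal * (r + √d) ^ d := by
  have hpos : 0 < r + √d := by
    have : 0 < √(d : ℝ) := sqrt_pos.2 (mod_cast hd)
    linarith
  have h : volume (⋃ n ∈ latticeBall d r, unitCube n) ≤ volume (euclBall d (r + √d)) := by
    refine measure_mono fun x hx => ?_; simp only [Set.mem_iUnion, exists_prop] at hx
    obtain ⟨n, hn, hx⟩ := hx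
    rw [mem_latticeBall hr] at hn; rw [mem_unitCube_iff] at hx
    have h1 := sqrt_sum_sq_add_le (fun i => (n i : ℝ)) (fun i => x i - n i)
    have h2 : √(∑ i, (n i : ℝ) ^ 2) ≤ r := sqrt_le_iff.2 ⟨hr, hn⟩
    have h3 := sqrt_sum_sq_le_sqrt (fun i => x i - n i) (fun i => by
      have : n i = ⌊x i⌋ := (congrFun hx i).symm
      rw [this, abs_le]
      have a1 := Int.floor_le (x i)
      have a2 := Int.lt_floor_add_one (x i)
      constructor <;> linarith)
    simp only [add_sub_cancel] at h1; exact (sqrt_le_iff.1 (h1.trans (add_le_add h2 h3))).2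
  rw [volume_iUnion_unitCube, volume_euclBall hpos] at h
  have h2 := ENNReal.toReal_mono (ENNReal.mul_ne_top ENNReal.ofReal_ne_top
    volume_euclBall_one_lt_top.ne) h
  rw [ENNReal.toReal_natCast, ENNReal.toReal_mul, ENNReal.toReal_ofReal pos%] at h2; linarith

lemma le_card_latticeBall {r : ℝ} (hr : √d < r) :
    (volume (euclBall d 1)).toReal * (r - √d) ^ d ≤ (latticeBall d r).card := by
  have hr0 : 0 ≤ r := (sqrt_nonneg _).trans hr.le
  have h : volume (euclBall d (r - √d)) ≤ volume (⋃ n ∈ latticeBall d r, unitCube n) := by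
    refine measure_mono fun x hx => ?_; simp only [Set.mem_iUnion, exists_prop]
    refine ⟨fun i => ⌊x i⌋, ?_, mem_unitCube_iff.2 rfl⟩; rw [mem_latticeBall hr0]
    have h1 := sqrt_sum_sq_add_le x (fun i => (⌊x i⌋ : ℝ) - x i)
    have h2 : √(∑ i, x i ^ 2) ≤ r - √d := sqrt_le_iff.2 ⟨lin%, hx⟩
    have h3 := sqrt_sum_sq_le_sqrt (fun i => (⌊x i⌋ : ℝ) - x i) (fun i => by
      rw [abs_le]
      have a1 := Int.floor_le (x i)
      have a2 := Int.lt_floor_add_one (x i)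
      constructor <;> linarith)
    simp only [add_sub_cancel] at h1; exact (sqrt_le_iff.1 (h1.trans (lin% : _ ≤ r))).2
  rw [volume_iUnion_unitCube, volume_euclBall lin%] at h
  have h2 := ENNReal.toReal_mono (ENNReal.natCast_ne_top _) h
  rw [ENNReal.toReal_natCast, ENNReal.toReal_mul, ENNReal.toReal_ofReal (pow_nonneg lin% _)] at h2
  linarith

/-- Lattice points in a ball, with the trivial error term. -/
lemma exists_card_latticeBall_sub_le (hd : 0 < d) : ∃ C, 0 < C ∧ ∀ r : ℝ, 0 ≤ r →
      |((latticeBall d r).card : ℝ) - (volume (euclBall d 1)).toReal * r ^ d|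
        ≤ C * (1 + r) ^ (d - 1) := by
  set v := (volume (euclBall d 1)).toReal
  have hv0 : 0 ≤ v := ENNReal.toReal_nonneg
  have hd1 : (1 : ℝ) ≤ d := mod_cast hd
  have hs1 : 1 ≤ √(d : ℝ) := one_le_sqrt.2 hd1
  refine ⟨v * (√d * d * √d ^ (d - 1)) + 1, pos%, fun r hr => ?_⟩
  have hp : 0 < (1 + r) ^ (d - 1) := pos%
  have hpow : ∀ a : ℝ, 0 ≤ a → a ≤ r + √d → |a - r| ≤ √d →
    |v * a ^ d - v * r ^ d| ≤ v * (√d * d * √d ^ (d - 1)) * (1 + r) ^ (d - 1) := by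
    intro a ha har had; rw [← mul_sub, abs_mul, abs_of_nonneg hv0, mul_assoc]
    refine mul_le_mul_of_nonneg_left ?_ hv0; refine (abs_pow_sub_pow_le a r d).trans ?_
    rw [abs_of_nonneg ha, abs_of_nonneg hr, mul_assoc _ _ ((1 + r) ^ (d - 1)), ← mul_pow]
    have hmax : max a r ≤ √d * (1 + r) := by apply max_le <;> nlinarith
    gcongr
  have h1 := card_latticeBall_le hr hd
  have h2 := hpow (r + √d) pos% le_rfl (by rw [add_sub_cancel_left, abs_of_nonneg pos%])
  rw [abs_le] at h2 ⊢; constructor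
  · rcases lt_or_ge (√(d : ℝ)) r with h | h
    · have h3 := le_card_latticeBall h
      have h4 := hpow (r - √d) lin% lin% (by rw [sub_sub_cancel_left, abs_neg, abs_of_nonneg pos%])
      rw [abs_le] at h4; nlinarith
    · have h3 : (0 : ℝ) ≤ (latticeBall d r).card := cast_nonneg _
      have h4 := hpow 0 le_rfl pos% (by rw [zero_sub, abs_neg, abs_of_nonneg hr]; exact h)
      rw [zero_pow hd.ne', mul_zero, abs_le] at h4; nlinarith
  · nlinarith

/-- Layer cake formula for the second moment of the lattice points in a ball. -/
lemma integral_card_latticeBall {R : ℝ} (hR : 0 ≤ R) :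
    ∫ r in (0 : ℝ)..R, 2 * r * ((latticeBall d r).card : ℝ)
      = ∑ n ∈ latticeBall d R, (R ^ 2 - ∑ i, (n i : ℝ) ^ 2) := by
  have hone : ∀ n ∈ latticeBall d R,
    IntervalIntegrable (fun r : ℝ => if √(∑ i, (n i : ℝ) ^ 2) ≤ r then 2 * r else 0) volume 0 R ∧
    ∫ r in (0 : ℝ)..R, (if √(∑ i, (n i : ℝ) ^ 2) ≤ r then 2 * r else 0)
      = R ^ 2 - ∑ i, (n i : ℝ) ^ 2 := by
    intro n hn; rw [mem_latticeBall hR] at hn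
    set a := √(∑ i, (n i : ℝ) ^ 2)
    have ha0 : 0 ≤ a := sqrt_nonneg _
    have haR : a ≤ R := sqrt_le_iff.2 ⟨hR, hn⟩
    have ha2 : a ^ 2 = ∑ i, (n i : ℝ) ^ 2 := sq_sqrt (sum_nonneg fun _ _ => sq_nonneg _)
    have e1 : ∀ᵐ r : ℝ, r ∈ Set.uIoc 0 a → (if a ≤ r then 2 * r else 0) = 0 := by
      have : ∀ᵐ r : ℝ, r ≠ a := by simp [ae_iff]
      filter_upwards [this] with r hr hm
      rw [Set.uIoc_of_le ha0] at hm; rw [if_neg (not_le.2 (lt_of_le_of_ne hm.2 hr))]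
    have e2 : ∀ r ∈ Set.uIcc a R, (if a ≤ r then 2 * r else 0) = 2 * r := fun r hr => by
      rw [uIcc_of_le haR] at hr; rw [if_pos hr.1]
    have i1 : IntervalIntegrable (fun r : ℝ => if a ≤ r then 2 * r else 0) volume 0 a :=
      (intervalIntegrable_const (c := (0 : ℝ))).congr_ae (by
        rw [Filter.EventuallyEq, ae_restrict_iff' measurableSet_uIoc]
        filter_upwards [e1] with r hr hm
        exact (hr hm).symm)
    have i2 : IntervalIntegrable (fun r : ℝ => if a ≤ r then 2 * r else 0) volume a R :=
      (Continuous.intervalIntegrable (u := fun r : ℝ => 2 * r) (by fun_prop) a R).congr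
        (fun r hr => (e2 r (Set.uIoc_subset_uIcc hr)).symm)
    refine ⟨i1.trans i2, ?_⟩
    have e3 : ∫ r in a..R, (if a ≤ r then 2 * r else 0) = ∫ r in a..R, 2 * r :=
      intervalIntegral.integral_congr e2
    have e4 : ∫ r in a..R, 2 * r = R ^ 2 - a ^ 2 := by
      rw [intervalIntegral.integral_const_mul (2 : ℝ) (fun r => r), integral_id]; ring
    rw [← intervalIntegral.integral_add_adjacent_intervals i1 i2,
      intervalIntegral.integral_congr_ae e1, e3, e4, ← ha2]
    simp
  rw [← sum_congr rfl fun n hn => (hone n hn).2,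
    ← intervalIntegral.integral_finsetSum fun n hn => (hone n hn).1]
  refine intervalIntegral.integral_congr fun r hr => ?_; rw [uIcc_of_le hR] at hr
  rw [← sum_filter, sum_const, nsmul_eq_mul, mul_comm]; congr 3
  ext n; rw [mem_filter, mem_latticeBall hr.1, mem_latticeBall hR, Real.sqrt_le_left hr.1]
  constructor
  · intro h; exact ⟨h.trans (by have := hr.1; have := hr.2; gcongr), h⟩
  · exact fun h => h.2

lemma exists_sum_sq_latticeBall (hd : 0 < d) : ∃ C, 0 < C ∧ ∀ R : ℝ, 0 ≤ R →
      |∑ n ∈ latticeBall d R, ∑ i, (n i : ℝ) ^ 2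
        - (volume (euclBall d 1)).toReal * (d / (d + 2)) * R ^ (d + 2)|
        ≤ C * (1 + R) ^ (d + 1) := by
  obtain ⟨C, hC0, hC⟩ := exists_card_latticeBall_sub_le hd
  set v := (volume (euclBall d 1)).toReal
  refine ⟨3 * C, pos%, fun R hR => ?_⟩
  have h1 := integral_card_latticeBall (d := d) hR
  rw [sum_sub_distrib, sum_const, nsmul_eq_mul] at h1
  have hI : ∫ r in (0 : ℝ)..R, 2 * r * (v * r ^ d) = 2 * v * R ^ (d + 2) / (d + 2) := by
    have : ∀ r : ℝ, 2 * r * (v * r ^ d) = 2 * v * r ^ (d + 1) := fun r => by ring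
    simp only [this]; rw [intervalIntegral.integral_const_mul, integral_pow]
    simp only [zero_pow (Nat.succ_ne_zero _), sub_zero]; push_cast; ring_nf
  have hmono : MonotoneOn (fun r : ℝ => ((latticeBall d r).card : ℝ)) (Set.uIcc 0 R) := by
    rw [uIcc_of_le hR]; intro r hr t ht hrt
    have : latticeBall d r ⊆ latticeBall d t := by
      intro n hn; rw [mem_latticeBall hr.1] at hn; rw [mem_latticeBall ht.1]
      exact hn.trans (by have := hr.1; gcongr)
    exact Nat.cast_le.2 (Finset.card_le_card this)
  have i1 : IntervalIntegrable (fun r : ℝ => 2 * r * ((latticeBall d r).card : ℝ)) volume 0 R :=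
    hmono.intervalIntegrable.continuousOn_mul (by fun_prop)
  have i2 : IntervalIntegrable (fun r : ℝ => 2 * r * (v * r ^ d)) volume 0 R :=
    Continuous.intervalIntegrable (by fun_prop) _ _
  have h2 : |(∫ r in (0 : ℝ)..R, 2 * r * ((latticeBall d r).card : ℝ))
    - 2 * v * R ^ (d + 2) / (d + 2)| ≤ 2 * R * (C * (1 + R) ^ (d - 1)) * R := by
    rw [← hI, ← intervalIntegral.integral_sub i1 i2]
    have := intervalIntegral.norm_integral_le_of_norm_le_const (a := 0) (b := R)
      (C := 2 * R * (C * (1 + R) ^ (d - 1)))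
      (f := fun r => 2 * r * ((latticeBall d r).card : ℝ) - 2 * r * (v * r ^ d)) (fun r hr => by
        rw [Set.uIoc_of_le hR] at hr
        have hr0 := hr.1
        have hr1 := hr.2
        rw [← mul_sub, norm_mul, norm_eq_abs, norm_eq_abs, abs_of_pos pos%]
        have := hC r hr0.le
        gcongr
        exact this.trans mono%)
    rwa [norm_eq_abs, sub_zero, abs_of_nonneg hR] at this
  have h3 := hC R hR
  have hpow : R ^ 2 * (1 + R) ^ (d - 1) ≤ (1 + R) ^ (d + 1) := by
    have : d + 1 = 2 + (d - 1) := by omega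
    rw [this, pow_add]; gcongr
    linarith
  set S := ∑ n ∈ latticeBall d R, ∑ i, (n i : ℝ) ^ 2
  set I' := ∫ r in (0 : ℝ)..R, 2 * r * ((latticeBall d r).card : ℝ)
  set N := ((latticeBall d R).card : ℝ)
  have e : S - v * (d / (d + 2)) * R ^ (d + 2)
    = R ^ 2 * (N - v * R ^ d) - (I' - 2 * v * R ^ (d + 2) / (d + 2)) := by
    have : S = N * R ^ 2 - I' := lin%
    rw [this]
    have hd2 : (d : ℝ) + 2 ≠ 0 := pos%
    field_simp; ring
  rw [e]
  calc _ ≤ |R ^ 2 * (N - v * R ^ d)| + |I' - 2 * v * R ^ (d + 2) / (d + 2)| := abs_sub _ _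
    _ ≤ R ^ 2 * (C * (1 + R) ^ (d - 1)) + 2 * R * (C * (1 + R) ^ (d - 1)) * R := by
      rw [abs_mul, abs_of_nonneg (sq_nonneg R)]; gcongr
    _ = 3 * C * (R ^ 2 * (1 + R) ^ (d - 1)) := by ring
    _ ≤ _ := mono%

end

section

/-! ### Diagonalization of the variance profile by characters -/

variable {d L : ℕ} [NeZero L]

/-- The character of the torus with frequency `k`. -/
def torusChar (k x : Torus d L) : ℂ := ∏ i, ZMod.stdAddChar (k i * x i)

lemma torusChar_add (k x y : Torus d L) : torusChar k (x + y) = torusChar k x * torusChar k y := by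
  simp only [torusChar, Pi.add_apply, mul_add, AddChar.map_add_eq_mul, Finset.prod_mul_distrib]

lemma sum_torusChar (x : Torus d L) :
    ∑ k, torusChar k x = if x = 0 then (card (Torus d L) : ℂ) else 0 := by
  have h : ∑ k : Torus d L, torusChar k x = ∏ i, ∑ j : ZMod L, ZMod.stdAddChar (j * x i) := by
    rw [Finset.prod_univ_sum, Fintype.piFinset_univ]; rfl
  rw [h]; simp only [AddChar.sum_mulShift _ (ZMod.isPrimitive_stdAddChar L)]
  split_ifs with hx
  · subst hx; simp [Fintype.card_pi]
  · obtain ⟨i, hi⟩ := ne_iff.1 hx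
    refine Finset.prod_eq_zero (mem_univ i) ?_
    have hi' : x i ≠ 0 := hi
    simp [hi']

/-- The eigenvalue of the variance profile at frequency `k`. -/
def symbol (d L : ℕ) [NeZero L] (W : ℝ) (k : Torus d L) : ℂ :=
  ∑ w, torusChar k w * (varS d L W w 0 : ℂ)

lemma sum_torusChar_mul_varS (W : ℝ) (k x y : Torus d L) :
    ∑ z, torusChar k (x - z) * (varS d L W z y : ℂ) = torusChar k (x - y) * symbol d L W k := by
  rw [symbol, mul_sum, ← Equiv.sum_comp (Equiv.subLeft y)]; refine sum_congr rfl fun w _ => ?_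
  rw [Equiv.subLeft_apply, ← mul_assoc, ← torusChar_add]; congr 2
  · abel
  · rw [varS_symm, ← varS_add_right (w - y)]; congr 1 <;> abel

lemma card_mul_pow_varS (W : ℝ) (m : ℕ) (x y : Torus d L) :
    (card (Torus d L) : ℂ) * (((varS d L W ^ m) x y : ℝ) : ℂ)
      = ∑ k, symbol d L W k ^ m * torusChar k (x - y) := by
  induction m generalizing y with
  | zero =>
    simp only [pow_zero, one_mul, sum_torusChar, sub_eq_zero, Matrix.one_apply]
    split_ifs <;> simp
  | succ m ih =>
    rw [pow_succ, Matrix.mul_apply]; push_cast; rw [mul_sum]; simp only [← mul_assoc, ih, sum_mul]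
    rw [sum_comm]; refine sum_congr rfl fun k _ => ?_; simp only [mul_assoc]
    rw [← mul_sum, sum_torusChar_mul_varS, pow_succ]; ring

lemma trace_pow_varS (W : ℝ) (m : ℕ) :
    (((varS d L W ^ m).trace : ℝ) : ℂ) = ∑ k, symbol d L W k ^ m := by
  have hcard : (card (Torus d L) : ℂ) ≠ 0 := by exact_mod_cast Fintype.card_ne_zero
  apply mul_left_cancel₀ hcard
  rw [Matrix.trace]; push_cast; rw [mul_sum]
  simp only [Matrix.diag_apply, card_mul_pow_varS, sub_self]
  have h1 : ∀ k : Torus d L, torusChar k 0 = 1 := fun k => by simp [torusChar]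
  simp [h1]

/-! ### Passing from the torus to the lattice -/

/-- The lattice points with `1 ≤ |n| ≤ W`. -/
def puncturedBall (d : ℕ) (W : ℝ) : Finset (Fin d → ℤ) := (latticeBall d W).erase 0

notation:max "V[" d ", " W "]" => Finset.card (puncturedBall d W)

lemma mem_puncturedBall {W : ℝ} (hW : 0 ≤ W) {n : Fin d → ℤ} :
    n ∈ puncturedBall d W ↔ 1 ≤ √(∑ i, (n i : ℝ) ^ 2) ∧ √(∑ i, (n i : ℝ) ^ 2) ≤ W := by
  rw [puncturedBall, mem_erase, mem_latticeBall hW, Real.sqrt_le_left hW, one_le_sqrt]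
  refine and_congr_left fun _ => ⟨fun h => ?_, fun h h0 => ?_⟩
  · obtain ⟨i, hi⟩ := ne_iff.1 h
    have h1 : (1 : ℤ) ≤ n i ^ 2 := by
      have : 0 < n i ^ 2 := by
        have hi' : n i ≠ 0 := hi
        positivity
      omega
    have h2 : (1 : ℝ) ≤ (n i : ℝ) ^ 2 := mod_cast h1
    exact h2.trans (single_le_sum (f := fun i => (n i : ℝ) ^ 2) (fun _ _ => sq_nonneg _)
      (mem_univ i))
  · subst h0; simp at h; linarith

/-- The representatives of a point of the torus of smallest absolute value. -/
def centeredRep (x : Torus d L) : Fin d → ℤ := fun i => (x i).valMinAbs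

open Classical in
lemma sum_torus_ball {β : Type*} [AddCommMonoid β] {W : ℝ} (hW : 0 ≤ W) (hWL : 2 * W < L)
    (f : (Fin d → ℤ) → β) :
    (∑ x : Torus d L, if 1 ≤ torusNorm x ∧ torusNorm x ≤ W then f (centeredRep x) else 0)
      = ∑ n ∈ puncturedBall d W, f n := by
  rw [← sum_filter]
  have hrep : ∀ n ∈ puncturedBall d W, centeredRep (fun i => ((n i : ℤ) : ZMod L)) = n := by
    intro n hn; rw [puncturedBall, mem_erase, mem_latticeBall hW] at hn; ext i
    rw [centeredRep, ZMod.valMinAbs_spec]; refine ⟨rfl, ?_⟩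
    have h1 : (n i : ℝ) ^ 2 ≤ W ^ 2 :=
      (single_le_sum (f := fun i => (n i : ℝ) ^ 2) (fun _ _ => sq_nonneg _) (mem_univ i)).trans hn.2
    have h2 := abs_le_of_sq_le_sq' h1 hW
    have h3 : -(L : ℝ) < n i * 2 := lin%
    have h4 : (n i : ℝ) * 2 ≤ L := lin%
    constructor
    · exact_mod_cast h3
    · exact_mod_cast h4
  refine sum_nbij' (fun x => centeredRep x) (fun n i => ((n i : ℤ) : ZMod L)) ?_ ?_ ?_ ?_ ?_
  · intro x hx; rw [mem_filter] at hx; rw [mem_puncturedBall hW]; exact hx.2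
  · intro n hn; rw [mem_filter]; refine ⟨mem_univ _, ?_⟩
    have h := (mem_puncturedBall hW).1 hn
    have h2 := hrep n hn
    simp only [torusNorm]
    have e : ∀ i, (((n i : ℤ) : ZMod L)).valMinAbs = n i := fun i => congrFun h2 i
    simp only [e]; exact h
  · intro x _; ext i; exact ZMod.coe_valMinAbs (x i)
  · exact hrep
  · intro x _; rfl

lemma bandM_eq_card {W : ℝ} (hW : 0 ≤ W) (hWL : 2 * W < L) : bandM d L W = V[d, W] := by
  classical
  have h := sum_torus_ball (d := d) hW hWL (fun _ => (1 : ℕ))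
  rw [sum_const, smul_eq_mul, mul_one] at h
  rw [← h, bandM, Nat.card_eq_fintype_card, Fintype.card_subtype, Finset.card_filter]

/-- The momentum corresponding to a frequency on the torus. -/
def momentum (k : Torus d L) : Fin d → ℝ := fun i => 2 * π * ((k i).valMinAbs : ℝ) / L

lemma abs_momentum_le (k : Torus d L) (i : Fin d) : |momentum k i| ≤ π := by
  have hL : (0 : ℝ) < L := mod_cast NeZero.pos L
  have h := (k i).valMinAbs_mem_Ioc
  have h1 : -(L : ℝ) ≤ (k i).valMinAbs * 2 := mod_cast h.1.le
  have h2 : ((k i).valMinAbs : ℝ) * 2 ≤ L := mod_cast h.2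
  rw [momentum, abs_div, abs_of_pos hL, div_le_iff₀ hL, abs_mul, abs_mul, abs_two,
    abs_of_pos pi_pos]
  have h3 : |((k i).valMinAbs : ℝ)| * 2 ≤ L := by
    rw [← abs_two (α := ℝ), ← abs_mul, abs_le]; exact ⟨h1, h2⟩
  nlinarith [pi_pos]

/-- The sum of a plane wave over the punctured ball. -/
def waveSum (d : ℕ) (W : ℝ) (p : Fin d → ℝ) : ℂ :=
  ∑ n ∈ puncturedBall d W, exp ((∑ i, p i * n i : ℝ) * I)

/-- The real form of the sum of a plane wave over the punctured ball. -/
def cosSum (d : ℕ) (W : ℝ) (p : Fin d → ℝ) : ℝ := ∑ n ∈ puncturedBall d W, cos (∑ i, p i * n i)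

lemma sum_puncturedBall_neg {β : Type*} [AddCommMonoid β] {W : ℝ} (hW : 0 ≤ W)
    (f : (Fin d → ℤ) → β) :
    ∑ n ∈ puncturedBall d W, f (-n) = ∑ n ∈ puncturedBall d W, f n := by
  refine sum_nbij' (fun n => -n) (fun n => -n) ?_ ?_ ?_ ?_ ?_
  · intro n hn; rw [mem_puncturedBall hW] at hn ⊢; simpa using hn
  · intro n hn; rw [mem_puncturedBall hW] at hn ⊢; simpa using hn
  · intro n _; simp
  · intro n _; simp
  · intro n _; rfl

lemma waveSum_eq_cosSum {W : ℝ} (hW : 0 ≤ W) (p : Fin d → ℝ) :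
    waveSum d W p = (cosSum d W p : ℂ) := by
  have h1 : conj (waveSum d W p) = waveSum d W p := by
    rw [waveSum, map_sum, ← sum_puncturedBall_neg hW]; refine sum_congr rfl fun n _ => ?_
    rw [← exp_conj, map_mul, conj_ofReal, conj_I]; congr 1
    simp
  have h2 : (waveSum d W p).re = cosSum d W p := by
    rw [waveSum, re_sum, cosSum]; exact sum_congr rfl fun n _ => Complex.exp_ofReal_mul_I_re _
  rw [← h2]; exact (Complex.conj_eq_iff_re.1 h1).symm

lemma symbol_eq {W : ℝ} (hW : 0 ≤ W) (hWL : 2 * W < L) (k : Torus d L) :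
    symbol d L W k = (((bandM d L W : ℝ) - 1)⁻¹ * cosSum d W (momentum k) : ℝ) := by
  have hL : (L : ℂ) ≠ 0 := mod_cast (NeZero.ne L)
  rw [ofReal_mul, ← waveSum_eq_cosSum hW, waveSum, ← sum_torus_ball (L := L) hW hWL,
    mul_sum, symbol]
  refine sum_congr rfl fun x _ => ?_
  have hchar : torusChar k x = exp ((∑ i, momentum k i * (centeredRep x i : ℝ) : ℝ) * I) := by
    rw [torusChar]; push_cast; rw [sum_mul, Complex.exp_sum]
    refine Finset.prod_congr rfl fun i _ => ?_
    have : k i * x i = (((k i).valMinAbs * (x i).valMinAbs : ℤ) : ZMod L) := by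
      rw [Int.cast_mul, ZMod.coe_valMinAbs, ZMod.coe_valMinAbs]
    rw [this, ZMod.stdAddChar_coe]; congr 1
    rw [momentum, centeredRep]; push_cast; field_simp
  rw [varS, sub_zero]
  split_ifs
  · rw [hchar]; push_cast; ring
  · simp

lemma trace_pow_eq_sum_cosSum {W : ℝ} (hW : 0 ≤ W) (hWL : 2 * W < L) (m : ℕ) :
    (varS d L W ^ m).trace
      = ∑ k : Torus d L, (((bandM d L W : ℝ) - 1)⁻¹ * cosSum d W (momentum k)) ^ m := by
  have h := trace_pow_varS (d := d) (L := L) W m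
  simp only [symbol_eq hW hWL] at h
  exact_mod_cast h

end

section

/-! ### The characteristic function of a step of the band walk -/

variable {d : ℕ}

lemma card_puncturedBall_eq {W : ℝ} (hW : 0 ≤ W) : (V[d, W] : ℝ) = (latticeBall d W).card - 1 := by
  have h0 : (0 : Fin d → ℤ) ∈ latticeBall d W := by rw [mem_latticeBall hW]; simp; positivity
  rw [puncturedBall, card_erase_of_mem h0, cast_sub (card_pos.2 ⟨_, h0⟩)]; simp

lemma mul_one_add_pow_le {C W : ℝ} (hC : 0 ≤ C) (hW : 1 ≤ W) (k : ℕ) :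
    C * (1 + W) ^ k ≤ C * 2 ^ k * W ^ k := by
  rw [mul_assoc, ← mul_pow]; gcongr; linarith

/-- The number of points of the punctured ball is of order `W ^ d`. -/
lemma exists_card_puncturedBall_bounds (hd : 0 < d) : ∃ c C, 0 < c ∧ 0 < C ∧ ∀ᶠ W : ℝ in atTop,
      c * W ^ d ≤ V[d, W] ∧ (V[d, W] : ℝ) ≤ C * W ^ d := by
  obtain ⟨C, hC0, hC⟩ := exists_card_latticeBall_sub_le hd
  set v := (volume (euclBall d 1)).toReal
  have hv0 : 0 < v := ENNReal.toReal_pos volume_euclBall_one_pos.ne' volume_euclBall_one_lt_top.ne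
  refine ⟨v / 2, v + C * 2 ^ (d - 1), pos%, pos%, ?_⟩
  filter_upwards [ev_ge (1 : ℝ), ev_ge (2 * (C * 2 ^ (d - 1) + 1) / v)] with W hW1 hWC
  have hW0 : 0 < W := lin%
  have h := hC W hW0.le
  have hcard := card_puncturedBall_eq (d := d) hW0.le
  have hWd : W ^ d = W * W ^ (d - 1) := by rw [← pow_succ', Nat.sub_add_cancel hd]
  have hP : 1 ≤ W ^ (d - 1) := one_le_pow₀ hW1
  have hb := mul_one_add_pow_le hC0.le hW1 (d - 1)
  rw [abs_le] at h; rw [hcard]; rw [div_le_iff₀ hv0] at hWC; constructor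
  · have : (C * 2 ^ (d - 1) + 1) * W ^ (d - 1) ≤ W * v / 2 * W ^ (d - 1) := by gcongr; linarith
    rw [hWd] at h ⊢; nlinarith
  · have : C * 2 ^ (d - 1) * W ^ (d - 1) ≤ C * 2 ^ (d - 1) * W ^ d := by
      rw [hWd]; gcongr
      nlinarith
    nlinarith

/-- The variance of a coordinate of a uniform point of the punctured ball. -/
def stepVar (d : ℕ) (W : ℝ) : ℝ := (∑ n ∈ latticeBall d W, ∑ i, (n i : ℝ) ^ 2) / (d * V[d, W])

lemma exists_stepVar_sub_le (hd : 0 < d) :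
    ∃ C, 0 < C ∧ ∀ᶠ W : ℝ in atTop, |stepVar d W - W ^ 2 / (d + 2)| ≤ C * W := by
  obtain ⟨C, hC0, hC⟩ := exists_card_latticeBall_sub_le hd
  obtain ⟨C', hC'0, hC'⟩ := exists_sum_sq_latticeBall hd
  obtain ⟨c, _, hc0, _, hcard⟩ := exists_card_puncturedBall_bounds hd
  set v := (volume (euclBall d 1)).toReal
  refine ⟨(C' * 2 ^ (d + 1) + C * 2 ^ (d - 1) + 1) / c, pos%, ?_⟩
  filter_upwards [ev_ge (1 : ℝ), hcard] with W hW1 hcW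
  have hW0 : 0 < W := lin%
  have hM := card_puncturedBall_eq (d := d) hW0.le
  have h1 := hC W hW0.le
  have h2 := hC' W hW0.le
  set S := ∑ n ∈ latticeBall d W, ∑ i, (n i : ℝ) ^ 2
  rw [stepVar]; change |S / _ - _| ≤ _
  set M := (V[d, W] : ℝ)
  have hM0 : 0 < M := lt_of_lt_of_le pos% hcW.1
  have hd0 : (0 : ℝ) < d := mod_cast hd
  have hd1 : (1 : ℝ) ≤ d := mod_cast hd
  have hWd : W ^ (d + 1) = W ^ 2 * W ^ (d - 1) := by rw [← pow_add]; congr 1; omega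
  have hb := mul_one_add_pow_le hC0.le hW1 (d - 1)
  have e : S / (d * M) - W ^ 2 / (d + 2) = (S - v * (d / (d + 2)) * W ^ (d + 2)
    - d / (d + 2) * W ^ 2 * ((latticeBall d W).card - v * W ^ d) + d / (d + 2) * W ^ 2)
      / (d * M) := by
    rw [hM] at hM0 ⊢
    have : ((latticeBall d W).card : ℝ) - 1 ≠ 0 := hM0.ne'
    field_simp; ring
  have hfrac : (d : ℝ) / (d + 2) ≤ 1 := by rw [div_le_one pos%]; linarith
  have hfrac0 : (0 : ℝ) ≤ d / (d + 2) := pos%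
  have hW2 : W ^ 2 ≤ W ^ (d + 1) := pow_le_pow_right₀ hW1 (by omega)
  rw [e, abs_div, abs_of_pos (pos% : 0 < d * M), div_le_iff₀ pos%]
  calc _ ≤ |S - v * (d / (d + 2)) * W ^ (d + 2)|
        + |d / (d + 2) * W ^ 2 * ((latticeBall d W).card - v * W ^ d)| + |d / (d + 2) * W ^ 2| :=
        (abs_add_le _ _).trans (add_le_add_left (abs_sub _ _) _)
    _ ≤ C' * 2 ^ (d + 1) * W ^ (d + 1) + 1 * W ^ 2 * (C * 2 ^ (d - 1) * W ^ (d - 1))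
      + 1 * W ^ 2 := by
      rw [abs_mul, abs_of_nonneg (pos% : 0 ≤ d / (d + 2) * W ^ 2)]; gcongr
      · exact h2.trans (mul_one_add_pow_le hC'0.le hW1 _)
      · exact h1.trans hb
    _ = C' * 2 ^ (d + 1) * W ^ (d + 1) + C * 2 ^ (d - 1) * W ^ (d + 1) + W ^ 2 := by rw [hWd]; ring
    _ ≤ C' * 2 ^ (d + 1) * W ^ (d + 1) + C * 2 ^ (d - 1) * W ^ (d + 1) + W ^ (d + 1) := mono%
    _ = (C' * 2 ^ (d + 1) + C * 2 ^ (d - 1) + 1) / c * W * (1 * (c * W ^ d)) := by field_simp; ring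
    _ ≤ _ := by
      gcongr
      exact hcW.1

lemma sum_coord_mul_coord_eq_zero {W : ℝ} (hW : 0 ≤ W) {i j : Fin d} (hij : i ≠ j) :
    ∑ n ∈ latticeBall d W, (n i : ℝ) * n j = 0 := by
  have h : ∑ n ∈ latticeBall d W, (n i : ℝ) * n j = ∑ n ∈ latticeBall d W, -((n i : ℝ) * n j) := by
    have hmem : ∀ n ∈ latticeBall d W, update n i (-n i) ∈ latticeBall d W := by
      intro n hn; rw [mem_latticeBall hW] at hn ⊢; convert hn using 2 with k
      by_cases hk : k = i
      · subst hk; simp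
      · rw [update_of_ne hk]
    refine sum_nbij' (fun n => update n i (-n i)) (fun n => update n i (-n i)) hmem hmem ?_ ?_ ?_
    · intro n _; simp
    · intro n _; simp
    · intro n _; rw [update_self, update_of_ne hij.symm]; push_cast; ring
  rw [Finset.sum_neg_distrib] at h; linarith

lemma sum_coord_sq_eq {W : ℝ} (hW : 0 ≤ W) (i j : Fin d) :
    ∑ n ∈ latticeBall d W, (n i : ℝ) ^ 2 = ∑ n ∈ latticeBall d W, (n j : ℝ) ^ 2 := by
  have hmem : ∀ n ∈ latticeBall d W, n ∘ swap i j ∈ latticeBall d W := by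
    intro n hn; rw [mem_latticeBall hW] at hn ⊢; rw [← Equiv.sum_comp (swap i j)] at hn; exact hn
  refine sum_nbij' (fun n => n ∘ swap i j) (fun n => n ∘ swap i j) hmem hmem ?_ ?_ ?_
  · intro n _; ext k; simp
  · intro n _; ext k; simp
  · intro n _; simp

local notation "Λ" p:max => ∑ i, p i ^ 2
local notation "⟪" p ", " n "⟫" => ∑ i, p i * (n i : ℝ)

/-- The covariance of the step distribution is a multiple of the identity. -/
lemma sum_inner_sq {W : ℝ} (hW : 0 ≤ W) (hd : 0 < d) (p : Fin d → ℝ) :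
    ∑ n ∈ latticeBall d W, ⟪p, n⟫ ^ 2
      = Λ p * ((∑ n ∈ latticeBall d W, ∑ i, (n i : ℝ) ^ 2) / d) := by
  have hd0 : (d : ℝ) ≠ 0 := mod_cast hd.ne'
  have hcoord : ∀ i, ∑ n ∈ latticeBall d W, (n i : ℝ) ^ 2
    = (∑ n ∈ latticeBall d W, ∑ j, (n j : ℝ) ^ 2) / d := by
    intro i; rw [sum_comm, sum_congr rfl fun j _ => sum_coord_sq_eq hW j i, sum_const]; simp [hd0]
  have hexp : ∀ n : Fin d → ℤ, ⟪p, n⟫ ^ 2 = ∑ i, ∑ j, p i * p j * ((n i : ℝ) * n j) := by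
    intro n; rw [sq, Finset.sum_mul_sum]
    exact sum_congr rfl fun i _ => sum_congr rfl fun j _ => by ring
  simp only [hexp]; rw [sum_comm, sum_mul]; refine sum_congr rfl fun i _ => ?_; rw [sum_comm]
  simp only [← mul_sum]; rw [Finset.sum_eq_single i]
  · simp only [← sq]; rw [hcoord]
  · intro j _ hj; rw [sum_coord_mul_coord_eq_zero hW hj.symm, mul_zero]
  · simp

/-- The characteristic function of a uniform point of the punctured ball. -/
def stepChar (d : ℕ) (W : ℝ) (p : Fin d → ℝ) : ℝ := cosSum d W p / V[d, W]

lemma sum_inner_sq_punctured {W : ℝ} (hW : 0 ≤ W) (hd : 0 < d) (p : Fin d → ℝ) (hM : 0 < V[d, W]) :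
    ∑ n ∈ puncturedBall d W, ⟪p, n⟫ ^ 2 = V[d, W] * (stepVar d W * Λ p) := by
  have hd0 : (d : ℝ) ≠ 0 := mod_cast hd.ne'
  have hM0 : (V[d, W] : ℝ) ≠ 0 := mod_cast hM.ne'
  rw [puncturedBall, Finset.sum_erase _ (by simp), sum_inner_sq hW hd, ← puncturedBall, stepVar]
  field_simp

lemma inner_sq_le {W : ℝ} (hW : 0 ≤ W) (p : Fin d → ℝ) {n : Fin d → ℤ}
    (hn : n ∈ puncturedBall d W) : ⟪p, n⟫ ^ 2 ≤ W ^ 2 * Λ p := by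
  rw [puncturedBall, mem_erase, mem_latticeBall hW] at hn
  refine (Finset.sum_mul_sq_le_sq_mul_sq _ _ _).trans ?_; rw [mul_comm]
  have : 0 ≤ Λ p := sum_nonneg fun _ _ => sq_nonneg _
  exact mul_le_mul_of_nonneg_right hn.2 this

/-- Taylor expansion of the characteristic function at the origin. -/
lemma abs_stepChar_sub_le {W : ℝ} (hW : 0 ≤ W) (hd : 0 < d) (p : Fin d → ℝ)
    (hM : 0 < V[d, W]) (hp : W ^ 2 * Λ p ≤ 1) :
    |stepChar d W p - (1 - stepVar d W * Λ p / 2)| ≤ (W ^ 2 * Λ p) ^ 2 * (5 / 96) := by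
  have hM0 : (0 : ℝ) < V[d, W] := mod_cast hM
  have h1 := sum_inner_sq_punctured hW hd p hM
  have e : stepChar d W p - (1 - stepVar d W * Λ p / 2)
    = (∑ n ∈ puncturedBall d W, (cos ⟪p, n⟫ - (1 - ⟪p, n⟫ ^ 2 / 2))) / V[d, W] := by
    rw [sum_sub_distrib, sum_sub_distrib, ← sum_div, h1, stepChar, cosSum, sum_const, nsmul_eq_mul]
    field_simp
  rw [e, abs_div, abs_of_pos hM0, div_le_iff₀ hM0]
  calc _ ≤ ∑ n ∈ puncturedBall d W, (W ^ 2 * Λ p) ^ 2 * (5 / 96) := by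
        refine (abs_sum_le_sum_abs _ _).trans (sum_le_sum fun n hn => ?_)
        have h2 := inner_sq_le hW p hn
        have h3 : |⟪p, n⟫| ≤ 1 := by rw [← sq_le_one_iff_abs_le_one]; linarith
        refine (Real.cos_bound h3).trans ?_
        have h4 : |⟪p, n⟫| ^ 4 = (⟪p, n⟫ ^ 2) ^ 2 := by rw [← sq_abs ⟪p, n⟫]; ring
        rw [h4]; gcongr
    _ = _ := by rw [sum_const, nsmul_eq_mul]; ring

lemma stepVar_mul_le {W : ℝ} (hW : 0 ≤ W) (hd : 0 < d) (p : Fin d → ℝ) (hM : 0 < V[d, W]) :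
    stepVar d W * Λ p ≤ W ^ 2 * Λ p := by
  have hM0 : (0 : ℝ) < V[d, W] := mod_cast hM
  have h1 := sum_inner_sq_punctured hW hd p hM
  have h2 : ∑ n ∈ puncturedBall d W, ⟪p, n⟫ ^ 2 ≤ ∑ n ∈ puncturedBall d W, W ^ 2 * Λ p :=
    sum_le_sum fun n hn => inner_sq_le hW p hn
  rw [h1, sum_const, nsmul_eq_mul] at h2; exact le_of_mul_le_mul_left h2 hM0

/-- Close to the origin the powers of the characteristic function are nearly Gaussian. -/
lemma abs_stepChar_pow_sub_le {W : ℝ} (hW : 0 < W) (hd : 0 < d) (p : Fin d → ℝ)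
    (hM : 0 < V[d, W]) (hσ : W ^ 2 / (2 * (d + 2)) ≤ stepVar d W)
    (hp : W ^ 2 * Λ p ≤ 1 / (d + 2)) {m : ℕ} (hm : 2 ≤ m) :
    |stepChar d W p ^ m - Real.exp (-(m * (stepVar d W * Λ p) / 2))|
      ≤ 2 * (32 * (d + 2)) ^ 2 / m * Real.exp (-(m * (W ^ 2 * Λ p) / (32 * (d + 2)))) := by
  have hd2 : (2 : ℝ) ≤ (d : ℝ) + 2 := by linarith [cast_nonneg (α := ℝ) d]
  have hP0 : 0 ≤ Λ p := sum_nonneg fun _ _ => sq_nonneg _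
  set D : ℝ := d + 2
  have hD0 : 0 < D := lin%
  have hD1 : 1 / D ≤ 1 := by rw [div_le_one hD0]; linarith
  have h1 := abs_stepChar_sub_le hW.le hd p hM (hp.trans hD1)
  have h2 := stepVar_mul_le hW.le hd p hM
  have h3 : W ^ 2 * Λ p / (2 * D) ≤ stepVar d W * Λ p := by
    calc _ = W ^ 2 / (2 * D) * Λ p := by ring
      _ ≤ _ := mono%
  set v := W ^ 2 * Λ p
  set y := stepVar d W * Λ p
  set A := stepChar d W p
  have hv0 : 0 ≤ v := pos%
  have hy0 : 0 ≤ y := le_trans pos% h3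
  clear_value v y A D
  have hm0 : (0 : ℝ) < m := mod_cast (by omega : 0 < m)
  have hvD : v * D ≤ 1 := by rwa [le_div_iff₀ hD0] at hp
  have hv2 : v ^ 2 ≤ v / D := by rw [le_div_iff₀ hD0]; nlinarith
  rw [abs_le] at h1
  have hyv : v / D ≤ 2 * y := by
    have : v / (2 * D) = v / D / 2 := by field_simp
    rw [this] at h3; linarith
  have hvD0 : 0 ≤ v / D := pos%
  have hvD' : v / D ≤ v := div_le_self hv0 lin%
  have hv1 : v ≤ 1 / 2 := by
    have : v * 2 ≤ v * D := mono%
    linarith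
  have hA0 : 0 ≤ A := by nlinarith
  have hexp1 : 1 - v / (8 * D) ≤ Real.exp (-(v / (8 * D))) := Real.one_sub_le_exp_neg _
  have h8 : v / (8 * D) = v / D / 8 := by field_simp
  have hA1 : A ≤ Real.exp (-(v / (8 * D))) := by refine le_trans ?_ hexp1; rw [h8]; nlinarith
  have hb1 : Real.exp (-(y / 2)) ≤ Real.exp (-(v / (8 * D))) := by
    apply exp_le_exp.2
    rw [h8]; linarith
  have hAb : |A - Real.exp (-(y / 2))| ≤ v ^ 2 := by
    have h5 := Real.abs_exp_sub_one_sub_id_le (x := -(y / 2)) (by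
      rw [abs_neg, abs_of_nonneg pos%]; linarith)
    rw [abs_le] at h5 ⊢
    have : y ^ 2 ≤ v ^ 2 := mono%
    constructor <;> nlinarith
  have hbm : Real.exp (-(m * y / 2)) = Real.exp (-(y / 2)) ^ m := by
    rw [← Real.exp_nat_mul]; congr 1; ring
  rw [hbm]; refine (abs_pow_sub_pow_le A (Real.exp (-(y / 2))) m).trans ?_
  have hmax : max |A| |Real.exp (-(y / 2))| ≤ Real.exp (-(v / (8 * D))) := by
    rw [abs_of_nonneg hA0, abs_of_pos (exp_pos _)]; exact max_le hA1 hb1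
  have hm1 : (m : ℝ) / 2 ≤ ((m - 1 : ℕ) : ℝ) := by
    rw [cast_sub (by omega)]
    have : (2 : ℝ) ≤ m := mod_cast hm
    push_cast; linarith
  set x := (m : ℝ) * v / (32 * D) with hx
  have hx0 : 0 ≤ x := pos%
  have hpow : max |A| |Real.exp (-(y / 2))| ^ (m - 1) ≤ Real.exp (-(2 * x)) := by
    calc _ ≤ Real.exp (-(v / (8 * D))) ^ (m - 1) := mono%
      _ = Real.exp (-(((m - 1 : ℕ) : ℝ) * (v / (8 * D)))) := by
        rw [← Real.exp_nat_mul]; congr 1; ring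
      _ ≤ _ := by
        apply exp_le_exp.2
        rw [neg_le_neg_iff]
        calc 2 * x = m / 2 * (v / (8 * D)) := by rw [hx]; field_simp; ring
          _ ≤ _ := mono%
  have hxe : x ^ 2 / 2 ≤ Real.exp x := by
    have := Real.pow_div_factorial_le_exp x hx0 2
    simpa using this
  calc _ ≤ v ^ 2 * m * Real.exp (-(2 * x)) := mono%
    _ = 2 * (32 * D) ^ 2 / m * (x ^ 2 / 2) * Real.exp (-(2 * x)) := by rw [hx]; field_simp
    _ ≤ 2 * (32 * D) ^ 2 / m * Real.exp x * Real.exp (-(2 * x)) := mono%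
    _ = 2 * (32 * D) ^ 2 / m * Real.exp (-x) := by rw [mul_assoc, ← Real.exp_add]; congr 2; ring

/-! ### Decay of the characteristic function away from the origin -/

/-- A nontrivial geometric sum on the unit circle is smaller than its number of terms. -/
lemma exists_norm_geom_sum_le {a : ℝ} (ha : 0 < a) :
    ∃ c, 0 < c ∧ c < 1 ∧ ∀ (N : ℕ) (θ : ℝ), 2 ≤ N → |θ| ≤ π → a ≤ N * |θ| →
      ‖∑ k ∈ range N, exp (I * θ) ^ k‖ ≤ (1 - c) * N := by
  set b := min a 1 / 6 with hb
  have hb0 : 0 < b := pos%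
  have hb1 : b ≤ 1 / 6 := by rw [hb]; gcongr; exact min_le_right _ _
  have hcosb : cos b < 1 := by
    have := Real.strictAntiOn_cos (Set.left_mem_Icc.2 pi_pos.le)
      (⟨hb0.le, by linarith [pi_gt_three]⟩ : b ∈ Set.Icc 0 π) hb0
    rwa [Real.cos_zero] at this
  have hcosb0 : 0 ≤ cos b := Real.cos_nonneg_of_mem_Icc
    ⟨by linarith [pi_gt_three], by linarith [pi_gt_three]⟩
  refine ⟨min (1 / 2) (2 / 3 * (1 - cos b)), lt_min num% lin%,
    (min_le_left _ _).trans_lt num%, fun N θ hN hθ haN => ?_⟩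
  have hN0 : (0 : ℝ) < N := mod_cast (by omega : 0 < N)
  set z := exp (I * θ) with hz
  have hz1 : ‖z‖ = 1 := by rw [hz, mul_comm, norm_expI]
  have hθ0 : 0 < |θ| := by
    by_contra h
    have : |θ| = 0 := le_antisymm (not_lt.1 h) (abs_nonneg _)
    rw [this, mul_zero] at haN; linarith
  rcases le_or_gt (2 * π) (N * |θ|) with hlarge | hsmall
  · have h1 : ‖∑ k ∈ range N, z ^ k‖ * ‖z - 1‖ ≤ 2 := by
      rw [← norm_mul, geom_sum_mul]
      calc _ ≤ ‖z ^ N‖ + ‖(1 : ℂ)‖ := norm_sub_le _ _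
        _ = 2 := by rw [norm_pow, hz1, one_pow, norm_one]; norm_num
    have h2 : 2 / π * |θ| ≤ ‖z - 1‖ := by
      rw [hz, Complex.norm_exp_I_mul_ofReal_sub_one, norm_eq_abs, abs_mul, abs_two]
      have := Real.mul_abs_le_abs_sin (x := θ / 2) (by rw [abs_div, abs_two]; linarith)
      rw [abs_div, abs_two] at this; linarith
    have h3 : ‖∑ k ∈ range N, z ^ k‖ ≤ 1 / 2 * N := by
      have hn := norm_nonneg (∑ k ∈ range N, z ^ k)
      set Q := ‖∑ k ∈ range N, z ^ k‖
      have h4 : Q * (2 / π * |θ|) ≤ 2 := (mul_le_mul_of_nonneg_left h2 hn).trans h1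
      have h5 : Q * (2 * |θ|) ≤ 2 * π := by
        have : Q * (2 / π * |θ|) = Q * (2 * |θ|) / π := by ring
        rw [this, div_le_iff₀ pi_pos] at h4; exact h4
      have h6 : Q * (2 * |θ|) ≤ N * |θ| := h5.trans hlarge
      have h7 : Q * 2 ≤ N := le_of_mul_le_mul_right lin% hθ0
      linarith
    refine h3.trans ?_; gcongr
    linarith [min_le_left (1 / 2) (2 / 3 * (1 - cos b))]
  · -- pair the terms `k` and `k + h` with `h = ⌊N / 2⌋`
    obtain ⟨h, r, hNr, hr⟩ : ∃ h r : ℕ, N = 2 * h + r ∧ r ≤ 1 := ⟨N / 2, N % 2, by omega, by omega⟩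
    have hh : 1 ≤ h := by omega
    have hsplit : ∑ k ∈ range N, z ^ k
      = (∑ k ∈ range h, z ^ k) * (1 + z ^ h) + ∑ k ∈ range r, z ^ (2 * h + k) := by
      rw [hNr, Finset.sum_range_add, two_mul, Finset.sum_range_add, mul_add, mul_one, sum_mul]
      congr 2
      exact sum_congr rfl fun k _ => by ring
    have hcos : ‖1 + z ^ h‖ ≤ 2 * cos b := by
      have e : 1 + z ^ h = exp ((h * θ / 2 : ℝ) * I) * ((2 * cos (h * θ / 2) : ℝ) : ℂ) := by
        have h2 : z ^ h = exp ((h * θ / 2 : ℝ) * I) * exp ((h * θ / 2 : ℝ) * I) := by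
          rw [hz, ← Complex.exp_nat_mul, ← exp_add]; congr 1; push_cast; ring
        have h3 : (1 : ℂ) = exp ((h * θ / 2 : ℝ) * I) * exp (-(h * θ / 2 : ℝ) * I) := by
          rw [← exp_add, neg_mul, add_neg_cancel, Complex.exp_zero]
        rw [h2]
        nth_rewrite 1 [h3]
        rw [← mul_add]; congr 1
        rw [ofReal_mul, ofReal_cos, Complex.ofReal_ofNat, two_cos, add_comm]
      rw [e, norm_mul, norm_expI, one_mul, norm_real, norm_eq_abs, abs_mul, abs_two]; gcongr
      have hy : |(h : ℝ) * θ / 2| = h * |θ| / 2 := by rw [abs_div, abs_two, abs_mul, Nat.abs_cast]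
      have hy1 : b ≤ h * |θ| / 2 := by
        have : (N : ℝ) ≤ 3 * h := mod_cast (by omega : N ≤ 3 * h)
        have h5 : (N : ℝ) * |θ| ≤ 3 * h * |θ| := mono%
        have h6 : min a 1 ≤ a := min_le_left _ _
        rw [hb]; linarith
      have hy2 : h * |θ| / 2 ≤ π / 2 := by
        have : (2 : ℝ) * h ≤ N := mod_cast (by omega : 2 * h ≤ N)
        have h5 : 2 * (h : ℝ) * |θ| ≤ N * |θ| := mono%
        linarith
      rw [← Real.cos_abs, hy, abs_of_nonneg (Real.cos_nonneg_of_mem_Icc ⟨by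
        have : 0 ≤ (h : ℝ) * |θ| / 2 := pos%
        linarith [pi_pos], hy2⟩)]
      exact Real.cos_le_cos_of_nonneg_of_le_pi hb0.le (by linarith [pi_pos]) hy1
    have hsum : ∀ (l : ℕ) (g : ℕ → ℕ), ‖∑ k ∈ range l, z ^ g k‖ ≤ l := by
      intro l g; refine (norm_sum_le _ _).trans ?_; simp [hz1]
    rw [hsplit]
    calc _ ≤ ‖∑ k ∈ range h, z ^ k‖ * ‖1 + z ^ h‖ + ‖∑ k ∈ range r, z ^ (2 * h + k)‖ := by
          rw [← norm_mul]; exact norm_add_le _ _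
      _ ≤ h * (2 * cos b) + r := by
        gcongr
        · exact hsum h fun k => k
        · exact hsum r fun k => 2 * h + k
      _ ≤ (1 - 2 / 3 * (1 - cos b)) * N := by
        have h1 : (N : ℝ) = 2 * h + r := mod_cast hNr
        have h2 : (r : ℝ) ≤ h := mod_cast (by omega : r ≤ h)
        rw [h1]; nlinarith
      _ ≤ _ := by
        gcongr
        exact min_le_right _ _

end

section

variable {d : ℕ}

/-- The lattice points of the cube of side `2 s`. -/
def latticeBox (d s : ℕ) : Finset (Fin d → ℤ) := Fintype.piFinset fun _ => Icc (-(s : ℤ)) s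

lemma sum_Icc_exp (s : ℕ) (θ : ℝ) : ‖∑ j ∈ Icc (-(s : ℤ)) s, exp ((θ * j : ℝ) * I)‖
      = ‖∑ k ∈ range (2 * s + 1), exp (I * θ) ^ k‖ := by
  have h : ∑ j ∈ Icc (-(s : ℤ)) s, exp ((θ * j : ℝ) * I) = exp ((-(θ * s) : ℝ) * I)
      * ∑ k ∈ range (2 * s + 1), exp (I * θ) ^ k := by
    rw [mul_sum]; refine sum_nbij' (fun j => (j + s).toNat) (fun k => (k : ℤ) - s) ?_ ?_ ?_ ?_ ?_
    · intro j hj; rw [mem_Icc] at hj; rw [mem_range]; omega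
    · intro k hk; rw [mem_range] at hk; rw [mem_Icc]; omega
    · intro j hj; rw [mem_Icc] at hj; omega
    · intro k _; simp
    · intro j hj; rw [mem_Icc] at hj
      have h1 : (((j + s).toNat : ℕ) : ℂ) = j + s := by
        have h2 : (((j + s).toNat : ℕ) : ℤ) = j + s := Int.toNat_of_nonneg (by omega)
        exact_mod_cast congrArg (fun z : ℤ => (z : ℂ)) h2
      rw [← Complex.exp_nat_mul, ← exp_add, h1]; congr 1
      push_cast; ring
  rw [h, norm_mul, norm_expI, one_mul]

lemma sum_latticeBox_exp (s : ℕ) (p : Fin d → ℝ) :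
    ∑ n ∈ latticeBox d s, exp ((∑ i, p i * n i : ℝ) * I)
      = ∏ i, ∑ j ∈ Icc (-(s : ℤ)) s, exp ((p i * j : ℝ) * I) := by
  rw [Finset.prod_univ_sum]; refine sum_congr rfl fun n _ => ?_; rw [← Complex.exp_sum]; congr 1
  push_cast; rw [sum_mul]

/-- Away from the origin the characteristic function is bounded away from one, because the ball
contains a cube of comparable size, on which the plane wave factorizes. -/
lemma exists_abs_stepChar_le (hd : 0 < d) {a : ℝ} (ha : 0 < a) :
    ∃ c, 0 < c ∧ c < 1 ∧ ∀ᶠ W : ℝ in atTop, ∀ p : Fin d → ℝ, (∀ i, |p i| ≤ π) →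
      a ≤ W ^ 2 * ∑ i, p i ^ 2 → |stepChar d W p| ≤ 1 - c := by
  obtain ⟨c1, C, hc1, hC, hcard⟩ := exists_card_puncturedBall_bounds hd
  have hd0 : (0 : ℝ) < d := mod_cast hd
  have hsd : 0 < √(d : ℝ) := sqrt_pos.2 hd0
  obtain ⟨c0, hc0, hc01, hgeom⟩ := exists_norm_geom_sum_le (a := √a / d) pos%
  set κ := (1 / √(d : ℝ)) ^ d with hκ
  have hκ0 : 0 < κ := pos%
  refine ⟨min (c0 * κ / (2 * C)) (1 / 2), pos%, (min_le_right _ _).trans_lt num%, ?_⟩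
  filter_upwards [hcard, ev_ge (1 : ℝ), ev_ge √(d : ℝ),
    ev_ge (4 / (c0 * κ))] with W hcW hW1 hWd hWc p hp hap
  have hW0 : 0 < W := lin%
  set s := ⌊W / √d⌋₊ with hs
  have hs1 : 1 ≤ s := by rw [hs, Nat.one_le_floor_iff, le_div_iff₀ hsd]; linarith
  have hsW : (s : ℝ) ≤ W / √d := Nat.floor_le pos%
  have hWs : W / √d < s + 1 := Nat.lt_floor_add_one _
  set N := 2 * s + 1 with hN
  have hNW : W / √d ≤ N := by
    have : (s : ℝ) + 1 ≤ N := by rw [hN]; exact_mod_cast (by omega : s + 1 ≤ 2 * s + 1)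
    linarith
  set e : Fin d → ℂ := fun i => ∑ j ∈ Icc (-(s : ℤ)) s, exp ((p i * j : ℝ) * I) with he
  have heN : ∀ i, ‖e i‖ ≤ N := fun i => by
    rw [he]; simp only; rw [sum_Icc_exp]; refine (norm_sum_le _ _).trans ?_
    have : ∀ k, ‖exp (I * (p i : ℂ)) ^ k‖ = 1 := fun k => by
      rw [norm_pow, mul_comm, norm_expI, one_pow]
    simp [this, hN]
  have hne : (univ : Finset (Fin d)).Nonempty := ⟨⟨0, hd⟩, mem_univ _⟩
  obtain ⟨i, _, hi⟩ := Finset.exists_max_image univ (fun i => p i ^ 2) hne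
  have hpi : ∑ j, p j ^ 2 ≤ d * p i ^ 2 := by
    calc ∑ j, p j ^ 2 ≤ ∑ _j : Fin d, p i ^ 2 := sum_le_sum fun j hj => hi j hj
      _ = d * p i ^ 2 := by simp
  have hei : ‖e i‖ ≤ (1 - c0) * N := by
    rw [he]; simp only; rw [sum_Icc_exp]; refine hgeom N (p i) (by omega) (hp i) ?_
    have h1 : (√a / d) ^ 2 ≤ (N * |p i|) ^ 2 := by
      have h2 : (W / √d) ^ 2 ≤ (N : ℝ) ^ 2 := mono%
      rw [div_pow, sq_sqrt hd0.le] at h2; rw [div_pow, sq_sqrt ha.le, mul_pow, sq_abs]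
      calc a / (d : ℝ) ^ 2 ≤ W ^ 2 * (d * p i ^ 2) / (d : ℝ) ^ 2 := by
            gcongr
            exact hap.trans mono%
        _ = W ^ 2 / d * p i ^ 2 := by field_simp
        _ ≤ _ := mono%
    exact (pow_le_pow_iff_left₀ pos% pos% two_ne_zero).1 h1
  have hprod : ‖∏ j, e j‖ ≤ (1 - c0) * (N : ℝ) ^ d := by
    rw [← Finset.mul_prod_erase univ e (mem_univ i), norm_mul, norm_prod]
    have h1 : ∏ j ∈ univ.erase i, ‖e j‖ ≤ (N : ℝ) ^ (d - 1) := by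
      calc _ ≤ ∏ _j ∈ univ.erase i, (N : ℝ) :=
            Finset.prod_le_prod (fun _ _ => norm_nonneg _) fun j _ => heN j
        _ = _ := by rw [Finset.prod_const, card_erase_of_mem (mem_univ i)]; simp
    calc _ ≤ ((1 - c0) * N) * (N : ℝ) ^ (d - 1) :=
          mul_le_mul hei h1 (Finset.prod_nonneg fun _ _ => norm_nonneg _)
            (mul_nonneg lin% (cast_nonneg _))
      _ = _ := by rw [mul_assoc, ← pow_succ', Nat.sub_add_cancel hd]
  have hsub : latticeBox d s ⊆ latticeBall d W := by
    intro n hn; rw [latticeBox, Fintype.mem_piFinset] at hn; rw [mem_latticeBall hW0.le]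
    calc ∑ i, (n i : ℝ) ^ 2 ≤ ∑ _i : Fin d, (s : ℝ) ^ 2 := by
          refine sum_le_sum fun i _ => ?_
          have := mem_Icc.1 (hn i)
          have h1 : (-(s : ℝ)) ≤ n i := mod_cast this.1
          have h2 : (n i : ℝ) ≤ s := mod_cast this.2
          exact sq_le_sq' h1 h2
      _ = d * (s : ℝ) ^ 2 := by simp
      _ ≤ d * (W / √d) ^ 2 := mono%
      _ = W ^ 2 := by rw [div_pow, sq_sqrt hd0.le]; field_simp
  have hboxcard : ((latticeBox d s).card : ℝ) = (N : ℝ) ^ d := by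
    have : (Icc (-(s : ℤ)) s).card = N := by rw [Int.card_Icc]; omega
    rw [latticeBox, Fintype.card_piFinset, this]; simp
  have h0 : (0 : Fin d → ℤ) ∈ latticeBall d W := by rw [mem_latticeBall hW0.le]; simp; positivity
  have hM : (V[d, W] : ℝ) = (latticeBall d W).card - 1 := by
    rw [puncturedBall, card_erase_of_mem h0, cast_sub (card_pos.2 ⟨_, h0⟩)]; simp
  set f : (Fin d → ℤ) → ℂ := fun n => exp ((∑ i, p i * n i : ℝ) * I) with hf
  have hf1 : ∀ n, ‖f n‖ = 1 := fun n => norm_expI _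
  have hwave : waveSum d W p = (∑ n ∈ latticeBall d W \ latticeBox d s, f n) + ∏ j, e j - 1 := by
    rw [waveSum, puncturedBall, Finset.sum_erase_eq_sub h0, ← Finset.sum_sdiff hsub,
      sum_latticeBox_exp]
    simp [hf, he]
  have hsd2 : ‖∑ n ∈ latticeBall d W \ latticeBox d s, f n‖
    ≤ (latticeBall d W).card - (N : ℝ) ^ d := by
    refine (norm_sum_le _ _).trans ?_; simp only [hf1]
    rw [sum_const, nsmul_eq_mul, mul_one, Finset.card_sdiff_of_subset hsub,
      cast_sub (Finset.card_le_card hsub), hboxcard]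
  have hcos : |cosSum d W p| ≤ V[d, W] + 2 - c0 * (N : ℝ) ^ d := by
    have h1 : |cosSum d W p| = ‖waveSum d W p‖ := by rw [waveSum_eq_cosSum hW0.le]; simp
    rw [h1, hwave]
    calc _ ≤ ‖∑ n ∈ latticeBall d W \ latticeBox d s, f n‖ + ‖∏ j, e j‖ + ‖(1 : ℂ)‖ :=
          (norm_sub_le _ _).trans (add_le_add_left (norm_add_le _ _) _)
      _ ≤ ((latticeBall d W).card - (N : ℝ) ^ d) + (1 - c0) * (N : ℝ) ^ d + 1 := by
        rw [norm_one]; gcongr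
      _ = _ := by rw [hM]; ring
  have hNd : κ * W ^ d ≤ (N : ℝ) ^ d := by rw [hκ, ← mul_pow, one_div, inv_mul_eq_div]; gcongr
  have hM0 : (0 : ℝ) < V[d, W] := lt_of_lt_of_le pos% hcW.1
  rw [stepChar, abs_div, abs_of_pos hM0, div_le_iff₀ hM0]; refine hcos.trans ?_
  have h2 : 2 ≤ c0 * κ * W ^ d / 2 := by
    rw [div_le_iff₀ pos%] at hWc
    have : W ≤ W ^ d := le_self_pow₀ hW1 hd.ne'
    nlinarith [mul_pos hc0 hκ0]
  have h3 : min (c0 * κ / (2 * C)) (1 / 2) * (V[d, W] : ℝ) ≤ c0 * κ * W ^ d / 2 := by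
    calc _ ≤ c0 * κ / (2 * C) * (C * W ^ d) := by
          gcongr
          · exact min_le_left _ _
          · exact hcW.2
      _ = _ := by field_simp
  have h4 : c0 * (κ * W ^ d) ≤ c0 * (N : ℝ) ^ d := mono%
  nlinarith

/-! ### Gaussian sums over the torus -/

/-- The Gaussian sum over the representatives of `ℤ / L` of smallest absolute value. -/
def gaussSum (L : ℕ) [NeZero L] (lam : ℝ) : ℝ :=
  ∑ j : ZMod L, Real.exp (-lam * ((j.valMinAbs : ℤ) : ℝ) ^ 2)

lemma sum_Icc_int (F : ℤ → ℝ) (J J' : ℕ) : ∑ a ∈ Icc (-(J' : ℤ)) J, F a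
      = F 0 + ∑ k ∈ range J, F (k + 1) + ∑ k ∈ range J', F (-(k + 1)) := by
  have h : Icc (-(J' : ℤ)) J = (range (J + 1)).image (fun k : ℕ => (k : ℤ))
    ∪ (range J').image (fun k : ℕ => -((k : ℤ) + 1)) := by
    ext a; simp only [mem_Icc, Finset.mem_union, Finset.mem_image, mem_range]; constructor
    · intro h
      rcases le_or_gt 0 a with h0 | h0
      · exact Or.inl ⟨a.toNat, by omega, by omega⟩
      · exact Or.inr ⟨(-a - 1).toNat, by omega, by omega⟩
    · rintro (⟨k, hk, rfl⟩ | ⟨k, hk, rfl⟩) <;> omega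
  rw [h, Finset.sum_union, Finset.sum_image, Finset.sum_image, Finset.sum_range_succ']
  · push_cast; ring
  · intro a _ b _ hab; simp only at hab; omega
  · intro a _ b _ hab; simp only at hab; omega
  · rw [Finset.disjoint_left]; intro a ha hb; simp only [Finset.mem_image, mem_range] at ha hb
    omega

lemma sum_zmod_valMinAbs (L : ℕ) [NeZero L] (F : ℤ → ℝ) :
    ∑ j : ZMod L, F j.valMinAbs = ∑ a ∈ Icc (-(((L - 1) / 2 : ℕ) : ℤ)) ((L / 2 : ℕ) : ℤ), F a := by
  have hL := NeZero.pos L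
  refine sum_nbij' (fun j => j.valMinAbs) (fun a => (a : ZMod L)) ?_ ?_ ?_ ?_ ?_
  · intro j _
    have := j.valMinAbs_mem_Ioc
    rw [Set.mem_Ioc] at this; rw [mem_Icc]; omega
  · intro a _; exact mem_univ _
  · intro j _; exact ZMod.coe_valMinAbs j
  · intro a ha; rw [mem_Icc] at ha; rw [ZMod.valMinAbs_spec]; refine ⟨rfl, ?_⟩
    rw [Set.mem_Ioc]; omega
  · intro j _; rfl

lemma integral_gaussian_tail_le {lam X : ℝ} (hlam : 0 < lam) (hX : 0 < X) :
    ∫ x in Ioi X, Real.exp (-lam * x ^ 2) ≤ 1 / (lam * X) := by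
  have h1 : ∫ x in Ioi X, lam⁻¹ * x ^ (-2 : ℝ) = 1 / (lam * X) := by
    rw [integral_const_mul, integral_Ioi_rpow_of_lt num% hX]; norm_num; rw [Real.rpow_neg_one]; ring
  rw [← h1]
  refine setIntegral_mono_on (integrable_exp_neg_mul_sq hlam).integrableOn
    ((integrableOn_Ioi_rpow_of_lt num% hX).const_mul _) measurableSet_Ioi fun x hx => ?_
  have hx0 : 0 < x := hX.trans hx
  have hy : 0 < lam * x ^ 2 := pos%
  have h2 : lam * x ^ 2 ≤ Real.exp (lam * x ^ 2) := by linarith [Real.add_one_le_exp (lam * x ^ 2)]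
  rw [neg_mul, Real.exp_neg, rpow_neg hx0.le, ← mul_inv, Real.rpow_two]; gcongr

lemma abs_gaussSum_sub_le (L : ℕ) [NeZero L] {lam : ℝ} (hlam : 0 < lam) :
    |gaussSum L lam - √(π / lam)| ≤ 1 + 4 / (lam * L) := by
  have hL : (0 : ℝ) < L := mod_cast NeZero.pos L
  set g : ℝ → ℝ := fun x => Real.exp (-lam * x ^ 2) with hg
  have hgi : Integrable g := integrable_exp_neg_mul_sq hlam
  have hg0 : ∀ x, 0 ≤ g x := fun x => (exp_pos _).le
  have hanti : ∀ a b : ℝ, 0 ≤ a → AntitoneOn g (Set.Icc a b) := by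
    intro a b ha x hx y hy hxy
    have h0 : 0 ≤ x := ha.trans hx.1
    apply exp_le_exp.2
    rw [neg_mul, neg_mul, neg_le_neg_iff]; gcongr
  have hI : ∫ x in Ioi (0 : ℝ), g x = √(π / lam) / 2 := integral_gaussian_Ioi lam
  have hupper : ∀ J : ℕ, ∑ k ∈ range J, g (k + 1) ≤ √(π / lam) / 2 := by
    intro J
    have h := (hanti 0 (0 + J) le_rfl).sum_le_integral
    have e : ∑ i ∈ range J, g (0 + (i + 1 : ℕ)) = ∑ k ∈ range J, g (k + 1) :=
      sum_congr rfl fun k _ => by push_cast; rw [zero_add]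
    rw [e] at h; refine h.trans ?_; rw [← hI, intervalIntegral.integral_of_le pos%]
    exact setIntegral_mono_set hgi.integrableOn (.of_forall hg0)
      (.of_forall Set.Ioc_subset_Ioi_self)
  have hlower : ∀ J : ℕ, (L - 1) / 2 ≤ J →
    √(π / lam) / 2 - 1 - 2 / (lam * L) ≤ ∑ k ∈ range J, g (k + 1) := by
    intro J hJ
    have h := (hanti 1 (1 + J) zero_le_one).integral_le_sum
    have e : ∑ i ∈ range J, g (1 + (i : ℕ)) = ∑ k ∈ range J, g (k + 1) :=
      sum_congr rfl fun k _ => by rw [add_comm]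
    rw [e] at h; refine le_trans ?_ h
    have hX : (0 : ℝ) < 1 + J := pos%
    have h01 : ∫ x in Ioc (0 : ℝ) 1, g x ≤ 1 := by
      calc _ ≤ ∫ x in Ioc (0 : ℝ) 1, (1 : ℝ) := by
            refine setIntegral_mono_on hgi.integrableOn (by simp) measurableSet_Ioc fun x _ => ?_
            apply Real.exp_le_one_iff.2
            rw [neg_mul, neg_nonpos]; positivity
        _ = 1 := by simp
    have hsplit : ∫ x in Ioi (0 : ℝ), g x = (∫ x in Ioc (0 : ℝ) 1, g x)
      + ((∫ x in Ioc (1 : ℝ) (1 + J), g x) + ∫ x in Ioi (1 + J : ℝ), g x) := by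
      rw [← setIntegral_union Set.Ioc_disjoint_Ioi_same measurableSet_Ioi hgi.integrableOn
        hgi.integrableOn, Set.Ioc_union_Ioi_eq_Ioi lin%,
        ← setIntegral_union Set.Ioc_disjoint_Ioi_same measurableSet_Ioi hgi.integrableOn
        hgi.integrableOn, Set.Ioc_union_Ioi_eq_Ioi zero_le_one]
    have htail := integral_gaussian_tail_le hlam hX
    have hJL : (L : ℝ) / 2 ≤ 1 + J := by
      have : L ≤ 2 * (1 + J) := by omega
      have : (L : ℝ) ≤ 2 * (1 + J) := mod_cast this
      linarith
    have htail2 : 1 / (lam * (1 + J)) ≤ 2 / (lam * L) := by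
      rw [div_le_div_iff₀ pos% pos%]; nlinarith
    rw [intervalIntegral.integral_of_le lin%]; rw [hI] at hsplit; linarith
  have hsum : gaussSum L lam = 1 + ∑ k ∈ range (L / 2), g (k + 1)
    + ∑ k ∈ range ((L - 1) / 2), g (k + 1) := by
    rw [gaussSum, sum_zmod_valMinAbs L (fun a => Real.exp (-lam * (a : ℝ) ^ 2)), sum_Icc_int]
    congr 1
    · congr 1
      · simp
      · exact sum_congr rfl fun k _ => by simp only [hg]; push_cast; ring_nf
    · exact sum_congr rfl fun k _ => by simp only [hg]; push_cast; ring_nf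
  have u1 := hupper (L / 2)
  have u2 := hupper ((L - 1) / 2)
  have l1 := hlower (L / 2) (by omega)
  have l2 := hlower ((L - 1) / 2) le_rfl
  have h4 : 4 / (lam * L) = 2 * (2 / (lam * L)) := by ring
  have h5 : 0 ≤ 2 / (lam * L) := pos%
  rw [hsum, h4, abs_le]; constructor <;> linarith

/-- The Gaussian sum over the momenta of the torus factorizes over the coordinates. -/
lemma sum_exp_momentum (L : ℕ) [NeZero L] (c : ℝ) :
    ∑ k : Torus d L, Real.exp (-(c * ∑ i, momentum k i ^ 2))
      = gaussSum L (c * (2 * π / L) ^ 2) ^ d := by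
  have hL : (L : ℝ) ≠ 0 := mod_cast NeZero.ne L
  have h : gaussSum L (c * (2 * π / L) ^ 2) ^ d = ∏ _i : Fin d, ∑ j : ZMod L,
      Real.exp (-(c * (2 * π / L) ^ 2) * ((j.valMinAbs : ℤ) : ℝ) ^ 2) := by
    simp [gaussSum]
  rw [h, Finset.prod_univ_sum, Fintype.piFinset_univ]; refine sum_congr rfl fun k _ => ?_
  rw [← Real.exp_sum]; congr 1
  rw [← mul_sum, neg_mul, mul_assoc]; congr 2
  rw [mul_sum]; refine sum_congr rfl fun i _ => ?_; rw [momentum]; ring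

/-- The rescaled one-dimensional Gaussian sum. -/
lemma abs_mul_gaussSum_sub_le {L : ℕ} [NeZero L] {W c : ℝ} (hW : 0 < W) (hc : 0 < c) :
    |W / L * gaussSum L (c * W ^ 2 * (2 * π / L) ^ 2) - (√(4 * π * c))⁻¹|
      ≤ W / L + 1 / (c * W) := by
  have hL : (0 : ℝ) < L := mod_cast NeZero.pos L
  have hpi := pi_pos
  set lam := c * W ^ 2 * (2 * π / L) ^ 2 with hlam
  have hlam0 : 0 < lam := pos%
  have h := abs_gaussSum_sub_le L hlam0
  have e : W / L * √(π / lam) = (√(4 * π * c))⁻¹ := by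
    have h1 : W / L = √((W / L) ^ 2) := (sqrt_sq pos%).symm
    rw [h1, ← sqrt_mul pos%, ← sqrt_inv]; congr 1
    rw [hlam]; field_simp; ring
  rw [← e, ← mul_sub, abs_mul, abs_of_pos pos%]
  calc _ ≤ W / L * (1 + 4 / (lam * L)) := mono%
    _ = W / L + 1 / (c * W) * (1 / π ^ 2) := by rw [hlam]; field_simp; ring
    _ ≤ W / L + 1 / (c * W) * 1 := by
      gcongr
      rw [div_le_one pos%]; nlinarith [pi_gt_three]
    _ = _ := by rw [mul_one]

end

section

/-! ### The local limit theorem for the return probabilities -/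

variable {d : ℕ}

local notation "Λ" k:max => ∑ i, momentum k i ^ 2

lemma trace_varS_sq_le {L : ℕ} [NeZero L] {W : ℝ} (hM : 1 < bandM d L W) :
    (varS d L W ^ 2).trace ≤ (L : ℝ) ^ d * (1 / ((bandM d L W : ℝ) - 1)
      * ((bandM d L W : ℝ) * (1 / ((bandM d L W : ℝ) - 1)))) := by
  set q := (bandM d L W : ℝ) * (1 / ((bandM d L W : ℝ) - 1)) with hq
  have h : ∀ x : Torus d L, (varS d L W ^ 2) x x ≤ 1 / ((bandM d L W : ℝ) - 1) * q := by
    intro x; rw [hq, sq, Matrix.mul_apply, ← sum_varS x, mul_sum]; refine sum_le_sum fun y _ => ?_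
    rw [mul_comm]; exact mul_le_mul_of_nonneg_right (varS_le hM y x) (varS_nonneg hM x y)
  refine (sum_le_sum fun x _ => h x).trans_eq ?_
  rw [sum_const, nsmul_eq_mul, card_univ, Fintype.card_pi]; simp [ZMod.card]

lemma sqrt_natCast_le {m : ℕ} (hm : 1 ≤ m) : √(m : ℝ) ≤ m :=
  sqrt_le_iff.2 ⟨m.cast_nonneg, le_self_pow₀ (mod_cast hm) two_ne_zero⟩

lemma div_two_mul_le_of_abs_sub_le {C D W σ : ℝ} (hD : 0 < D) (hW : 0 ≤ W)
    (h : |σ - W ^ 2 / D| ≤ C * W) (hCW : 2 * C * D ≤ W) : W ^ 2 / (2 * D) ≤ σ := by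
  have h1 : C * W ≤ W ^ 2 / (2 * D) := by rw [le_div_iff₀ pos%]; nlinarith
  have h2 : W ^ 2 / D = W ^ 2 / (2 * D) + W ^ 2 / (2 * D) := by field_simp; ring
  linarith [(abs_le.1 h).1]

/-- Parseval bound for the characteristic function. -/
lemma exists_sum_stepChar_sq_le (hd : 0 < d) :
    ∃ C, 0 < C ∧ ∀ᶠ W : ℝ in atTop, ∀ (L : ℕ) [NeZero L], 2 * W < L →
      (W / L) ^ d * ∑ k : Torus d L, stepChar d W (momentum k) ^ 2 ≤ C := by
  obtain ⟨c, C, hc, hC, hcard⟩ := exists_card_puncturedBall_bounds hd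
  refine ⟨4 / c, pos%, ?_⟩
  filter_upwards [hcard, ev_ge (1 : ℝ), ev_ge (2 / c)] with W hcW hW1 hWc L _ hWL
  have hW0 : 0 < W := lin%
  have hL : (0 : ℝ) < L := lin%
  have hMeq := bandM_eq_card (d := d) (L := L) hW0.le hWL
  have hM2 : (2 : ℝ) ≤ bandM d L W := by
    rw [hMeq]; refine le_trans ?_ hcW.1; rw [div_le_iff₀ hc] at hWc
    have : W ≤ W ^ d := le_self_pow₀ hW1 hd.ne'
    nlinarith
  have hM1 : 1 < bandM d L W := by
    have : 2 ≤ bandM d L W := mod_cast hM2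
    omega
  have h1 := trace_varS_sq_le hM1
  rw [trace_pow_eq_sum_cosSum hW0.le hWL] at h1
  have hcW1 : c * W ^ d ≤ bandM d L W := by rw [hMeq]; exact hcW.1
  have hstep : ∀ k : Torus d L, stepChar d W (momentum k) ^ 2
    ≤ (((bandM d L W : ℝ) - 1)⁻¹ * cosSum d W (momentum k)) ^ 2 := by
    intro k; rw [stepChar, ← hMeq, div_eq_inv_mul, mul_pow, mul_pow]
    have h0 : 0 < (bandM d L W : ℝ) - 1 := lin%
    gcongr
    linarith
  set M := (bandM d L W : ℝ)
  have h2 : 1 / (M - 1) * (M * (1 / (M - 1))) ≤ 4 / M := by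
    have h0 : 0 < M - 1 := lin%
    have e : 1 / (M - 1) * (M * (1 / (M - 1))) = M / (M - 1) ^ 2 := by field_simp
    rw [e, div_le_div_iff₀ pos% lin%]; nlinarith
  calc _ ≤ (W / L) ^ d * ((L : ℝ) ^ d * (4 / M)) := by
        gcongr
        exact (sum_le_sum fun k _ => hstep k).trans (h1.trans mono%)
    _ ≤ (W / L) ^ d * ((L : ℝ) ^ d * (4 / (c * W ^ d))) := mono%
    _ = 4 / c := by rw [div_pow]; field_simp

lemma exists_sum_exp_le {c : ℝ} (hc : 0 < c) :
    ∃ K, 0 < K ∧ ∀ (W : ℝ) (L m : ℕ) [NeZero L], 1 ≤ W → 1 ≤ m → W * √m ≤ L →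
      (W / L) ^ d * ∑ k : Torus d L, Real.exp (-(m * (W ^ 2 * Λ k) * c)) ≤ (K / √m) ^ d := by
  refine ⟨(√(4 * π * c))⁻¹ + 1 + 1 / c, pos%, fun W L m _ hW hm hWL => ?_⟩
  have hW0 : 0 < W := lin%
  have hL : (0 : ℝ) < L := mod_cast NeZero.pos L
  have hm1 : (1 : ℝ) ≤ m := mod_cast hm
  have hm0 : (0 : ℝ) < m := lin%
  have hs1 : 1 ≤ √(m : ℝ) := one_le_sqrt.2 hm1
  have hsm := sqrt_natCast_le hm
  have h := abs_mul_gaussSum_sub_le (L := L) hW0 (c := m * c) pos%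
  have e : ∀ k : Torus d L, Real.exp (-(m * (W ^ 2 * Λ k) * c))
    = Real.exp (-((m * c * W ^ 2) * Λ k)) := fun k => by congr 1; ring
  simp only [e]; rw [sum_exp_momentum, ← mul_pow]
  have h0 : 0 ≤ W / L * gaussSum L (m * c * W ^ 2 * (2 * π / L) ^ 2) :=
    mul_nonneg pos% (sum_nonneg fun _ _ => (exp_pos _).le)
  refine pow_le_pow_left₀ h0 ?_ d; rw [abs_le] at h
  have h1 : (√(4 * π * (m * c)))⁻¹ = (√(4 * π * c))⁻¹ / √m := by
    rw [show 4 * π * (m * c) = m * (4 * π * c) by ring, sqrt_mul hm0.le, mul_inv]; ring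
  have h2 : W / L ≤ 1 / √m := by rw [div_le_div_iff₀ hL pos%]; linarith
  have h3 : 1 / (m * c * W) ≤ 1 / c / √m := by
    rw [div_div]; apply one_div_le_one_div_of_le pos%
    have : √(m : ℝ) * c ≤ m * c := mono%
    have : m * c * 1 ≤ m * c * W := mono%
    nlinarith
  rw [add_div, add_div]; linarith [h.2]

set_option maxHeartbeats 800000 in
/-- The Gaussian sum with the variance of the band walk. -/
lemma exists_sum_exp_stepVar_sub_le (hd : 0 < d) :
    ∃ C, 0 < C ∧ ∀ᶠ W : ℝ in atTop, ∀ (L m : ℕ) [NeZero L], 1 ≤ m → W * √m ≤ L →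
      |(W / L) ^ d * ∑ k : Torus d L, Real.exp (-(m * (stepVar d W * Λ k) / 2))
        - √((d + 2) / (2 * π * m)) ^ d| ≤ C * (1 / √m) ^ d * (W * √m / L + 1 / W) := by
  obtain ⟨C, hC0, hC⟩ := exists_stepVar_sub_le hd
  have hpi := pi_pos
  set D : ℝ := d + 2
  have hD0 : 0 < D := pos%
  have hD3 : 3 ≤ D := by
    have : (1 : ℝ) ≤ d := mod_cast hd
    linarith
  set K := 1 + 4 * D + 2 * D * C * D with hK
  have hK1 : 1 ≤ K := by rw [hK]; linarith [show 0 < 4 * D + 2 * D * C * D from pos%]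
  refine ⟨K * d * (D + 2 * K) ^ (d - 1), pos%, ?_⟩
  filter_upwards [hC, ev_ge (1 : ℝ), ev_ge (2 * C * D)] with W hCW hW1 hWC L m _ hm hWL
  have hW0 : 0 < W := lin%
  have hL : (0 : ℝ) < L := mod_cast NeZero.pos L
  have hm1 : (1 : ℝ) ≤ m := mod_cast hm
  have hm0 : (0 : ℝ) < m := lin%
  have hs1 : 1 ≤ √(m : ℝ) := one_le_sqrt.2 hm1
  have hsq : √(m : ℝ) ^ 2 = m := sq_sqrt hm0.le
  have hsm := sqrt_natCast_le hm
  have hσ := div_two_mul_le_of_abs_sub_le hD0 hW0.le hCW hWC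
  set σ := stepVar d W
  have hσ0 : 0 < σ := lt_of_lt_of_le pos% hσ
  set c := m * σ / (2 * W ^ 2) with hc
  have hc0 : 0 < c := pos%
  have e : ∀ k : Torus d L, Real.exp (-(m * (σ * Λ k) / 2))
    = Real.exp (-((c * W ^ 2) * Λ k)) := fun k => by
    congr 1; rw [hc]; field_simp
  simp only [e]; rw [sum_exp_momentum, ← mul_pow]
  have h := abs_mul_gaussSum_sub_le (L := L) hW0 hc0
  clear_value σ
  set g := W / L * gaussSum L (c * W ^ 2 * (2 * π / L) ^ 2)
  set t := √(D / (2 * π * m)) with ht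
  have ht0 : 0 < t := sqrt_pos.2 pos%
  set u := 1 / √(m : ℝ) with hu
  have hu0 : 0 < u := pos%
  have hmu : 1 / (m : ℝ) ≤ u := one_div_le_one_div_of_le pos% hsm
  have htu : t ≤ D * u := by
    rw [ht, Real.sqrt_le_left pos%, mul_pow, hu, div_pow, hsq, one_pow,
      mul_one_div, div_le_div_iff₀ pos% hm0]
    nlinarith [mul_pos (mul_pos hD0 hD0) hm0, mul_le_mul_of_nonneg_left hD3 (mul_pos hD0 hm0).le,
      mul_le_mul_of_nonneg_left pi_gt_three.le (mul_pos (mul_pos hD0 hD0) hm0).le]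
  -- comparison of the two Gaussian normalizations
  have hst : |(√(4 * π * c))⁻¹ - t| ≤ 2 * D * C * D * u * (1 / W) := by
    rw [← sqrt_inv]
    have hx : (4 * π * c)⁻¹ = W ^ 2 / (2 * π * m * σ) := by rw [hc]; field_simp; ring
    rw [hx]
    set x := W ^ 2 / (2 * π * m * σ) with hxd
    have hx0 : 0 < x := pos%
    have h1 : |√x - t| * t ≤ |x - D / (2 * π * m)| := by
      have h2 : x - D / (2 * π * m) = (√x - t) * (√x + t) := by
        rw [ht, ← sq_sqrt hx0.le, ← sq_sqrt (pos% : 0 ≤ D / (2 * π * m)),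
          sqrt_sq (sqrt_nonneg _), sqrt_sq (sqrt_nonneg _)]
        ring
      rw [h2, abs_mul, abs_of_nonneg (pos% : 0 ≤ √x + t)]; gcongr
      linarith [sqrt_nonneg x]
    have h3 : |x - D / (2 * π * m)| ≤ t ^ 2 * (2 * D * C / W) := by
      have e3 : x - D / (2 * π * m) = -(t ^ 2 * ((σ - W ^ 2 / D) / σ)) := by
        rw [ht, sq_sqrt pos%, hxd]; field_simp; ring
      rw [e3, abs_neg, abs_mul, abs_of_pos (pos% : 0 < t ^ 2), abs_div, abs_of_pos hσ0]
      refine mul_le_mul_of_nonneg_left ?_ (sq_nonneg t); rw [div_le_div_iff₀ hσ0 hW0]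
      calc _ ≤ C * W * W := mono%
        _ = 2 * D * C * (W ^ 2 / (2 * D)) := by field_simp
        _ ≤ _ := mono%
    have h4 : |√x - t| ≤ t * (2 * D * C / W) := by
      have : |√x - t| * t ≤ t * (2 * D * C / W) * t := by
        calc _ ≤ _ := h1.trans h3
          _ = _ := by ring
      exact le_of_mul_le_mul_right this ht0
    calc _ ≤ D * u * (2 * D * C / W) := h4.trans mono%
      _ = _ := by ring
  have hcW : 1 / (c * W) ≤ 4 * D * u * (1 / W) := by
    have h1 : m / (4 * D) ≤ c := by
      have h2 : m / (4 * D) = m * (W ^ 2 / (2 * D)) / (2 * W ^ 2) := by field_simp; ring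
      rw [h2, hc]; gcongr
    calc 1 / (c * W) ≤ 1 / (m / (4 * D) * W) := mono%
      _ = 4 * D * (1 / m) * (1 / W) := by field_simp
      _ ≤ _ := mono%
  set ε := W * √m / L + 1 / W with hε
  have hε0 : 0 < ε := pos%
  have hε2 : ε ≤ 2 := by
    have h1 : W * √m / L ≤ 1 := by rw [div_le_one hL]; exact hWL
    have h2 : 1 / W ≤ 1 := by rw [div_le_one hW0]; exact hW1
    linarith
  have hWL' : W / L = u * (W * √m / L) := by rw [hu]; field_simp
  have hgt : |g - t| ≤ K * u * ε := by
    have e1 : g - t = (g - (√(4 * π * c))⁻¹) + ((√(4 * π * c))⁻¹ - t) := by ring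
    have h0 : 0 ≤ W * √m / L := pos%
    have h0' : 0 ≤ 1 / W := pos%
    rw [e1]
    calc _ ≤ (W / L + 1 / (c * W)) + 2 * D * C * D * u * (1 / W) :=
          (abs_add_le _ _).trans (add_le_add h hst)
      _ ≤ (u * (W * √m / L) + 4 * D * u * (1 / W)) + 2 * D * C * D * u * (1 / W) := by
        rw [hWL']; gcongr
      _ = u * (W * √m / L) + (K - 1) * u * (1 / W) := by rw [hK]; ring
      _ ≤ K * u * (W * √m / L) + K * u * (1 / W) := by
        gcongr
        · exact le_mul_of_one_le_left hu0.le hK1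
        · linarith
      _ = _ := by rw [hε]; ring
  have hmax : max |g| |t| ≤ (D + 2 * K) * u := by
    have h1 : |g - t| ≤ 2 * K * u := hgt.trans (by calc K * u * ε ≤ K * u * 2 := mono%
        _ = _ := by ring)
    rw [abs_of_pos ht0]
    have hKu : 0 ≤ 2 * K * u := pos%
    apply max_le
    · calc |g| = |(g - t) + t| := by congr 1; ring
        _ ≤ |g - t| + |t| := abs_add_le _ _
        _ ≤ _ := by rw [abs_of_pos ht0]; linarith
    · linarith
  refine (abs_pow_sub_pow_le g t d).trans ?_
  calc |g - t| * d * max |g| |t| ^ (d - 1) ≤ K * u * ε * d * ((D + 2 * K) * u) ^ (d - 1) := by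
        gcongr
    _ = K * d * (D + 2 * K) ^ (d - 1) * (u * u ^ (d - 1)) * ε := by rw [mul_pow]; ring
    _ = _ := by rw [← pow_succ', Nat.sub_add_cancel hd]

lemma exists_pow_le_inv (d : ℕ) {c : ℝ} (hc0 : 0 < c) (hc1 : c < 1) :
    ∃ C, 0 < C ∧ ∀ m : ℕ, 2 ≤ m → (1 - c) ^ (m - 2) ≤ C / m * (1 / √m) ^ d := by
  refine ⟨((1 - c) ^ 2)⁻¹ * ((d + 1)! / c ^ (d + 1)), by
    have : 0 < 1 - c := lin%
    positivity, fun m hm => ?_⟩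
  have h1c : 0 < 1 - c := lin%
  have hm0 : (0 : ℝ) < m := mod_cast (by omega : 0 < m)
  have hm1 : (1 : ℝ) ≤ m := mod_cast (by omega : 1 ≤ m)
  have hs0 : 0 < √(m : ℝ) := sqrt_pos.2 hm0
  have hsm := sqrt_natCast_le (by omega : 1 ≤ m)
  have e : (1 - c) ^ (m - 2) = ((1 - c) ^ 2)⁻¹ * (1 - c) ^ m := by
    have : (1 - c) ^ m = (1 - c) ^ (m - 2) * (1 - c) ^ 2 := by rw [← pow_add]; congr 1; omega
    rw [this]; field_simp
  have h1 : (1 - c) ^ m ≤ Real.exp (-(m * c)) := by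
    calc _ ≤ Real.exp (-c) ^ m := by
          gcongr
          exact Real.one_sub_le_exp_neg c
      _ = _ := by rw [← Real.exp_nat_mul]; congr 1; ring
  have h2 : Real.exp (-(m * c)) ≤ (d + 1)! / (m * c) ^ (d + 1) := by
    have h3 := Real.pow_div_factorial_le_exp (m * c) pos% (d + 1)
    rw [Real.exp_neg, ← inv_div]; gcongr
  have h3 : ((d + 1)! : ℝ) / (m * c) ^ (d + 1)
    ≤ (d + 1)! / c ^ (d + 1) * (1 / m * (1 / √m) ^ d) := by
    have : ((d + 1)! : ℝ) / (m * c) ^ (d + 1) = (d + 1)! / c ^ (d + 1) * (1 / m * (1 / m) ^ d) := by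
      rw [mul_pow, pow_succ (m : ℝ), one_div_pow]; field_simp
    rw [this]; gcongr
  rw [e]
  calc _ ≤ ((1 - c) ^ 2)⁻¹ * ((d + 1)! / c ^ (d + 1) * (1 / m * (1 / √m) ^ d)) := by
        gcongr
        exact h1.trans (h2.trans h3)
    _ = _ := by ring

/-- Local limit theorem: the sum of the powers of the characteristic function over the momenta of
the torus is asymptotically given by its Gaussian counterpart. -/
lemma exists_sum_stepChar_pow_sub_le (hd : 0 < d) :
    ∃ C, 0 < C ∧ ∀ᶠ W : ℝ in atTop, ∀ (L m : ℕ) [NeZero L], 2 * W < L → 2 ≤ m → W * √m ≤ L →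
      |(W / L) ^ d * ∑ k : Torus d L, stepChar d W (momentum k) ^ m - √((d + 2) / (2 * π * m)) ^ d|
        ≤ C * (1 / √m) ^ d * (1 / m + W * √m / L + 1 / W) := by
  obtain ⟨C1, hC10, hC1⟩ := exists_sum_exp_stepVar_sub_le hd
  obtain ⟨C2, hC20, hC2⟩ := exists_sum_stepChar_sq_le hd
  obtain ⟨C3, hC30, hC3⟩ := exists_stepVar_sub_le hd
  obtain ⟨c4, C4, hc4, hC4, hcard⟩ := exists_card_puncturedBall_bounds hd
  have hd1 : (1 : ℝ) ≤ d := mod_cast hd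
  set D : ℝ := d + 2 with hD
  have hD0 : 0 < D := lin%
  obtain ⟨c, hc0, hc1, hfar⟩ := exists_abs_stepChar_le hd (a := 1 / D) pos%
  obtain ⟨C5, hC50, hC5⟩ := exists_pow_le_inv d hc0 hc1
  obtain ⟨K, hK0, hK⟩ := exists_sum_exp_le (d := d) (c := (32 * D)⁻¹) pos%
  set A := 2 * (32 * D) ^ 2 with hA
  refine ⟨C1 + A * K ^ d + C2 * C5, pos%, ?_⟩
  filter_upwards [hC1, hC2, hC3, hcard, hfar, ev_ge (1 : ℝ), ev_ge (2 * C3 * D)]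
    with W h₁ h₂ h₃ h₄ h₅ hW1 hWC L m _ hWL hm hmL
  have hW0 : 0 < W := lin%
  have hL : (0 : ℝ) < L := lin%
  have hm0 : (0 : ℝ) < m := mod_cast (by omega : 0 < m)
  have hM : 0 < V[d, W] := Nat.cast_pos.1 (lt_of_lt_of_le pos% h₄.1)
  have hσ := div_two_mul_le_of_abs_sub_le hD0 hW0.le h₃ hWC
  have hterm : ∀ k : Torus d L, |stepChar d W (momentum k) ^ m
    - Real.exp (-(m * (stepVar d W * Λ k) / 2))|
    ≤ A / m * Real.exp (-(m * (W ^ 2 * Λ k) * (32 * D)⁻¹))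
      + (1 - c) ^ (m - 2) * stepChar d W (momentum k) ^ 2 := by
    intro k
    have hpow0 : 0 ≤ (1 - c) ^ (m - 2) * stepChar d W (momentum k) ^ 2 :=
      mul_nonneg (pow_nonneg lin% _) (sq_nonneg _)
    rcases le_or_gt (W ^ 2 * Λ k) (1 / D) with hn | hn
    · have h := abs_stepChar_pow_sub_le hW0 hd (momentum k) hM hσ hn hm
      rw [← hD, ← hA, div_eq_mul_inv (m * (W ^ 2 * Λ k))] at h; linarith
    · have hA2 := h₅ (momentum k) (abs_momentum_le k) hn.le
      have h1 : |stepChar d W (momentum k) ^ m|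
        ≤ (1 - c) ^ (m - 2) * stepChar d W (momentum k) ^ 2 := by
        rw [abs_pow, ← sq_abs (stepChar d W (momentum k))]
        calc _ = |stepChar d W (momentum k)| ^ (m - 2) * |stepChar d W (momentum k)| ^ 2 := by
              rw [← pow_add]; congr 1; omega
          _ ≤ _ := mono%
      have h2 : Real.exp (-(m * (stepVar d W * Λ k) / 2))
        ≤ A / m * Real.exp (-(m * (W ^ 2 * Λ k) * (32 * D)⁻¹)) := by
        have hP0 : 0 ≤ Λ k := sum_nonneg fun _ _ => sq_nonneg _
        have h3 : W ^ 2 * Λ k / (2 * D) ≤ stepVar d W * Λ k := by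
          calc _ = W ^ 2 / (2 * D) * Λ k := by ring
            _ ≤ _ := mono%
        set v := W ^ 2 * Λ k
        set x := (m : ℝ) / (32 * D ^ 2) with hx
        have hx0 : 0 < x := pos%
        have h4 : x ≤ m * v * (32 * D)⁻¹ := by
          calc x = m * (1 / D) * (32 * D)⁻¹ := by rw [hx]; field_simp
            _ ≤ _ := mono%
        have h5 : m * v * (32 * D)⁻¹ + x ≤ m * (stepVar d W * Λ k) / 2 := by
          calc _ ≤ m * v * (32 * D)⁻¹ + m * v * (32 * D)⁻¹ := lin%
            _ ≤ m * (v / (2 * D)) / 2 := by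
              have e1 : m * v * (32 * D)⁻¹ + m * v * (32 * D)⁻¹ = m * v / (16 * D) := by
                field_simp; ring
              have e2 : m * (v / (2 * D)) / 2 = m * v / (4 * D) := by field_simp; ring
              rw [e1, e2]
              have : 0 ≤ v := pos%
              gcongr
              norm_num
            _ ≤ _ := mono%
        have h6 : Real.exp (-x) ≤ A / m := by
          have h7 : x ≤ Real.exp x := by linarith [Real.add_one_le_exp x]
          rw [Real.exp_neg]
          calc _ ≤ x⁻¹ := mono%
            _ = 32 * D ^ 2 / m := by rw [hx, inv_div]
            _ ≤ A / m := by
              gcongr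
              rw [hA]; nlinarith [sq_nonneg D]
        calc _ ≤ Real.exp (-x + -(m * v * (32 * D)⁻¹)) := exp_le_exp.2 lin%
          _ = Real.exp (-x) * Real.exp (-(m * v * (32 * D)⁻¹)) := Real.exp_add _ _
          _ ≤ _ := mono%
      calc _ ≤ |stepChar d W (momentum k) ^ m|
            + |Real.exp (-(m * (stepVar d W * Λ k) / 2))| := abs_sub _ _
        _ ≤ _ := by rw [abs_of_pos (exp_pos _)]; linarith
  have hE := h₁ L m (by omega) hmL
  have hK' := hK W L m hW1 (by omega) hmL
  have h2' := h₂ L hWL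
  have h5' := hC5 m hm
  set u := (1 / √(m : ℝ)) ^ d with hu
  have hu0 : 0 ≤ u := pos%
  have hKu : (K / √(m : ℝ)) ^ d = K ^ d * u := by rw [hu, ← mul_pow]; congr 1; ring
  rw [hKu] at hK'
  set P := (W / L) ^ d
  have hP0 : 0 ≤ P := pos%
  have hdiff : |P * ∑ k : Torus d L, stepChar d W (momentum k) ^ m
    - P * ∑ k : Torus d L, Real.exp (-(m * (stepVar d W * Λ k) / 2))|
    ≤ A / m * (K ^ d * u) + C5 / m * u * C2 := by
    rw [← mul_sub, ← sum_sub_distrib, abs_mul, abs_of_nonneg hP0]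
    calc _ ≤ P * ∑ k : Torus d L, (A / m * Real.exp (-(m * (W ^ 2 * Λ k) * (32 * D)⁻¹))
            + (1 - c) ^ (m - 2) * stepChar d W (momentum k) ^ 2) :=
          mul_le_mul_of_nonneg_left ((abs_sum_le_sum_abs _ _).trans (sum_le_sum fun k _ => hterm k)) hP0
      _ = A / m * (P * ∑ k : Torus d L, Real.exp (-(m * (W ^ 2 * Λ k) * (32 * D)⁻¹)))
        + (1 - c) ^ (m - 2) * (P * ∑ k : Torus d L, stepChar d W (momentum k) ^ 2) := by
        rw [sum_add_distrib, ← mul_sum, ← mul_sum]; ring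
      _ ≤ _ := by
        have : 0 ≤ P * ∑ k : Torus d L, stepChar d W (momentum k) ^ 2 :=
          mul_nonneg hP0 (sum_nonneg fun _ _ => sq_nonneg _)
        gcongr
  set T := P * ∑ k : Torus d L, stepChar d W (momentum k) ^ m
  set G := P * ∑ k : Torus d L, Real.exp (-(m * (stepVar d W * Λ k) / 2))
  set t := √(D / (2 * π * m)) ^ d
  have hr0 : 0 ≤ W * √m / L + 1 / W := pos%
  have hmi : 0 ≤ 1 / (m : ℝ) := pos%
  calc |T - t| = |(T - G) + (G - t)| := by congr 1; ring
    _ ≤ (A / m * (K ^ d * u) + C5 / m * u * C2) + C1 * u * (W * √m / L + 1 / W) :=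
      (abs_add_le _ _).trans (add_le_add hdiff hE)
    _ = (A * K ^ d + C2 * C5) * (u * (1 / m)) + C1 * (u * (W * √m / L + 1 / W)) := by ring
    _ ≤ (C1 + A * K ^ d + C2 * C5) * (u * (1 / m))
      + (C1 + A * K ^ d + C2 * C5) * (u * (W * √m / L + 1 / W)) := by
      have hAK : 0 ≤ A * K ^ d := pos%
      have hCC : 0 ≤ C2 * C5 := pos%
      gcongr
      · linarith
      · linarith
    _ = _ := by ring

end

section

/-! ### Return probabilities of the band walk -/

variable {d : ℕ}

lemma abs_stepChar_le_one (W : ℝ) (p : Fin d → ℝ) : |stepChar d W p| ≤ 1 := by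
  rw [stepChar, abs_div, Nat.abs_cast]
  refine div_le_one_of_le₀ ((abs_sum_le_sum_abs _ _).trans ?_) (cast_nonneg _)
  simpa using sum_le_sum fun n (_ : n ∈ puncturedBall d W) =>
    abs_cos_le_one (∑ i, p i * n i)

lemma eventually_two_mul_lt (hd : 0 < d) :
    ∀ᶠ W : ℝ in atTop, ∀ L : ℕ, W ^ (1 + (d : ℝ) / 6) ≤ L → 2 * W < L := by
  have hd' : (0 : ℝ) < d / 6 := pos%
  filter_upwards [eventually_le_rpow 3 hd', ev_ge 1] with W h3 h1 L hL
  have hW : 0 < W := lin%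
  rw [rpow_add hW, rpow_one] at hL
  have : W * 3 ≤ W * W ^ ((d : ℝ) / 6) := mono%
  linarith

lemma exists_bandM_bounds (hd : 0 < d) :
    ∃ c C, 0 < c ∧ 1 ≤ C ∧ ∀ᶠ W : ℝ in atTop, ∀ (L : ℕ) [NeZero L],
      W ^ (1 + (d : ℝ) / 6) ≤ L → 2 * W < L ∧ bandM d L W = V[d, W] ∧
      c * W ^ d ≤ (bandM d L W : ℝ) ∧ (bandM d L W : ℝ) ≤ C * W ^ d := by
  obtain ⟨c, C, hc, hC, h⟩ := exists_card_puncturedBall_bounds hd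
  refine ⟨c, max C 1, hc, le_max_right _ _, ?_⟩
  filter_upwards [h, eventually_two_mul_lt hd, ev_ge 0] with W h1 h2 h0 L _ hL
  have hM := bandM_eq_card (d := d) h0 (h2 L hL)
  refine ⟨h2 L hL, hM, by rw [hM]; exact h1.1, ?_⟩
  rw [hM]; exact h1.2.trans (by gcongr; exact le_max_left _ _)

/-- Properties of all large `M` hold for the number of neighbours once the band is wide. -/
lemma eventually_bandM (hd : 0 < d) {p : ℝ → Prop} (hp : ∀ᶠ M : ℝ in atTop, p M) :
    ∀ᶠ W : ℝ in atTop, ∀ (L : ℕ) [NeZero L], W ^ (1 + (d : ℝ) / 6) ≤ L → p (bandM d L W) := by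
  obtain ⟨c, C, hc, _, h⟩ := exists_bandM_bounds hd
  obtain ⟨a, ha⟩ := Filter.eventually_atTop.1 hp
  have ht : Filter.Tendsto (fun W : ℝ => c * W ^ d) atTop atTop :=
    (Filter.tendsto_pow_atTop hd.ne').const_mul_atTop hc
  filter_upwards [h, ht.eventually_ge_atTop a] with W h1 h2 L _ hL
  exact ha _ (h2.trans (h1 L hL).2.2.1)

/-- The return probability `(W/L)^d Tr S^m`, normalized by the volume of the band: the local limit
lemma for moderate `m`, and a uniform bound. The exponent `1 + d/6` in the lower bound on `L`
makes the torus larger than the diffusion scale `W√m`. -/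
lemma exists_trace_pow_sub_le (hd : 0 < d) {τ : ℝ} (hτ : τ < 1 / 3) :
    ∃ C, 0 < C ∧ ∀ᶠ W : ℝ in atTop, ∀ (L : ℕ) [NeZero L], W ^ (1 + (d : ℝ) / 6) ≤ L →
      (∀ m : ℕ, 2 ≤ m → (m : ℝ) ≤ (bandM d L W : ℝ) ^ τ →
        |(W / L) ^ d * (varS d L W ^ m).trace - √((d + 2) / (2 * π)) ^ d * (1 / √m) ^ d|
          ≤ C * (1 / √m) ^ d * (1 / m + (bandM d L W : ℝ) ^ (-(min (1 / 6 - τ / 2) (1 / d))))) ∧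
      ∀ m : ℕ, 2 ≤ m → m ≤ bandM d L W → |(W / L) ^ d * (varS d L W ^ m).trace| ≤ C := by
  obtain ⟨c0, C0, hc0, hC0, h₀⟩ := exists_bandM_bounds hd
  obtain ⟨C1, hC1, h₁⟩ := exists_sum_stepChar_pow_sub_le hd
  obtain ⟨C2, hC2, h₂⟩ := exists_sum_stepChar_sq_le hd
  set a := min (1 / 6 - τ / 2) (1 / (d : ℝ))
  have hd1 : (1 : ℝ) ≤ d := mod_cast hd
  have ha0 : 0 < 1 / 6 - τ / 2 := lin%
  set k := √((d + 2) / (2 * π)) ^ d with hk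
  refine ⟨6 * C0 * C1 + 4 * k + Real.exp 2 * C2, pos%, ?_⟩
  filter_upwards [h₀, h₁, h₂, ev_ge 1, eventually_bandM hd (ev_ge 4),
    eventually_bandM hd (eventually_const_mul_rpow_le (C := C0) ha0 one_pos),
    eventually_bandM hd (eventually_const_mul_rpow_le (C := 2) (a := 1 - τ) (b := 1) lin% one_pos)]
    with W hW₀ hW₁ hW2 hW1 hM4 hMτ hMτ' L _ hL
  obtain ⟨hWL, hcard, hMl, hMu⟩ := hW₀ L hL
  specialize hM4 L hL
  specialize hMτ L hL
  specialize hMτ' L hL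
  have hW0 : 0 < W := lin%
  have hL0 : (0 : ℝ) < L := lin%
  have htr : ∀ m : ℕ, (W / L) ^ d * (varS d L W ^ m).trace
    = ((bandM d L W : ℝ) / (bandM d L W - 1)) ^ m
      * ((W / L) ^ d * ∑ k : Torus d L, stepChar d W (momentum k) ^ m) := by
    intro m
    rw [trace_pow_eq_sum_cosSum hW0.le hWL, ← mul_assoc, mul_comm (_ ^ m) ((W / L) ^ d), mul_assoc,
      mul_sum _ _ (_ ^ m)]
    congr 1
    refine sum_congr rfl fun k _ => ?_; rw [← mul_pow, stepChar, ← hcard]; congr 1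
    field_simp
  have hq : ∀ m : ℕ, ((bandM d L W : ℝ) / (bandM d L W - 1)) ^ m
    ≤ Real.exp (2 * (m / (bandM d L W : ℝ))) := by
    intro m
    have h1 : (bandM d L W : ℝ) / (bandM d L W - 1) ≤ Real.exp (2 / bandM d L W) := by
      refine le_trans ?_ (Real.add_one_le_exp _)
      rw [div_add_one lin%, div_le_div_iff₀ lin% lin%]; linarith
    calc _ ≤ Real.exp (2 / bandM d L W) ^ m := by
          gcongr
          exact div_nonneg lin% lin%
      _ = _ := by rw [← Real.exp_nat_mul]; congr 1; ring
  have hq1 : ∀ m : ℕ, 1 ≤ ((bandM d L W : ℝ) / (bandM d L W - 1)) ^ m := fun m =>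
    one_le_pow₀ (by rw [le_div_iff₀ lin%]; linarith)
  set M : ℝ := (bandM d L W : ℝ) with hM
  have hM0 : 0 < M := lin%
  have hM1 : 1 ≤ M := lin%
  constructor
  · intro m hm hmM
    have hm0 : (0 : ℝ) < m := mod_cast (by omega : 0 < m)
    set X := M ^ (-a)
    have hX0 : 0 < X := rpow_pos_of_pos hM0 _
    -- a power of `1 / W` is comparable to the corresponding power of `1 / M`
    have hWpow : ∀ {x : ℝ}, 0 ≤ x → x ≤ 1 → (W ^ d) ^ (-x) ≤ C0 * M ^ (-x) := by
      intro x hx hx1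
      have h1 : M ^ x ≤ C0 * (W ^ d) ^ x := by
        calc M ^ x ≤ (C0 * W ^ d) ^ x := Real.rpow_le_rpow hM0.le hMu hx
          _ = C0 ^ x * (W ^ d) ^ x := mul_rpow lin% pos%
          _ ≤ _ := by
            gcongr
            calc C0 ^ x ≤ C0 ^ (1 : ℝ) := rpow_mono hC0 hx1
              _ = C0 := rpow_one _
      rw [rpow_neg pos%, rpow_neg hM0.le, inv_eq_one_div, ← div_eq_mul_inv,
        div_le_div_iff₀ pos% pos%]
      linarith
    have hWd : W = (W ^ d) ^ (1 / (d : ℝ)) := by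
      rw [← rpow_natCast, ← rpow_mul hW0.le, mul_one_div_cancel lin%, rpow_one]
    have h1W : 1 / W ≤ C0 * X := by
      have h := hWpow (x := 1 / d) pos% (by rw [div_le_one lin%]; exact hd1)
      rw [rpow_neg pos%, ← hWd, inv_eq_one_div] at h; refine h.trans ?_
      have : M ^ (-(1 / d) : ℝ) ≤ X := rpow_mono hM1 (neg_le_neg (min_le_right _ _))
      gcongr
    have hsm : √(m : ℝ) ≤ M ^ (τ / 2) := by
      rw [Real.sqrt_le_left pos%, ← rpow_natCast, ← rpow_mul hM0.le]; simpa using hmM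
    have hdiff : W * √m / L ≤ C0 * M ^ (-(1 / 6 - τ / 2)) := by
      calc W * √m / L ≤ W * M ^ (τ / 2) / W ^ (1 + (d : ℝ) / 6) := mono%
        _ = (W ^ d) ^ (-(1 / 6) : ℝ) * M ^ (τ / 2) := by
          rw [rpow_add hW0, rpow_one, ← rpow_natCast, ← rpow_mul hW0.le,
            show (d : ℝ) * -(1 / 6) = -(d / 6) by ring, rpow_neg hW0.le]
          field_simp
        _ ≤ C0 * M ^ (-(1 / 6) : ℝ) * M ^ (τ / 2) := by
          gcongr
          exact hWpow num% num%
        _ = _ := by rw [mul_assoc, ← rpow_add hM0]; congr 2; ring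
    have hdX : W * √m / L ≤ C0 * X := hdiff.trans (by
      gcongr; exact rpow_mono hM1 (neg_le_neg (min_le_left _ _)))
    have hG := hW₁ L m hWL hm (by rw [← div_le_one hL0]; exact hdiff.trans hMτ)
    have hmM' : m / M ≤ M ^ (-(1 - τ)) := by
      calc m / M ≤ M ^ τ / M := mono%
        _ = _ := by rw [← Real.rpow_sub_one hM0.ne']; congr 1; ring
    have hmX : m / M ≤ X := hmM'.trans (rpow_mono hM1 (neg_le_neg ((min_le_left _ _).trans lin%)))
    have hQ : (M / (M - 1)) ^ m ≤ 1 + 4 * X := by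
      have h0 : 0 ≤ 2 * (m / M) := pos%
      have h := Real.abs_exp_sub_one_le (x := 2 * (m / M)) (by rw [abs_of_nonneg h0]; linarith)
      rw [abs_of_nonneg h0, abs_le] at h; linarith [hq m]
    have hQ3 : (M / (M - 1)) ^ m ≤ 3 := by
      refine (hq m).trans ((exp_le_exp.2 (lin% : 2 * (m / M) ≤ 1)).trans ?_)
      linarith [Real.exp_one_lt_d9]
    rw [htr]
    have hQ1 := hq1 m
    set Q := (M / (M - 1)) ^ m
    set G := (W / L) ^ d * ∑ k : Torus d L, stepChar d W (momentum k) ^ m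
    set u := (1 / √(m : ℝ)) ^ d with hu
    have hu0 : 0 < u := pos%
    have ht : √((d + 2) / (2 * π * m)) ^ d = k * u := by
      rw [hk, hu, ← mul_pow, ← div_div, Real.sqrt_div pos%]; congr 1; ring
    rw [ht] at hG
    have hmi : 0 < 1 / (m : ℝ) := pos%
    have hk0 : 0 ≤ k := pos%
    calc |Q * G - k * u| = |Q * (G - k * u) + (Q - 1) * (k * u)| := by congr 1; ring
      _ ≤ |Q * (G - k * u)| + |(Q - 1) * (k * u)| := abs_add_le _ _
      _ = Q * |G - k * u| + (Q - 1) * (k * u) := by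
        rw [abs_mul, abs_of_pos (lt_of_lt_of_le one_pos hQ1),
          abs_of_nonneg (mul_nonneg (sub_nonneg.2 hQ1) pos%)]
      _ ≤ 3 * (C1 * u * (1 / m + C0 * X + C0 * X)) + 4 * X * (k * u) := by
        have h1 : |G - k * u| ≤ C1 * u * (1 / m + C0 * X + C0 * X) := hG.trans mono%
        have h2 : Q - 1 ≤ 4 * X := lin%
        gcongr
      _ ≤ 3 * (C1 * u * (2 * C0 * (1 / m) + C0 * X + C0 * X)) + 4 * (1 / m + X) * (k * u) := by
        have h1 : 1 / (m : ℝ) ≤ 2 * C0 * (1 / m) := le_mul_of_one_le_left hmi.le lin%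
        gcongr
        linarith
      _ = (6 * C0 * C1 + 4 * k) * u * (1 / m + X) := by ring
      _ ≤ _ := by
        refine mul_le_mul_of_nonneg_right (mul_le_mul_of_nonneg_right ?_ hu0.le) pos%
        exact le_add_of_nonneg_right pos%
  · intro m hm hmM
    have hmM' : (m : ℝ) ≤ M := by rw [hM]; exact_mod_cast hmM
    rw [htr, abs_mul, abs_of_nonneg (by linarith [hq1 m]), abs_mul,
      abs_of_nonneg (pos% : 0 ≤ (W / L) ^ d)]
    have h1 : (M / (M - 1)) ^ m ≤ Real.exp 2 :=
      (hq m).trans (exp_le_exp.2 (by linarith [div_le_one_of_le₀ hmM' hM0.le]))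
    have h2 : |∑ k : Torus d L, stepChar d W (momentum k) ^ m|
      ≤ ∑ k : Torus d L, stepChar d W (momentum k) ^ 2 := by
      refine (abs_sum_le_sum_abs _ _).trans (sum_le_sum fun k _ => ?_)
      rw [abs_pow, ← sq_abs (stepChar d W (momentum k))]
      exact pow_le_pow_of_le_one (abs_nonneg _) (abs_stepChar_le_one _ _) hm
    calc _ ≤ Real.exp 2 * ((W / L) ^ d * ∑ k : Torus d L, stepChar d W (momentum k) ^ 2) := by
          gcongr
      _ ≤ Real.exp 2 * C2 := by gcongr; exact hW2 L hWL
      _ ≤ _ := by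
        have : 0 ≤ 6 * C0 * C1 + 4 * k := pos%
        linarith

end

section

/-! ### Weighted sums of slowly varying functions -/

lemma exists_sum_rpow_le {τ : ℝ} (hτ : 0 < τ) :
    ∃ C, 0 < C ∧ ∀ (b : ℝ) (N : ℕ) (R : ℝ), 0 ≤ b + 1 + τ → (N : ℝ) ≤ R →
      ∑ m ∈ Ico 3 N, (m : ℝ) ^ b ≤ C * R ^ (b + 1 + τ) := by
  have hs : Summable fun m : ℕ => (m : ℝ) ^ (-1 - τ) := Real.summable_nat_rpow.2 lin%
  refine ⟨∑' m : ℕ, (m : ℝ) ^ (-1 - τ) + 1, by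
    have : 0 ≤ ∑' m : ℕ, (m : ℝ) ^ (-1 - τ) := tsum_nonneg fun m => pos%
    positivity, fun b N R hb hN => ?_⟩
  have hR0 : 0 ≤ R := le_trans (cast_nonneg _) hN
  calc ∑ m ∈ Ico 3 N, (m : ℝ) ^ b ≤ ∑ m ∈ Ico 3 N, (m : ℝ) ^ (-1 - τ) * R ^ (b + 1 + τ) := by
        refine sum_le_sum fun m hm => ?_; rw [mem_Ico] at hm
        have hm0 : (0 : ℝ) < m := mod_cast (by omega : 0 < m)
        have hmR : (m : ℝ) ≤ R := le_trans (mod_cast hm.2.le) hN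
        calc (m : ℝ) ^ b = (m : ℝ) ^ (-1 - τ) * (m : ℝ) ^ (b + 1 + τ) := by
              rw [← rpow_add hm0]; congr 1; ring
          _ ≤ _ := mono%
    _ = (∑ m ∈ Ico 3 N, (m : ℝ) ^ (-1 - τ)) * R ^ (b + 1 + τ) := by rw [sum_mul]
    _ ≤ _ := by
      gcongr
      linarith [hs.sum_le_tsum (Ico 3 N) fun m _ => pos%]

lemma abs_rpow_sub_rpow_le {a x : ℝ} {m : ℕ} (ha : -1 ≤ a) (ha' : a ≤ 1) (hm : 0 < m)
    (hx : (m : ℝ) ≤ x) (hx' : x ≤ m + 1) : |x ^ a - (m : ℝ) ^ a| ≤ (m : ℝ) ^ (a - 1) := by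
  have hm0 : (0 : ℝ) < m := mod_cast hm
  set y := x / m with hy
  have hy1 : 1 ≤ y := by rw [hy, le_div_iff₀ hm0]; linarith
  have hy2 : y ≤ 1 + 1 / m := by
    rw [hy, div_le_iff₀ hm0, add_mul, one_div_mul_cancel hm0.ne']; linarith
  have hxy : x = m * y := by rw [hy]; field_simp
  have h1 : y ^ a ≤ y := by simpa using rpow_mono hy1 ha'
  have h2 : 1 - 1 / m ≤ y ^ a := by
    have h3 : y⁻¹ ≤ y ^ a := by simpa [Real.rpow_neg_one] using rpow_mono hy1 ha
    have h4 : 1 - (y - 1) ≤ y⁻¹ := by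
      rw [← one_div, le_div_iff₀ lin%]
      linarith [show (1 - (y - 1)) * y = 1 - (y - 1) ^ 2 by ring, sq_nonneg (y - 1)]
    linarith
  rw [hxy, mul_rpow hm0.le lin%, Real.rpow_sub_one hm0.ne',
    show (m : ℝ) ^ a * y ^ a - (m : ℝ) ^ a = (m : ℝ) ^ a * (y ^ a - 1) by ring, abs_mul,
    abs_of_pos (rpow_pos_of_pos hm0 a), div_eq_mul_one_div]
  gcongr
  rw [abs_le]; constructor <;> linarith

/-- Continuous functions that are bounded, Hölder continuous with exponent `1/2` and of quadratic
decay, all with the same constant. -/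
structure IsTame (K : ℝ) (f : ℝ → ℂ) : Prop where
  continuous : Continuous f
  bdd : ∀ t, ‖f t‖ ≤ K
  holder : ∀ t u, ‖f t - f u‖ ≤ K * √|t - u|
  decay : ∀ t, ‖f t‖ * t ^ 2 ≤ K

lemma IsTame.nonneg {K : ℝ} {f : ℝ → ℂ} (hf : IsTame K f) : 0 ≤ K :=
  (norm_nonneg _).trans (hf.bdd 0)

/-- The error terms of the sum over `m`, relative to the weight `m ^ a`. -/
def weightSum (a x : ℝ) (N : ℕ) : ℝ := ∑ m ∈ Ico 3 N, ((m : ℝ) ^ (a - 1) + x * (m : ℝ) ^ a)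

section

variable {f : ℝ → ℂ} {K a h : ℝ}

local notation "w[" x "]" => ((x ^ a : ℝ) : ℂ) * f (x * h)

lemma norm_rpow_mul_sub_le (hf : IsTame K f) (ha : -1 ≤ a) (ha' : a ≤ 1) (hh : 0 < h)
    {m : ℕ} {x : ℝ} (hm : 0 < m) (hx : (m : ℝ) ≤ x) (hx' : x ≤ m + 1) :
    ‖w[x] - w[(m : ℝ)]‖ ≤ K * ((m : ℝ) ^ (a - 1) + √h * (m : ℝ) ^ a) := by
  have hK := hf.nonneg
  have e : w[x] - w[(m : ℝ)] = ((x ^ a - (m : ℝ) ^ a : ℝ) : ℂ) * f (x * h)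
      + (((m : ℝ) ^ a : ℝ) : ℂ) * (f (x * h) - f (m * h)) := by push_cast; ring
  have h1 : ‖f (x * h) - f (m * h)‖ ≤ K * √h := by
    refine (hf.holder _ _).trans ?_; gcongr
    rw [← sub_mul, abs_mul, abs_of_pos hh, abs_of_nonneg lin%]
    exact mul_le_of_le_one_left hh.le lin%
  rw [e]; refine (norm_add_le _ _).trans ?_
  rw [norm_mul, norm_mul, norm_real, norm_real, norm_eq_abs, norm_of_nonneg pos%]
  calc _ ≤ (m : ℝ) ^ (a - 1) * K + (m : ℝ) ^ a * (K * √h) := by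
        gcongr
        · exact abs_rpow_sub_rpow_le ha ha' hm hx hx'
        · exact hf.bdd _
    _ = _ := by ring

lemma continuousOn_rpow_mul (hc : Continuous f) {s : Set ℝ} (hs : ∀ x ∈ s, 0 < x) :
    ContinuousOn (fun x : ℝ => w[x]) s := by
  refine ContinuousOn.mul (Complex.continuous_ofReal.comp_continuousOn
    (continuousOn_id.rpow_const fun x hx => Or.inl (hs x hx).ne')) ?_
  exact (hc.comp (continuous_id.mul continuous_const)).continuousOn

lemma norm_rpow_mul_le (hf : IsTame K f) (hh : 0 < h) {x : ℝ} (hx : 0 < x) : ‖w[x]‖ ≤ K * x ^ a ∧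
      ‖w[x]‖ ≤ K * (h ^ 2)⁻¹ * x ^ (a - 2) := by
  rw [norm_mul, norm_real, norm_of_nonneg pos%]
  have h1 := hf.decay (x * h)
  have h2 : x ^ a = x ^ (a - 2) * x ^ 2 := by
    rw [← rpow_natCast, ← rpow_add hx]; congr 1; push_cast; ring
  refine ⟨by rw [mul_comm]; gcongr; exact hf.bdd _, ?_⟩
  calc x ^ a * ‖f (x * h)‖ = x ^ (a - 2) * (h ^ 2)⁻¹ * (‖f (x * h)‖ * (x * h) ^ 2) := by
        rw [h2]; field_simp
    _ ≤ x ^ (a - 2) * (h ^ 2)⁻¹ * K := mono%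
    _ = _ := by ring

lemma integrableOn_rpow_mul (ha : -1 < a) (ha' : a < 1) (hf : IsTame K f) (hh : 0 < h) :
    IntegrableOn (fun x : ℝ => w[x]) (Ioi 0) := by
  have hb := fun (x : ℝ) (hx : 0 < x) => norm_rpow_mul_le (a := a) hf hh hx
  rw [← Set.Ioc_union_Ioi_eq_Ioi zero_le_one]; refine IntegrableOn.union ?_ ?_
  · refine Integrable.mono' (((intervalIntegrable_iff_integrableOn_Ioc_of_le zero_le_one).1
      (intervalIntegral.intervalIntegrable_rpow' ha)).const_mul K)
      ((continuousOn_rpow_mul hf.continuous fun x hx => hx.1).aestronglyMeasurable measurableSet_Ioc)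
      ((ae_restrict_iff' measurableSet_Ioc).2 (.of_forall fun x hx => (hb x hx.1).1))
  · refine Integrable.mono' ((integrableOn_Ioi_rpow_of_lt lin% one_pos).const_mul _)
      ((continuousOn_rpow_mul hf.continuous fun x hx => one_pos.trans hx).aestronglyMeasurable
        measurableSet_Ioi)
      ((ae_restrict_iff' measurableSet_Ioi).2 (.of_forall fun x hx => (hb x (one_pos.trans hx)).2))

/-- Comparison of a weighted sum with the corresponding integral. -/
lemma norm_sum_sub_integral_le (hf : IsTame K f) (ha : -1 ≤ a) (ha' : a ≤ 1) (hh : 0 < h)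
    {N : ℕ} (hN : 3 ≤ N) :
    ‖∑ m ∈ Ico 3 N, w[(m : ℝ)] - ∫ x in (3 : ℝ)..N, w[x]‖ ≤ K * weightSum a (√h) N := by
  have hint : ∀ m : ℕ, 3 ≤ m → IntervalIntegrable
    (fun x : ℝ => w[x]) volume (m : ℝ) ((m + 1 : ℕ) : ℝ) := by
    intro m hm; refine (continuousOn_rpow_mul hf.continuous fun x hx => ?_).intervalIntegrable
    rw [uIcc_of_le (by push_cast; linarith)] at hx
    exact lt_of_lt_of_le (mod_cast (by omega : 0 < m)) hx.1
  have hs := intervalIntegral.sum_integral_adjacent_intervals_Ico (a := fun m : ℕ => (m : ℝ)) hN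
    fun k hk => hint k hk.1
  simp only [Nat.cast_ofNat] at hs; rw [← hs, ← sum_sub_distrib, weightSum, mul_sum]
  refine norm_sum_le_of_le _ (fun m hm => ?_); rw [mem_Ico] at hm
  have e : w[(m : ℝ)] = ∫ _ in (m : ℝ)..((m + 1 : ℕ) : ℝ), w[(m : ℝ)] := by
    rw [intervalIntegral.integral_const]; simp
  rw [norm_sub_rev]; rw [e]
  rw [← intervalIntegral.integral_sub (hint m hm.1) intervalIntegrable_const]
  refine (intervalIntegral.norm_integral_le_of_norm_le_const fun x hx => ?_).trans
    (le_of_eq (b := K * ((m : ℝ) ^ (a - 1) + √h * (m : ℝ) ^ a) * |((m + 1 : ℕ) : ℝ) - m|)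
      rfl) |>.trans (le_of_eq (by simp))
  rw [Set.uIoc_of_le (by push_cast; linarith)] at hx
  exact norm_rpow_mul_sub_le hf ha ha' hh (by omega) hx.1.le (mod_cast hx.2)

/-- Summation by parts: an oscillating weighted sum is bounded by the variation of the weights. -/
lemma norm_sub_one_mul_sum_le (hf : IsTame K f) (ha : -1 ≤ a) (ha' : a ≤ 1) (hh : 0 < h)
    {z : ℂ} (hz : ‖z‖ = 1) {N : ℕ} (hN : 3 ≤ N) :
    ‖z - 1‖ * ‖∑ m ∈ Ico 3 N, z ^ m * (w[(m : ℝ)])‖ ≤ 2 * K * (3 + weightSum a (√h) N) := by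
  set g : ℕ → ℂ := fun m => w[(m : ℝ)] with hg
  have hab : ∀ n, 3 ≤ n → (z - 1) * ∑ m ∈ Ico 3 n, z ^ m * g m
    = z ^ n * g n - z ^ 3 * g 3 - ∑ m ∈ Ico 3 n, z ^ (m + 1) * (g (m + 1) - g m) := by
    intro n hn
    induction n, hn using Nat.le_induction with
    | base => simp
    | succ n hn ih =>
      rw [Finset.sum_Ico_succ_top hn, Finset.sum_Ico_succ_top hn, mul_add, ih]; ring
  have hdiff : ∑ m ∈ Ico 3 N, ‖g (m + 1) - g m‖ ≤ K * weightSum a (√h) N := by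
    rw [weightSum, mul_sum]; refine sum_le_sum fun m hm => ?_; rw [mem_Ico] at hm
    have := norm_rpow_mul_sub_le hf ha ha' hh (m := m) (x := m + 1) (by omega) lin% le_rfl
    simpa [hg] using this
  have hg3 : ‖g 3‖ ≤ 3 * K := by
    simp only [hg, norm_mul, norm_real, Nat.cast_ofNat]; rw [norm_of_nonneg pos%]
    refine mul_le_mul ?_ (hf.bdd _) (norm_nonneg _) num%
    simpa using rpow_mono (num% : (1 : ℝ) ≤ 3) ha'
  have hgN : ‖g N‖ ≤ ‖g 3‖ + ∑ m ∈ Ico 3 N, ‖g (m + 1) - g m‖ := by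
    have e : g N = g 3 + ∑ m ∈ Ico 3 N, (g (m + 1) - g m) := by rw [Finset.sum_Ico_sub _ hN]; ring
    rw [e]; exact (norm_add_le _ _).trans (add_le_add_right (norm_sum_le _ _) _)
  rw [← norm_mul, hab N hN]
  calc _ ≤ ‖z ^ N * g N‖ + ‖z ^ 3 * g 3‖ + ∑ m ∈ Ico 3 N, ‖z ^ (m + 1) * (g (m + 1) - g m)‖ :=
        (norm_sub_le _ _).trans (add_le_add (norm_sub_le _ _) (norm_sum_le _ _))
    _ = ‖g N‖ + ‖g 3‖ + ∑ m ∈ Ico 3 N, ‖g (m + 1) - g m‖ := by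
      simp only [norm_mul, norm_pow, hz, one_pow, one_mul]
    _ ≤ _ := lin%

/-- The integral over a long interval is close to the integral over the half-line. -/
lemma exists_norm_integral_sub_le (ha : -1 < a) (ha' : a < 1) :
    ∃ C, 0 < C ∧ ∀ (f : ℝ → ℂ) (K h : ℝ) (N : ℕ), IsTame K f → 0 < h → 3 ≤ N →
      ‖(∫ x in (3 : ℝ)..N, ((x ^ a : ℝ) : ℂ) * f (x * h))
        - ((h ^ (-(a + 1)) : ℝ) : ℂ) * ∫ t in Ioi (0 : ℝ), ((t ^ a : ℝ) : ℂ) * f t‖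
        ≤ C * K * (1 + (h ^ 2)⁻¹ * (N : ℝ) ^ (a - 1)) := by
  refine ⟨3 ^ (a + 1) / (a + 1) + 1 / (1 - a), by
    have : 0 < a + 1 := lin%
    have : 0 < 1 - a := lin%
    positivity, fun f K h N hf hh hN => ?_⟩
  have hK := hf.nonneg
  have hN0 : (0 : ℝ) < N := mod_cast (by omega : 0 < N)
  have hN3 : (3 : ℝ) ≤ N := mod_cast hN
  set g : ℝ → ℂ := fun x => ((x ^ a : ℝ) : ℂ) * f (x * h) with hg
  have hb := fun (x : ℝ) (hx : 0 < x) => norm_rpow_mul_le (a := a) hf hh hx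
  have hI1 : IntegrableOn (fun x : ℝ => K * x ^ a) (Ioc 0 3) :=
    ((intervalIntegrable_iff_integrableOn_Ioc_of_le num%).1
      (intervalIntegral.intervalIntegrable_rpow' ha)).const_mul K
  have hI2 : IntegrableOn (fun x : ℝ => K * (h ^ 2)⁻¹ * x ^ (a - 2)) (Ioi (N : ℝ)) :=
    (integrableOn_Ioi_rpow_of_lt lin% hN0).const_mul _
  have hgi : IntegrableOn g (Ioi 0) := integrableOn_rpow_mul ha ha' hf hh
  have hg1 : IntegrableOn g (Ioc 0 3) := hgi.mono_set Set.Ioc_subset_Ioi_self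
  have hg3' : IntegrableOn g (Ioi 3) := hgi.mono_set (Set.Ioi_subset_Ioi num%)
  have hg2 : IntegrableOn g (Ioc 3 N) := hg3'.mono_set Set.Ioc_subset_Ioi_self
  have hg3 : IntegrableOn g (Ioi (N : ℝ)) := hg3'.mono_set (Set.Ioi_subset_Ioi hN3)
  have hscale : ((h ^ (-(a + 1)) : ℝ) : ℂ) * ∫ t in Ioi (0 : ℝ), ((t ^ a : ℝ) : ℂ) * f t
    = ∫ x in Ioi (0 : ℝ), g x := by
    have h1 := integral_comp_mul_right_Ioi (fun t : ℝ => ((t ^ a : ℝ) : ℂ) * f t) 0 hh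
    rw [zero_mul] at h1
    have h2 : ∀ x ∈ Ioi (0 : ℝ), g x
      = ((h ^ (-a) : ℝ) : ℂ) * ((((x * h) ^ a : ℝ) : ℂ) * f (x * h)) := by
      intro x hx; rw [hg, ← mul_assoc, ← ofReal_mul, mul_rpow (le_of_lt hx) hh.le]
      rw [mul_comm (x ^ a), ← mul_assoc, ← rpow_add hh, neg_add_cancel, Real.rpow_zero, one_mul]
    rw [setIntegral_congr_fun measurableSet_Ioi h2, integral_const_mul, h1, real_smul,
      ← mul_assoc, ← ofReal_mul]
    rw [neg_add, rpow_add hh, Real.rpow_neg_one]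
  have hsplit : ∫ x in Ioi (0 : ℝ), g x = (∫ x in Ioc 0 3, g x)
    + ((∫ x in Ioc (3 : ℝ) N, g x) + ∫ x in Ioi (N : ℝ), g x) := by
    rw [← setIntegral_union (Set.Ioc_disjoint_Ioi le_rfl) measurableSet_Ioi hg2 hg3,
      Set.Ioc_union_Ioi_eq_Ioi hN3, ← setIntegral_union (Set.Ioc_disjoint_Ioi le_rfl)
      measurableSet_Ioi hg1 hg3',
      Set.Ioc_union_Ioi_eq_Ioi num%]
  have hb1 : ‖∫ x in Ioc (0 : ℝ) 3, g x‖ ≤ K * (3 ^ (a + 1) / (a + 1)) := by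
    refine (norm_integral_le_of_norm_le hI1
      ((ae_restrict_iff' measurableSet_Ioc).2 (.of_forall fun x hx => (hb x hx.1).1))).trans
      (le_of_eq ?_)
    rw [integral_const_mul, ← intervalIntegral.integral_of_le num%,
      integral_rpow (Or.inl ha), Real.zero_rpow lin%, sub_zero]
  have hb2 : ‖∫ x in Ioi (N : ℝ), g x‖ ≤ K * (h ^ 2)⁻¹ * ((N : ℝ) ^ (a - 1) / (1 - a)) := by
    refine (norm_integral_le_of_norm_le hI2
      ((ae_restrict_iff' measurableSet_Ioi).2 (.of_forall fun x hx => (hb x (hN0.trans hx)).2))).trans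
      (le_of_eq ?_)
    rw [integral_const_mul, integral_Ioi_rpow_of_lt lin% hN0,
      show a - 2 + 1 = a - 1 by ring, neg_div, ← div_neg, neg_sub]
  rw [hscale, hsplit, intervalIntegral.integral_of_le hN3]
  have h1a : 0 < 1 - a := lin%
  have h2a : 0 < a + 1 := lin%
  calc _ = ‖(∫ x in Ioc (0 : ℝ) 3, g x) + ∫ x in Ioi (N : ℝ), g x‖ := by
        rw [← norm_neg]; congr 1; ring
    _ ≤ K * (3 ^ (a + 1) / (a + 1)) + K * (h ^ 2)⁻¹ * ((N : ℝ) ^ (a - 1) / (1 - a)) :=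
      (norm_add_le _ _).trans (add_le_add hb1 hb2)
    _ ≤ _ := by
      have h1 : 0 ≤ 3 ^ (a + 1) / (a + 1) * K * ((h ^ 2)⁻¹ * (N : ℝ) ^ (a - 1)) := pos%
      have h2 : 0 ≤ 1 / (1 - a) * K := pos%
      have e : K * (h ^ 2)⁻¹ * ((N : ℝ) ^ (a - 1) / (1 - a))
        = 1 / (1 - a) * K * ((h ^ 2)⁻¹ * (N : ℝ) ^ (a - 1)) := by ring
      rw [e]; linarith

/-- In the critical case the integral diverges logarithmically. -/
lemma norm_integral_inv_sub_le (hf : IsTame K f) (hh : 0 < h) {N : ℕ} (h3 : 3 ≤ h⁻¹) (hN : h⁻¹ ≤ N) :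
    ‖(∫ x in (3 : ℝ)..N, ((x ^ (-1 : ℝ) : ℝ) : ℂ) * f (x * h)) - (log h⁻¹ : ℂ) * f 0‖ ≤ 6 * K := by
  have hK := hf.nonneg
  set g : ℝ → ℂ := fun x => ((x ^ (-1 : ℝ) : ℝ) : ℂ) * f (x * h) with hg
  have hX0 : 0 < h⁻¹ := pos%
  have hint : ∀ {p q : ℝ}, 0 < p → p ≤ q → IntervalIntegrable g volume p q := fun hp hpq =>
    (continuousOn_rpow_mul hf.continuous fun x hx => by
      rw [uIcc_of_le hpq] at hx; exact hp.trans_le hx.1).intervalIntegrable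
  have hinv : IntervalIntegrable (fun x : ℝ => (((x⁻¹ : ℝ) : ℂ)) * f 0) volume 3 h⁻¹ := by
    refine ContinuousOn.intervalIntegrable fun x hx => ?_; rw [uIcc_of_le h3] at hx
    have : x ≠ 0 := by linarith [hx.1]
    exact ((Complex.continuous_ofReal.continuousAt.comp (continuousAt_inv₀ this)).mul
      continuousAt_const).continuousWithinAt
  have hmain : ‖(∫ x in (3 : ℝ)..h⁻¹, g x) - ∫ x in (3 : ℝ)..h⁻¹, ((x⁻¹ : ℝ) : ℂ) * f 0‖
    ≤ 2 * K := by
    rw [← intervalIntegral.integral_sub (hint num% h3) hinv]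
    have hb : ∀ x ∈ Ioc 3 h⁻¹, ‖g x - ((x⁻¹ : ℝ) : ℂ) * f 0‖ ≤ K * √h * x ^ (-(1 / 2) : ℝ) := by
      intro x hx
      have hx0 : 0 < x := by linarith [hx.1]
      rw [hg]; simp only [Real.rpow_neg_one]
      rw [← mul_sub, norm_mul, norm_real, norm_of_nonneg pos%]
      calc _ ≤ x⁻¹ * (K * √|x * h - 0|) := by gcongr; exact hf.holder _ _
        _ = _ := by
          rw [sub_zero, abs_of_pos pos%, sqrt_mul hx0.le, rpow_neg hx0.le, ← sqrt_eq_rpow]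
          have := Real.mul_self_sqrt hx0.le
          field_simp; rw [pow_two, this, mul_comm]
    refine (intervalIntegral.norm_integral_le_of_norm_le h3 (.of_forall hb)
      ((intervalIntegral.intervalIntegrable_rpow' num%).const_mul _)).trans ?_
    rw [intervalIntegral.integral_const_mul, integral_rpow (Or.inl num%),
      show (-(1 / 2) + 1 : ℝ) = 1 / 2 from num%, ← sqrt_eq_rpow, ← sqrt_eq_rpow,
      sqrt_inv]
    have h1 : 0 < √h := sqrt_pos.2 hh
    have h2 : K * √h * (((√h)⁻¹ - √3) / (1 / 2)) = 2 * K - 2 * (K * √h * √3) := by field_simp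
    rw [h2]; linarith [show 0 ≤ K * √h * √3 from pos%]
  have hlog : ∫ x in (3 : ℝ)..h⁻¹, ((x⁻¹ : ℝ) : ℂ) * f 0 = ((log h⁻¹ - log 3 : ℝ) : ℂ) * f 0 := by
    rw [intervalIntegral.integral_mul_const, intervalIntegral.integral_ofReal,
      integral_inv_of_pos num% hX0, Real.log_div hX0.ne' num%]
  have htail : ‖∫ x in h⁻¹..(N : ℝ), g x‖ ≤ K := by
    have hb : ∀ x ∈ Ioc h⁻¹ (N : ℝ), ‖g x‖ ≤ K * (h ^ 2)⁻¹ * x ^ (-3 : ℝ) := fun x hx => by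
      rw [show (-3 : ℝ) = -1 - 2 from num%]; exact (norm_rpow_mul_le hf hh (hX0.trans hx.1)).2
    have hn0 : (0 : ℝ) ∉ Set.uIcc h⁻¹ (N : ℝ) := by
      rw [uIcc_of_le hN]; exact fun h0 => absurd h0.1 (not_le.2 hX0)
    refine (intervalIntegral.norm_integral_le_of_norm_le hN (.of_forall hb)
      ((intervalIntegral.intervalIntegrable_rpow (Or.inr hn0)).const_mul _)).trans ?_
    rw [intervalIntegral.integral_const_mul, integral_rpow (Or.inr ⟨num%, hn0⟩)]
    have h1 : (h⁻¹ : ℝ) ^ (-3 + 1 : ℝ) = h ^ 2 := by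
      rw [Real.inv_rpow hh.le, ← rpow_neg hh.le, ← rpow_natCast]; norm_num
    rw [h1, show (-3 + 1 : ℝ) = -2 from num%]
    have h2 : K * (h ^ 2)⁻¹ * (((N : ℝ) ^ (-2 : ℝ) - h ^ 2) / -2)
      = K / 2 - K * (h ^ 2)⁻¹ * (N : ℝ) ^ (-2 : ℝ) / 2 := by field_simp; ring
    rw [h2]; linarith [show 0 ≤ K * (h ^ 2)⁻¹ * (N : ℝ) ^ (-2 : ℝ) from pos%]
  rw [← intervalIntegral.integral_add_adjacent_intervals (hint num% h3) (hint hX0 hN)]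
  have hl3 : ‖(log 3 : ℂ) * f 0‖ ≤ 2 * K := by
    rw [norm_mul, norm_real, norm_of_nonneg (Real.log_nonneg num%)]; gcongr
    · linarith [Real.log_le_sub_one_of_pos (num% : (0 : ℝ) < 3)]
    · exact hf.bdd 0
  calc _ = ‖((∫ x in (3 : ℝ)..h⁻¹, g x) - ∫ x in (3 : ℝ)..h⁻¹, ((x⁻¹ : ℝ) : ℂ) * f 0)
        + (∫ x in h⁻¹..(N : ℝ), g x) - (log 3 : ℂ) * f 0‖ := by
        rw [hlog]; congr 1; push_cast; ring
    _ ≤ 2 * K + K + 2 * K :=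
      (norm_sub_le _ _).trans (add_le_add ((norm_add_le _ _).trans (add_le_add hmain htail)) hl3)
    _ ≤ _ := lin%

end

end

section

/-! ### Smoothing by the Poisson kernel -/

/-- The Poisson kernel of width `y`, without the factor `π⁻¹`. -/
def poissonKer (y x : ℝ) : ℝ := y / (x ^ 2 + y ^ 2)

/-- The convolution of a test function with the normalized Poisson kernel. -/
def poissonSmooth (φ : ℝ → ℝ) (y x : ℝ) : ℝ := π⁻¹ * ∫ u, φ u * poissonKer y (x - u)

section

variable {y : ℝ}

lemma poissonKer_nonneg (hy : 0 < y) (x : ℝ) : 0 ≤ poissonKer y x := by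
  unfold poissonKer; positivity

lemma poissonKer_le (hy : 0 < y) (x : ℝ) : poissonKer y x ≤ 1 / y := by
  rw [poissonKer, div_le_div_iff₀ pos% hy]; nlinarith [sq_nonneg x]

lemma continuous_poissonKer (hy : 0 < y) : Continuous (poissonKer y) := by
  unfold poissonKer; exact continuous_const.div (by fun_prop) fun x => pos%

lemma poissonKer_mul (hy : 0 < y) (v : ℝ) : poissonKer y (y * v) = y⁻¹ * (1 + v ^ 2)⁻¹ := by
  rw [poissonKer]; field_simp; ring

lemma integral_mul_poissonKer (hy : 0 < y) (g : ℝ → ℝ) :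
    ∫ u, g u * poissonKer y u = ∫ v, g (y * v) * (1 + v ^ 2)⁻¹ := by
  have h := Measure.integral_comp_mul_left (fun u => g u * poissonKer y u) y
  rw [abs_of_pos (inv_pos.2 hy), smul_eq_mul] at h
  rw [← mul_right_inj' (inv_pos.2 hy).ne', ← h, ← integral_const_mul]
  refine integral_congr_ae (.of_forall fun v => ?_); simp only [poissonKer_mul hy]; ring

lemma integrable_poissonKer (hy : 0 < y) : Integrable (poissonKer y) := by
  rw [← integrable_comp_mul_left_iff (poissonKer y) hy.ne']
  exact (integrable_inv_one_add_sq.const_mul y⁻¹).congr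
    (.of_forall fun v => (poissonKer_mul hy v).symm)

lemma integral_poissonKer (hy : 0 < y) : ∫ u, poissonKer y u = π := by
  simpa [integral_univ_inv_one_add_sq] using integral_mul_poissonKer hy fun _ => 1

end

section

variable {φ : ℝ → ℝ} {C K y : ℝ}

lemma poissonSmooth_eq (φ : ℝ → ℝ) (y x : ℝ) :
    poissonSmooth φ y x = π⁻¹ * ∫ u, φ (x - u) * poissonKer y u := by
  rw [poissonSmooth, ← integral_sub_left_eq_self (fun u => φ u * poissonKer y (x - u)) volume x]
  simp only [sub_sub_cancel]

/-- For a Hölder function the smoothing error is of the order of the square root of the width. -/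
lemma abs_sub_poissonSmooth_le (hc : Continuous φ) (hb : ∀ x, |φ x| ≤ C)
    (hH : ∀ x u, |φ x - φ u| ≤ K * √|x - u|) (hy : 0 < y) (x : ℝ) :
    |φ x - poissonSmooth φ y x| ≤ K * (∫ v : ℝ, (1 + v ^ 2) ^ (-(3 / 4) : ℝ)) * √y := by
  have hK : 0 ≤ K := by
    have := (abs_nonneg _).trans (hH 1 0)
    simpa using this
  have hI := integrable_one_add_sq_rpow (p := 3 / 4) num%
  have hi1 : Integrable fun u => φ (x - u) * poissonKer y u :=
    (integrable_poissonKer hy).bdd_mul (c := C) (by fun_prop) (.of_forall fun u => hb _)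
  have e : φ x - poissonSmooth φ y x = π⁻¹ * ∫ v, (φ x - φ (x - y * v)) * (1 + v ^ 2)⁻¹ := by
    rw [← integral_mul_poissonKer hy fun u => φ x - φ (x - u), poissonSmooth_eq]
    simp only [sub_mul]
    rw [integral_sub ((integrable_poissonKer hy).const_mul _) hi1, integral_const_mul,
      integral_poissonKer hy, mul_sub]
    congr 1
    field_simp
  rw [e, abs_mul, abs_of_pos (inv_pos.2 pi_pos)]
  have h1 : |∫ v, (φ x - φ (x - y * v)) * (1 + v ^ 2)⁻¹|
    ≤ ∫ v : ℝ, K * √y * (1 + v ^ 2) ^ (-(3 / 4) : ℝ) := by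
    rw [← norm_eq_abs]; refine norm_integral_le_of_norm_le (hI.const_mul _) (.of_forall fun v => ?_)
    rw [norm_mul, norm_eq_abs, norm_of_nonneg pos%]
    calc _ ≤ K * √|x - (x - y * v)| * (1 + v ^ 2)⁻¹ := by gcongr; exact hH _ _
      _ = K * √y * (√|v| / (1 + v ^ 2)) := by
        rw [sub_sub_cancel, abs_mul, abs_of_pos hy, sqrt_mul hy.le]; ring
      _ ≤ _ := by gcongr; exact sqrt_abs_mul_le v
  rw [integral_const_mul] at h1
  have h2 : 0 ≤ ∫ v : ℝ, (1 + v ^ 2) ^ (-(3 / 4) : ℝ) := integral_nonneg fun v => pos%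
  calc _ ≤ 1 * (K * √y * ∫ v : ℝ, (1 + v ^ 2) ^ (-(3 / 4) : ℝ)) := by
        gcongr
        exact inv_le_one_of_one_le₀ (by linarith [pi_gt_three])
    _ = _ := by ring

/-- Smoothing at scale at most one preserves quadratic decay. -/
lemma abs_poissonSmooth_le (hb : ∀ x, |φ x| ≤ C / (1 + x ^ 2)) (hy : 0 < y) (hy1 : y ≤ 1)
    (x : ℝ) : |poissonSmooth φ y x| ≤ 16 * C / (1 + x ^ 2) := by
  have hC : 0 ≤ C := by simpa using (abs_nonneg _).trans (hb 0)
  have hi : Integrable fun u => poissonKer y (x - u) := (integrable_poissonKer hy).comp_sub_left x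
  have hpt : ∀ u, |φ u * poissonKer y (x - u)|
    ≤ 8 * C / (1 + x ^ 2) * (poissonKer y (x - u) + (1 + u ^ 2)⁻¹) := by
    intro u
    have hp := poissonKer_nonneg hy (x - u)
    have hu : 0 ≤ (1 + u ^ 2)⁻¹ := pos%
    rw [abs_mul, abs_of_nonneg hp]; refine (mul_le_mul_of_nonneg_right (hb u) hp).trans ?_
    rw [mul_add]
    by_cases h : 1 + x ^ 2 ≤ 8 * (1 + u ^ 2)
    · have h1 : C / (1 + u ^ 2) ≤ 8 * C / (1 + x ^ 2) := by
        rw [div_le_div_iff₀ pos% pos%]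
        calc C * (1 + x ^ 2) ≤ C * (8 * (1 + u ^ 2)) := mono%
          _ = _ := by ring
      exact le_add_of_le_of_nonneg mono% pos%
    · have h1 : poissonKer y (x - u) ≤ 8 / (1 + x ^ 2) := by
        rw [poissonKer, div_le_div_iff₀ pos% pos%]
        have h2 : 1 + x ^ 2 ≤ 8 * (x - u) ^ 2 := by nlinarith [sq_nonneg (x - 2 * u)]
        calc y * (1 + x ^ 2) ≤ 1 * (8 * (x - u) ^ 2) := mono%
          _ ≤ _ := by linarith [sq_nonneg y]
      have h3 : C / (1 + u ^ 2) * poissonKer y (x - u) ≤ C / (1 + u ^ 2) * (8 / (1 + x ^ 2)) := by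
        gcongr
      refine le_add_of_nonneg_of_le pos% (h3.trans (le_of_eq ?_)); rw [div_eq_mul_inv C]; ring
  rw [poissonSmooth, abs_mul, abs_of_pos (inv_pos.2 pi_pos)]
  have h := norm_integral_le_of_norm_le (f := fun u => φ u * poissonKer y (x - u)) (((hi.add integrable_inv_one_add_sq).const_mul
    (8 * C / (1 + x ^ 2)))) (.of_forall hpt)
  have e : ∫ u, poissonKer y (x - u) = π := by
    rw [integral_sub_left_eq_self (poissonKer y) volume x, integral_poissonKer hy]
  simp only [Pi.add_apply] at h
  rw [integral_const_mul, integral_add hi integrable_inv_one_add_sq, e,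
    integral_univ_inv_one_add_sq] at h
  calc _ ≤ π⁻¹ * (8 * C / (1 + x ^ 2) * (π + π)) := by gcongr; exact h
    _ = _ := by field_simp; ring

/-- The smoothing error at scale `R⁻⁴` is dominated by a small multiple of a wide Poisson
kernel. -/
lemma exists_abs_sub_poissonSmooth_le (hc : Continuous φ)
    (hb : ∀ x, |φ x| ≤ C / (1 + x ^ 2)) (hH : ∀ x u, |φ x - φ u| ≤ K * √|x - u|) :
    ∃ A, 0 < A ∧ ∀ R : ℝ, 1 ≤ R → ∀ x,
      |φ x - poissonSmooth φ (R ^ 4)⁻¹ x| ≤ A / R * poissonKer R x := by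
  have hC : 0 ≤ C := by simpa using (abs_nonneg _).trans (hb 0)
  have hb' : ∀ x, |φ x| ≤ C := fun x => (hb x).trans (div_le_self hC (by linarith [sq_nonneg x]))
  set J := |K * ∫ v : ℝ, (1 + v ^ 2) ^ (-(3 / 4) : ℝ)|
  refine ⟨2 * J + 34 * C + 1, pos%, fun R hR x => ?_⟩
  have hR0 : 0 < R := lin%
  have e : (2 * J + 34 * C + 1) / R * poissonKer R x
    = (2 * J + 34 * C + 1) / (x ^ 2 + R ^ 2) := by rw [poissonKer]; field_simp
  rw [e]
  rcases le_or_gt (x ^ 2) (R ^ 2) with h | h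
  · have h1 := abs_sub_poissonSmooth_le hc hb' hH (y := (R ^ 4)⁻¹) pos% x
    have h2 : √(R ^ 4)⁻¹ = (R ^ 2)⁻¹ := by
      rw [sqrt_inv, show R ^ 4 = (R ^ 2) ^ 2 by ring, sqrt_sq pos%]
    rw [h2] at h1
    calc _ ≤ J * (R ^ 2)⁻¹ := h1.trans (by gcongr; exact le_abs_self _)
      _ = 2 * J / (R ^ 2 + R ^ 2) := by field_simp; ring
      _ ≤ _ := by gcongr; linarith
  · have h1 := abs_poissonSmooth_le hb (y := (R ^ 4)⁻¹) pos%
      (inv_le_one_of_one_le₀ (one_le_pow₀ hR)) x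
    calc _ ≤ |φ x| + |poissonSmooth φ (R ^ 4)⁻¹ x| := abs_sub _ _
      _ ≤ C / (1 + x ^ 2) + 16 * C / (1 + x ^ 2) := add_le_add (hb x) h1
      _ = 34 * C / ((1 + x ^ 2) + (1 + x ^ 2)) := by field_simp; ring
      _ ≤ _ := by
        gcongr
        · linarith [show 0 ≤ J from abs_nonneg _]
        · linarith
        · linarith

end

end

section

/-! ### The mean density of states -/

variable {d L : ℕ} [NeZero L] {W e y : ℝ} (s : SymmetryClass)

/-- The eigenvalue density of `H / 2` smoothed by the Poisson kernel of width `y` at energy `e`. -/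
def poissonAvg (W e y : ℝ) (a : Sample d L) : ℝ :=
  ((L : ℝ) ^ d)⁻¹ * ∑ i, poissonKer y ((halfBandMatrix_isHermitian W a).eigenvalues i - e)

/-- The expectation of `poissonAvg`, expressed by the averaged resolvent of `H`. -/
def poissonMean (s : SymmetryClass) (d L : ℕ) [NeZero L] (W e y : ℝ) : ℝ :=
  2 * (meanGreen s d L W (2 * (e + y * I))).im

lemma poissonAvg_eq (hy : 0 < y) (a : Sample d L) : poissonAvg W e y a = ((L : ℝ) ^ d)⁻¹
      * ∑ x, 2 * (green (bandMatrix W a) (2 * (e + y * I)) x x).im := by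
  set w : ℂ := e + y * I with hw
  have hwi : w.im = y := by simp [hw]
  have h2w : 0 < (2 * w).im := by simpa [hwi] using hy
  have hg : green (halfBandMatrix W a) w = (2 : ℂ) • green (bandMatrix W a) (2 * w) := by
    refine Matrix.inv_eq_right_inv ?_
    have h := mul_green (bandMatrix_isHermitian W a) h2w.ne'
    have e1 : halfBandMatrix W a - w • (1 : Matrix _ _ ℂ)
      = (2⁻¹ : ℂ) • (bandMatrix W a - (2 * w) • (1 : Matrix _ _ ℂ)) := by
      rw [smul_sub, smul_smul, inv_mul_cancel_left₀ two_ne_zero]; congr 1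
      ext x z; simp [halfBandMatrix, div_eq_inv_mul]
    rw [e1, Matrix.smul_mul, Matrix.mul_smul, h, smul_smul, inv_mul_cancel₀ two_ne_zero, one_smul]
  have ht := congrArg im (trace_green (halfBandMatrix_isHermitian W a) (hwi.symm ▸ hy.ne' : w.im ≠ 0))
  rw [poissonAvg]; congr 1
  rw [hg, Matrix.trace_smul, Matrix.trace, im_sum, smul_eq_mul, mul_sum, im_sum] at ht
  calc _ = ∑ i, (((halfBandMatrix_isHermitian W a).eigenvalues i : ℂ) - w)⁻¹.im := by
        refine sum_congr rfl fun i _ => ?_; rw [Complex.inv_im, normSq_apply, poissonKer]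
        simp [hw, pow_two]
    _ = _ := by rw [← ht]; exact sum_congr rfl fun x _ => by simp

lemma card_torus (d L : ℕ) [NeZero L] : (card (Torus d L) : ℝ) = (L : ℝ) ^ d := by
  simp [ZMod.card]

lemma poissonAvg_nonneg (hy : 0 < y) (a : Sample d L) : 0 ≤ poissonAvg W e y a :=
  mul_nonneg pos% (sum_nonneg fun _ _ => poissonKer_nonneg hy _)

lemma poissonAvg_le (hy : 0 < y) (a : Sample d L) : poissonAvg W e y a ≤ 1 / y := by
  have hL : (0 : ℝ) < (L : ℝ) ^ d := by
    have : (0 : ℝ) < L := mod_cast NeZero.pos L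
    positivity
  have h := sum_le_sum fun i (_ : i ∈ univ) =>
    poissonKer_le hy ((halfBandMatrix_isHermitian W a).eigenvalues i - e)
  rw [sum_const, card_univ, nsmul_eq_mul, card_torus] at h; rw [poissonAvg, inv_mul_le_iff₀ hL]
  exact h

lemma measurable_poissonAvg (hy : 0 < y) :
    Measurable fun p : Sample d L × ℝ => poissonAvg W p.2 y p.1 := by
  simp only [poissonAvg_eq hy]
  refine measurable_const.mul (Finset.measurable_sum _ fun x _ => measurable_const.mul
    (measurable_im.comp ?_))
  have hc : Continuous (fun p : Sample d L × ℝ =>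
    bandMatrix W p.1 - (2 * ((p.2 : ℂ) + y * I)) • (1 : Matrix _ _ ℂ)) :=
    ((continuous_bandMatrix W).comp continuous_fst).sub (by fun_prop)
  simp only [green, Matrix.inv_def, Ring.inverse_eq_inv']
  exact hc.matrix_det.measurable.inv.mul (hc.matrix_adjugate.matrix_elem x x).measurable

lemma integrable_poissonAvg (hy : 0 < y) :
    Integrable (fun a => poissonAvg W e y a) (sampleLaw s d L) := by
  have hm : Measurable fun a : Sample d L => poissonAvg W e y a := by
    simp only [poissonAvg_eq hy]
    exact measurable_const.mul (Finset.measurable_sum _ fun x _ => measurable_const.mul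
      (measurable_im.comp (measurable_green W _ x x)))
  refine Integrable.of_bound hm.aestronglyMeasurable (1 / y) (.of_forall fun a => ?_)
  rw [norm_of_nonneg (poissonAvg_nonneg hy a)]; exact poissonAvg_le hy a

lemma integral_poissonAvg (hy : 0 < y) :
    ∫ a, poissonAvg W e y a ∂(sampleLaw s d L) = poissonMean s d L W e y := by
  have hz : 0 < (2 * ((e : ℂ) + y * I)).im := by simpa using hy
  have hL : (L : ℝ) ^ d ≠ 0 := by
    have : (L : ℝ) ≠ 0 := mod_cast NeZero.ne L
    positivity
  simp only [poissonAvg_eq hy]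
  rw [integral_const_mul, integral_finsetSum _ fun x _ =>
    (integrable_green_im s hz x x).const_mul 2]
  simp only [integral_const_mul, integral_im_green_diag s hz]
  rw [sum_const, card_univ, nsmul_eq_mul, card_torus, ← mul_assoc,
    inv_mul_cancel₀ hL, one_mul, poissonMean]

lemma poissonMean_mem (hy : 0 < y) : poissonMean s d L W e y ∈ Set.Icc 0 (1 / y) := by
  rw [← integral_poissonAvg s hy]; refine ⟨integral_nonneg fun a => poissonAvg_nonneg hy a, ?_⟩
  refine (integral_mono (integrable_poissonAvg s hy) (integrable_const (1 / y))
    fun a => poissonAvg_le hy a).trans (le_of_eq ?_)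
  simp

lemma exists_poissonMean_sub_le {κ : ℝ} (hκ : 0 < κ) :
    ∃ C, 0 < C ∧ ∀ (s : SymmetryClass) (d L : ℕ) [NeZero L] (W e y : ℝ),
      e ∈ bulk κ → 0 < y → y ≤ 1 / 2 → 30 ≤ (bandM d L W : ℝ) * y ^ 3 →
      |poissonMean s d L W e y - 2 * √(1 - e ^ 2)| ≤ C * (1 / ((bandM d L W : ℝ) * y ^ 3) + y) := by
  refine ⟨2160 / √κ, pos%, fun s d L _ W e y he hy hy2 hM => ?_⟩
  have h := abs_im_meanGreen_sub_le s (d := d) (L := L) (W := W)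
    (z := 2 * ((e : ℂ) + y * I)) (by simpa using hy) (by simp; linarith)
    (by simp [abs_mul]; exact abs_lt.2 ⟨by linarith [he.1], by linarith [he.2]⟩)
    (by simp; linarith [show (bandM d L W : ℝ) * (2 * y) ^ 3 = 8 * (bandM d L W * y ^ 3) by ring])
  have e1 : (2 * ((e : ℂ) + y * I)).im = 2 * y := by simp
  have e2 : √(4 - (2 * ((e : ℂ) + y * I)).re ^ 2) = 2 * √(1 - e ^ 2) := by
    rw [show 4 - (2 * ((e : ℂ) + y * I)).re ^ 2 = 2 ^ 2 * (1 - e ^ 2) by simp; ring,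
      sqrt_mul num%, sqrt_sq num%]
  rw [e1, e2] at h
  have hs := sqrt_le_of_mem_bulk hκ he
  have hs0 : 0 < √κ := sqrt_pos.2 hκ
  set q := √(1 - e ^ 2)
  set M : ℝ := (bandM d L W : ℝ)
  set p := M * y ^ 3 with hp
  have hp0 : 0 < p := lin%
  rw [show M * (2 * y) ^ 3 = 8 * p by rw [hp]; ring] at h
  rw [poissonMean]
  set g := (meanGreen s d L W (2 * ((e : ℂ) + y * I))).im
  calc |2 * g - 2 * q| = 2 * |g - 2 * q / 2| := by
        rw [mul_div_cancel_left₀ _ two_ne_zero, ← mul_sub, abs_mul, abs_two]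
    _ ≤ 2 * ((17280 / (8 * p) + 16 * (2 * y)) / (2 * q)) := mono%
    _ = (2160 * (1 / p) + 32 * y) / q := by
      have : 0 < q := hs0.trans_le hs
      field_simp; ring
    _ ≤ (2160 * (1 / p) + 2160 * y) / √κ := by gcongr; norm_num
    _ = _ := by ring

/-- Rescaling: the density seen through `poissonKer` at scale `η`. -/
lemma scaled_poissonKer {η : ℝ} (hη : 0 < η) (r lam E u : ℝ) :
    η⁻¹ * poissonKer r (η⁻¹ * (lam - E) - u) = poissonKer (η * r) (lam - (E + η * u)) := by
  have h : η⁻¹ * (lam - E) - u = η⁻¹ * (lam - (E + η * u)) := by field_simp; ring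
  rw [h, poissonKer, poissonKer]; field_simp

section

variable {φ : ℝ → ℝ} {η r E : ℝ}

lemma localDensity_poissonSmooth (hφ : Integrable φ) (hη : 0 < η) (hr : 0 < r) (a : Sample d L) :
    localDensity W η (poissonSmooth φ r) E a
      = π⁻¹ * ∫ u, φ u * poissonAvg W (E + η * u) (η * r) a := by
  have hi : ∀ lam : ℝ, Integrable fun u => φ u * poissonKer (η * r) (lam - (E + η * u)) := fun lam =>
    hφ.mul_bdd (c := 1 / (η * r)) ((continuous_poissonKer pos%).comp
      (by fun_prop)).aestronglyMeasurable (.of_forall fun u => by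
        rw [norm_of_nonneg (poissonKer_nonneg pos% _)]
        exact poissonKer_le pos% _)
  have hsum : ∀ u, φ u * poissonAvg W (E + η * u) (η * r) a = ((L : ℝ) ^ d)⁻¹
    * ∑ i, φ u * poissonKer (η * r)
      ((halfBandMatrix_isHermitian W a).eigenvalues i - (E + η * u)) := fun u => by
    rw [poissonAvg, ← mul_sum]; ring
  simp only [hsum]
  rw [integral_const_mul, integral_finsetSum _ fun i _ => hi _, localDensity, mul_left_comm,
    mul_sum _ _ (π⁻¹)]
  congr 1
  refine sum_congr rfl fun i _ => ?_; rw [poissonSmooth, mul_left_comm, ← integral_const_mul]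
  congr 2
  ext u; rw [← scaled_poissonKer hη]; ring

lemma integrable_mul_poissonAvg (hφ : Integrable φ) (hη : 0 < η) (hr : 0 < r) :
    Integrable (fun p : Sample d L × ℝ => φ p.2 * poissonAvg W (E + η * p.2) (η * r) p.1)
      ((sampleLaw s d L).prod volume) := by
  have hy : 0 < η * r := pos%
  refine (hφ.comp_snd (sampleLaw s d L)).mul_bdd (c := 1 / (η * r))
    ((measurable_poissonAvg hy).comp (g := fun p : Sample d L × ℝ => poissonAvg W p.2 (η * r) p.1)
      (f := fun p : Sample d L × ℝ => (p.1, E + η * p.2)) (by fun_prop)).aestronglyMeasurable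
    (.of_forall fun p => ?_)
  rw [norm_of_nonneg (poissonAvg_nonneg hy _)]; exact poissonAvg_le hy _

lemma integral_localDensity_poissonSmooth (hφ : Integrable φ) (hη : 0 < η) (hr : 0 < r) :
    ∫ a, localDensity W η (poissonSmooth φ r) E a ∂(sampleLaw s d L)
      = π⁻¹ * ∫ u, φ u * poissonMean s d L W (E + η * u) (η * r) := by
  simp only [localDensity_poissonSmooth hφ hη hr]
  rw [integral_const_mul, integral_integral_swap (integrable_mul_poissonAvg s hφ hη hr)]
  simp only [integral_const_mul, integral_poissonAvg s (pos% : 0 < η * r)]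

lemma integrable_localDensity_poissonSmooth (hφ : Integrable φ) (hη : 0 < η) (hr : 0 < r) :
    Integrable (fun a => localDensity W η (poissonSmooth φ r) E a) (sampleLaw s d L) := by
  simp only [localDensity_poissonSmooth hφ hη hr]
  exact (integrable_mul_poissonAvg s hφ hη hr).integral_prod_left.const_mul _

lemma abs_localDensity_sub_le {ψ : ℝ → ℝ} {A : ℝ} (hη : 0 < η)
    (h : ∀ x, |φ x - ψ x| ≤ A * poissonKer r x) (a : Sample d L) :
    |localDensity W η φ E a - localDensity W η ψ E a| ≤ A * poissonAvg W E (η * r) a := by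
  rw [localDensity, localDensity, poissonAvg, ← mul_sub, ← sum_sub_distrib, abs_mul,
    abs_of_nonneg pos%, mul_left_comm]
  refine mul_le_mul_of_nonneg_left ?_ pos%; rw [mul_sum]
  refine (abs_sum_le_sum_abs _ _).trans (sum_le_sum fun i _ => ?_)
  rw [← mul_sub, abs_mul, abs_of_pos (inv_pos.2 hη)]
  have := scaled_poissonKer hη r ((halfBandMatrix_isHermitian W a).eigenvalues i) E 0
  rw [mul_zero, add_zero, sub_zero] at this; rw [← this, mul_left_comm]; gcongr
  exact h _

/-- The local density is an integrable function of the sample, as a uniform limit of Poisson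
smoothings. -/
lemma integrable_localDensity {A : ℝ} (hφ : Integrable φ) (hη : 0 < η)
    (h : ∀ R : ℝ, 1 ≤ R → ∀ x, |φ x - poissonSmooth φ (R ^ 4)⁻¹ x| ≤ A / R * poissonKer R x) :
    Integrable (fun a => localDensity W η φ E a) (sampleLaw s d L) := by
  have hA : 0 ≤ A := by
    have := (abs_nonneg _).trans (h 1 le_rfl 0)
    rw [poissonKer] at this; simpa using this
  have hR : ∀ n : ℕ, (1 : ℝ) ≤ n + 1 := fun n => by linarith [(cast_nonneg n : (0 : ℝ) ≤ n)]
  have hbd : ∀ (n : ℕ) (a : Sample d L), |localDensity W η φ E a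
    - localDensity W η (poissonSmooth φ (((n : ℝ) + 1) ^ 4)⁻¹) E a| ≤ A * η⁻¹ * (1 / (n + 1)) := by
    intro n a
    have hn := hR n
    refine (abs_localDensity_sub_le hη (h _ hn) a).trans ?_
    calc _ ≤ A / (n + 1) * (1 / (η * (n + 1))) := by
          gcongr
          exact poissonAvg_le pos% a
      _ = A * η⁻¹ * (1 / (n + 1)) * (1 / (n + 1)) := by field_simp
      _ ≤ _ := mul_le_of_le_one_right pos% (by rw [div_le_one lin%]; exact hn)
  have hI : ∀ n : ℕ, Integrable (fun a => localDensity W η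
    (poissonSmooth φ (((n : ℝ) + 1) ^ 4)⁻¹) E a) (sampleLaw s d L) := fun n =>
    integrable_localDensity_poissonSmooth s hφ hη pos%
  have hm : AEStronglyMeasurable (fun a => localDensity W η φ E a) (sampleLaw s d L) := by
    refine aestronglyMeasurable_of_tendsto_ae atTop (fun n => (hI n).1) (.of_forall fun a => ?_)
    rw [tendsto_iff_dist_tendsto_zero]
    refine squeeze_zero (fun _ => dist_nonneg) (fun n => ?_)
      (by simpa using (tendsto_one_div_add_atTop_nhds_zero_nat (𝕜 := ℝ)).const_mul (A * η⁻¹))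
    rw [dist_comm, Real.dist_eq]; simpa only [one_div] using hbd n a
  have hd : Integrable (fun a => localDensity W η φ E a
    - localDensity W η (poissonSmooth φ ((((0 : ℕ) : ℝ) + 1) ^ 4)⁻¹) E a) (sampleLaw s d L) :=
    Integrable.of_bound (hm.sub (hI 0).1) _ (.of_forall fun a => hbd 0 a)
  exact (hd.add (hI 0)).congr (.of_forall fun a => by simp)

end

end

/-! ### The mean density of a test function -/

/-- The test functions of the theorem: the Cauchy kernel and rapidly decaying functions. -/
structure IsAdmissible (φ : ℝ → ℝ) : Prop extends IsTestFunction φ where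
  decay : IsCauchyKernel φ ∨ HasRapidDecay φ

lemma HasRapidDecay.exists_quartic_decay {φ : ℝ → ℝ} (h : HasRapidDecay φ) :
    ∃ C, 0 < C ∧ ∀ u, |φ u| * (1 + u ^ 2) ≤ C * (1 + u ^ 2)⁻¹ := by
  obtain ⟨C, hC⟩ := h 4 num%
  refine ⟨2 * (|C| + 1), pos%, fun u => ?_⟩
  have e : |u| ^ (4 : ℝ) = (u ^ 2) ^ 2 := by
    rw [show (4 : ℝ) = ((4 : ℕ) : ℝ) from num%, rpow_natCast, ← sq_abs u]; ring
  have h1 : |φ u| ≤ (|C| + 1) / (1 + (u ^ 2) ^ 2) := by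
    refine (hC u).trans ?_; rw [e]; gcongr
    linarith [le_abs_self C]
  rw [← div_eq_mul_inv, le_div_iff₀ pos%, mul_assoc]
  calc |φ u| * ((1 + u ^ 2) * (1 + u ^ 2))
        ≤ (|C| + 1) / (1 + (u ^ 2) ^ 2) * (2 * (1 + (u ^ 2) ^ 2)) :=
          mul_le_mul h1 (by nlinarith [sq_nonneg (u ^ 2 - 1)]) pos% pos%
    _ = _ := by field_simp

lemma abs_sqrt_sub_sqrt_le {κ E e : ℝ} (hκ : 0 < κ) (hE : E ∈ bulk κ)
    (he : |e| ≤ 1) : |√(1 - e ^ 2) - ς E| ≤ 2 / √κ * |e - E| := by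
  have hs := sqrt_le_of_mem_bulk hκ hE
  have hκ0 : 0 < √κ := sqrt_pos.2 hκ
  rw [abs_le] at he
  have ha : √(1 - e ^ 2) ^ 2 = 1 - e ^ 2 := sq_sqrt (by nlinarith)
  have hb : ς E ^ 2 = 1 - E ^ 2 := sq_sqrt (by nlinarith [hE.1, hE.2])
  have ha0 := sqrt_nonneg (1 - e ^ 2)
  set p := √(1 - e ^ 2)
  set q := ς E
  have h1 : |p - q| * (p + q) = |e - E| * |e + E| := by
    rw [← abs_of_nonneg (lin% : 0 ≤ p + q), ← abs_mul, ← abs_mul,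
      show (p - q) * (p + q) = p ^ 2 - q ^ 2 by ring, ha, hb, ← abs_neg]
    congr 1; ring
  have h2 : |e + E| ≤ 2 := abs_le.2 ⟨by linarith [hE.1], by linarith [hE.2]⟩
  rw [div_mul_eq_mul_div, le_div_iff₀ hκ0]
  calc |p - q| * √κ ≤ |p - q| * (p + q) := by gcongr; linarith
    _ = |e - E| * |e + E| := h1
    _ ≤ |e - E| * 2 := mono%
    _ = _ := mul_comm _ _

/-- The Poisson mean at a displaced energy, uniformly in the displacement. Far outside the bulk
only the trivial bound `1 / y` is available, at the price of a quadratic weight. -/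
lemma exists_poissonMean_displaced_le {κ : ℝ} (hκ : 0 < κ) :
    ∃ C, 0 < C ∧ ∀ (s : SymmetryClass) (d L : ℕ) [NeZero L] (W E η r u : ℝ),
      E ∈ bulk κ → 0 < η → 0 < r → r ≤ 1 → η * r ≤ 1 / 2 →
      30 ≤ (bandM d L W : ℝ) * (η * r) ^ 3 →
      |poissonMean s d L W (E + η * u) (η * r) - 2 * ς E|
        ≤ C * (1 / ((bandM d L W : ℝ) * (η * r) ^ 3) + η / r) * (1 + u ^ 2) := by
  obtain ⟨C, hC, h⟩ := exists_poissonMean_sub_le (half_pos hκ)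
  refine ⟨C + 4 / √κ + 8 / κ ^ 2, pos%, fun s d L _ W E η r u hE hη hr hr1 hy hM => ?_⟩
  set M : ℝ := (bandM d L W : ℝ)
  have hy0 : 0 < η * r := pos%
  set p := 1 / (M * (η * r) ^ 3)
  have hp0 : 0 < p := pos%
  have hηr : η * r ≤ η / r := by
    rw [le_div_iff₀ hr, mul_assoc]; exact mul_le_of_le_one_right hη.le (mul_le_one₀ hr1 hr.le hr1)
  have hηr' : η ≤ η / r := by rw [le_div_iff₀ hr]; exact mul_le_of_le_one_right hη.le hr1
  have hu1 : |u| ≤ 1 + u ^ 2 := by rw [← sq_abs]; nlinarith [sq_nonneg (|u| - 1), abs_nonneg u]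
  have h1u : 1 ≤ 1 + u ^ 2 := by linarith [sq_nonneg u]
  have hS0 := sqrt_nonneg (1 - E ^ 2)
  rcases le_or_gt (η * |u|) (κ / 2) with hu | hu
  · have hu' : |η * u| ≤ κ / 2 := by rwa [abs_mul, abs_of_pos hη]
    rw [abs_le] at hu'
    have he : E + η * u ∈ Set.Icc (-1 + κ / 2) (1 - κ / 2) :=
      ⟨by linarith [hE.1], by linarith [hE.2]⟩
    have h1 := h s d L W (E + η * u) (η * r) he hy0 hy hM
    have h2 := abs_sqrt_sub_sqrt_le hκ hE (e := E + η * u)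
      (abs_le.2 ⟨by linarith [he.1], by linarith [he.2]⟩)
    rw [add_sub_cancel_left, abs_mul, abs_of_pos hη] at h2
    set m := poissonMean s d L W (E + η * u) (η * r)
    set a := √(1 - (E + η * u) ^ 2)
    set b := ς E
    calc |m - 2 * b| = |(m - 2 * a) + 2 * (a - b)| := by congr 1; ring
      _ ≤ |m - 2 * a| + 2 * |a - b| := by
        refine (abs_add_le _ _).trans (le_of_eq ?_); rw [abs_mul, abs_two]
      _ ≤ C * (p + η * r) + 2 * (2 / √κ * (η * |u|)) := mono%
      _ ≤ C * (p + η / r) * (1 + u ^ 2) + 2 * (2 / √κ * (η / r * (1 + u ^ 2))) := by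
        have h3 : C * (p + η * r) ≤ C * (p + η / r) * (1 + u ^ 2) :=
          (mul_le_mul_of_nonneg_left lin% hC.le).trans (le_mul_of_one_le_right pos% h1u)
        refine add_le_add h3 ?_; gcongr
      _ = C * (p + η / r) * (1 + u ^ 2) + 4 / √κ * (η / r) * (1 + u ^ 2) := by ring
      _ ≤ C * (p + η / r) * (1 + u ^ 2) + 4 / √κ * (p + η / r) * (1 + u ^ 2)
        + 8 / κ ^ 2 * (p + η / r) * (1 + u ^ 2) := by
        have : η / r ≤ p + η / r := lin%
        have h3 : 0 ≤ 8 / κ ^ 2 * (p + η / r) * (1 + u ^ 2) := pos%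
        refine le_add_of_le_of_nonneg ?_ h3; gcongr
      _ = _ := by ring
  · have hm := poissonMean_mem s (d := d) (L := L) (W := W) (e := E + η * u) hy0
    have hb1 : ς E ≤ 1 := sqrt_le_one.2 (by linarith [sq_nonneg E])
    have h2 : (2 : ℝ) ≤ 1 / (η * r) := by rw [le_div_iff₀ hy0]; linarith
    have h3 : κ ^ 2 ≤ 4 * η ^ 2 * u ^ 2 := by
      rw [← sq_abs u]
      calc κ ^ 2 = (2 * (κ / 2)) ^ 2 := by ring
        _ ≤ (2 * (η * |u|)) ^ 2 := mono%
        _ = _ := by ring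
    calc _ ≤ 1 / (η * r) := abs_le.2 ⟨by linarith [hm.1], by linarith [hm.2]⟩
      _ = κ ^ 2 * (1 / κ ^ 2 / (η * r)) := by field_simp
      _ ≤ 4 * η ^ 2 * u ^ 2 * (1 / κ ^ 2 / (η * r)) := mono%
      _ = 4 / κ ^ 2 * (η / r) * u ^ 2 := by field_simp
      _ ≤ (C + 4 / √κ + 8 / κ ^ 2) * (p + η / r) * (1 + u ^ 2) := by
        have : 4 / κ ^ 2 ≤ 8 / κ ^ 2 := by gcongr; norm_num
        have : 0 < 4 / √κ := pos%
        gcongr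
        · linarith
        · linarith
        · linarith

lemma localDensity_cauchy {φ : ℝ → ℝ} (h : IsCauchyKernel φ) {d L : ℕ} [NeZero L] {W η E : ℝ}
    (hη : 0 < η) (a : Sample d L) : localDensity W η φ E a = 2 * poissonAvg W E η a := by
  rw [localDensity, poissonAvg, mul_left_comm, mul_sum _ _ (2 : ℝ)]; congr 1
  refine sum_congr rfl fun i _ => ?_; rw [h, poissonKer]; field_simp

/-- Quantitative form of the convergence of the mean density. The scale `R` is a free parameter:
the test function is smoothed by a Poisson kernel of width `R⁻⁴`, and the error is controlled by
one of width `R`. -/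
lemma exists_abs_meanDensity_sub_le {φ : ℝ → ℝ} (hφ : IsAdmissible φ) {κ : ℝ} (hκ : 0 < κ) :
    ∃ C, 0 < C ∧ ∀ (s : SymmetryClass) (d L : ℕ) [NeZero L] (W E η R : ℝ),
      E ∈ bulk κ → 0 < η → 1 ≤ R → η * R ≤ 1 / 2 →
      30 ≤ (bandM d L W : ℝ) * (η * (R ^ 4)⁻¹) ^ 3 →
      |meanDensity s d L W η φ E - semicircle E * ∫ x, φ x|
        ≤ C * (1 / R + (1 / ((bandM d L W : ℝ) * (η * (R ^ 4)⁻¹) ^ 3) + η * R ^ 4)) := by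
  obtain ⟨C1, hC1, h₁⟩ := exists_poissonMean_displaced_le hκ
  obtain ⟨D, hD, hdec⟩ := exists_quadratic_decay hφ.decay
  obtain ⟨Λ, hΛ, hlip⟩ := hφ.exists_lipschitz
  have hfin : ∀ {R : ℝ}, 1 ≤ R → 0 < (R ^ 4)⁻¹ ∧ (R ^ 4)⁻¹ ≤ 1 := fun hR =>
    ⟨pos%, inv_le_one_of_one_le₀ (one_le_pow₀ hR)⟩
  rcases hφ.decay with hd | hd
  · refine ⟨2 * C1, pos%, fun s d L _ W E η R hE hη hR hηR hM => ?_⟩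
    obtain ⟨hr0, hr1⟩ := hfin hR
    have hη2 : η ≤ 1 / 2 := le_trans (le_mul_of_one_le_right hη.le hR) hηR
    have hηr : η * (R ^ 4)⁻¹ ≤ η := mul_le_of_le_one_right hη.le hr1
    have hMη : (bandM d L W : ℝ) * (η * (R ^ 4)⁻¹) ^ 3 ≤ bandM d L W * (η * 1) ^ 3 := by
      rw [mul_one]; gcongr
    have h := h₁ s d L W E η 1 0 hE hη one_pos le_rfl lin% (hM.trans hMη)
    have hint : ∫ x, φ x = 2 * π := by
      rw [show φ = fun x : ℝ => 2 * (1 + x ^ 2)⁻¹ by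
        ext x; rw [hd, div_eq_mul_inv, add_comm], integral_const_mul, integral_univ_inv_one_add_sq]
    have e : meanDensity s d L W η φ E = 2 * poissonMean s d L W E η := by
      simp only [meanDensity, localDensity_cauchy hd hη]
      rw [integral_const_mul, integral_poissonAvg s hη]
    rw [e, hint, semicircle, show 2 * poissonMean s d L W E η - 2 / π * ς E * (2 * π)
      = 2 * (poissonMean s d L W E η - 2 * ς E) by field_simp, abs_mul, abs_two]
    simp only [mul_zero, add_zero, zero_pow two_ne_zero, mul_one, div_one] at h hMη
    have hR1 : 0 ≤ 1 / R := pos%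
    have hηR4 : η ≤ η * R ^ 4 := le_mul_of_one_le_right hη.le (one_le_pow₀ hR)
    have hi : 1 / ((bandM d L W : ℝ) * η ^ 3) ≤ 1 / (bandM d L W * (η * (R ^ 4)⁻¹) ^ 3) :=
      one_div_le_one_div_of_le lin% hMη
    calc _ ≤ 2 * (C1 * (1 / ((bandM d L W : ℝ) * η ^ 3) + η)) := mono%
      _ ≤ 2 * (C1 * (1 / R + (1 / (bandM d L W * (η * (R ^ 4)⁻¹) ^ 3) + η * R ^ 4))) := by
        have hle : 1 / ((bandM d L W : ℝ) * η ^ 3) + η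
          ≤ 1 / R + (1 / (bandM d L W * (η * (R ^ 4)⁻¹) ^ 3) + η * R ^ 4) := lin%
        exact mul_le_mul_of_nonneg_left (mul_le_mul_of_nonneg_left hle hC1.le) two_pos.le
      _ = _ := by ring
  · obtain ⟨Q, hQ, hquart⟩ := hd.exists_quartic_decay
    have hD0 : ∀ x, |φ x| ≤ D := fun x =>
      (hdec x).trans (div_le_self hD.le (by linarith [sq_nonneg x]))
    have hH : ∀ x u, |φ x - φ u| ≤ (2 * D + Λ) * √|x - u| := by
      intro x u
      rcases le_or_gt |x - u| 1 with h | h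
      · have h1 : |x - u| ≤ √|x - u| := Real.le_sqrt_of_sq_le (by
          rw [pow_two]; exact mul_le_of_le_one_left (abs_nonneg _) h)
        calc _ ≤ Λ * |x - u| := hlip x u
          _ ≤ (2 * D + Λ) * √|x - u| := by gcongr; linarith
      · have h1 : 1 ≤ √|x - u| := one_le_sqrt.2 h.le
        calc _ ≤ |φ x| + |φ u| := abs_sub _ _
          _ ≤ (2 * D + Λ) * 1 := by linarith [hD0 x, hD0 u]
          _ ≤ _ := mono%
    obtain ⟨A, hA, hsm⟩ := exists_abs_sub_poissonSmooth_le hφ.continuous hdec hH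
    refine ⟨A * (2 + 2 * C1) + C1 * Q, pos%, fun s d L _ W E η R hE hη hR hηR hM => ?_⟩
    obtain ⟨hr0, hr1⟩ := hfin hR
    have hR0 : 0 < R := lin%
    have hi := hφ.integrable_self
    have hS1 : ς E ≤ 1 := sqrt_le_one.2 (by linarith [sq_nonneg E])
    set r := (R ^ 4)⁻¹ with hr
    have hηr : η * r ≤ η * R := by gcongr; linarith
    set M : ℝ := (bandM d L W : ℝ)
    set p := 1 / (M * (η * r) ^ 3)
    have hp0 : 0 < p := pos%
    have hηr4 : η / r = η * R ^ 4 := by rw [hr]; field_simp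
    -- the error of smoothing
    have hwide : poissonMean s d L W E (η * R) ≤ 2 + 2 * C1 := by
      have hM' : 30 ≤ M * (η * R * 1) ^ 3 := by
        rw [mul_one]; refine hM.trans (mul_le_mul_of_nonneg_left ?_ (cast_nonneg _)); gcongr
      have h := h₁ s d L W E (η * R) 1 0 hE pos% one_pos le_rfl lin% hM'
      have h2 : 1 / (M * (η * R * 1) ^ 3) ≤ 1 := by rw [div_le_one lin%]; linarith
      have h3 : C1 * (1 / (M * (η * R * 1) ^ 3) + η * R / 1) * (1 + 0 ^ 2) ≤ C1 * 2 := by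
        simp only [zero_pow two_ne_zero, add_zero, mul_one, div_one] at h2 ⊢; gcongr
        linarith
      have h4 := (le_abs_self _).trans (h.trans h3)
      simp only [mul_zero, add_zero, mul_one] at h4; linarith
    have hI1 := integrable_localDensity (W := W) (E := E) (d := d) (L := L) s hi hη hsm
    have hI2 := integrable_localDensity_poissonSmooth (W := W) (E := E) (d := d) (L := L) s hi hη hr0
    have h1 : |meanDensity s d L W η φ E - π⁻¹ * ∫ u, φ u * poissonMean s d L W (E + η * u) (η * r)|
      ≤ A / R * (2 + 2 * C1) := by
      rw [meanDensity, ← integral_localDensity_poissonSmooth s hi hη hr0, ← integral_sub hI1 hI2]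
      rw [← norm_eq_abs]
      refine le_trans (norm_integral_le_of_norm_le
        ((integrable_poissonAvg s (e := E) (W := W) (pos% : 0 < η * R)).const_mul (A / R))
        (.of_forall fun a => abs_localDensity_sub_le hη (hsm R hR) a)) ?_
      rw [integral_const_mul, integral_poissonAvg s pos%]; gcongr
    -- the smoothed density
    have hbound : ∀ u, |φ u * (poissonMean s d L W (E + η * u) (η * r) - 2 * ς E)|
      ≤ C1 * Q * (p + η * R ^ 4) * (1 + u ^ 2)⁻¹ := by
      intro u
      have h := h₁ s d L W E η r u hE hη hr0 hr1 (hηr.trans hηR) hM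
      rw [hηr4] at h; rw [abs_mul]
      calc _ ≤ |φ u| * (C1 * (p + η * R ^ 4) * (1 + u ^ 2)) := mono%
        _ = C1 * (p + η * R ^ 4) * (|φ u| * (1 + u ^ 2)) := by ring
        _ ≤ C1 * (p + η * R ^ 4) * (Q * (1 + u ^ 2)⁻¹) := mul_le_mul_of_nonneg_left (hquart u) pos%
        _ = _ := by ring
    have hI3 : Integrable fun u => φ u * poissonMean s d L W (E + η * u) (η * r) := by
      have := (integrable_mul_poissonAvg (d := d) (L := L) (W := W) (E := E) s hi hη
        hr0).integral_prod_right
      simpa only [integral_const_mul, integral_poissonAvg s (pos% : 0 < η * r)] using this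
    have h2 : |π⁻¹ * (∫ u, φ u * poissonMean s d L W (E + η * u) (η * r))
      - semicircle E * ∫ x, φ x| ≤ C1 * Q * (p + η * R ^ 4) := by
      have e : π⁻¹ * (∫ u, φ u * poissonMean s d L W (E + η * u) (η * r))
        - semicircle E * ∫ x, φ x = π⁻¹ * ∫ u, φ u
          * (poissonMean s d L W (E + η * u) (η * r) - 2 * ς E) := by
        simp only [mul_sub]; rw [integral_sub hI3 (hi.mul_const _), integral_mul_const, semicircle]
        ring
      rw [e, abs_mul, abs_of_pos (inv_pos.2 pi_pos), inv_mul_le_iff₀ pi_pos, ← norm_eq_abs]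
      refine (norm_integral_le_of_norm_le (integrable_inv_one_add_sq.const_mul _)
        (.of_forall hbound)).trans (le_of_eq ?_)
      rw [integral_const_mul, integral_univ_inv_one_add_sq, mul_comm]
    have hR1 : 0 < 1 / R := pos%
    calc _ ≤ A / R * (2 + 2 * C1) + C1 * Q * (p + η * R ^ 4) :=
          (abs_sub_le _ _ _).trans (add_le_add h1 h2)
      _ = A * (2 + 2 * C1) * (1 / R) + C1 * Q * (p + η * R ^ 4) := by ring
      _ ≤ (A * (2 + 2 * C1) + C1 * Q) * (1 / R)
        + (A * (2 + 2 * C1) + C1 * Q) * (p + η * R ^ 4) := by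
        gcongr
        · linarith [show 0 ≤ C1 * Q from pos%]
        · linarith [show 0 ≤ A * (2 + 2 * C1) from pos%]
      _ = _ := by ring

/-- The mean density at the scale `η = M^(-ρ)`, `ρ < 1/3`, is given by the semicircle law up to a
negative power of `M`. -/
lemma exists_meanDensity_sub_le {φ : ℝ → ℝ} (hφ : IsAdmissible φ) {κ ρ : ℝ} (hκ : 0 < κ) (hρ : 0 < ρ)
    (hρ' : ρ < 1 / 3) :
    ∃ c C : ℝ, 0 < c ∧ 0 < C ∧ ∀ᶠ M : ℝ in atTop, ∀ (s : SymmetryClass) (d L : ℕ) [NeZero L]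
      (W E : ℝ), (bandM d L W : ℝ) = M → E ∈ bulk κ →
      |meanDensity s d L W (M ^ (-ρ)) φ E - semicircle E * ∫ x, φ x| ≤ C * M ^ (-c) := by
  obtain ⟨C, hC, h⟩ := exists_abs_meanDensity_sub_le hφ hκ
  set b := min ((1 - 3 * ρ) / 13) (ρ / 5)
  have hb0 : 0 < b := lt_min lin% lin%
  have hb1 : 13 * b ≤ 1 - 3 * ρ := by linarith [min_le_left ((1 - 3 * ρ) / 13) (ρ / 5)]
  have hb2 : 5 * b ≤ ρ := by linarith [min_le_right ((1 - 3 * ρ) / 13) (ρ / 5)]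
  clear_value b
  refine ⟨b, 3 * C, hb0, pos%, ?_⟩
  filter_upwards [ev_ge 1, eventually_le_rpow 30 hb0] with M hM1 hM30 s d L _ W E hM hE
  have hM0 : 0 < M := lin%
  have hR4 : ((M ^ b) ^ 4)⁻¹ = M ^ (-(4 * b)) := by
    rw [← rpow_natCast, ← rpow_mul hM0.le, rpow_neg hM0.le]; congr 2; push_cast; ring
  have hcube : M * (M ^ (-ρ) * ((M ^ b) ^ 4)⁻¹) ^ 3 = M ^ (1 - 3 * ρ - 12 * b) := by
    rw [hR4, ← rpow_add hM0, ← rpow_natCast, ← rpow_mul hM0.le]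
    nth_rewrite 1 [← rpow_one M]
    rw [← rpow_add hM0]; congr 1; push_cast; ring
  have hbig : M ^ b ≤ M ^ (1 - 3 * ρ - 12 * b) := rpow_mono hM1 lin%
  have hinv : (M ^ b)⁻¹ = M ^ (-b) := (rpow_neg hM0.le b).symm
  have hMb0 : 0 < M ^ b := rpow_pos_of_pos hM0 _
  have hsm : M ^ (-b) ≤ 1 / 2 := by
    rw [← hinv, inv_eq_one_div]; exact one_div_le_one_div_of_le num% lin%
  have hηR : M ^ (-ρ) * M ^ b ≤ M ^ (-b) := by rw [← rpow_add hM0]; exact rpow_mono hM1 lin%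
  have hηR4 : M ^ (-ρ) * (M ^ b) ^ 4 ≤ M ^ (-b) := by
    rw [← rpow_natCast, ← rpow_mul hM0.le, ← rpow_add hM0]
    exact rpow_mono hM1 (by push_cast; linarith)
  have hmain := h s d L W E (M ^ (-ρ)) (M ^ b) hE (rpow_pos_of_pos hM0 _)
    lin% (hηR.trans hsm) (by rw [hM, hcube]; linarith)
  rw [hM, hcube] at hmain; refine hmain.trans ?_
  have h3 : 1 / M ^ (1 - 3 * ρ - 12 * b) ≤ M ^ (-b) := by
    rw [← hinv, inv_eq_one_div]; exact one_div_le_one_div_of_le hMb0 hbig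
  calc _ ≤ C * (M ^ (-b) + (M ^ (-b) + M ^ (-b))) := by rw [one_div, hinv]; gcongr
    _ = _ := by ring

/-! ### The sum over the lengths of the dumbbells -/

lemma IsTame.conj {K : ℝ} {f : ℝ → ℂ} (hf : IsTame K f) : IsTame K fun t => conj (f t) where
  continuous := continuous_conj.comp hf.continuous
  bdd t := by simpa using hf.bdd t
  holder t u := by rw [← map_sub, Complex.norm_conj]; exact hf.holder t u
  decay t := by simpa using hf.decay t

lemma IsTame.mul {K K' : ℝ} {f g : ℝ → ℂ} (hf : IsTame K f) (hg : IsTame K' g) :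
    IsTame (2 * K * K') fun t => f t * g t := by
  have hK := hf.nonneg
  have hK' := hg.nonneg
  have hKK : K * K' ≤ 2 * K * K' := by nlinarith [mul_nonneg hK hK']
  refine ⟨hf.continuous.mul hg.continuous, fun t => ?_, fun t u => ?_, fun t => ?_⟩
  · rw [norm_mul]; exact (mul_le_mul (hf.bdd t) (hg.bdd t) (norm_nonneg _) hK).trans hKK
  · have e : f t * g t - f u * g u = (f t - f u) * g t + f u * (g t - g u) := by ring
    rw [e]; refine (norm_add_le _ _).trans ?_; rw [norm_mul, norm_mul]
    calc _ ≤ K * √|t - u| * K' + K * (K' * √|t - u|) := by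
          gcongr
          · exact hf.holder t u
          · exact hg.bdd t
          · exact hf.bdd u
          · exact hg.holder t u
      _ = _ := by ring
  · rw [norm_mul, mul_assoc]; exact (mul_le_mul (hf.bdd t) (hg.decay t) pos% hK).trans hKK

lemma IsTame.mono {K K' : ℝ} {f : ℝ → ℂ} (hf : IsTame K f) (h : K ≤ K') : IsTame K' f where
  continuous := hf.continuous
  bdd t := (hf.bdd t).trans h
  holder t u := (hf.holder t u).trans mono%
  decay t := (hf.decay t).trans h

lemma IsAdmissible.exists_isTame {φ : ℝ → ℝ} (hφ : IsAdmissible φ) : ∃ K, 0 < K ∧ IsTame K (ℱ φ) := by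
  obtain ⟨C, _, hC⟩ := exists_quadratic_decay hφ.decay
  obtain ⟨K1, hK1, h1⟩ := exists_fourierHat_holder hφ.toIsTestFunction hC
  obtain ⟨K2, h02, hK2⟩ := hφ.exists_fourierHat_decay 0
  obtain ⟨K3, h03, hK3⟩ := hφ.exists_fourierHat_decay 2
  refine ⟨K1 + K2 + K3, pos%, hφ.continuous_fourierHat, fun t => ?_, fun t u => ?_, fun t => ?_⟩
  · have := hK2 t
    rw [pow_zero, mul_one] at this; linarith
  · exact (h1 t u).trans (by gcongr; linarith)
  · have := hK3 t
    rw [sq_abs] at this; linarith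

/-- Product formula: the slowly varying and the oscillating part of a product of two waves. -/
lemma linearTransform_mul (φ1 φ2 : ℝ → ℝ) (η E : ℝ) (n : ℕ) :
    linearTransform φ1 η E n * linearTransform φ2 η E n = 2 / ς E ^ 2 * (conj (ℱ φ1 (n * (η / ς E)))
        * ℱ φ2 (n * (η / ς E))
        + exp (I * (2 * arccos E : ℝ)) ^ n * (conj (ℱ φ1 (n * (η / ς E)))
            * conj (ℱ φ2 (n * (η / ς E))))).re := by
  have e1 : exp (I * (2 * arccos E : ℝ)) ^ n = exp (I * n * arccos E) * exp (I * n * arccos E) := by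
    rw [← Complex.exp_nat_mul, ← exp_add]; congr 1; push_cast; ring
  have e2 : conj (exp (I * n * arccos E)) * exp (I * n * arccos E) = 1 := by
    rw [mul_comm, mul_conj', show I * n * (arccos E : ℂ)
      = I * ((n * arccos E : ℝ) : ℂ) by push_cast; ring, mul_comm,
      norm_expI]
    simp
  rw [e1, linearTransform, linearTransform, mul_div_assoc]
  set w := exp (I * n * arccos E)
  set x := ℱ φ1 (n * (η / ς E))
  set y := ℱ φ2 (n * (η / ς E))
  have e3 : conj x * y + w * w * (conj x * conj y)
    = (w * conj x) * conj (w * conj y) + (w * conj x) * (w * conj y) := by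
    rw [map_mul, conj_conj]
    linear_combination (-(conj x) * y) * e2
  rw [e3]; simp only [Complex.add_re, Complex.mul_re (w * conj x), Complex.conj_re, Complex.conj_im]
  ring

lemma weightSum_nonneg {a x : ℝ} (hx : 0 ≤ x) (N : ℕ) : 0 ≤ weightSum a x N :=
  sum_nonneg fun _ _ => pos%

lemma weightSum_mul_le {a x y C : ℝ} (hC : 1 ≤ C) (h : y ≤ C * x) (N : ℕ) :
    weightSum a y N ≤ C * weightSum a x N := by
  rw [weightSum, weightSum, mul_sum]; refine sum_le_sum fun m _ => ?_
  have h1 : 0 ≤ (m : ℝ) ^ (a - 1) := pos%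
  calc (m : ℝ) ^ (a - 1) + y * (m : ℝ) ^ a ≤ C * (m : ℝ) ^ (a - 1) + C * x * (m : ℝ) ^ a :=
        add_le_add (le_mul_of_one_le_left h1 hC) mono%
    _ = _ := by ring

/-- The integral that replaces the sum over the bridge lengths between `3` and `N`. -/
def bridgeIntegral (φ1 φ2 : ℝ → ℝ) (a h : ℝ) (N : ℕ) : ℂ :=
  ∫ x in (3 : ℝ)..N, ((x ^ a : ℝ) : ℂ) * (conj (ℱ φ1 (x * h)) * ℱ φ2 (x * h))

/-- The sum of the idealized terms is an integral up to the error terms: the oscillating part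
cancels, since `E` is away from `±1`. -/
lemma exists_ideal_sum_sub_le {φ1 φ2 : ℝ → ℝ} (hφ1 : IsAdmissible φ1) (hφ2 : IsAdmissible φ2)
    {κ : ℝ} (hκ : 0 < κ) :
    ∃ C, 0 < C ∧ ∀ (E η a : ℝ) (N : ℕ), E ∈ bulk κ → 0 < η → -1 ≤ a → a ≤ 1 → 3 ≤ N →
      |∑ m ∈ Ico 3 N, (m : ℝ) ^ a * (linearTransform φ1 η E m * linearTransform φ2 η E m)
        - 2 / ς E ^ 2 * (bridgeIntegral φ1 φ2 a (η / ς E) N).re|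
        ≤ C * (3 + weightSum a √(η / ς E) N) := by
  obtain ⟨K1, hK1, t1⟩ := hφ1.exists_isTame
  obtain ⟨K2, hK2, t2⟩ := hφ2.exists_isTame
  have hF := t1.conj.mul t2
  have hG := t1.conj.mul t2.conj
  set K := 2 * K1 * K2
  have hK0 : 0 < K := pos%
  have hκ0 : 0 < √κ := sqrt_pos.2 hκ
  refine ⟨2 / √κ ^ 2 * (K + K / √κ), pos%, fun E η a N hE hη ha ha' hN => ?_⟩
  have hs := sqrt_le_of_mem_bulk hκ hE
  have hz : ‖exp (I * (2 * arccos E : ℝ)) - 1‖ = 2 * ς E := by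
    rw [Complex.norm_exp_I_mul_ofReal_sub_one, mul_div_cancel_left₀ _ two_ne_zero,
      Real.sin_arccos, norm_of_nonneg pos%]
  have hz1 : ‖exp (I * (2 * arccos E : ℝ))‖ = 1 := by rw [mul_comm, norm_expI]
  simp only [linearTransform_mul, bridgeIntegral]
  set q := ς E
  have hq0 : 0 < q := hκ0.trans_le hs
  set h := η / q
  have hh0 : 0 < h := pos%
  set z := exp (I * (2 * arccos E : ℝ))
  set F : ℝ → ℂ := fun t => conj (ℱ φ1 t) * ℱ φ2 t
  set G : ℝ → ℂ := fun t => conj (ℱ φ1 t) * conj (ℱ φ2 t)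
  have h1 := norm_sum_sub_integral_le hF ha ha' hh0 hN
  have h2 := norm_sub_one_mul_sum_le hG ha ha' hh0 hz1 hN
  rw [hz] at h2
  have hw := weightSum_nonneg (a := a) (sqrt_nonneg h) N
  set w := weightSum a (√h) N
  set I' := ∫ x in (3 : ℝ)..N, ((x ^ a : ℝ) : ℂ) * F (x * h)
  set S1 := ∑ m ∈ Ico 3 N, (((m : ℝ) ^ a : ℝ) : ℂ) * F (m * h)
  set S2 := ∑ m ∈ Ico 3 N, z ^ m * ((((m : ℝ) ^ a : ℝ) : ℂ) * G (m * h))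
  have e : ∑ m ∈ Ico 3 N, (m : ℝ) ^ a * (2 / q ^ 2 * (F (m * h) + z ^ m * G (m * h)).re)
    = 2 / q ^ 2 * (S1 + S2).re := by
    rw [← sum_add_distrib, re_sum, mul_sum]; refine sum_congr rfl fun m _ => ?_
    rw [← mul_assoc, mul_comm ((m : ℝ) ^ a), mul_assoc, ← re_ofReal_mul]; congr 2
    ring
  have h2' : ‖S2‖ ≤ K / √κ * (3 + w) := by
    have h3 : ‖S2‖ * √κ ≤ K * (3 + w) := by
      have : ‖S2‖ * √κ ≤ ‖S2‖ * q := mono%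
      linarith
    rw [div_mul_eq_mul_div, le_div_iff₀ hκ0]; exact h3
  calc _ = |2 / q ^ 2 * ((S1 - I') + S2).re| := by
        rw [show S1 - I' + S2 = S1 + S2 - I' by ring, sub_re, mul_sub, ← e]
    _ ≤ 2 / √κ ^ 2 * (K * w + K / √κ * (3 + w)) := by
      rw [abs_mul, abs_of_pos pos%]; gcongr
      exact (abs_re_le_norm _).trans ((norm_add_le _ _).trans (add_le_add h1 h2'))
    _ ≤ 2 / √κ ^ 2 * (K * (3 + w) + K / √κ * (3 + w)) := by gcongr; linarith
    _ = _ := by ring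

/-! ### Asymptotics of the dumbbell sum -/

lemma mul_one_div_sqrt_pow (d : ℕ) {m : ℕ} (hm : 0 < m) :
    (m : ℝ) * (1 / √(m : ℝ)) ^ d = (m : ℝ) ^ (1 - (d : ℝ) / 2) := by
  have hm0 : (0 : ℝ) < m := mod_cast hm
  rw [rpow_sub hm0, rpow_one, one_div, inv_pow, sqrt_eq_rpow, ← rpow_natCast,
    ← rpow_mul hm0.le, show 1 / 2 * (d : ℝ) = d / 2 by ring, ← div_eq_mul_inv]

/-- The dumbbell sum is an integral over the bridge length, up to the errors of the local limit
lemma and of the linearization. Only bridges of length at most `M^(ρ+ε)` contribute. -/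
lemma exists_mainV_sub_le {d : ℕ} (hd : 0 < d) (hd4 : d ≤ 4) {φ1 φ2 : ℝ → ℝ}
    (hφ1 : IsAdmissible φ1) (hφ2 : IsAdmissible φ2)
    {ρ μ δ κ ε : ℝ} (hρ : 0 < ρ) (hμ : μ < 1 / 3) (hδ : 0 < δ) (hκ : 0 < κ) (hε : 0 < ε)
    (hεμ : ρ + ε < μ) {c : ℝ} (hc : c ≤ min (1 - 3 * μ) (ρ / 8))
    (hc' : c ≤ min (1 / 6 - μ / 2) (1 / (d : ℝ))) :
    ∃ C, 0 < C ∧ ∀ᶠ W : ℝ in atTop, ∀ (L : ℕ) [NeZero L], W ^ (1 + (d : ℝ) / 6) ≤ L →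
      ∀ E ∈ bulk κ, ∀ M : ℝ, M = bandM d L W →
      ∀ N : ℕ, N = ⌊M ^ (ρ + ε)⌋₊ + 1 →
      |(W / L) ^ d * mainV d L W ρ μ δ φ1 φ2 E E - √((d + 2) / (2 * π)) ^ d
        * (2 / ς E ^ 2 * (bridgeIntegral φ1 φ2 (1 - (d : ℝ) / 2) (M ^ (-ρ) / ς E) N).re)|
        ≤ C * (1 + weightSum (1 - (d : ℝ) / 2) (M ^ (-c)) N) := by
  obtain ⟨D1, _, q1⟩ := exists_quadratic_decay hφ1.decay
  obtain ⟨D2, _, q2⟩ := exists_quadratic_decay hφ2.decay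
  obtain ⟨CD, hCD, hD⟩ := exists_dumbbell_sub_le hφ1.toIsTestFunction hφ2.toIsTestFunction q1 q2 hρ hμ hδ hκ hε hεμ
  obtain ⟨CT, hCT, hT⟩ := exists_trace_pow_sub_le hd hμ
  obtain ⟨K1, hK1, hb1⟩ := exists_linearTransform_bdd hφ1.toIsTestFunction hκ
  obtain ⟨K2, hK2, hb2⟩ := exists_linearTransform_bdd hφ2.toIsTestFunction hκ
  obtain ⟨CI, hCI, hI⟩ := exists_ideal_sum_sub_le hφ1 hφ2 hκ
  have hd1 : (1 : ℝ) ≤ d := mod_cast hd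
  have hd4' : (d : ℝ) ≤ 4 := mod_cast hd4
  set k := √((d + 2) / (2 * π)) ^ d
  have hk0 : 0 ≤ k := pos%
  set A := (k + 2 * CT) * CD + CT * (K1 * K2) with hA
  have hA0 : 0 < A := pos%
  set Y := 1 + √(1 / √κ)
  refine ⟨CT * CD + A + k * CI * (3 * Y), pos%, ?_⟩
  filter_upwards [hT, eventually_bandM hd hD, eventually_bandM hd (ev_ge 1),
    eventually_bandM hd (eventually_le_rpow 2 (sub_pos.2 hεμ)),
    eventually_bandM hd (eventually_le_rpow 2 (show 0 < ρ + ε from lin%))]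
    with W hT hD hM1 hMμ hMρ L _ hL E hE M hM N hN
  obtain ⟨hT1, hT2⟩ := hT L hL
  have hD := hD L hL E hE
  have hM1 := hM1 L hL
  have hMμ := hMμ L hL
  have hMρ := hMρ L hL
  rw [mainV_eq_sum]
  have hMnat : ∀ m : ℕ, (m : ℝ) ≤ M → m ≤ bandM d L W := fun m h => by
    rw [hM] at h; exact_mod_cast h
  rw [← hM] at *
  have hM0 : 0 < M := lin%
  set B := ⌊M ^ μ / 2⌋₊
  set R := M ^ (ρ + ε)
  set Q := M / (M - 1)
  set Dm : ℕ → ℝ := fun m => dumbbell B Q (fun n => 2 * (gammaTilde M ρ δ n E φ1).re)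
    (fun n => 2 * (gammaTilde M ρ δ n E φ2).re) m with hDm
  set T : ℕ → ℝ := fun m => (W / L) ^ d * (varS d L W ^ m).trace with hTdef
  set P : ℕ → ℝ := fun m => linearTransform φ1 (M ^ (-ρ)) E m * linearTransform φ2 (M ^ (-ρ)) E m
    with hP
  set a := 1 - (d : ℝ) / 2 with ha
  set X := M ^ (-c)
  have hX0 : 0 < X := rpow_pos_of_pos hM0 _
  have hRμ : R ≤ M ^ μ / 2 := by
    have h2 : M ^ μ = R * M ^ (μ - (ρ + ε)) := by rw [← rpow_add hM0]; congr 1; ring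
    have h3 : R * 2 ≤ R * M ^ (μ - (ρ + ε)) := mono%
    linarith
  have hR0 : 0 < R := lin%
  have hNB : N ≤ B + 1 := by rw [hN]; exact Nat.add_le_add_right (Nat.floor_le_floor hRμ) 1
  have hN3 : 3 ≤ N := by
    have : 2 ≤ ⌊R⌋₊ := Nat.le_floor (mod_cast hMρ)
    omega
  have hBle : (B : ℝ) ≤ M ^ μ / 2 := Nat.floor_le pos%
  have hμM : M ^ μ ≤ M := by simpa using rpow_mono hM1 (show μ ≤ 1 from lin%)
  have hfar : |∑ m ∈ Ico N (B + 1), (m : ℝ) * (T m * Dm m)| ≤ CT * CD := by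
    have h1 : ∀ m ∈ Ico N (B + 1), |(m : ℝ) * (T m * Dm m)|
      ≤ M ^ μ * (CT * (CD * M ^ (2 * μ + 2 * ρ - 2))) := by
      intro m hm; rw [mem_Ico] at hm
      have hmB : (m : ℝ) ≤ B := mod_cast Nat.lt_succ_iff.1 hm.2
      have hmR : R ≤ m := (Nat.lt_floor_add_one R).le.trans (by rw [hN] at hm; exact_mod_cast hm.1)
      rw [abs_mul, abs_mul, Nat.abs_cast]
      have := (hD m (Nat.lt_succ_iff.1 hm.2)).2 hmR
      have := hT2 m (by omega) (hMnat m lin%)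
      gcongr
      linarith
    refine (abs_sum_le_sum_abs _ _).trans ((sum_le_sum h1).trans ?_)
    rw [sum_const, Nat.card_Ico, nsmul_eq_mul]
    have h2 : ((B + 1 - N : ℕ) : ℝ) ≤ M ^ μ := by
      have : ((B + 1 - N : ℕ) : ℝ) ≤ B := mod_cast (by omega)
      linarith
    have h3 : M ^ (4 * μ + 2 * ρ - 2) ≤ 1 := Real.rpow_le_one_of_one_le_of_nonpos hM1 lin%
    calc _ ≤ M ^ μ * (M ^ μ * (CT * (CD * M ^ (2 * μ + 2 * ρ - 2)))) := mono%
      _ = CT * CD * M ^ (4 * μ + 2 * ρ - 2) := by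
        rw [show 4 * μ + 2 * ρ - 2 = μ + (μ + (2 * μ + 2 * ρ - 2)) by ring, rpow_add hM0,
          rpow_add hM0]
        ring
      _ ≤ _ := mul_le_of_le_one_right pos% h3
  have hnear : |∑ m ∈ Ico 3 N, (m : ℝ) * (T m * Dm m)
    - k * ∑ m ∈ Ico 3 N, (m : ℝ) ^ a * P m| ≤ A * weightSum a X N := by
    rw [mul_sum, ← sum_sub_distrib, weightSum, mul_sum]
    refine (abs_sum_le_sum_abs _ _).trans (sum_le_sum fun m hm => ?_); rw [mem_Ico] at hm
    have hm0 : (0 : ℝ) < m := mod_cast (by omega : 0 < m)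
    have hm1 : (1 : ℝ) ≤ m := mod_cast (by omega : 1 ≤ m)
    have hmR : (m : ℝ) ≤ R := (Nat.le_floor_iff hR0.le).1 (by omega)
    have hpow : ∀ {x : ℝ}, c ≤ x → M ^ (-x) ≤ X := fun hx =>
      rpow_mono hM1 (neg_le_neg hx)
    have h1 := hT1 m (by omega) (hmR.trans lin%)
    have h2 := (hD m (by omega)).1
    have h3 : |P m| ≤ K1 * K2 := by
      rw [hP, abs_mul]; exact mul_le_mul (hb1 _ _ _ hE) (hb2 _ _ _ hE) (abs_nonneg _) hK1.le
    change |T m - k * _| ≤ _ at h1; change |Dm m - P m| ≤ _ at h2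
    have hma := mul_one_div_sqrt_pow d (show 0 < m by omega)
    rw [← ha] at hma; rw [Real.rpow_sub_one hm0.ne', ← hma]
    set u := (1 / √(m : ℝ)) ^ d
    have hu0 : 0 ≤ u := pos%
    have hmi : 1 / (m : ℝ) ≤ 1 := by rw [div_le_one hm0]; exact hm1
    have hT' : |T m| ≤ (k + 2 * CT) * u := by
      have h4 : M ^ (-min (1 / 6 - μ / 2) (1 / (d : ℝ))) ≤ 1 := by
        refine Real.rpow_le_one_of_one_le_of_nonpos hM1 (neg_nonpos.2 (le_min ?_ ?_))
        · linarith
        · positivity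
      have h5 : |T m - k * u| ≤ CT * u * 2 := h1.trans (mul_le_mul_of_nonneg_left lin% pos%)
      calc |T m| = |(T m - k * u) + k * u| := by congr 1; ring
        _ ≤ CT * u * 2 + k * u := (abs_add_le _ _).trans (add_le_add h5 (abs_of_nonneg pos%).le)
        _ = _ := by ring
    calc _ = |m * (T m * (Dm m - P m)) + m * ((T m - k * u) * P m)| := by congr 1; ring
      _ ≤ m * ((k + 2 * CT) * u * (CD * X)) + m * (CT * u * (1 / m + X) * (K1 * K2)) := by
        refine (abs_add_le _ _).trans ?_
        rw [abs_mul (m : ℝ), abs_mul (m : ℝ), Nat.abs_cast, abs_mul (T m), abs_mul (T m - k * u)]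
        have h4 : |Dm m - P m| ≤ CD * X := h2.trans (mul_le_mul_of_nonneg_left (hpow hc) hCD.le)
        have h5 : |T m - k * u| ≤ CT * u * (1 / m + X) := h1.trans
          (mul_le_mul_of_nonneg_left (by linarith [hpow hc']) pos%)
        have h6 := mul_le_mul hT' h4 (abs_nonneg _) pos%
        have h7 := mul_le_mul h5 h3 (abs_nonneg _) pos%
        exact add_le_add (mul_le_mul_of_nonneg_left h6 hm0.le) (mul_le_mul_of_nonneg_left h7 hm0.le)
      _ ≤ _ := by
        have e : A * (m * u / m + X * (m * u)) = m * ((k + 2 * CT) * u * (CD * X))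
          + m * (CT * u * (1 / m + X) * (K1 * K2)) + (k + 2 * CT) * CD * u := by
          rw [hA]; field_simp; ring
        rw [e]; exact le_add_of_nonneg_right pos%
  have hideal := hI E (M ^ (-ρ)) a N hE (rpow_pos_of_pos hM0 _) lin% lin% hN3
  set J := 2 / ς E ^ 2 * (bridgeIntegral φ1 φ2 a (M ^ (-ρ) / ς E) N).re
  have hY1 : 1 ≤ Y := by linarith [sqrt_nonneg (1 / √κ)]
  have hκ0 : 0 < √κ := sqrt_pos.2 hκ
  have hh : √(M ^ (-ρ) / ς E) ≤ Y * X := by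
    have h1 : M ^ (-ρ) / ς E ≤ M ^ (-ρ) * (1 / √κ) := by
      rw [mul_one_div]; exact div_le_div_of_nonneg_left pos% hκ0 (sqrt_le_of_mem_bulk hκ hE)
    have h2 : √(M ^ (-ρ)) ≤ X := by
      rw [sqrt_eq_rpow, ← rpow_mul hM0.le]; refine rpow_mono hM1 ?_
      linarith [min_le_right (1 - 3 * μ) (ρ / 8)]
    calc _ ≤ √(M ^ (-ρ) * (1 / √κ)) := Real.sqrt_le_sqrt h1
      _ = √(M ^ (-ρ)) * √(1 / √κ) := sqrt_mul pos% _
      _ ≤ X * Y := by gcongr; linarith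
      _ = _ := mul_comm _ _
  have hw := weightSum_mul_le (a := a) (N := N) hY1 hh
  have hw0 := weightSum_nonneg (a := a) hX0.le N
  have hsum : (W / L) ^ d * ∑ m ∈ Icc 3 B, (m : ℝ) * ((varS d L W ^ m).trace * Dm m)
    = ∑ m ∈ Ico 3 N, (m : ℝ) * (T m * Dm m) + ∑ m ∈ Ico N (B + 1), (m : ℝ) * (T m * Dm m) := by
    rw [Finset.sum_Ico_consecutive _ hN3 hNB, mul_sum]; refine sum_congr rfl fun m _ => ?_
    rw [hTdef]; ring
  rw [hsum]
  set S := ∑ m ∈ Ico 3 N, (m : ℝ) * (T m * Dm m)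
  set S' := ∑ m ∈ Ico N (B + 1), (m : ℝ) * (T m * Dm m)
  set Z := ∑ m ∈ Ico 3 N, (m : ℝ) ^ a * P m
  set w := weightSum a X N
  have hk2 : |k * (Z - J)| ≤ k * CI * (3 * Y) * (1 + w) := by
    rw [abs_mul, abs_of_nonneg hk0]
    calc _ ≤ k * (CI * (3 * Y + Y * w)) := by
          refine mul_le_mul_of_nonneg_left (hideal.trans ?_) hk0
          exact mul_le_mul_of_nonneg_left lin% hCI.le
      _ ≤ k * (CI * (3 * Y + 3 * (Y * w))) := by
        have : 0 ≤ Y * w := pos%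
        exact mul_le_mul_of_nonneg_left (mul_le_mul_of_nonneg_left lin% hCI.le) hk0
      _ = _ := by ring
  calc |S + S' - k * J| = |(S - k * Z) + S' + k * (Z - J)| := by congr 1; ring
    _ ≤ A * w + CT * CD + k * CI * (3 * Y) * (1 + w) :=
      (abs_add_le _ _).trans (add_le_add ((abs_add_le _ _).trans (add_le_add hnear hfar)) hk2)
    _ ≤ A * w + CT * CD + k * CI * (3 * Y) * (1 + w) + (A + CT * CD * w) :=
      le_add_of_nonneg_right pos%
    _ = _ := by ring

lemma weightSum_eq (a x : ℝ) (N : ℕ) : weightSum a x N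
    = ∑ m ∈ Ico 3 N, (m : ℝ) ^ (a - 1) + x * ∑ m ∈ Ico 3 N, (m : ℝ) ^ a := by
  rw [weightSum, mul_sum, ← sum_add_distrib]

lemma floor_add_one_bounds {R : ℝ} (hR : 1 ≤ R) :
    R ≤ (⌊R⌋₊ + 1 : ℕ) ∧ ((⌊R⌋₊ + 1 : ℕ) : ℝ) ≤ 2 * R := by
  push_cast; exact ⟨(Nat.lt_floor_add_one R).le, by linarith [Nat.floor_le (zero_le_one.trans hR)]⟩

/-- In dimension at most three every error gains a power of `M` on the main term `η^(-(a+1))`: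
the sums over the bridge length are dominated by lengths comparable to `η⁻¹ = M^ρ`. -/
lemma exists_one_add_weightSum_le {a c ρ ε : ℝ} (ha : -(1 / 2) ≤ a) (ha' : a ≤ 1 / 2)
    (hρ : 0 < ρ) (hρ' : ρ ≤ 1 / 3) (hε : 0 < ε) (hεc : 6 * ε ≤ c) (hερ : 10 * ε ≤ ρ) :
    ∃ C, 0 < C ∧ ∀ (M : ℝ) (N : ℕ), 1 ≤ M → N = ⌊M ^ (ρ + ε)⌋₊ + 1 →
      1 + weightSum a (M ^ (-c)) N + M ^ (2 * ρ) * (N : ℝ) ^ (a - 1)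
        ≤ C * M ^ (ρ * (a + 1) - ε / 2) := by
  obtain ⟨C1, hC1, h1⟩ := exists_sum_rpow_le (show (0 : ℝ) < 3 / 4 from num%)
  obtain ⟨C2, hC2, h2⟩ := exists_sum_rpow_le hε
  refine ⟨1 + C1 * 2 ^ (a - 1 + 1 + 3 / 4) + C2 * 2 ^ (a + 1 + ε) + 1, pos%, fun M N hM hN => ?_⟩
  have hM0 : 0 < M := lin%
  have hR := floor_add_one_bounds (one_le_rpow hM (show 0 ≤ ρ + ε from lin%))
  rw [← hN] at hR
  have hmono : ∀ {x y : ℝ}, x ≤ y → M ^ x ≤ M ^ y := rpow_mono hM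
  have hpow : ∀ p : ℝ, (2 * M ^ (ρ + ε)) ^ p = 2 ^ p * M ^ ((ρ + ε) * p) := fun p => by
    rw [mul_rpow num% pos%, ← rpow_mul hM0.le]
  have s1 := h1 (a - 1) N _ lin% hR.2
  have s2 := h2 a N _ lin% hR.2
  rw [hpow] at s1 s2
  set D := M ^ (ρ * (a + 1) - ε / 2)
  have e0 : 1 ≤ D := one_le_rpow hM (by nlinarith)
  have e1 : M ^ ((ρ + ε) * (a - 1 + 1 + 3 / 4)) ≤ D := hmono (by nlinarith)
  have e2 : M ^ (-c) * M ^ ((ρ + ε) * (a + 1 + ε)) ≤ D := by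
    rw [← rpow_add hM0]; exact hmono (by nlinarith)
  have e3 : M ^ (2 * ρ) * (N : ℝ) ^ (a - 1) ≤ D := by
    calc _ ≤ M ^ (2 * ρ) * (M ^ (ρ + ε)) ^ (a - 1) := mul_le_mul_of_nonneg_left
          (Real.rpow_le_rpow_of_nonpos pos% hR.1 lin%) pos%
      _ = M ^ (2 * ρ + (ρ + ε) * (a - 1)) := by rw [← rpow_mul hM0.le, ← rpow_add hM0]
      _ ≤ D := hmono (by nlinarith)
  rw [weightSum_eq]
  have f1 : C1 * (2 ^ (a - 1 + 1 + 3 / 4) * M ^ ((ρ + ε) * (a - 1 + 1 + 3 / 4)))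
    ≤ C1 * 2 ^ (a - 1 + 1 + 3 / 4) * D := by
    rw [mul_assoc]; gcongr
  have f2 : M ^ (-c) * ∑ m ∈ Ico 3 N, (m : ℝ) ^ a ≤ C2 * 2 ^ (a + 1 + ε) * D := by
    refine (mul_le_mul_of_nonneg_left s2 pos%).trans ?_
    calc _ = C2 * 2 ^ (a + 1 + ε) * (M ^ (-c) * M ^ ((ρ + ε) * (a + 1 + ε))) := by ring
      _ ≤ _ := mono%
  linarith

/-- In dimension four the errors are bounded, while the main term is of order `|log η|`. -/
lemma exists_weightSum_neg_one_le {c ρ : ℝ} (hc : 0 < c) (hρ : ρ ≤ 1) (hρ0 : 0 ≤ ρ) :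
    ∃ C, 0 < C ∧ ∀ (M : ℝ) (N : ℕ), 1 ≤ M → N = ⌊M ^ ρ⌋₊ + 1 → weightSum (-1) (M ^ (-c)) N ≤ C := by
  obtain ⟨C1, hC1, h1⟩ := exists_sum_rpow_le one_pos
  obtain ⟨C2, hC2, h2⟩ := exists_sum_rpow_le hc
  refine ⟨C1 + C2 * 2 ^ c, pos%, fun M N hM hN => ?_⟩
  have hM0 : 0 < M := lin%
  have hR := (floor_add_one_bounds (one_le_rpow hM hρ0)).2
  rw [← hN] at hR; rw [weightSum_eq]; refine add_le_add ?_ ?_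
  · simpa using h1 (-1 - 1) N _ num% hR
  · have s := h2 (-1) N _ lin% hR
    rw [neg_add_cancel, zero_add, mul_rpow num% pos%] at s
    have e : (M ^ ρ) ^ c ≤ M ^ c := by rw [← rpow_mul hM0.le]; exact rpow_mono hM (by nlinarith)
    calc _ ≤ M ^ (-c) * (C2 * (2 ^ c * M ^ c)) := by gcongr; exact s.trans mono%
      _ = C2 * 2 ^ c * (M ^ (-c + c)) := by rw [rpow_add hM0]; ring
      _ = _ := by simp

lemma formV_eq {d : ℕ} (hd : 0 < d) (hd3 : d ≤ 3) {φ1 φ2 : ℝ → ℝ} {K : ℝ}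
    (h : IsTame K fun t => conj (ℱ φ1 t) * ℱ φ2 t) : formV d φ1 φ2 =
    ((2 * (∫ t in Ioi (0 : ℝ), ((t ^ (1 - (d : ℝ) / 2) : ℝ) : ℂ)
      * (conj (ℱ φ1 t) * ℱ φ2 t)).re : ℝ) : ℂ) := by
  have hd1 : (1 : ℝ) ≤ d := mod_cast hd
  have hd3' : (d : ℝ) ≤ 3 := mod_cast hd3
  set f : ℝ → ℂ := fun t => conj (ℱ φ1 t) * ℱ φ2 t with hf
  set a := 1 - (d : ℝ) / 2 with ha
  set G : ℝ → ℂ := fun t => ((|t| ^ a : ℝ) : ℂ) * f t with hG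
  have hneg : ∀ t, G (-t) = conj (G t) := fun t => by
    simp only [hG, hf, abs_neg, fourierHat_neg, map_mul, conj_ofReal, conj_conj]
  have heq : Set.EqOn G (fun t => ((t ^ a : ℝ) : ℂ) * f t) (Ioi 0) := fun t ht => by
    rw [hG]; simp only [abs_of_pos (Set.mem_Ioi.1 ht)]
  have h1 : IntegrableOn G (Ioi 0) := by
    refine IntegrableOn.congr_fun ?_ heq.symm measurableSet_Ioi
    simpa using integrableOn_rpow_mul (a := a) lin% lin% h one_pos
  have h2 : IntegrableOn G (Set.Iic 0) := by
    have h3 : IntegrableOn (fun t => conj (G t)) (Set.Ici (-0)) := by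
      rw [neg_zero, integrableOn_Ici_iff_integrableOn_Ioi]
      exact Complex.conjLIE.integrable_comp_iff.2 h1
    refine h3.comp_neg_Iic.congr_fun (fun t _ => ?_) measurableSet_Iic; change conj (G (-t)) = G t
    rw [← hneg, neg_neg]
  have h5 : formV d φ1 φ2 = ∫ t, G t := by rw [formV]; congr 1; ext t; rw [hG, hf, mul_assoc]
  rw [h5, integral_eq_two_re (integrableOn_univ.1 (Set.Iic_union_Ioi (a := (0 : ℝ)) ▸ h2.union h1)) hneg,
    setIntegral_congr_fun measurableSet_Ioi heq]

lemma fourierHat_zero (φ : ℝ → ℝ) : ℱ φ 0 = (((2 * π)⁻¹ * ∫ x, φ x : ℝ) : ℂ) := by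
  simp [fourierHat]; exact integral_ofReal

lemma abs_sub_mul_le {X k q J Y b1 b2 : ℝ} (hk : 0 < k) (hq : 1 ≤ q) (h1 : |X - k * (q * J)| ≤ b1)
    (h2 : |J - Y| ≤ b2) : |X - k * q * Y| ≤ k * q * (b1 / k + b2) := by
  calc |X - k * q * Y| = |(X - k * (q * J)) + k * q * (J - Y)| := by congr 1; ring
    _ ≤ b1 + k * q * b2 := by
      refine (abs_add_le _ _).trans (add_le_add h1 ?_)
      rw [abs_mul, abs_of_nonneg (pos% : 0 ≤ k * q)]; gcongr
    _ ≤ q * b1 + k * q * b2 := by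
      gcongr
      exact le_mul_of_one_le_left ((abs_nonneg _).trans h1) hq
    _ = _ := by field_simp

set_option maxHeartbeats 400000 in
/-- The dumbbell sum for `d ≤ 3`; the main term is `G` times half of `V_d`. -/
lemma exists_mainV_sub_formV_le {d : ℕ} (hd : 0 < d) (hd3 : d ≤ 3) {φ1 φ2 : ℝ → ℝ}
    (hφ1 : IsAdmissible φ1) (hφ2 : IsAdmissible φ2)
    {ρ μ δ κ : ℝ} (hρ : 0 < ρ) (hμ : μ < 1 / 3) (hδ : 0 < δ) (hκ : 0 < κ) (hρμ : ρ < μ) :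
    ∃ c C : ℝ, 0 < c ∧ 0 < C ∧ ∀ᶠ W : ℝ in atTop, ∀ (L : ℕ) [NeZero L],
      W ^ (1 + (d : ℝ) / 6) ≤ L → ∀ E ∈ bulk κ,
      ∀ G : ℝ, G = √((d + 2) / (2 * π)) ^ d * (2 / ς E ^ 2)
        * ((bandM d L W : ℝ) ^ (-ρ) / ς E) ^ ((d : ℝ) / 2 - 2) →
      |(W / L) ^ d * mainV d L W ρ μ δ φ1 φ2 E E - G * ((formV d φ1 φ2).re / 2)|
        ≤ G * (C * (bandM d L W : ℝ) ^ (-c)) := by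
  have hd1 : (1 : ℝ) ≤ d := mod_cast hd
  have hd3' : (d : ℝ) ≤ 3 := mod_cast hd3
  set c := min (min (1 - 3 * μ) (ρ / 8)) (min (1 / 6 - μ / 2) (1 / (d : ℝ))) with hc
  have hc0 : 0 < c := lt_min (lt_min lin% lin%) (lt_min lin% pos%)
  set ε := min (min (c / 6) (ρ / 10)) ((μ - ρ) / 2)
  have hε : 0 < ε := lt_min (lt_min lin% lin%) lin%
  have hεc : ε ≤ c / 6 := (min_le_left _ _).trans (min_le_left _ _)
  have hερ : ε ≤ ρ / 10 := (min_le_left _ _).trans (min_le_right _ _)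
  have hεμ : ρ + ε < μ := by linarith [min_le_right (min (c / 6) (ρ / 10)) ((μ - ρ) / 2)]
  obtain ⟨C1, hC1', h1⟩ := exists_mainV_sub_le (c := c) hd (by omega) hφ1 hφ2 hρ hμ hδ hκ hε hεμ
    (min_le_left _ _) (hc ▸ min_le_right _ _)
  set a := 1 - (d : ℝ) / 2 with ha
  obtain ⟨C2, hC2', h2⟩ := exists_one_add_weightSum_le (a := a) (c := c) lin%
    lin% hρ lin% hε lin% lin%
  obtain ⟨C3, hC3, h3⟩ := exists_norm_integral_sub_le (a := a) lin% lin%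
  obtain ⟨K1, hK1, t1⟩ := hφ1.exists_isTame
  obtain ⟨K2, hK2, t2⟩ := hφ2.exists_isTame
  set k := √((d + 2) / (2 * π)) ^ d
  have hk0 : 0 < k := pos%
  have ht := t1.conj.mul t2
  set K := 2 * K1 * K2
  have hK : 0 < K := pos%
  set f : ℝ → ℂ := fun t => conj (ℱ φ1 t) * ℱ φ2 t
  refine ⟨ε / 2, (C1 / k + C3 * K) * C2 * (1 / √κ) ^ (a + 1), pos%, pos%, ?_⟩
  filter_upwards [h1, eventually_bandM hd (ev_ge 1),
    eventually_bandM hd (eventually_le_rpow 2 (show 0 < ρ + ε from lin%))]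
    with W h1 hM1 hM2 L _ hL E hE G hG
  have h1 := h1 L hL E hE _ rfl _ rfl
  have hM1 := hM1 L hL
  set M : ℝ := ((bandM d L W : ℕ) : ℝ)
  have hM0 : 0 < M := lin%
  set N := ⌊M ^ (ρ + ε)⌋₊ + 1 with hN
  have hκ0 : 0 < √κ := sqrt_pos.2 hκ
  have hs := sqrt_le_of_mem_bulk hκ hE
  have hs1 : ς E ≤ 1 := sqrt_le_one.2 (by nlinarith)
  set s0 := ς E
  have hs0 : 0 < s0 := hκ0.trans_le hs
  set h := M ^ (-ρ) / s0 with hh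
  have hh0 : 0 < h := pos%
  have hN3 : 3 ≤ N := by
    have : 2 ≤ ⌊M ^ (ρ + ε)⌋₊ := Nat.le_floor (mod_cast hM2 L hL)
    omega
  have h2 := h2 M N hM1 hN
  have h3 := h3 f K h N ht hh0 hN3
  set J := bridgeIntegral φ1 φ2 a h N
  change ‖J - _‖ ≤ _ at h3
  have hv : (formV d φ1 φ2).re / 2 = (∫ t in Ioi (0 : ℝ), ((t ^ a : ℝ) : ℂ) * f t).re := by
    rw [formV_eq hd hd3 ht, ofReal_re]; ring
  rw [hv]
  set I0 := ∫ t in Ioi (0 : ℝ), ((t ^ a : ℝ) : ℂ) * f t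
  set X := (W / L) ^ d * mainV d L W ρ μ δ φ1 φ2 E E
  set H := h ^ (-(a + 1)) with hH
  have hH0 : 0 < H := rpow_pos_of_pos hh0 _
  set Z := M ^ (ρ * (a + 1) - ε / 2) with hZ
  have hZ0 : 0 < Z := pos%
  have hZH : Z ≤ (1 / √κ) ^ (a + 1) * M ^ (-(ε / 2)) * H := by
    have h4 : h ≤ M ^ (-ρ) * (1 / √κ) := by
      rw [mul_one_div]; exact div_le_div_of_nonneg_left pos% hκ0 hs
    have h5 : (M ^ (-ρ) * (1 / √κ)) ^ (-(a + 1)) ≤ H := Real.rpow_le_rpow_of_nonpos hh0 h4 lin%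
    rw [mul_rpow pos% pos%, ← rpow_mul hM0.le, rpow_neg pos%] at h5
    calc Z = (1 / √κ) ^ (a + 1) * M ^ (-(ε / 2)) * (M ^ (-ρ * -(a + 1))
          * ((1 / √κ) ^ (a + 1))⁻¹) := by
          rw [hZ, show ρ * (a + 1) - ε / 2 = -(ε / 2) + -ρ * -(a + 1) by ring, rpow_add hM0]
          field_simp
      _ ≤ _ := mono%
  have hJ : |J.re - H * I0.re| ≤ C3 * K * (C2 * Z) := by
    have h4 : (h ^ 2)⁻¹ ≤ M ^ (2 * ρ) := by
      have e : (h ^ 2)⁻¹ = s0 ^ 2 * M ^ (2 * ρ) := by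
        rw [hh, div_pow, ← rpow_natCast (M ^ (-ρ)), ← rpow_mul hM0.le, inv_div,
          div_eq_mul_inv, ← rpow_neg hM0.le]
        congr 2
        push_cast; ring
      rw [e]; exact mul_le_of_le_one_left pos% (pow_le_one₀ hs0.le hs1)
    have e : J.re - H * I0.re = (J - (H : ℂ) * I0).re := by rw [sub_re, re_ofReal_mul]
    rw [e]; refine (abs_re_le_norm _).trans (h3.trans (mul_le_mul_of_nonneg_left ?_ pos%))
    have h5 : (h ^ 2)⁻¹ * (N : ℝ) ^ (a - 1) ≤ M ^ (2 * ρ) * (N : ℝ) ^ (a - 1) := mono%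
    linarith [weightSum_nonneg (a := a) (x := M ^ (-c)) pos% N]
  have h1' : |X - k * (2 / s0 ^ 2 * J.re)| ≤ C1 * (C2 * Z) := by
    refine h1.trans (mul_le_mul_of_nonneg_left ?_ hC1'.le)
    have : 0 ≤ M ^ (2 * ρ) * (N : ℝ) ^ (a - 1) := pos%
    linarith
  have hGH : G = k * (2 / s0 ^ 2) * H := by
    rw [hG, hH, show (d : ℝ) / 2 - 2 = -(a + 1) by rw [ha]; ring]
  have hs2 : 1 ≤ 2 / s0 ^ 2 := by rw [le_div_iff₀ pos%]; nlinarith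
  rw [hGH, mul_assoc _ H, mul_assoc _ H]
  refine (abs_sub_mul_le hk0 hs2 h1' hJ).trans (mul_le_mul_of_nonneg_left ?_ pos%)
  calc _ = (C1 / k + C3 * K) * C2 * Z := by ring
    _ ≤ (C1 / k + C3 * K) * C2 * ((1 / √κ) ^ (a + 1) * M ^ (-(ε / 2)) * H) := mono%
    _ = _ := by ring

/-- The dumbbell sum for `d = 4`, where the logarithm comes from the weight `1 / m`. -/
lemma exists_mainV_sub_log_le {φ1 φ2 : ℝ → ℝ} (hφ1 : IsAdmissible φ1) (hφ2 : IsAdmissible φ2)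
    {ρ μ δ κ : ℝ} (hρ : 0 < ρ) (hμ : μ < 1 / 3) (hδ : 0 < δ) (hκ : 0 < κ) (hρμ : ρ < μ) :
    ∃ C : ℝ, 0 < C ∧ ∀ᶠ W : ℝ in atTop, ∀ (L : ℕ) [NeZero L],
      W ^ (1 + ((4 : ℕ) : ℝ) / 6) ≤ L → ∀ E ∈ bulk κ,
      ∀ G : ℝ, G = √(((4 : ℕ) + 2) / (2 * π)) ^ 4 * (2 / ς E ^ 2) →
      |(W / L) ^ 4 * mainV 4 L W ρ μ δ φ1 φ2 E E
        - G * (ρ * log (bandM 4 L W) * (conj (ℱ φ1 0) * ℱ φ2 0).re)|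
        ≤ G * C := by
  set c := min (min (1 - 3 * μ) (ρ / 8)) (min (1 / 6 - μ / 2) (1 / ((4 : ℕ) : ℝ))) with hc
  have hc0 : 0 < c := lt_min (lt_min lin% lin%) (lt_min lin% num%)
  have hε : 0 < (μ - ρ) / 2 := lin%
  obtain ⟨C1, hC1', h1⟩ := exists_mainV_sub_le (c := c) num% le_rfl hφ1 hφ2 hρ hμ hδ hκ
    hε lin% (min_le_left _ _) (hc ▸ min_le_right _ _)
  set ε := (μ - ρ) / 2 with hεdef
  obtain ⟨C2, hC2', h2⟩ := exists_weightSum_neg_one_le (ρ := ρ + ε) hc0 lin% lin%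
  obtain ⟨K1, hK1, t1⟩ := hφ1.exists_isTame
  obtain ⟨K2, hK2, t2⟩ := hφ2.exists_isTame
  rw [show 1 - (((4 : ℕ) : ℝ)) / 2 = -1 from num%] at h1
  set k := √(((4 : ℕ) + 2) / (2 * π)) ^ 4
  have hk0 : 0 < k := pos%
  have ht := t1.conj.mul t2
  set K := 2 * K1 * K2
  have hK : 0 < K := pos%
  set f : ℝ → ℂ := fun t => conj (ℱ φ1 t) * ℱ φ2 t
  have hκ0 : 0 < √κ := sqrt_pos.2 hκ
  refine ⟨C1 / k * (1 + C2) + (6 * K + |log √κ| * K), pos%, ?_⟩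
  filter_upwards [h1, eventually_bandM (d := 4) num% (ev_ge 1),
    eventually_bandM (d := 4) num% (eventually_le_rpow (3 / √κ) hρ)]
    with W h1 hM1 hM3 L _ hL E hE G hG
  have h1 := h1 L hL E hE _ rfl _ rfl
  have hM1 := hM1 L hL
  have hM3 := hM3 L hL
  set M : ℝ := ((bandM 4 L W : ℕ) : ℝ)
  have hM0 : 0 < M := lin%
  set N := ⌊M ^ (ρ + ε)⌋₊ + 1 with hN
  have hs := sqrt_le_of_mem_bulk hκ hE
  have hs1 : ς E ≤ 1 := sqrt_le_one.2 (by nlinarith)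
  set s0 := ς E
  have hs0 : 0 < s0 := hκ0.trans_le hs
  set h := M ^ (-ρ) / s0 with hh
  have hh0 : 0 < h := pos%
  have hhi : h⁻¹ = s0 * M ^ ρ := by rw [hh, inv_div, rpow_neg hM0.le, div_inv_eq_mul]
  have hh3 : 3 ≤ h⁻¹ := by rw [div_le_iff₀ hκ0] at hM3; rw [hhi]; nlinarith [rpow_pos_of_pos hM0 ρ]
  have hhN : h⁻¹ ≤ N := by
    have h4 : M ^ ρ ≤ M ^ (ρ + ε) := rpow_mono hM1 lin%
    have h5 := (floor_add_one_bounds (one_le_rpow hM1 (show 0 ≤ ρ + ε from lin%))).1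
    rw [hhi]; exact (mul_le_of_le_one_left pos% hs1).trans (h4.trans h5)
  have h2 := h2 M N hM1 hN
  have h3 := norm_integral_inv_sub_le ht hh0 hh3 hhN
  set J := bridgeIntegral φ1 φ2 (-1) h N
  change ‖J - _ * f 0‖ ≤ _ at h3; change |_ - G * (_ * (f 0).re)| ≤ _
  set X := (W / L) ^ 4 * mainV 4 L W ρ μ δ φ1 φ2 E E
  have hlog : log h⁻¹ = log s0 + ρ * log M := by
    rw [hhi, Real.log_mul hs0.ne' pos%, Real.log_rpow hM0]
  have hls : |log s0| ≤ |log √κ| := by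
    rw [abs_of_nonpos (Real.log_nonpos hs0.le hs1)]
    exact (neg_le_neg (Real.log_le_log hκ0 hs)).trans (neg_le_abs _)
  have hJ : |J.re - ρ * log M * (f 0).re| ≤ 6 * K + |log √κ| * K := by
    have e : J.re - ρ * log M * (f 0).re = (J - (log h⁻¹ : ℂ) * f 0).re + log s0 * (f 0).re := by
      rw [sub_re, re_ofReal_mul, hlog]; ring
    rw [e]; refine (abs_add_le _ _).trans (add_le_add ((abs_re_le_norm _).trans h3) ?_)
    rw [abs_mul]
    exact mul_le_mul hls ((abs_re_le_norm _).trans (ht.bdd 0)) (abs_nonneg _) (abs_nonneg _)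
  have h1' : |X - k * (2 / s0 ^ 2 * J.re)| ≤ C1 * (1 + C2) :=
    h1.trans (mul_le_mul_of_nonneg_left lin% hC1'.le)
  have hs2 : 1 ≤ 2 / s0 ^ 2 := by rw [le_div_iff₀ pos%]; nlinarith
  rw [hG]; exact (abs_sub_mul_le hk0 hs2 h1' hJ).trans (le_of_eq (by ring))

/-- The expected densities in the denominator are `ν ∫ φᵢ` up to a relative error that is a power
of `M`; an approximation of the numerator thus gives one of `Θ`. -/
lemma exists_leadingTheta_eq (s : SymmetryClass) {d : ℕ} (hd : 0 < d) {φ1 φ2 : ℝ → ℝ}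
    (hφ1 : IsAdmissible φ1) (hφ2 : IsAdmissible φ2) {ρ μ δ κ : ℝ}
    (hρ : 0 < ρ) (hρ' : ρ < 1 / 3) (hκ : 0 < κ) :
    ∃ c C : ℝ, 0 < c ∧ 0 < C ∧ ∀ᶠ W : ℝ in atTop, ∀ (L : ℕ) [NeZero L],
      W ^ (1 + (d : ℝ) / 6) ≤ L → ∀ E ∈ bulk κ, ∀ G v e : ℝ, 0 < G →
      |(W / L) ^ d * mainV d L W ρ μ δ φ1 φ2 E E - G * v| ≤ G * e →
      ∃ r : ℝ, |r| ≤ C * (e + |v| * (bandM d L W : ℝ) ^ (-c)) ∧ leadingTheta s d L W ρ μ δ φ1 φ2 E E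
          = 2 / s.beta * (G / (semicircle E ^ 2 * ((∫ x, φ1 x) * ∫ x, φ2 x))) * (v + r) := by
  obtain ⟨c1, C1, hc1, hC1', h1⟩ := exists_meanDensity_sub_le hφ1 hκ hρ hρ'
  obtain ⟨c2, C2, hc2, hC2', h2⟩ := exists_meanDensity_sub_le hφ2 hκ hρ hρ'
  set I1 := ∫ x, φ1 x
  set I2 := ∫ x, φ2 x
  have hI10 : I1 ≠ 0 := hφ1.integral_ne_zero
  have hI20 : I2 ≠ 0 := hφ2.integral_ne_zero
  set c := min c1 c2
  have hc : 0 < c := lt_min hc1 hc2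
  set ν0 := 2 / π * √κ
  have hκ0 : 0 < √κ := sqrt_pos.2 hκ
  have hν00 : 0 < ν0 := pos%
  set p0 := ν0 ^ 2 * |I1 * I2| with hp₀
  have hp00 : 0 < p0 := mul_pos pos% (abs_pos.2 (mul_ne_zero hI10 hI20))
  set A := C1 * (|I2| + C2) + |I1| * C2 with hA
  have hA0 : 0 < A := pos%
  refine ⟨c, 2 + 2 * A / p0, hc, pos%, ?_⟩
  filter_upwards [eventually_bandM hd h1, eventually_bandM hd h2, eventually_bandM hd (ev_ge 1),
    eventually_bandM hd (eventually_const_mul_rpow_le (C := A) hc (half_pos hp00))]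
    with W h1 h2 hM1 hMA L _ hL E hE G v e hG hX
  have h1 := h1 L hL s d L W E rfl hE
  have h2 := h2 L hL s d L W E rfl hE
  have hM1 := hM1 L hL
  have hMA := hMA L hL
  rw [leadingTheta]
  set M : ℝ := ((bandM d L W : ℕ) : ℝ)
  have hM0 : 0 < M := lin%
  set ν := semicircle E with hν
  have hνκ : ν0 ≤ ν := mul_le_mul_of_nonneg_left (sqrt_le_of_mem_bulk hκ hE) pos%
  have hν1 : ν ≤ 1 := by
    rw [hν, semicircle]; refine mul_le_one₀ ?_ (sqrt_nonneg _) (sqrt_le_one.2 (by nlinarith))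
    rw [div_le_one pi_pos]; exact Real.two_le_pi
  have hν0 : 0 < ν := hν00.trans_le hνκ
  set P1 := meanDensity s d L W (M ^ (-ρ)) φ1 E
  set P2 := meanDensity s d L W (M ^ (-ρ)) φ2 E
  set x := M ^ (-c)
  have hx0 : 0 < x := rpow_pos_of_pos hM0 _
  have hx1 : x ≤ 1 := Real.rpow_le_one_of_one_le_of_nonpos hM1 lin%
  have h1' : |P1 - ν * I1| ≤ C1 * x := h1.trans (mul_le_mul_of_nonneg_left
    (rpow_mono hM1 (neg_le_neg (min_le_left _ _))) hC1'.le)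
  have h2' : |P2 - ν * I2| ≤ C2 * x := h2.trans (mul_le_mul_of_nonneg_left
    (rpow_mono hM1 (neg_le_neg (min_le_right _ _))) hC2'.le)
  set p := ν ^ 2 * (I1 * I2) with hp
  have hp0 : p ≠ 0 := mul_ne_zero pos% (mul_ne_zero hI10 hI20)
  have hpp : p0 ≤ |p| := by rw [hp, hp₀, abs_mul (ν ^ 2), abs_of_nonneg (sq_nonneg ν)]; gcongr
  have hνI : ∀ I' : ℝ, |ν * I'| ≤ |I'| := fun I' => by
    rw [abs_mul, abs_of_pos hν0]; exact mul_le_of_le_one_left (abs_nonneg _) hν1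
  have hP2 : |P2| ≤ |I2| + C2 := by
    calc |P2| = |ν * I2 + (P2 - ν * I2)| := by congr 1; ring
      _ ≤ |I2| + C2 * x := (abs_add_le _ _).trans (add_le_add (hνI _) h2')
      _ ≤ _ := by linarith [mul_le_of_le_one_right hC2'.le hx1]
  have hPp : |P1 * P2 - p| ≤ A * x := by
    calc |P1 * P2 - p| = |(P1 - ν * I1) * P2 + ν * I1 * (P2 - ν * I2)| := by congr 1; rw [hp]; ring
      _ ≤ C1 * x * (|I2| + C2) + |I1| * (C2 * x) := by
        refine (abs_add_le _ _).trans ?_; rw [abs_mul, abs_mul (ν * I1)]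
        have := hνI I1
        gcongr
      _ = _ := by rw [hA]; ring
  have hP : p0 / 2 ≤ |P1 * P2| := by
    have := abs_sub_abs_le_abs_sub p (P1 * P2)
    rw [abs_sub_comm] at this; linarith
  have hP0 : P1 * P2 ≠ 0 := abs_pos.1 lin%
  set Q := p / (P1 * P2) with hQ
  have hQ1 : |Q - 1| ≤ 2 * A / p0 * x := by
    have e : Q - 1 = (p - P1 * P2) / (P1 * P2) := by rw [hQ, sub_div, div_self hP0]
    rw [e, abs_div, abs_sub_comm, div_le_iff₀ lin%]
    calc _ ≤ A * x := hPp
      _ = 2 * A / p0 * x * (p0 / 2) := by field_simp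
      _ ≤ _ := mono%
  have hQ2 : |Q| ≤ 2 := by
    have h3 : 2 * A / p0 * x ≤ 1 := by rw [div_mul_eq_mul_div, div_le_one hp00]; linarith
    have := abs_sub_abs_le_abs_sub Q 1
    rw [abs_one] at this; linarith
  set X := (W / L) ^ d * mainV d L W ρ μ δ φ1 φ2 E E with hXdef
  have he : |X / G - v| ≤ e := by
    have e' : X / G - v = (X - G * v) / G := by field_simp
    rw [e', abs_div, abs_of_pos hG, div_le_iff₀ hG]; linarith
  have he0 : 0 ≤ e := (abs_nonneg _).trans he
  refine ⟨(X / G - v) * Q + v * (Q - 1), ?_, ?_⟩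
  · calc _ ≤ e * 2 + |v| * (2 * A / p0 * x) := by
          refine (abs_add_le _ _).trans ?_; rw [abs_mul, abs_mul]; gcongr
      _ ≤ e * 2 + |v| * (2 * A / p0 * x) + (2 * A / p0 * e + 2 * (|v| * x)) :=
        le_add_of_nonneg_right pos%
      _ = _ := by ring
  · have hL0 : (L : ℝ) ≠ 0 := mod_cast NeZero.ne L
    have e1 : v + ((X / G - v) * Q + v * (Q - 1)) = X / G * Q := by ring
    rw [e1, hQ, hXdef, hp, div_pow, mul_pow]; field_simp

/-! ### Prefactors -/

lemma SymmetryClass.beta_pos (s : SymmetryClass) : 0 < s.beta := by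
  cases s <;> norm_num [SymmetryClass.beta]

/-- The constants of the two asymptotic expansions combine to the prefactor of `Θ`; here `I'`
stands for `∫ φ₁ * ∫ φ₂`, and `8π² / I'` is twice the reciprocal of `φ̂₁(0) φ̂₂(0)`. -/
lemma prefactor_eq {d : ℕ} {β η s0 ν I' : ℝ} (hβ : β ≠ 0) (hη : 0 < η) (hν : 0 < ν) (hI : I' ≠ 0)
    (hs : s0 = π * ν / 2) (b : ℝ) (hb : b = (d : ℝ) / 2 - 2) :
    2 / β * (√((d + 2) / (2 * π)) ^ d * (2 / s0 ^ 2) * (η / s0) ^ b / (ν ^ 2 * I'))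
      = ((d : ℝ) + 2) ^ ((d : ℝ) / 2) / (2 * β * π ^ (2 + d) * ν ^ 4) * (η / ν) ^ b
        * (8 * π ^ 2 / I') := by
  have hπ := pi_pos
  have h1 : √((d + 2) / (2 * π)) ^ d = (d + 2 : ℝ) ^ ((d : ℝ) / 2) / (2 * π) ^ ((d : ℝ) / 2) := by
    rw [sqrt_eq_rpow, ← rpow_natCast, ← rpow_mul pos%,
      show 1 / 2 * (d : ℝ) = d / 2 by ring, Real.div_rpow pos% pos%]
  have h2 : (η / s0) ^ b = (η / ν) ^ b * ((2 : ℝ) ^ ((d : ℝ) / 2) / 4 * (π ^ 2 / π ^ ((d : ℝ) / 2))) := by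
    rw [hs, show η / (π * ν / 2) = η / ν * (2 / π) by field_simp,
      mul_rpow pos% pos%, Real.div_rpow num% hπ.le, hb,
      rpow_sub two_pos, rpow_sub hπ, Real.rpow_two, Real.rpow_two]
    field_simp; norm_num
  have h3 : π ^ ((d : ℝ) / 2) * π ^ ((d : ℝ) / 2) = π ^ d := by
    rw [← rpow_add hπ, add_halves, rpow_natCast]
  rw [h1, h2, mul_rpow two_pos.le hπ.le, hs, pow_add, ← h3]
  set t := (2 : ℝ) ^ ((d : ℝ) / 2)
  have ht : t ≠ 0 := pos%
  set u := π ^ ((d : ℝ) / 2)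
  have hu : u ≠ 0 := pos%
  field_simp; norm_num

lemma eventually_log_rpow_mul_rpow_le {ρ c : ℝ} (hρ : 0 ≤ ρ) (hc : 0 < c) :
    ∀ᶠ M : ℝ in atTop, ρ * log M * M ^ (-c) ≤ ρ := by
  have h := (isLittleO_log_rpow_atTop hc).bound one_pos
  filter_upwards [h, ev_ge 1] with M h hM
  have hM0 : 0 < M := lin%
  rw [norm_of_nonneg (Real.log_nonneg hM), norm_of_nonneg pos%, one_mul] at h
  rw [mul_assoc, rpow_neg hM0.le]; refine mul_le_of_le_one_right hρ ?_
  rw [← div_eq_mul_inv, div_le_one pos%]; exact h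

lemma conj_fourierHat_zero_mul (φ1 φ2 : ℝ → ℝ) : conj (ℱ φ1 0) * ℱ φ2 0
    = (((∫ x, φ1 x) * (∫ x, φ2 x) / (4 * π ^ 2) : ℝ) : ℂ) := by
  rw [fourierHat_zero, fourierHat_zero, conj_ofReal, ← ofReal_mul]; congr 1
  field_simp; ring

lemma fourierHat_zero_mul (φ1 φ2 : ℝ → ℝ) : ℱ φ1 0 * ℱ φ2 0
    = (((∫ x, φ1 x) * (∫ x, φ2 x) / (4 * π ^ 2) : ℝ) : ℂ) := by
  rw [← conj_fourierHat_zero_mul, fourierHat_zero φ1, conj_ofReal]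

end RandomBand

open RandomBand

/-- The constants `c₁`, `C`, `W₀` may depend on all parameters quantified before them, but not on
`L`, `W`, `E`. Dividing by `fourierHat φᵢ 0 = (2π)⁻¹ ∫ φᵢ` expresses the normalization
`∫ φᵢ = 2π`, under which these factors equal `1`. -/
theorem theorem2p2
    (s : RandomBand.SymmetryClass) (d : ℕ)
    (ρ μ δ κ K : ℝ) (hρ : 0 < ρ) (hμ : μ < 1 / 3) (hδ : 0 < δ)
    (hμδ : 2 * δ < μ - ρ ∧ μ - ρ < 3 * δ) (hκ : 0 < κ)
    (φ₁ φ₂ : ℝ → ℝ)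
    (hφ₁ : RandomBand.IsTestFunction φ₁) (hφ₂ : RandomBand.IsTestFunction φ₂)
    (hC : (RandomBand.IsCauchyKernel φ₁ ∧ RandomBand.IsCauchyKernel φ₂) ∨
      (RandomBand.HasRapidDecay φ₁ ∧ RandomBand.HasRapidDecay φ₂)) :
    ((d = 1 ∨ d = 2 ∨ d = 3) →
      ∃ c₁ C W₀ : ℝ, 0 < c₁ ∧
        ∀ (L : ℕ) [NeZero L] (W E : ℝ),
          W₀ ≤ W → 1 ≤ W → W ^ (1 + (d : ℝ) / 6) ≤ L → (L : ℝ) ≤ W ^ K →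
          E ∈ Set.Icc (-1 + κ) (1 - κ) →
          ∃ r : ℂ, ‖r‖ ≤ C * (RandomBand.bandM d L W : ℝ) ^ (-c₁) ∧
            (RandomBand.leadingTheta s d L W ρ μ δ φ₁ φ₂ E E : ℂ) =
              ((((d : ℝ) + 2) ^ ((d : ℝ) / 2)
                / (2 * s.beta * Real.pi ^ (2 + d) * RandomBand.semicircle E ^ 4)
                * ((RandomBand.bandM d L W : ℝ) ^ (-ρ) / RandomBand.semicircle E)
                    ^ ((d : ℝ) / 2 - 2) : ℝ) : ℂ)
              * (RandomBand.formV d φ₁ φ₂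
                  / (RandomBand.fourierHat φ₁ 0 * RandomBand.fourierHat φ₂ 0) + r)) ∧
    (d = 4 →
      ∃ C W₀ : ℝ,
        ∀ (L : ℕ) [NeZero L] (W E : ℝ),
          W₀ ≤ W → 1 ≤ W → W ^ (1 + (d : ℝ) / 6) ≤ L → (L : ℝ) ≤ W ^ K →
          E ∈ Set.Icc (-1 + κ) (1 - κ) →
          ∃ r : ℂ, ‖r‖ ≤ C ∧
            (RandomBand.leadingTheta s d L W ρ μ δ φ₁ φ₂ E E : ℂ) =
              ((18 / (s.beta * Real.pi ^ 6 * RandomBand.semicircle E ^ 4) : ℝ) : ℂ)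
              * (RandomBand.formV4 φ₁ φ₂
                  / (RandomBand.fourierHat φ₁ 0 * RandomBand.fourierHat φ₂ 0)
                  * ((|Real.log ((RandomBand.bandM d L W : ℝ) ^ (-ρ))| : ℝ) : ℂ) + r)) := by
  have hφ1 : IsAdmissible φ₁ := ⟨hφ₁, hC.imp And.left And.left⟩
  have hφ2 : IsAdmissible φ₂ := ⟨hφ₂, hC.imp And.right And.right⟩
  have hρμ : ρ < μ := lin%
  have hβ := s.beta_pos.ne'
  set I' := (∫ x, φ₁ x) * ∫ x, φ₂ x with hI
  have hI0 : I' ≠ 0 := mul_ne_zero hφ1.integral_ne_zero hφ2.integral_ne_zero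
  have hν : ∀ E ∈ bulk κ, 0 < ς E ∧ 0 < semicircle E := fun E hE => by
    have h := (sqrt_pos.2 hκ).trans_le (sqrt_le_of_mem_bulk hκ hE)
    exact ⟨h, by unfold semicircle; positivity⟩
  refine ⟨fun hd3 => ?_, fun hd4 => ?_⟩
  · have hd : 0 < d := by omega
    obtain ⟨c1, C1, hc1, hC1', h1⟩ := exists_mainV_sub_formV_le hd (by omega) hφ1 hφ2 hρ hμ hδ hκ hρμ
    obtain ⟨c2, C2, hc2, hC2', h2⟩ := exists_leadingTheta_eq s (μ := μ) (δ := δ) hd hφ1 hφ2 hρ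
      lin% hκ
    obtain ⟨K1, hK1, t1⟩ := hφ1.exists_isTame
    obtain ⟨K2, hK2, t2⟩ := hφ2.exists_isTame
    have hreal : formV d φ₁ φ₂ = (((formV d φ₁ φ₂).re : ℝ) : ℂ) := by
      rw [formV_eq hd (by omega) (t1.conj.mul t2), ofReal_re]
    set V := (formV d φ₁ φ₂).re
    obtain ⟨W0, hW0⟩ := Filter.eventually_atTop.1 (h1.and (h2.and
      (eventually_bandM hd (ev_ge 1))))
    refine ⟨min c1 c2, 8 * π ^ 2 / |I'| * (C2 * (C1 + |V / 2|)), W0, lt_min hc1 hc2,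
      fun L _ W E hW _ hL _ hE => ?_⟩
    obtain ⟨h1, h2, hM⟩ := hW0 W hW
    have hM := hM L hL
    obtain ⟨hs0, hν⟩ := hν E hE
    have hM0 : (0 : ℝ) < bandM d L W := lin%
    obtain ⟨r, hr, hθ⟩ := h2 L hL E hE _ _ _ pos% (h1 L hL E hE _ rfl)
    rw [prefactor_eq hβ pos% hν hI0 (by unfold semicircle; field_simp) _ rfl] at hθ
    refine ⟨((8 * π ^ 2 / I' * r : ℝ) : ℂ), ?_, ?_⟩
    · rw [norm_real, norm_eq_abs, abs_mul, abs_div, abs_of_pos pos%, mul_assoc (_ / _)]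
      refine mul_le_mul_of_nonneg_left (hr.trans ?_) pos%
      rw [mul_assoc, add_mul]
      have e1 := rpow_mono hM (neg_le_neg (min_le_left c1 c2))
      have e2 := rpow_mono hM (neg_le_neg (min_le_right c1 c2))
      gcongr
    · have e : 8 * π ^ 2 / I' * (V / 2 + r) = V / (I' / (4 * π ^ 2)) + 8 * π ^ 2 / I' * r := by
        field_simp; ring
      rw [hθ, hreal, fourierHat_zero_mul, ← hI, ← Complex.ofReal_div, ← Complex.ofReal_add,
        ← ofReal_mul, mul_assoc, e]
  · subst hd4
    obtain ⟨C1, hC1', h1⟩ := exists_mainV_sub_log_le hφ1 hφ2 hρ hμ hδ hκ hρμ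
    obtain ⟨c2, C2, hc2, hC2', h2⟩ := exists_leadingTheta_eq (d := 4) s (μ := μ) (δ := δ)
      num% hφ1 hφ2 hρ lin% hκ
    rw [conj_fourierHat_zero_mul, ofReal_re] at h1
    rw [formV4, mul_assoc, conj_fourierHat_zero_mul, fourierHat_zero_mul]
    simp only [← hI] at h1 h2 ⊢
    obtain ⟨W0, hW0⟩ := Filter.eventually_atTop.1 (h1.and (h2.and
      (eventually_bandM (d := 4) num%
        ((ev_ge 1).and (eventually_log_rpow_mul_rpow_le hρ.le hc2)))))
    refine ⟨8 * π ^ 2 / |I'| * (C2 * (C1 + ρ * |I' / (4 * π ^ 2)|)), W0,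
      fun L _ W E hW _ hL _ hE => ?_⟩
    obtain ⟨h1, h2, hM⟩ := hW0 W hW
    obtain ⟨hM, hlog⟩ := hM L hL
    obtain ⟨hs0, hν⟩ := hν E hE
    have hM0 : (0 : ℝ) < bandM 4 L W := lin%
    have hl0 : 0 ≤ ρ * log (bandM 4 L W) := mul_nonneg hρ.le (Real.log_nonneg hM)
    obtain ⟨r, hr, hθ⟩ := h2 L hL E hE _ _ _ pos% (h1 L hL E hE _ rfl)
    have hpre := prefactor_eq (d := 4) hβ one_pos hν hI0
      (s0 := ς E) (by unfold semicircle; field_simp) 0 num%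
    rw [Real.rpow_zero, Real.rpow_zero, mul_one, mul_one] at hpre
    rw [hpre] at hθ
    refine ⟨((8 * π ^ 2 / I' * r : ℝ) : ℂ), ?_, ?_⟩
    · rw [norm_real, norm_eq_abs, abs_mul, abs_div, abs_of_pos (pos% : 0 < 8 * π ^ 2)]
      refine mul_le_mul_of_nonneg_left (hr.trans ?_) pos%
      rw [abs_mul, abs_of_nonneg hl0, mul_right_comm]
      gcongr
    · rw [Real.log_rpow hM0, neg_mul, abs_neg, abs_of_nonneg hl0, hθ, ← Complex.ofReal_ofNat]
      simp only [← ofReal_mul, ← Complex.ofReal_div, ← Complex.ofReal_add]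
      congr 1
      norm_num
      field_simp
      ring

end
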